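/- **Setting.** Let $X,C\ge 0$ (event time, censoring time) and $Z\in\mathbb R^p$ (covariates) be random variables such that $X$ and $C$ are conditionally independent given $Z$; given $Z=z$, both are absolutely continuous and $X$ has the hazard $\lambda(x\mid z)=\lambda_0(x)e^{\beta_0'z}$, where $\lambda_0\ge 0$ is the baseline hazard and $\beta_0\in\mathbb R^p$. Put $\Lambda_0(x)=\int_0^x\lambda_0$, $F_0=1-e^{-\Lambda_0}$ and $f_0=\lambda_0(1-F_0)$. Let $T=\min(X,C)$, $\Delta=\mathbf 1\{X\le C\}$, and let $(T_i,\Delta_i,Z_i)$, $i\ge1$, be i.i.d. copies of $(T,\Delta,Z)$. Let $\tau_F,\tau_G,\tau_H$ be the right end points of the supports of the distributions of $X$, $C$, $T$. Assume: * (A1) $\tau_H=\tau_G<\tau_F\le\infty$; * (A2) there is $\varepsilon>0$ with $\sup_{|\beta-\beta_0|\le\varepsilon}\mathbb E\big[|Z|^2e^{2\beta'Z}\big]<\infty$; * (identifiability of the regression coefficients) for every $v\in\mathbb R^p$ with $\mathbb P(v'Z\ne0)>0$ there is a time $t$ with $\mathbb P(T\le t,\Delta=1)>0$ such that $v'Z$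 is not almost surely constant on $\{T\ge t\}$. **Estimators** (based on the first $n$ observations, $T_{(1)}<\dots<T_{(n)}$ being the ordered follow-up times). Let $\hat\beta_n$ be a maximum partial likelihood estimator, i.e. a maximizer of $$\beta\mapsto\prod_{i\le n:\,\Delta_i=1}\frac{e^{\beta'Z_i}}{\sum_{j\le n}\mathbf 1\{T_j\ge T_i\}e^{\beta'Z_j}}$$ (chosen arbitrarily if there is none). The Breslow estimator is $$\Lambda_n(x)=\sum_{i\le n:\,\Delta_i=1,\,T_i\le x}\Big(\sum_{j\le n}\mathbf 1\{T_j\ge T_i\}e^{\hat\beta_n'Z_j}\Big)^{-1},$$ and $F_n=1-e^{-\Lambda_n}$. For a hazard $\lambda$ put $$L_n(\lambda)=\prod_{i\le n}\big[\lambda(T_i)e^{\hat\beta_n'Z_i}\big]^{\Delta_i}\exp\Big(-e^{\hat\beta_n'Z_i}\int_0^{T_i}\lambda(u)\,du\Big).$$ * Nondecreasing case: $\hat\lambda_n$ is the NPMLE, that is, on $[0,T_{(n)})$ the pointwise limit as $M\to\infty$ of maximizers of $L_n$ over the nondecreasing $\lambda:[0,\infty)\to[0,M]$ (with arbitrary values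 on $[T_{(n)},\infty)$), and $\tilde\lambda_n$ is the left-hand slope of the greatest convex minorant of $\Lambda_n$ on $[0,T_{(n)}]$. * Nonincreasing case: $\hat\lambda_n$ is the NPMLE, that is, a maximizer of $L_n$ over the nonincreasing $\lambda:[0,\infty)\to[0,\infty)$, and $\tilde\lambda_n$ is the left-hand slope of the least concave majorant of $\Lambda_n$ on $[0,T_{(n)}]$. * Nonincreasing density: $\tilde f_n$ is the left-hand slope of the least concave majorant of $F_n$ on $[0,T_{(n)}]$. **Theorem.** Let $x_0\in(0,\tau_H)$, and write $g(x_0-)$, $g(x_0+)$ for the left and right limits of a function $g$ at $x_0$. 1. If $\lambda_0$ is nondecreasing on $(0,\infty)$, then with probability one $$\lambda_0(x_0-)\le\liminf_{n\to\infty}\hat\lambda_n(x_0)\le\limsup_{n\to\infty}\hat\lambda_n(x_0)\le\lambda_0(x_0+),$$ $$\lambda_0(x_0-)\le\liminf_{n\to\infty}\tilde\lambda_n(x_0)\le\limsup_{n\to\infty}\tilde\lambda_n(x_0)\le\lambda_0(x_0+).$$ 2. If $\lambda_0$ is nonincreasing on $(0,\infty)$, then with probability one $$\lambda_0(x_0+)\le\liminf_{n\to\infty}\hat\lambda_n(x_0)\le\limsup_{n\to\infty}\hat\lambda_n(x_0)\le\lambda_0(x_0-),$$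 $$\lambda_0(x_0+)\le\liminf_{n\to\infty}\tilde\lambda_n(x_0)\le\limsup_{n\to\infty}\tilde\lambda_n(x_0)\le\lambda_0(x_0-).$$ 3. If $f_0$ is nonincreasing on $(0,\infty)$, then with probability one $$f_0(x_0+)\le\liminf_{n\to\infty}\tilde f_n(x_0)\le\limsup_{n\to\infty}\tilde f_n(x_0)\le f_0(x_0-).$$ -/

import Mathlib

open MeasureTheory ProbabilityTheory Filter Topology Set
open scoped RealInnerProductSpace

noncomputable section

namespace CoxShape

/-- Covariate vectors, and regression coefficients: `ℝ^p` with the Euclidean norm. -/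
abbrev Cov (p : ℕ) : Type := EuclideanSpace ℝ (Fin p)

/-! ### The Cox model -/

/-- The law `μ` of a nonnegative random variable is absolutely continuous and has hazard `h`:
it has the Lebesgue density `f = h * (1 - F)` on `[0, ∞)`, that is `h = f / (1 - F)`. -/
def HasHazard (μ : Measure ℝ) (h : ℝ → ℝ) : Prop :=
  μ = (volume.restrict (Ici 0)).withDensity fun x => ENNReal.ofReal (h x) * μ (Ioi x)

/-- The Cox proportional hazards model for a generic event time `X`, censoring time `C` and
covariate vector `Z`, with regression coefficients `β₀` and baseline hazard `lam0`. -/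
structure IsCoxModel {Ω : Type*} [MeasurableSpace Ω] {p : ℕ} (P : Measure Ω)
    [IsProbabilityMeasure P] (X C : Ω → ℝ) (Z : Ω → Cov p) (β₀ : Cov p) (lam0 : ℝ → ℝ) :
    Prop where
  measurable_X : Measurable X
  measurable_C : Measurable C
  measurable_Z : Measurable Z
  measurable_hazard : Measurable lam0
  hazard_nonneg : ∀ x, 0 ≤ x → 0 ≤ lam0 x
  /-- `X` and `C` are conditionally independent given `Z`. -/
  condIndep : ∀ᵐ z ∂(P.map Z), condDistrib (fun ω => (X ω, C ω)) Z P z =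
    (condDistrib X Z P z).prod (condDistrib C Z P z)
  /-- Given `Z = z`, the event time has the hazard `lam0 x * exp (β₀' z)`. -/
  hazard : ∀ᵐ z ∂(P.map Z),
    HasHazard (condDistrib X Z P z) fun x => lam0 x * Real.exp ⟪β₀, z⟫
  /-- Given `Z = z`, the censoring time is nonnegative and absolutely continuous. -/
  censoring_nonneg : ∀ᵐ z ∂(P.map Z), condDistrib C Z P z (Iio 0) = 0
  censoring_ac : ∀ᵐ z ∂(P.map Z), condDistrib C Z P z ≪ volume

/-- The right end point of the support of a distribution on the line. -/
def supportEnd (μ : Measure ℝ) : EReal := sSup ((fun x : ℝ => (x : EReal)) '' μ.support)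

/-- `τ_H = τ_G < τ_F ≤ ∞`, where `F`, `G`, `H` are the distributions of `X`, `C` and of
the follow-up time `T = min X C`. -/
def ConditionA1 {Ω : Type*} [MeasurableSpace Ω] (P : Measure Ω) (X C : Ω → ℝ) : Prop :=
  supportEnd (P.map fun ω => min (X ω) (C ω)) = supportEnd (P.map C) ∧
    supportEnd (P.map C) < supportEnd (P.map X)

/-- For some `ε > 0`, the supremum of `E[|Z|² exp (2 β' Z)]` over `|β - β₀| ≤ ε` is finite. -/
def ConditionA2 {Ω : Type*} [MeasurableSpace Ω] {p : ℕ} (P : Measure Ω) (Z : Ω → Cov p)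
    (β₀ : Cov p) : Prop :=
  ∃ ε : ℝ, 0 < ε ∧ ∃ K : NNReal, ∀ β : Cov p, ‖β - β₀‖ ≤ ε →
    ∫⁻ ω, ENNReal.ofReal (‖Z ω‖ ^ 2 * Real.exp (2 * ⟪β, Z ω⟫)) ∂P ≤ K

/-- Identifiability of the regression coefficients: for every direction `v` that the covariates
see at all, there is a time `t` before which events are observed with positive probability
and such that `v' Z` is not almost surely constant among the individuals at risk at `t`. -/
def Identifiable {Ω : Type*} [MeasurableSpace Ω] {p : ℕ} (P : Measure Ω) (X C : Ω → ℝ)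
    (Z : Ω → Cov p) : Prop :=
  ∀ v : Cov p, ¬ (∀ᵐ ω ∂P, ⟪v, Z ω⟫ = 0) →
    ∃ t : ℝ, 0 < P {ω | min (X ω) (C ω) ≤ t ∧ X ω ≤ C ω} ∧
      ¬ ∃ c : ℝ, ∀ᵐ ω ∂P, t ≤ min (X ω) (C ω) → ⟪v, Z ω⟫ = c

/-- The baseline cumulative hazard `Λ₀(x) = ∫₀ˣ lam0`, possibly `∞` (beyond `τ_F`). -/
def cumHazard (lam0 : ℝ → ℝ) (x : ℝ) : ENNReal := ∫⁻ u in Ioc 0 x, ENNReal.ofReal (lam0 u)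

/-- The baseline distribution function `F₀ = 1 - exp (-Λ₀)`. -/
def baselineCDF (lam0 : ℝ → ℝ) (x : ℝ) : ℝ :=
  if cumHazard lam0 x = ⊤ then 1 else 1 - Real.exp (-(cumHazard lam0 x).toReal)

/-- The baseline density `f₀ = lam0 * (1 - F₀)`. -/
def baselineDensity (lam0 : ℝ → ℝ) (x : ℝ) : ℝ := lam0 x * (1 - baselineCDF lam0 x)

/-! ### The data -/

/-- An observation `(T, Δ, Z)`; the indicator `Δ` takes the values `0` and `1`. -/
abbrev Obs (p : ℕ) : Type := ℝ × ℝ × Cov p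

/-- The follow-up time. -/
def time {p : ℕ} (o : Obs p) : ℝ := o.1

/-- The censoring indicator, `1` for an observed event. -/
def ind {p : ℕ} (o : Obs p) : ℝ := o.2.1

/-- The covariate vector. -/
def cov {p : ℕ} (o : Obs p) : Cov p := o.2.2

/-- What is observed of an event time `x`, a censoring time `c` and a covariate vector `z`. -/
def observe {p : ℕ} (x c : ℝ) (z : Cov p) : Obs p := (min x c, if x ≤ c then 1 else 0, z)

/-! ### Estimators based on the first `n` terms of a data sequence `y` -/

/-- `∑_{i ≤ n} {T_i ≥ x} exp (β' Z_i)`. -/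
def riskSum {p : ℕ} (n : ℕ) (y : ℕ → Obs p) (β : Cov p) (x : ℝ) : ℝ :=
  ∑ i ∈ Finset.range n, if x ≤ time (y i) then Real.exp ⟪β, cov (y i)⟫ else 0

/-- The partial likelihood: a product over the observed events. -/
def partialLikelihood {p : ℕ} (n : ℕ) (y : ℕ → Obs p) (β : Cov p) : ℝ :=
  ∏ i ∈ Finset.range n, if ind (y i) = 1 then
    Real.exp ⟪β, cov (y i)⟫ / riskSum n y β (time (y i)) else 1

/-- `b` is a maximum partial likelihood estimate; `b` is arbitrary for those (finite) samples
whose partial likelihood does not attain its supremum. -/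
def IsMPLE {p : ℕ} (n : ℕ) (y : ℕ → Obs p) (b : Cov p) : Prop :=
  (∃ b', IsMaxOn (partialLikelihood n y) univ b') → IsMaxOn (partialLikelihood n y) univ b

/-- The Breslow estimator `Λ_n`, where `β` is the estimate of the regression coefficients. -/
def breslow {p : ℕ} (n : ℕ) (y : ℕ → Obs p) (β : Cov p) (x : ℝ) : ℝ :=
  ∑ i ∈ Finset.range n, if ind (y i) = 1 ∧ time (y i) ≤ x then
    1 / riskSum n y β (time (y i)) else 0

/-- The estimator `F_n = 1 - exp (-Λ_n)` of the baseline distribution function. -/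
def cdfEst {p : ℕ} (n : ℕ) (y : ℕ → Obs p) (β : Cov p) (x : ℝ) : ℝ :=
  1 - Real.exp (-breslow n y β x)

/-- The interval `[0, T_(n)]`. -/
def obsInterval {p : ℕ} (n : ℕ) (y : ℕ → Obs p) : Set ℝ :=
  {x | 0 ≤ x ∧ ∃ i < n, x ≤ time (y i)}

/-- The greatest convex minorant of `f` on `I`. -/
def gcm (I : Set ℝ) (f : ℝ → ℝ) (x : ℝ) : ℝ :=
  sSup {a | ∃ g : ℝ → ℝ, ConvexOn ℝ I g ∧ (∀ u ∈ I, g u ≤ f u) ∧ a = g x}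

/-- The least concave majorant of `f` on `I`. -/
def lcm (I : Set ℝ) (f : ℝ → ℝ) (x : ℝ) : ℝ :=
  sInf {a | ∃ g : ℝ → ℝ, ConcaveOn ℝ I g ∧ (∀ u ∈ I, f u ≤ g u) ∧ a = g x}

/-- The left-hand slope. -/
def leftSlope (f : ℝ → ℝ) (x : ℝ) : ℝ := derivWithin f (Iic x) x

/-- Grenander type estimator of a nondecreasing baseline hazard. -/
def hazardGrenanderInc {p : ℕ} (n : ℕ) (y : ℕ → Obs p) (β : Cov p) (x : ℝ) : ℝ :=
  leftSlope (gcm (obsInterval n y) (breslow n y β)) x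

/-- Grenander type estimator of a nonincreasing baseline hazard. -/
def hazardGrenanderDec {p : ℕ} (n : ℕ) (y : ℕ → Obs p) (β : Cov p) (x : ℝ) : ℝ :=
  leftSlope (lcm (obsInterval n y) (breslow n y β)) x

/-- Grenander type estimator of a nonincreasing baseline density. -/
def densityGrenanderDec {p : ℕ} (n : ℕ) (y : ℕ → Obs p) (β : Cov p) (x : ℝ) : ℝ :=
  leftSlope (lcm (obsInterval n y) (cdfEst n y β)) x

/-- The (pseudo) likelihood of a baseline hazard `l`, for given `β`:
`∏_{i ≤ n} [l(T_i) exp (β' Z_i)]^{Δ_i} exp (- exp (β' Z_i) ∫₀^{T_i} l)`. -/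
def likelihood {p : ℕ} (n : ℕ) (y : ℕ → Obs p) (β : Cov p) (l : ℝ → ℝ) : ℝ :=
  ∏ i ∈ Finset.range n,
    (if ind (y i) = 1 then l (time (y i)) * Real.exp ⟪β, cov (y i)⟫ else 1) *
      Real.exp (-(Real.exp ⟪β, cov (y i)⟫ * ∫ u in (0 : ℝ)..time (y i), l u))

/-- Nondecreasing hazards on `[0, ∞)` that are bounded by `M`. -/
def incHazards (M : ℝ) : Set (ℝ → ℝ) :=
  {l | MonotoneOn l (Ici 0) ∧ ∀ x, 0 ≤ x → 0 ≤ l x ∧ l x ≤ M}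

/-- Nonincreasing hazards on `[0, ∞)`. -/
def decHazards : Set (ℝ → ℝ) :=
  {l | AntitoneOn l (Ici 0) ∧ ∀ x, 0 ≤ x → 0 ≤ l x}

/-- `l` is the NPMLE of a nondecreasing baseline hazard, for given `β`: on `[0, T_(n))` it is the
limit, as `M → ∞`, of maximizers of the likelihood over the nondecreasing hazards bounded by `M`
(the bound is needed since the value at `T_(n)` can be chosen arbitrarily large; the NPMLE is not
determined by the likelihood on `[T_(n), ∞)`, and its values there are left free). -/
def IsIncNPMLE {p : ℕ} (n : ℕ) (y : ℕ → Obs p) (β : Cov p) (l : ℝ → ℝ) : Prop :=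
  ∃ s : ℝ → ℝ → ℝ,
    (∀ᶠ M in atTop, s M ∈ incHazards M ∧ IsMaxOn (likelihood n y β) (incHazards M) (s M)) ∧
      ∀ x, 0 ≤ x → (∃ i < n, x < time (y i)) → Tendsto (fun M => s M x) atTop (𝓝 (l x))

/-- `l` is an NPMLE of a nonincreasing baseline hazard, for given `β`. -/
def IsDecNPMLE {p : ℕ} (n : ℕ) (y : ℕ → Obs p) (β : Cov p) (l : ℝ → ℝ) : Prop :=
  l ∈ decHazards ∧ IsMaxOn (likelihood n y β) decHazards l

/-- `a ≤ liminf u ≤ limsup u ≤ b`, with the lower and upper limits taken in `[-∞, ∞]`. -/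
def LimitsBetween (a : ℝ) (u : ℕ → ℝ) (b : ℝ) : Prop :=
  (a : EReal) ≤ liminf (fun n => (u n : EReal)) atTop ∧
    liminf (fun n => (u n : EReal)) atTop ≤ limsup (fun n => (u n : EReal)) atTop ∧
      limsup (fun n => (u n : EReal)) atTop ≤ (b : EReal)

end CoxShape

end

set_option linter.unusedSectionVars false

/-! ### Limit bounds and uniform convergence of monotone functions -/

namespace CoxShape

/-! The argument separates a probabilistic half, which shows that almost every data sequence is a
`ConsistentPath`, from a deterministic half, which derives all the limit bounds along such a path.

Deterministic half, slope estimators. The Breslow estimator converges to `Λ₀` pointwise on `[0, τ)`,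
hence uniformly on compact subintervals by Pólya's lemma. When `λ₀` is nondecreasing, the line
through `(x₀, Λ₀(x₀))` with slope `λ₀(x₀)` supports `Λ₀` from below, so, lowered by `ε`, it lies
below `Λ_n` and the convex minorant at `x₀` is nearly `Λ₀(x₀)`. At neighbouring points the minorant
is at most `Λ_n`, and convexity squeezes its left slope between difference quotients
(`eventually_leftSlope_gcm`). Concave majorants follow by a change of sign, but need in addition
that `Λ_n` gains little mass near `τ`.

Deterministic half, likelihood estimators. No explicit form of the maximizer is used. If it exceeded
some `κ > λ₀(x₀+)` at `x₀`, cutting it down towards `κ` on one side would keep it monotone and raise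
the likelihood. Indeed, by the layer cake formula, the first order effect of subtracting `g` is an
integral over the level sets of `g`. These are essentially intervals, on which events are at most `k
< κ` times the weighted time at risk, up to a uniformly small error (`event_sum_lt`,
`le_of_lowering`). Lower bounds come from raising the maximizer (`lt_event_sum`, `le_of_raising`).

Probabilistic half. All information about the model is contained in `CoxLaw`, whose core is
Campbell's formula: an event at time `t` has intensity `{t ≤ T} exp (β₀' Z) dΛ₀(t)`. Given all other
observations it still holds for predictable integrands (`IsSample.campbell`) and plays the part of
martingale theory.

The main difficulty is the end point `τ`, where the risk sums become small and their reciprocals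
large. Let the number of events in a set `G` at which the risk sum of the observations collected so
far is at most `L` be counted. Its compensator is at most `L * Λ(G)`, whatever the sample size, and
a second moment bound gives a tail estimate uniform in `n`. Dyadic cells at scales `L = 16 ^ (l +
1)` and Borel–Cantelli then bound the Nelson–Aalen increment over `[b, τ)` by a multiple of `τ - b`
(`eventually_sum_inv_riskSum_le`).

For the regression coefficients, the partial likelihood ratio against the truth has expectation at
most one (`lintegral_plRatio_le_one`), so along any deterministic sequence it is eventually at most
`n ^ 2`. Testing at distance `n ^ (-1/4)` from `β₀` bounds the score by a multiple of `n * n ^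
(-1/4)`. Identifiability and compactness of the sphere give quadratic curvature, and concavity
confines the maximizer to a ball of radius `K * n ^ (-1/4)`, up to directions orthogonal to all
covariates (`exists_rate_of_isMPLE`). A rate, and not just consistency, is what allows risk sums at
the estimate and at `β₀` to be compared by a factor at every event, including those close to `τ`
(`eventually_riskSum_le_two_mul`). -/

theorem limitsBetween_of_eventually {a b : ℝ} {u : ℕ → ℝ}
    (h : ∀ ε > 0, ∀ᶠ n in atTop, a - ε ≤ u n ∧ u n ≤ b + ε) : LimitsBetween a u b := by
  refine ⟨?_, liminf_le_limsup, ?_⟩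
  · refine le_of_forall_lt fun c hc => ?_
    obtain ⟨c', hc1, hc2⟩ := EReal.lt_iff_exists_real_btwn.1 hc
    refine lt_of_lt_of_le hc1 (le_liminf_of_le (by isBoundedDefault) ?_)
    have hpos : 0 < a - c' := sub_pos.2 (EReal.coe_lt_coe_iff.1 hc2)
    filter_upwards [h _ hpos] with n hn
    exact EReal.coe_le_coe_iff.2 (by linarith [hn.1])
  · refine le_of_forall_gt fun c hc => ?_
    obtain ⟨c', hc1, hc2⟩ := EReal.lt_iff_exists_real_btwn.1 hc
    refine lt_of_le_of_lt (limsup_le_of_le (by isBoundedDefault) ?_) hc2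
    have hpos : 0 < c' - b := sub_pos.2 (EReal.coe_lt_coe_iff.1 hc1)
    filter_upwards [h _ hpos] with n hn
    exact EReal.coe_le_coe_iff.2 (by linarith [hn.2])

/-- Pólya's lemma: monotone functions that converge at the points of equidistant grids to a
continuous function converge uniformly. -/
theorem eventually_uniform_of_monotoneOn {f : ℕ → ℝ → ℝ} {g : ℝ → ℝ} {a b : ℝ} (hab : a < b)
    (hf : ∀ n, MonotoneOn (f n) (Icc a b)) (hg : ContinuousOn g (Icc a b))
    (h : ∀ k m : ℕ, 0 < m → k ≤ m →
      Tendsto (fun n => f n (a + (b - a) * (k / m))) atTop (𝓝 (g (a + (b - a) * (k / m)))))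
    {ε : ℝ} (hε : 0 < ε) : ∀ᶠ n in atTop, ∀ t ∈ Icc a b, |f n t - g t| ≤ ε := by
  have huc := isCompact_Icc.uniformContinuousOn_of_continuous hg
  obtain ⟨δ, hδ, hgδ⟩ := Metric.uniformContinuousOn_iff.1 huc (ε / 2) (half_pos hε)
  obtain ⟨m, hm⟩ := exists_nat_gt ((b - a) / δ)
  have hba : 0 < b - a := sub_pos.2 hab
  have hm0 : (0 : ℝ) < m := lt_trans (by positivity) hm
  have hm0' : 0 < m := by exact_mod_cast hm0
  have hstep : (b - a) / m < δ := by
    rw [div_lt_iff₀ hm0]; rw [div_lt_iff₀ hδ] at hm; linarith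
  have hgrid : ∀ᶠ n in atTop, ∀ k ∈ Finset.range (m + 1),
      |f n (a + (b - a) * (k / m)) - g (a + (b - a) * (k / m))| < ε / 2 := by
    rw [Filter.eventually_all_finset]
    intro k hk
    have := h k m hm0' (by simpa [Nat.lt_succ_iff] using hk)
    exact (Metric.tendsto_atTop'.1 this (ε / 2) (half_pos hε)).elim
      fun N hN => (eventually_gt_atTop N).mono fun n hn => hN n hn
  filter_upwards [hgrid] with n hn t ht
  have hpt : ∀ k : ℕ, k ≤ m → a + (b - a) * (k / m) ∈ Icc a b := by
    intro k hk
    have h1 : (k : ℝ) / m ≤ 1 := (div_le_one hm0).2 (by exact_mod_cast hk)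
    have h0 : (0 : ℝ) ≤ k / m := by positivity
    constructor <;> nlinarith
  obtain ⟨k, hk, hk1, hk2⟩ : ∃ k : ℕ, k < m ∧ a + (b - a) * (k / m) ≤ t ∧
      t ≤ a + (b - a) * ((k + 1 : ℕ) / m) := by
    set z := (t - a) / (b - a) * m with hz
    have hz0 : 0 ≤ z := by have := ht.1; have : 0 ≤ t - a := by linarith
                           positivity
    have hzm : z ≤ m := by
      have : (t - a) / (b - a) ≤ 1 := (div_le_one hba).2 (by linarith [ht.2])
      nlinarith
    have hconv : t = a + (b - a) * (z / m) := by rw [hz]; field_simp; ring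
    rcases lt_or_ge (⌊z⌋₊) m with hlt | hge
    · refine ⟨⌊z⌋₊, hlt, ?_, ?_⟩
      · rw [hconv]; have := Nat.floor_le hz0; gcongr
      · rw [hconv]; have := (Nat.lt_floor_add_one z).le; push_cast; gcongr
    -- The right end point `t = b` has floor `m`; it is put into the last cell, whose index is `m -
    -- 1`.
    · have : z = m := le_antisymm hzm
        (le_trans (by exact_mod_cast hge) (Nat.floor_le hz0))
      refine ⟨m - 1, by omega, ?_, ?_⟩
      · rw [hconv, this]; gcongr; omega
      · rw [hconv, this, Nat.sub_add_cancel hm0']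
  have hkm : k ∈ Finset.range (m + 1) := by simp; omega
  have hkm' : k + 1 ∈ Finset.range (m + 1) := by simp; omega
  have e1 := abs_lt.1 (hn k hkm)
  have e2 := abs_lt.1 (hn (k + 1) hkm')
  have p1 := hpt k hk.le
  have p2 := hpt (k + 1) hk
  have m1 := hf n p1 ht hk1
  have m2 := hf n ht p2 hk2
  have hdist : a + (b - a) * (((k + 1 : ℕ) : ℝ) / m) - (a + (b - a) * (k / m)) = (b - a) / m := by
    push_cast; field_simp; ring
  have c1 := hgδ _ p1 t ht (by rw [Real.dist_eq, abs_lt]; constructor <;> linarith)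
  have c2 := hgδ _ p2 t ht (by rw [Real.dist_eq, abs_lt]; constructor <;> linarith)
  rw [Real.dist_eq, abs_lt] at c1 c2
  rw [abs_le]
  constructor <;> linarith

theorem eventually_uniform_of_antitoneOn {f : ℕ → ℝ → ℝ} {g : ℝ → ℝ} {a b : ℝ} (hab : a < b)
    (hf : ∀ n, AntitoneOn (f n) (Icc a b)) (hg : ContinuousOn g (Icc a b))
    (h : ∀ k m : ℕ, 0 < m → k ≤ m →
      Tendsto (fun n => f n (a + (b - a) * (k / m))) atTop (𝓝 (g (a + (b - a) * (k / m)))))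
    {ε : ℝ} (hε : 0 < ε) : ∀ᶠ n in atTop, ∀ t ∈ Icc a b, |f n t - g t| ≤ ε := by
  have := eventually_uniform_of_monotoneOn (f := fun n t => -f n t) (g := fun t => -g t) hab
    (fun n => (hf n).neg) hg.neg (fun k m hm hk => (h k m hm hk).neg) hε
  filter_upwards [this] with n hn t ht
  rw [← abs_neg]
  convert hn t ht using 2
  ring

/-! ### Slopes of convex minorants and concave majorants -/

theorem bddAbove_gcm {I : Set ℝ} {f : ℝ → ℝ} {x : ℝ} (hx : x ∈ I) :
    BddAbove {a | ∃ g : ℝ → ℝ, ConvexOn ℝ I g ∧ (∀ u ∈ I, g u ≤ f u) ∧ a = g x} :=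
  ⟨f x, by rintro _ ⟨g, -, hg, rfl⟩; exact hg x hx⟩

theorem le_gcm {I : Set ℝ} {f g : ℝ → ℝ} (hg : ConvexOn ℝ I g) (hgf : ∀ u ∈ I, g u ≤ f u)
    {x : ℝ} (hx : x ∈ I) : g x ≤ gcm I f x :=
  le_csSup (bddAbove_gcm hx) ⟨g, hg, hgf, rfl⟩

theorem gcm_le {I : Set ℝ} {f g : ℝ → ℝ} (hg : ConvexOn ℝ I g) (hgf : ∀ u ∈ I, g u ≤ f u)
    {x : ℝ} (hx : x ∈ I) : gcm I f x ≤ f x :=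
  csSup_le ⟨_, g, hg, hgf, rfl⟩ (by rintro _ ⟨g, -, hg, rfl⟩; exact hg x hx)

theorem convexOn_gcm {I : Set ℝ} {f g : ℝ → ℝ} (hg : ConvexOn ℝ I g)
    (hgf : ∀ u ∈ I, g u ≤ f u) : ConvexOn ℝ I (gcm I f) := by
  refine ⟨hg.1, fun x hx y hy a b ha hb hab => csSup_le ⟨_, g, hg, hgf, rfl⟩ ?_⟩
  rintro _ ⟨k, hk, hkf, rfl⟩
  refine (hk.2 hx hy ha hb hab).trans ?_
  have h1 := le_gcm hk hkf hx
  have h2 := le_gcm hk hkf hy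
  simp only [smul_eq_mul]
  gcongr

/-- Slopes of a convex function increase, so its left derivative lies between any difference
quotient on the left and any on the right. This converts closeness of values into closeness of
slopes. -/
theorem leftSlope_mem_of_convexOn {I : Set ℝ} {f : ℝ → ℝ} (hf : ConvexOn ℝ I f) {x h k : ℝ}
    (hh : 0 < h) (hk : 0 < k) (h1 : x - h ∈ I) (h2 : x + k ∈ I) :
    (f x - f (x - h)) / h ≤ leftSlope f x ∧ leftSlope f x ≤ (f (x + k) - f x) / k := by
  have hsub : Icc (x - h) (x + k) ⊆ I := hf.1.ordConnected.out h1 h2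
  have hint : x ∈ interior I :=
    interior_mono hsub (by rw [interior_Icc]; constructor <;> linarith)
  have hx : x ∈ I := interior_subset hint
  have hd := hf.hasDerivWithinAt_leftDeriv_of_mem_interior hint
  have heq : leftSlope f x = derivWithin f (Iio x) x :=
    hd.Iic_of_Iio.derivWithin (uniqueDiffOn_Iic x x self_mem_Iic)
  rw [heq]
  constructor
  · have := hf.slope_le_of_hasDerivWithinAt_Iio h1 hx (by linarith) hd
    rwa [slope_def_field, sub_sub_cancel] at this
  · refine (hf.leftDeriv_le_rightDeriv_of_mem_interior hint).trans ?_
    have := hf.rightDeriv_le_slope_of_mem_interior hint h2 (by linarith)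
    rwa [slope_def_field, add_sub_cancel_left] at this

/-- The minorant has to be bounded from below only at `x₀`, where an approximate supporting line of
`f n` serves, and from above only at one point on each side, where it is at most `f n`. The line
must stay below `f n` on the whole of `I n`, since convex minorants are global objects. -/
theorem eventually_leftSlope_gcm {I : ℕ → Set ℝ} {f : ℕ → ℝ → ℝ} {Φ : ℝ → ℝ}
    {x₀ a lo hi δ : ℝ} (hI : ∀ n, Convex ℝ (I n))
    (hmem : ∀ᶠ n in atTop, x₀ - δ ∈ I n ∧ x₀ + δ ∈ I n)
    (hlow : ∀ ε > 0, ∀ᶠ n in atTop, ∀ u ∈ I n, Φ x₀ + a * (u - x₀) - ε ≤ f n u)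
    (hconv : ∀ x ∈ Icc (x₀ - δ) (x₀ + δ), Tendsto (fun n => f n x) atTop (𝓝 (Φ x)))
    (hlo : ∀ ε > 0, ∃ h ∈ Ioc 0 δ, lo - ε ≤ (Φ x₀ - Φ (x₀ - h)) / h)
    (hhi : ∀ ε > 0, ∃ h ∈ Ioc 0 δ, (Φ (x₀ + h) - Φ x₀) / h ≤ hi + ε) {ε : ℝ} (hε : 0 < ε) :
    ∀ᶠ n in atTop, lo - ε ≤ leftSlope (gcm (I n) (f n)) x₀ ∧
      leftSlope (gcm (I n) (f n)) x₀ ≤ hi + ε := by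
  obtain ⟨h, ⟨hh, hhδ⟩, hh2⟩ := hlo (ε / 2) (half_pos hε)
  obtain ⟨k, ⟨hk, hkδ⟩, hk2⟩ := hhi (ε / 2) (half_pos hε)
  -- Each difference quotient suffers two errors `e`, from the line at `x₀` and from the convergence
  -- at the neighbour; after division by `h` or `k` they cost at most `ε / 2`.
  set e := min (h * ε / 4) (k * ε / 4) with he
  have hepos : 0 < e := by positivity
  have c1 := (Metric.tendsto_nhds.1 (hconv (x₀ - h) ⟨by linarith, by linarith⟩)) e hepos
  have c2 := (Metric.tendsto_nhds.1 (hconv (x₀ + k) ⟨by linarith, by linarith⟩)) e hepos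
  filter_upwards [hmem, hlow e hepos, c1, c2] with n hn hl c1 c2
  have hsub : Icc (x₀ - δ) (x₀ + δ) ⊆ I n := (hI n).ordConnected.out hn.1 hn.2
  have hl1 : x₀ - h ∈ I n := hsub ⟨by linarith, by linarith⟩
  have hl2 : x₀ + k ∈ I n := hsub ⟨by linarith, by linarith⟩
  have hl0 : x₀ ∈ I n := hsub ⟨by linarith, by linarith⟩
  have hline : ConvexOn ℝ (I n) fun u => Φ x₀ + a * (u - x₀) - e := by
    refine ⟨hI n, fun x _ y _ s t _ _ hst => le_of_eq ?_⟩
    simp only [smul_eq_mul]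
    linear_combination (-(Φ x₀ - a * x₀ - e)) * hst
  have b0 := le_gcm hline hl hl0
  have b1 := gcm_le hline hl hl1
  have b2 := gcm_le hline hl hl2
  obtain ⟨d1, d2⟩ := leftSlope_mem_of_convexOn (convexOn_gcm hline hl) hh hk hl1 hl2
  rw [Real.dist_eq, abs_lt] at c1 c2
  have e1 : e ≤ h * ε / 4 := min_le_left _ _
  have e2 : e ≤ k * ε / 4 := min_le_right _ _
  simp only [sub_self, mul_zero, add_zero] at b0
  constructor
  · refine le_trans ?_ d1
    rw [le_div_iff₀ hh]
    rw [le_div_iff₀ hh] at hh2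
    nlinarith
  · refine d2.trans ?_
    rw [div_le_iff₀ hk]
    rw [div_le_iff₀ hk] at hk2
    nlinarith

theorem lcm_eq_neg_gcm (I : Set ℝ) (f : ℝ → ℝ) : lcm I f = fun x => -gcm I (fun u => -f u) x := by
  funext x
  rw [lcm, gcm, ← Real.sInf_neg]
  congr 1
  ext a
  simp only [mem_ofPred_eq, Set.mem_neg]
  constructor
  · rintro ⟨g, hg, hfg, rfl⟩
    exact ⟨fun u => -g u, hg.neg, fun u hu => neg_le_neg (hfg u hu), rfl⟩
  · rintro ⟨g, hg, hfg, h⟩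
    exact ⟨fun u => -g u, hg.neg, fun u hu => by linarith [hfg u hu], by linarith⟩

theorem eventually_leftSlope_lcm {I : ℕ → Set ℝ} {f : ℕ → ℝ → ℝ} {Φ : ℝ → ℝ}
    {x₀ a lo hi δ : ℝ} (hI : ∀ n, Convex ℝ (I n))
    (hmem : ∀ᶠ n in atTop, x₀ - δ ∈ I n ∧ x₀ + δ ∈ I n)
    (hupp : ∀ ε > 0, ∀ᶠ n in atTop, ∀ u ∈ I n, f n u ≤ Φ x₀ + a * (u - x₀) + ε)
    (hconv : ∀ x ∈ Icc (x₀ - δ) (x₀ + δ), Tendsto (fun n => f n x) atTop (𝓝 (Φ x)))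
    (hhi : ∀ ε > 0, ∃ h ∈ Ioc 0 δ, (Φ x₀ - Φ (x₀ - h)) / h ≤ hi + ε)
    (hlo : ∀ ε > 0, ∃ h ∈ Ioc 0 δ, lo - ε ≤ (Φ (x₀ + h) - Φ x₀) / h) {ε : ℝ} (hε : 0 < ε) :
    ∀ᶠ n in atTop, lo - ε ≤ leftSlope (lcm (I n) (f n)) x₀ ∧
      leftSlope (lcm (I n) (f n)) x₀ ≤ hi + ε := by
  have key := eventually_leftSlope_gcm (f := fun n u => -f n u) (Φ := fun u => -Φ u) (a := -a)
    (lo := -hi) (hi := -lo) (δ := δ) (x₀ := x₀) hI hmem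
    (fun e he => (hupp e he).mono fun n hn u hu => by linarith [hn u hu])
    (fun x hx => (hconv x hx).neg)
    (fun e he => (hhi e he).imp fun h hh => ⟨hh.1, by
      have : (-Φ x₀ - -Φ (x₀ - h)) / h = -((Φ x₀ - Φ (x₀ - h)) / h) := by ring
      rw [this]; linarith [hh.2]⟩)
    (fun e he => (hlo e he).imp fun h hh => ⟨hh.1, by
      have : (-Φ (x₀ + h) - -Φ x₀) / h = -((Φ (x₀ + h) - Φ x₀) / h) := by ring
      rw [this]; linarith [hh.2]⟩) hε
  filter_upwards [key] with n hn
  have : leftSlope (lcm (I n) (f n)) x₀ = -leftSlope (gcm (I n) fun u => -f n u) x₀ := by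
    rw [lcm_eq_neg_gcm, leftSlope, leftSlope, derivWithin.fun_neg]
  rw [this]
  constructor <;> linarith [hn.1, hn.2]

end CoxShape

namespace CoxShape

variable {p : ℕ}

/-! ### Perturbations of the baseline hazard in the likelihood -/

/-- The counting measure of the observed events among the first `n` observations. -/
noncomputable def eventMeasure (n : ℕ) (y : ℕ → Obs p) : Measure ℝ :=
  ∑ i ∈ Finset.range n, if ind (y i) = 1 then Measure.dirac (time (y i)) else 0

/-- The measure with density `riskSum n y β`. -/
noncomputable def riskMeasure (n : ℕ) (y : ℕ → Obs p) (β : Cov p) : Measure ℝ :=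
  ∑ i ∈ Finset.range n,
    ENNReal.ofReal (Real.exp ⟪β, cov (y i)⟫) • volume.restrict (Ioc 0 (time (y i)))

theorem lintegral_eventMeasure (n : ℕ) (y : ℕ → Obs p) {g : ℝ → ℝ} (hg : Measurable g)
    (hg0 : ∀ u, 0 ≤ g u) :
    ∫⁻ u, ENNReal.ofReal (g u) ∂(eventMeasure n y) = ENNReal.ofReal
      (∑ i ∈ Finset.range n, if ind (y i) = 1 then g (time (y i)) else 0) := by
  rw [eventMeasure, lintegral_finsetSum_measure, ENNReal.ofReal_sum_of_nonneg]
  · refine Finset.sum_congr rfl fun i _ => ?_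
    split_ifs
    · rw [lintegral_dirac' _ (by fun_prop)]
    · simp
  · intro i _; split_ifs <;> simp [hg0]

theorem lintegral_riskMeasure (n : ℕ) (y : ℕ → Obs p) (β : Cov p) {g : ℝ → ℝ}
    (hg0 : ∀ u, 0 ≤ g u) (hT : ∀ i < n, 0 ≤ time (y i))
    (hgi : ∀ i < n, IntervalIntegrable g volume 0 (time (y i))) :
    ∫⁻ u, ENNReal.ofReal (g u) ∂(riskMeasure n y β) = ENNReal.ofReal
      (∑ i ∈ Finset.range n, Real.exp ⟪β, cov (y i)⟫ * ∫ u in (0 : ℝ)..time (y i), g u) := by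
  rw [riskMeasure, lintegral_finsetSum_measure, ENNReal.ofReal_sum_of_nonneg]
  · refine Finset.sum_congr rfl fun i hi => ?_
    have hi' := Finset.mem_range.1 hi
    rw [lintegral_smul_measure, ENNReal.ofReal_mul (Real.exp_pos _).le, smul_eq_mul,
      intervalIntegral.integral_of_le (hT i hi'),
      ofReal_integral_eq_lintegral_ofReal
        ((intervalIntegrable_iff_integrableOn_Ioc_of_le (hT i hi')).1 (hgi i hi'))
        (ae_of_all _ hg0)]
  · intro i hi
    exact mul_nonneg (Real.exp_pos _).le
      (intervalIntegral.integral_nonneg (hT i (Finset.mem_range.1 hi)) fun u _ => hg0 u)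

/-- The increment of the log-likelihood, kept in multiplicative form so that no logarithm of a
possibly vanishing factor occurs. -/
theorem likelihood_mul_exp_le {n : ℕ} {y : ℕ → Obs p} {β : Cov p} {l l' : ℝ → ℝ} (e f : ℕ → ℝ)
    (hl : ∀ i < n, ind (y i) = 1 → 0 ≤ l (time (y i)))
    (he : ∀ i < n, ind (y i) = 1 → l (time (y i)) * Real.exp (e i) ≤ l' (time (y i)))
    (hf : ∀ i < n, ∫ u in (0 : ℝ)..time (y i), l' u = (∫ u in (0 : ℝ)..time (y i), l u) - f i) :
    likelihood n y β l * Real.exp (∑ i ∈ Finset.range n,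
      ((if ind (y i) = 1 then e i else 0) + Real.exp ⟪β, cov (y i)⟫ * f i)) ≤
      likelihood n y β l' := by
  rw [likelihood, likelihood, Real.exp_sum, ← Finset.prod_mul_distrib]
  refine Finset.prod_le_prod (fun i hi => ?_) fun i hi => ?_
  · have := hl i (Finset.mem_range.1 hi)
    split_ifs with h
    · have := this h; positivity
    · positivity
  · have hi' := Finset.mem_range.1 hi
    rw [hf i hi', Real.exp_add]
    have h1 : Real.exp (-(Real.exp ⟪β, cov (y i)⟫ *
        ((∫ u in (0 : ℝ)..time (y i), l u) - f i))) =
        Real.exp (-(Real.exp ⟪β, cov (y i)⟫ * ∫ u in (0 : ℝ)..time (y i), l u)) *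
          Real.exp (Real.exp ⟪β, cov (y i)⟫ * f i) := by
      rw [← Real.exp_add]; congr 1; ring
    rw [h1]
    split_ifs with h
    · have h2 := mul_le_mul_of_nonneg_right (he i hi' h)
        (by positivity : 0 ≤ Real.exp ⟪β, cov (y i)⟫ *
          (Real.exp (-(Real.exp ⟪β, cov (y i)⟫ * ∫ u in (0 : ℝ)..time (y i), l u)) *
            Real.exp (Real.exp ⟪β, cov (y i)⟫ * f i)))
      linarith
    · simp

theorem likelihood_pos_iff {n : ℕ} {y : ℕ → Obs p} {β : Cov p} {l : ℝ → ℝ}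
    (hl : ∀ i < n, 0 ≤ l (time (y i))) :
    0 < likelihood n y β l ↔ ∀ i < n, ind (y i) = 1 → 0 < l (time (y i)) := by
  constructor
  · intro h i hi hind
    refine lt_of_le_of_ne (hl i hi) fun h0 => h.ne' ?_
    exact Finset.prod_eq_zero (Finset.mem_range.2 hi) (by simp [hind, ← h0])
  · intro h
    refine Finset.prod_pos fun i hi => ?_
    have := h i (Finset.mem_range.1 hi)
    split_ifs with hind
    · have := this hind; positivity
    · positivity

/-- Subtracting `g` costs `log (l / (l - g)) ≤ g / (l - g) ≤ g / κ` at an event where `g` does not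
vanish, and gains the weighted integrals of `g`. If the likelihood does not increase, the gain is at
most the cost. -/
theorem sum_le_of_likelihood_sub_le {n : ℕ} {y : ℕ → Obs p} {β : Cov p} {l g : ℝ → ℝ} {κ : ℝ}
    (hκ : 0 < κ) (hg : ∀ u, 0 ≤ g u) (hpos : 0 < likelihood n y β l)
    (hl : ∀ i < n, 0 ≤ l (time (y i)))
    (hlg : ∀ i < n, g (time (y i)) = 0 ∨ κ ≤ l (time (y i)) - g (time (y i)))
    (hli : ∀ i < n, IntervalIntegrable l volume 0 (time (y i)))
    (hgi : ∀ i < n, IntervalIntegrable g volume 0 (time (y i)))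
    (hmax : likelihood n y β (fun u => l u - g u) ≤ likelihood n y β l) :
    κ * (∑ i ∈ Finset.range n, Real.exp ⟪β, cov (y i)⟫ * ∫ u in (0 : ℝ)..time (y i), g u) ≤
      ∑ i ∈ Finset.range n, if ind (y i) = 1 then g (time (y i)) else 0 := by
  have h := likelihood_mul_exp_le (n := n) (y := y) (β := β) (l := l) (l' := fun u => l u - g u)
    (fun i => -(g (time (y i)) / κ)) (fun i => ∫ u in (0 : ℝ)..time (y i), g u)
    (fun i hi _ => hl i hi) (fun i hi _ => ?_) (fun i hi => ?_)
  · have h2 := h.trans hmax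
    have h3 := le_of_mul_le_mul_left (h2.trans_eq (mul_one _).symm) hpos
    rw [Real.exp_le_one_iff, Finset.sum_add_distrib] at h3
    have h4 : (∑ i ∈ Finset.range n, if ind (y i) = 1 then -(g (time (y i)) / κ) else 0) =
        -((∑ i ∈ Finset.range n, if ind (y i) = 1 then g (time (y i)) else 0) / κ) := by
      rw [Finset.sum_div, ← Finset.sum_neg_distrib]
      exact Finset.sum_congr rfl fun i _ => by split_ifs <;> simp
    rw [h4] at h3
    rw [mul_comm, ← le_div_iff₀ hκ]
    linarith
  · rcases hlg i hi with h0 | h0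
    · simp [h0]
    · have hpos' : 0 < l (time (y i)) - g (time (y i)) := lt_of_lt_of_le hκ h0
      set a := l (time (y i)) - g (time (y i)) with ha
      have hla : l (time (y i)) = a * (1 + g (time (y i)) / a) := by
        field_simp; rw [ha]; ring
      have h1 : 1 + g (time (y i)) / a ≤ Real.exp (g (time (y i)) / κ) :=
        (by linarith [Real.add_one_le_exp (g (time (y i)) / a)] :
          1 + g (time (y i)) / a ≤ Real.exp (g (time (y i)) / a)).trans
          (Real.exp_le_exp.2 (div_le_div_of_nonneg_left (hg _) hκ h0))
      rw [hla, mul_assoc]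
      refine mul_le_of_le_one_right hpos'.le ?_
      rw [Real.exp_neg, ← div_eq_mul_inv]
      exact div_le_one_of_le₀ h1 (Real.exp_pos _).le
  · exact intervalIntegral.integral_sub (hli i hi) (hgi i hi)

/-- Adding `g` gains `log ((l + g) / l) ≥ g / (l + g) ≥ g / κ` at such an event, where `l` is
positive because the likelihood is. -/
theorem sum_le_of_likelihood_add_le {n : ℕ} {y : ℕ → Obs p} {β : Cov p} {l g : ℝ → ℝ} {κ : ℝ}
    (hκ : 0 < κ) (hg : ∀ u, 0 ≤ g u) (hpos : 0 < likelihood n y β l)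
    (hl : ∀ i < n, 0 ≤ l (time (y i)))
    (hlg : ∀ i < n, g (time (y i)) = 0 ∨ l (time (y i)) + g (time (y i)) ≤ κ)
    (hli : ∀ i < n, IntervalIntegrable l volume 0 (time (y i)))
    (hgi : ∀ i < n, IntervalIntegrable g volume 0 (time (y i)))
    (hmax : likelihood n y β (fun u => l u + g u) ≤ likelihood n y β l) :
    (∑ i ∈ Finset.range n, if ind (y i) = 1 then g (time (y i)) else 0) ≤
    κ * (∑ i ∈ Finset.range n, Real.exp ⟪β, cov (y i)⟫ * ∫ u in (0 : ℝ)..time (y i), g u) := by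
  have hl' := (likelihood_pos_iff hl).1 hpos
  have h := likelihood_mul_exp_le (n := n) (y := y) (β := β) (l := l) (l' := fun u => l u + g u)
    (fun i => g (time (y i)) / κ) (fun i => -∫ u in (0 : ℝ)..time (y i), g u)
    (fun i hi _ => hl i hi) (fun i hi hind => ?_) (fun i hi => ?_)
  · have h2 := h.trans hmax
    have h3 := le_of_mul_le_mul_left (h2.trans_eq (mul_one _).symm) hpos
    rw [Real.exp_le_one_iff, Finset.sum_add_distrib] at h3
    have h4 : (∑ i ∈ Finset.range n, if ind (y i) = 1 then g (time (y i)) / κ else 0) =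
        (∑ i ∈ Finset.range n, if ind (y i) = 1 then g (time (y i)) else 0) / κ := by
      rw [Finset.sum_div]
      exact Finset.sum_congr rfl fun i _ => by split_ifs <;> simp
    simp only [mul_neg, Finset.sum_neg_distrib] at h3
    rw [h4] at h3
    rw [mul_comm, ← div_le_iff₀ hκ]
    linarith
  · rcases hlg i hi with h0 | h0
    · simp [h0]
    · have hp := hl' i hi hind
      have hsum : 0 < l (time (y i)) + g (time (y i)) := by linarith [hg (time (y i))]
      have h1 : g (time (y i)) / κ ≤ g (time (y i)) / (l (time (y i)) + g (time (y i))) :=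
        div_le_div_of_nonneg_left (hg _) hsum h0
      have h2 := Real.one_sub_le_exp_neg
        (g (time (y i)) / (l (time (y i)) + g (time (y i))))
      have h3 : 1 - g (time (y i)) / (l (time (y i)) + g (time (y i))) =
          l (time (y i)) / (l (time (y i)) + g (time (y i))) := by field_simp; ring
      rw [h3, div_le_iff₀ hsum, Real.exp_neg] at h2
      have h4 := mul_le_mul_of_nonneg_left h2
        (Real.exp_pos (g (time (y i)) / (l (time (y i)) + g (time (y i))))).le
      rw [← mul_assoc, mul_inv_cancel₀ (Real.exp_pos _).ne', one_mul, mul_comm] at h4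
      exact (mul_le_mul_of_nonneg_left (Real.exp_le_exp.2 h1) hp.le).trans h4
  · rw [intervalIntegral.integral_add (hli i hi) (hgi i hi)]; ring

/-- By the layer cake formula both integrals are integrals over the height `t` of the measures of
`{t < g}`. A slack `δ` at every height in `(0, c)` adds up to `δ * c`, and above `c` the level sets
are empty. -/
theorem lintegral_add_le_of_level_sets {μ ν : Measure ℝ} {g : ℝ → ℝ} {c : ℝ} {δ : ENNReal}
    (hg : Measurable g) (hg0 : ∀ u, 0 ≤ g u) (hgc : ∀ u, g u ≤ c)
    (h : ∀ t ∈ Ioo 0 c, μ {u | t < g u} + δ ≤ ν {u | t < g u}) :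
    ∫⁻ u, ENNReal.ofReal (g u) ∂μ + δ * ENNReal.ofReal c ≤ ∫⁻ u, ENNReal.ofReal (g u) ∂ν := by
  rw [lintegral_eq_lintegral_meas_lt μ (ae_of_all _ hg0) hg.aemeasurable,
    lintegral_eq_lintegral_meas_lt ν (ae_of_all _ hg0) hg.aemeasurable]
  have h1 : δ * ENNReal.ofReal c = ∫⁻ t in Ioi (0 : ℝ), (Ioo 0 c).indicator (fun _ => δ) t := by
    rw [lintegral_indicator measurableSet_Ioo, Measure.restrict_restrict measurableSet_Ioo]
    have : Ioo 0 c ∩ Ioi 0 = Ioo 0 c := inter_eq_left.2 fun t ht => ht.1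
    rw [this]; simp
  rw [h1, ← lintegral_add_right _ (measurable_const.indicator measurableSet_Ioo)]
  refine setLIntegral_mono' measurableSet_Ioi fun t ht => ?_
  by_cases htc : t < c
  · rw [indicator_of_mem (show t ∈ Ioo 0 c from ⟨ht, htc⟩)]
    exact h t ⟨ht, htc⟩
  · have : {u | t < g u} = ∅ := by
      ext u; simp only [mem_ofPred_eq, mem_empty_iff_false, iff_false, not_lt]
      exact (hgc u).trans (not_lt.1 htc)
    rw [this, indicator_of_notMem (fun hh => htc hh.2)]
    simp

end CoxShape

/-! ### Deterministic comparison of events with time at risk -/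

namespace CoxShape

variable {p : ℕ}

/-- The events and the risk process of a sample are uniformly `e`-close, per observation,
to cumulative limits `H` and `S` on `[0, τ]`. -/
structure SampleClose (n : ℕ) (y : ℕ → Obs p) (β : Cov p) (H S : ℝ → ℝ) (τ e : ℝ) : Prop where
  time_mem : ∀ i < n, time (y i) ∈ Icc 0 τ
  event_le : ∀ a b, 0 ≤ a → a ≤ b → b ≤ τ →
    eventMeasure n y (Icc a b) ≤ ENNReal.ofReal (n * (H b - H a + e))
  le_event : ∀ a b, 0 ≤ a → a ≤ b → b ≤ τ →
    ENNReal.ofReal (n * (H b - H a - e)) ≤ eventMeasure n y (Ioo a b)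
  risk_le : ∀ a b, 0 ≤ a → a ≤ b → b ≤ τ →
    riskMeasure n y β (Icc a b) ≤ ENNReal.ofReal (n * (S b - S a + e))
  le_risk : ∀ a b, 0 ≤ a → a ≤ b → b ≤ τ →
    ENNReal.ofReal (n * (S b - S a - e)) ≤ riskMeasure n y β (Ioo a b)

theorem eventMeasure_inter_Icc {n : ℕ} {y : ℕ → Obs p} {τ : ℝ}
    (h : ∀ i < n, time (y i) ∈ Icc 0 τ) (A : Set ℝ) :
    eventMeasure n y (A ∩ Icc 0 τ) = eventMeasure n y A := by
  refine measure_inter_conull ?_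
  rw [eventMeasure]
  simp only [Measure.coe_finsetSum, Finset.sum_apply]
  refine Finset.sum_eq_zero fun i hi => ?_
  split_ifs
  · rw [Measure.dirac_apply' _ measurableSet_Icc.compl]
    exact indicator_of_notMem (notMem_compl_iff.2 (h i (Finset.mem_range.1 hi))) _
  · simp

theorem riskMeasure_inter_Icc {n : ℕ} {y : ℕ → Obs p} {β : Cov p} {τ : ℝ}
    (h : ∀ i < n, time (y i) ∈ Icc 0 τ) (A : Set ℝ) :
    riskMeasure n y β (A ∩ Icc 0 τ) = riskMeasure n y β A := by
  refine measure_inter_conull ?_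
  rw [riskMeasure]
  simp only [Measure.coe_finsetSum, Finset.sum_apply, Measure.smul_apply]
  refine Finset.sum_eq_zero fun i hi => ?_
  have : volume.restrict (Ioc 0 (time (y i))) (Icc 0 τ)ᶜ = 0 := by
    rw [Measure.restrict_apply measurableSet_Icc.compl]
    convert measure_empty (μ := (volume : Measure ℝ))
    ext u
    simp only [mem_inter_iff, mem_compl_iff, mem_Icc, mem_Ioc, mem_empty_iff_false, iff_false]
    rintro ⟨h1, h2, h3⟩
    exact h1 ⟨h2.le, h3.trans (h i (Finset.mem_range.1 hi)).2⟩
  simp [this]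

/-- An order connected set is the interval between its infimum and supremum, up to end points. This
is why `SampleClose` controls closed intervals from above and open ones from below: level sets of
unknown type are then covered. -/
theorem exists_Ioo_subset_subset_Icc {J : Set ℝ} {c₁ c₂ d₁ d₂ : ℝ} (hc : c₁ < c₂)
    (hJ : J.OrdConnected) (h1 : Ioo c₁ c₂ ⊆ J) (h2 : J ⊆ Icc d₁ d₂) :
    ∃ a b, d₁ ≤ a ∧ a ≤ c₁ ∧ c₂ ≤ b ∧ b ≤ d₂ ∧ Ioo a b ⊆ J ∧ J ⊆ Icc a b := by
  have hne : J.Nonempty := (nonempty_Ioo.2 hc).mono h1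
  have hb : BddBelow J := bddBelow_Icc.mono h2
  have ha : BddAbove J := bddAbove_Icc.mono h2
  refine ⟨sInf J, sSup J, le_csInf hne fun x hx => (h2 hx).1, ?_, ?_,
    csSup_le hne fun x hx => (h2 hx).2,
    IsConnected.Ioo_csInf_csSup_subset ⟨hne, hJ.isPreconnected⟩ hb ha,
    fun x hx => ⟨csInf_le hb hx, le_csSup ha hx⟩⟩
  · calc sInf J ≤ sInf (Ioo c₁ c₂) := csInf_le_csInf hb (nonempty_Ioo.2 hc) h1
      _ = c₁ := csInf_Ioo hc
  · calc c₂ = sSup (Ioo c₁ c₂) := (csSup_Ioo hc).symm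
      _ ≤ sSup J := csSup_le_csSup ha (nonempty_Ioo.2 hc) h1

section

variable {n : ℕ} {y : ℕ → Obs p} {β : Cov p} {H S : ℝ → ℝ} {τ e : ℝ}
  {g : ℝ → ℝ} {c κ k σ c₁ c₂ d₁ d₂ : ℝ}

/-- On each level set the events number at most `k` times the time at risk, up to `e`, and `k ≤ κ`.
The gap `κ - k` pays for the errors provided that the level sets contain a core `(c₁, c₂)` with a
fixed amount `σ` of time at risk. -/
theorem event_sum_lt (hs : SampleClose n y β H S τ e) (hn : 0 < n) (hg : Measurable g)
    (hg0 : ∀ u, 0 ≤ g u) (hgc : ∀ u, g u ≤ c) (hc : 0 < c) (hκ : 0 < κ) (hk : k ≤ κ)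
    (hd : 0 ≤ d₁) (hd2 : d₂ ≤ τ) (hc12 : c₁ < c₂)
    (hgi : ∀ i < n, IntervalIntegrable g volume 0 (time (y i)))
    (hlev : ∀ t ∈ Ioo 0 c, ({u | t < g u} ∩ Icc 0 τ).OrdConnected ∧
      Ioo c₁ c₂ ⊆ {u | t < g u} ∩ Icc 0 τ ∧ {u | t < g u} ∩ Icc 0 τ ⊆ Icc d₁ d₂)
    (hHS : ∀ a b, d₁ ≤ a → a ≤ b → b ≤ d₂ → H b - H a ≤ k * (S b - S a))
    (hH : MonotoneOn H (Icc 0 τ)) (hS : MonotoneOn S (Icc 0 τ)) (he0 : 0 ≤ e) (hσ : σ ≤ S c₂ - S c₁)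
    (he : (1 + κ) * e < (κ - k) * σ) :
    (∑ i ∈ Finset.range n, if ind (y i) = 1 then g (time (y i)) else 0) <
    κ * (∑ i ∈ Finset.range n, Real.exp ⟪β, cov (y i)⟫ * ∫ u in (0 : ℝ)..time (y i), g u) := by
  have hn' : (0 : ℝ) < n := by exact_mod_cast hn
  -- The slack per level is the gain on the core minus one error `e` for the events and `κ * e` for
  -- the time at risk; it is positive by `he`.
  have key := lintegral_add_le_of_level_sets (μ := eventMeasure n y)
    (ν := ENNReal.ofReal κ • riskMeasure n y β) (c := c)
    (δ := ENNReal.ofReal (n * ((κ - k) * σ - (1 + κ) * e))) hg hg0 hgc ?_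
  · rw [lintegral_smul_measure, lintegral_eventMeasure n y hg hg0,
      lintegral_riskMeasure n y β hg0 (fun i hi => (hs.time_mem i hi).1) hgi, smul_eq_mul,
      ← ENNReal.ofReal_mul hκ.le, ← ENNReal.ofReal_mul (by nlinarith),
      ← ENNReal.ofReal_add (Finset.sum_nonneg fun i _ => by split_ifs <;> simp [hg0])
        (by have : 0 < (κ - k) * σ - (1 + κ) * e := by linarith
            positivity)] at key
    have h0 : 0 < n * ((κ - k) * σ - (1 + κ) * e) * c := by
      have : 0 < (κ - k) * σ - (1 + κ) * e := by linarith
      positivity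
    rw [ENNReal.ofReal_le_ofReal_iff] at key
    · linarith
    · refine mul_nonneg hκ.le (Finset.sum_nonneg fun i hi => ?_)
      exact mul_nonneg (Real.exp_pos _).le (intervalIntegral.integral_nonneg
        (hs.time_mem i (Finset.mem_range.1 hi)).1 fun u _ => hg0 u)
  · intro t ht
    obtain ⟨hoc, hin, hout⟩ := hlev t ht
    obtain ⟨a, b, h1, h2, h3, h4, h5, h6⟩ := exists_Ioo_subset_subset_Icc hc12 hoc hin hout
    have hab : a ≤ b := by linarith
    have ha0 : 0 ≤ a := hd.trans h1
    have hbτ : b ≤ τ := h4.trans hd2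
    have m1 : S a ≤ S c₁ := hS ⟨ha0, hab.trans hbτ⟩ ⟨ha0.trans h2, by linarith⟩ h2
    have m2 : S c₂ ≤ S b := hS ⟨by linarith, h3.trans hbτ⟩ ⟨ha0.trans hab, hbτ⟩ h3
    have m3 := hHS a b h1 hab h4
    rw [← eventMeasure_inter_Icc hs.time_mem, Measure.smul_apply,
      ← riskMeasure_inter_Icc hs.time_mem, smul_eq_mul]
    have e1 := (measure_mono h6).trans (hs.event_le a b ha0 hab hbτ)
    have e2 := (hs.le_risk a b ha0 hab hbτ).trans (measure_mono h5)
    refine (add_le_add_left e1 _).trans (le_trans ?_ (mul_le_mul_right e2 _))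
    have m0 : H a ≤ H b := hH ⟨ha0, hab.trans hbτ⟩ ⟨ha0.trans hab, hbτ⟩ hab
    rw [← ENNReal.ofReal_mul hκ.le, ← ENNReal.ofReal_add
      (mul_nonneg hn'.le (by linarith)) (mul_nonneg hn'.le (by linarith))]
    refine ENNReal.ofReal_le_ofReal ?_
    -- The interval contains the core, so its time at risk is at least `σ`.
    have m5 : (κ - k) * σ ≤ (κ - k) * (S b - S a) :=
      mul_le_mul_of_nonneg_left (by linarith) (by linarith)
    have m6 : H b - H a + e + ((κ - k) * σ - (1 + κ) * e) ≤ κ * (S b - S a - e) := by linarith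
    have := mul_le_mul_of_nonneg_left m6 hn'.le
    linarith

theorem lt_event_sum (hs : SampleClose n y β H S τ e) (hn : 0 < n) (hg : Measurable g)
    (hg0 : ∀ u, 0 ≤ g u) (hgc : ∀ u, g u ≤ c) (hc : 0 < c) (hκ : 0 < κ) (hk : κ ≤ k)
    (hd : 0 ≤ d₁) (hd2 : d₂ ≤ τ) (hc12 : c₁ < c₂)
    (hgi : ∀ i < n, IntervalIntegrable g volume 0 (time (y i)))
    (hlev : ∀ t ∈ Ioo 0 c, ({u | t < g u} ∩ Icc 0 τ).OrdConnected ∧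
      Ioo c₁ c₂ ⊆ {u | t < g u} ∩ Icc 0 τ ∧ {u | t < g u} ∩ Icc 0 τ ⊆ Icc d₁ d₂)
    (hHS : ∀ a b, d₁ ≤ a → a ≤ b → b ≤ d₂ → k * (S b - S a) ≤ H b - H a)
    (hS : MonotoneOn S (Icc 0 τ)) (he0 : 0 ≤ e) (hσ : σ ≤ S c₂ - S c₁)
    (he : (1 + κ) * e < (k - κ) * σ) :
    κ * (∑ i ∈ Finset.range n, Real.exp ⟪β, cov (y i)⟫ * ∫ u in (0 : ℝ)..time (y i), g u) <
    (∑ i ∈ Finset.range n, if ind (y i) = 1 then g (time (y i)) else 0) := by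
  have hn' : (0 : ℝ) < n := by exact_mod_cast hn
  have hpos : 0 < (k - κ) * σ - (1 + κ) * e := by linarith
  have hrisk0 : 0 ≤ ∑ i ∈ Finset.range n,
      Real.exp ⟪β, cov (y i)⟫ * ∫ u in (0 : ℝ)..time (y i), g u :=
    Finset.sum_nonneg fun i hi => mul_nonneg (Real.exp_pos _).le
      (intervalIntegral.integral_nonneg
        (hs.time_mem i (Finset.mem_range.1 hi)).1 fun u _ => hg0 u)
  have key := lintegral_add_le_of_level_sets (ν := eventMeasure n y)
    (μ := ENNReal.ofReal κ • riskMeasure n y β) (c := c)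
    (δ := ENNReal.ofReal (n * ((k - κ) * σ - (1 + κ) * e))) hg hg0 hgc ?_
  · rw [lintegral_smul_measure, lintegral_eventMeasure n y hg hg0,
      lintegral_riskMeasure n y β hg0 (fun i hi => (hs.time_mem i hi).1) hgi, smul_eq_mul,
      ← ENNReal.ofReal_mul hκ.le, ← ENNReal.ofReal_mul (by positivity),
      ← ENNReal.ofReal_add (by positivity) (by positivity)] at key
    have h0 : 0 < n * ((k - κ) * σ - (1 + κ) * e) * c := by positivity
    rw [ENNReal.ofReal_le_ofReal_iff] at key
    · linarith
    · exact Finset.sum_nonneg fun i hi => by split_ifs <;> simp [hg0]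
  · intro t ht
    obtain ⟨hoc, hin, hout⟩ := hlev t ht
    obtain ⟨a, b, h1, h2, h3, h4, h5, h6⟩ := exists_Ioo_subset_subset_Icc hc12 hoc hin hout
    have hab : a ≤ b := by linarith
    have ha0 : 0 ≤ a := hd.trans h1
    have hbτ : b ≤ τ := h4.trans hd2
    have m0 : S a ≤ S b := hS ⟨ha0, hab.trans hbτ⟩ ⟨ha0.trans hab, hbτ⟩ hab
    have m1 : S a ≤ S c₁ := hS ⟨ha0, hab.trans hbτ⟩ ⟨ha0.trans h2, by linarith⟩ h2
    have m2 : S c₂ ≤ S b := hS ⟨by linarith, h3.trans hbτ⟩ ⟨ha0.trans hab, hbτ⟩ h3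
    have m3 := hHS a b h1 hab h4
    rw [← eventMeasure_inter_Icc hs.time_mem, Measure.smul_apply,
      ← riskMeasure_inter_Icc hs.time_mem, smul_eq_mul]
    have e1 := (measure_mono h6).trans (hs.risk_le a b ha0 hab hbτ)
    have e2 := (hs.le_event a b ha0 hab hbτ).trans (measure_mono h5)
    refine (add_le_add_left (mul_le_mul_right e1 _) _).trans (le_trans ?_ e2)
    rw [← ENNReal.ofReal_mul hκ.le, ← ENNReal.ofReal_add
      (mul_nonneg hκ.le (mul_nonneg hn'.le (by linarith))) (by positivity)]
    refine ENNReal.ofReal_le_ofReal ?_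
    have m5 : (k - κ) * σ ≤ (k - κ) * (S b - S a) :=
      mul_le_mul_of_nonneg_left (by linarith) (by linarith)
    have m6 : κ * (S b - S a + e) + ((k - κ) * σ - (1 + κ) * e) ≤ H b - H a - e := by linarith
    have := mul_le_mul_of_nonneg_left m6 hn'.le
    linarith

/-- Hazards are monotone on `[0, ∞)` only and arbitrary elsewhere, so measurability is available
only after composing with `max u 0`. -/
theorem measurable_indicator_comp {l F : ℝ → ℝ} {R : Set ℝ} (hR : MeasurableSet R)
    (hR0 : R ⊆ Ici 0) (hl : Measurable fun u => l (max u 0)) (hF : Measurable F) :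
    Measurable (R.indicator fun u => F (l u)) := by
  have : (R.indicator fun u => F (l u)) = R.indicator fun u => F (l (max u 0)) := by
    funext u
    by_cases hu : u ∈ R
    · rw [indicator_of_mem hu, indicator_of_mem hu, max_eq_left (hR0 hu)]
    · rw [indicator_of_notMem hu, indicator_of_notMem hu]
  rw [this]
  exact (hF.comp hl).indicator hR

/-- A maximizer of the likelihood cannot be large at a point of a region `R` where the limiting
hazard is small, if it can be lowered there. -/
theorem le_of_lowering {l : ℝ → ℝ} {R : Set ℝ} {x : ℝ}
    (hs : SampleClose n y β H S τ e) (hn : 0 < n) (hκ : 0 < κ) (hk : k ≤ κ)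
    (hR : MeasurableSet R) (hR0 : R ⊆ Ici 0) (hlm : Measurable fun u => l (max u 0))
    (hpos : 0 < likelihood n y β l) (hl : ∀ u, 0 ≤ u → 0 ≤ l u)
    (hli : ∀ i < n, IntervalIntegrable l volume 0 (time (y i)))
    (hli' : ∀ i < n, IntervalIntegrable
      (fun u => l u - R.indicator (fun u => max (min (l u) (l x) - κ) 0) u)
      volume 0 (time (y i)))
    (hmax : likelihood n y β
      (fun u => l u - R.indicator (fun u => max (min (l u) (l x) - κ) 0) u) ≤ likelihood n y β l)
    (hd : 0 ≤ d₁) (hd2 : d₂ ≤ τ) (hc12 : c₁ < c₂)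
    (hoc : ∀ a, ({u ∈ R | a < l u} ∩ Icc 0 τ).OrdConnected)
    (hcore : Ioo c₁ c₂ ⊆ {u ∈ R | l x ≤ l u} ∩ Icc 0 τ) (hRd : R ∩ Icc 0 τ ⊆ Icc d₁ d₂)
    (hHS : ∀ a b, d₁ ≤ a → a ≤ b → b ≤ d₂ → H b - H a ≤ k * (S b - S a))
    (hH : MonotoneOn H (Icc 0 τ)) (hS : MonotoneOn S (Icc 0 τ)) (he0 : 0 ≤ e)
    (hσ : σ ≤ S c₂ - S c₁) (he : (1 + κ) * e < (κ - k) * σ) : l x ≤ κ := by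
  by_contra! hcon
  -- The cap at `l x` bounds `g` by `l x - κ` and ensures that each level set at a height below this
  -- bound contains every point of `R` where `l` is at least `l x`, in particular the core.
  set g : ℝ → ℝ := R.indicator fun u => max (min (l u) (l x) - κ) 0 with hgdef
  have hg0 : ∀ u, 0 ≤ g u := fun u => indicator_nonneg (fun _ _ => le_max_right _ _) u
  have hgc : ∀ u, g u ≤ l x - κ := fun u => by
    refine indicator_apply_le' (fun _ => max_le ?_ (by linarith)) fun _ => by linarith
    linarith [min_le_right (l u) (l x)]
  have hgi : ∀ i < n, IntervalIntegrable g volume 0 (time (y i)) := fun i hi => by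
    have := (hli i hi).sub (hli' i hi)
    simpa using this
  have hset : ∀ t ∈ Ioo 0 (l x - κ), {u | t < g u} = {u ∈ R | κ + t < l u} := by
    intro t ht
    ext u
    simp only [mem_ofPred_eq, hgdef]
    by_cases hu : u ∈ R
    · rw [indicator_of_mem hu, lt_max_iff, lt_sub_iff_add_lt, lt_min_iff]
      have h1 := ht.1
      have h2 := ht.2
      constructor
      · rintro (h | h)
        · exact ⟨hu, by linarith [h.1]⟩
        · exact absurd h (not_lt.2 h1.le)
      · exact fun h => Or.inl ⟨by linarith [h.2], by linarith⟩
    · rw [indicator_of_notMem hu]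
      exact ⟨fun h => absurd h (not_lt.2 ht.1.le), fun h => absurd h.1 hu⟩
  refine absurd (sum_le_of_likelihood_sub_le hκ hg0 hpos
    (fun i hi => hl _ (hs.time_mem i hi).1) (fun i hi => ?_) hli hgi hmax) (not_le.2 ?_)
  · by_cases hu : time (y i) ∈ R
    · rw [hgdef, indicator_of_mem hu]
      rcases le_total (min (l (time (y i))) (l x) - κ) 0 with h | h
      · left; exact max_eq_right h
      · right; rw [max_eq_left h]; linarith [min_le_left (l (time (y i))) (l x)]
    · left; exact indicator_of_notMem hu _
  · refine event_sum_lt hs hn (measurable_indicator_comp hR hR0 hlm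
      (F := fun v => max (min v (l x) - κ) 0) (by fun_prop)) hg0 hgc
      (by linarith) hκ hk hd hd2 hc12 hgi (fun t ht => ?_) hHS hH hS he0 hσ he
    rw [hset t ht]
    refine ⟨hoc _, hcore.trans (inter_subset_inter_left _ fun u hu => ⟨hu.1, ?_⟩),
      (inter_subset_inter_left _ fun u hu => hu.1).trans hRd⟩
    linarith [hu.2, ht.2]

/-- A maximizer of the likelihood cannot be small at a point of a region `R` where the limiting
hazard is large, if it can be raised there. -/
theorem le_of_raising {l : ℝ → ℝ} {R : Set ℝ} {x : ℝ}
    (hs : SampleClose n y β H S τ e) (hn : 0 < n) (hκ : 0 < κ) (hk : κ ≤ k)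
    (hR : MeasurableSet R) (hR0 : R ⊆ Ici 0) (hlm : Measurable fun u => l (max u 0))
    (hpos : 0 < likelihood n y β l) (hl : ∀ u, 0 ≤ u → 0 ≤ l u)
    (hli : ∀ i < n, IntervalIntegrable l volume 0 (time (y i)))
    (hli' : ∀ i < n, IntervalIntegrable
      (fun u => l u + R.indicator (fun u => max (κ - max (l u) (l x)) 0) u)
      volume 0 (time (y i)))
    (hmax : likelihood n y β
      (fun u => l u + R.indicator (fun u => max (κ - max (l u) (l x)) 0) u) ≤ likelihood n y β l)
    (hd : 0 ≤ d₁) (hd2 : d₂ ≤ τ) (hc12 : c₁ < c₂)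
    (hoc : ∀ a, ({u ∈ R | l u < a} ∩ Icc 0 τ).OrdConnected)
    (hcore : Ioo c₁ c₂ ⊆ {u ∈ R | l u ≤ l x} ∩ Icc 0 τ) (hRd : R ∩ Icc 0 τ ⊆ Icc d₁ d₂)
    (hHS : ∀ a b, d₁ ≤ a → a ≤ b → b ≤ d₂ → k * (S b - S a) ≤ H b - H a)
    (hS : MonotoneOn S (Icc 0 τ)) (he0 : 0 ≤ e)
    (hσ : σ ≤ S c₂ - S c₁) (he : (1 + κ) * e < (k - κ) * σ) : κ ≤ l x := by
  by_contra! hcon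
  -- Here `l x` acts as a floor: `g` is bounded by `κ - l x`, and level sets contain the points of
  -- `R` where `l` is at most `l x`.
  set g : ℝ → ℝ := R.indicator fun u => max (κ - max (l u) (l x)) 0 with hgdef
  have hg0 : ∀ u, 0 ≤ g u := fun u => indicator_nonneg (fun _ _ => le_max_right _ _) u
  have hgc : ∀ u, g u ≤ κ - l x := fun u => by
    refine indicator_apply_le' (fun _ => max_le ?_ (by linarith)) fun _ => by linarith
    linarith [le_max_right (l u) (l x)]
  have hgi : ∀ i < n, IntervalIntegrable g volume 0 (time (y i)) := fun i hi => by
    have := (hli' i hi).sub (hli i hi)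
    simpa using this
  have hset : ∀ t ∈ Ioo 0 (κ - l x), {u | t < g u} = {u ∈ R | l u < κ - t} := by
    intro t ht
    ext u
    simp only [mem_ofPred_eq, hgdef]
    by_cases hu : u ∈ R
    · rw [indicator_of_mem hu, lt_max_iff, lt_sub_comm, max_lt_iff]
      have h1 := ht.1
      have h2 := ht.2
      constructor
      · rintro (h | h)
        · exact ⟨hu, h.1⟩
        · exact absurd h (not_lt.2 h1.le)
      · exact fun h => Or.inl ⟨h.2, by linarith⟩
    · rw [indicator_of_notMem hu]
      exact ⟨fun h => absurd h (not_lt.2 ht.1.le), fun h => absurd h.1 hu⟩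
  refine absurd (sum_le_of_likelihood_add_le hκ hg0 hpos
    (fun i hi => hl _ (hs.time_mem i hi).1) (fun i hi => ?_) hli hgi hmax) (not_le.2 ?_)
  · by_cases hu : time (y i) ∈ R
    · rw [hgdef, indicator_of_mem hu]
      rcases le_total (κ - max (l (time (y i))) (l x)) 0 with h | h
      · left; exact max_eq_right h
      · right; rw [max_eq_left h]; linarith [le_max_left (l (time (y i))) (l x)]
    · left; exact indicator_of_notMem hu _
  · refine lt_event_sum hs hn (measurable_indicator_comp hR hR0 hlm
      (F := fun v => max (κ - max v (l x)) 0) (by fun_prop)) hg0 hgc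
      (by linarith) hκ hk hd hd2 hc12 hgi (fun t ht => ?_) hHS hS he0 hσ he
    rw [hset t ht]
    refine ⟨hoc _, hcore.trans (inter_subset_inter_left _ fun u hu => ⟨hu.1, ?_⟩),
      (inter_subset_inter_left _ fun u hu => hu.1).trans hRd⟩
    linarith [hu.2, ht.2]

end

end CoxShape

/-! ### Bounds for maximum likelihood estimators of a monotone hazard -/

namespace CoxShape

variable {p : ℕ}

section

variable {n : ℕ} {y : ℕ → Obs p} {β : Cov p} {H S : ℝ → ℝ} {τ e κ k σ M s t x : ℝ} {l : ℝ → ℝ}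

/-- For `κ ≤ a` the map is the identity below `κ`, constant between `κ` and `a`, and a shift by `a -
κ` above `a`; for `a ≤ κ` it is the identity. Hence lowering preserves the order of the values. -/
theorem sub_lowering_mono {a z z' : ℝ} (h : z ≤ z') :
    z - max (min z a - κ) 0 ≤ z' - max (min z' a - κ) 0 := by
  rcases max_cases (min z a - κ) 0 with h1 | h1 <;> rcases max_cases (min z' a - κ) 0 with h2 | h2
      <;>
  rcases min_cases z a with h3 | h3 <;> rcases min_cases z' a with h4 | h4 <;> linarith

/-- For `a ≤ κ` the map shifts values below `a` by `κ - a`, is constant `κ` between `a` and `κ`, and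
the identity above `κ`. -/
theorem add_raising_mono {a z z' : ℝ} (h : z ≤ z') :
    z + max (κ - max z a) 0 ≤ z' + max (κ - max z' a) 0 := by
  rcases max_cases (κ - max z a) 0 with h1 | h1 <;> rcases max_cases (κ - max z' a) 0 with h2 | h2
      <;>
  rcases max_cases z a with h3 | h3 <;> rcases max_cases z' a with h4 | h4 <;> linarith

theorem ordConnected_of_le_max {R : Set ℝ} (hR : R.OrdConnected) {P : ℝ → Prop}
    (h : ∀ u ∈ R, ∀ v ∈ R, ∀ w ∈ R, u ≤ w → w ≤ v → P u → P v → P w) :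
    ({u ∈ R | P u} ∩ Icc 0 τ).OrdConnected := by
  refine ⟨fun u hu v hv w hw => ⟨?_, ordConnected_Icc.out hu.2 hv.2 hw⟩⟩
  have hwR := hR.out hu.1.1 hv.1.1 hw
  exact ⟨hwR, h u hu.1.1 v hv.1.1 w hwR hw.1 hw.2 hu.1.2 hv.1.2⟩

theorem measurable_comp_max_of_monotoneOn (hl : MonotoneOn l (Ici 0)) :
    Measurable fun u => l (max u 0) :=
  Monotone.measurable fun _ _ h => hl (mem_Ici.2 (le_max_right _ _)) (mem_Ici.2 (le_max_right _ _))
      (max_le_max_right 0 h)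

theorem measurable_comp_max_of_antitoneOn (hl : AntitoneOn l (Ici 0)) :
    Measurable fun u => l (max u 0) :=
  Antitone.measurable fun _ _ h => hl (mem_Ici.2 (le_max_right _ _)) (mem_Ici.2 (le_max_right _ _))
      (max_le_max_right 0 h)

theorem intervalIntegrable_of_monotoneOn_Ici (hl : MonotoneOn l (Ici 0)) {T : ℝ}
    (hT : 0 ≤ T) : IntervalIntegrable l volume 0 T :=
  MonotoneOn.intervalIntegrable (hl.mono (by rw [uIcc_of_le hT]; exact Icc_subset_Ici_self))

theorem intervalIntegrable_of_antitoneOn_Ici (hl : AntitoneOn l (Ici 0)) {T : ℝ}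
    (hT : 0 ≤ T) : IntervalIntegrable l volume 0 T :=
  AntitoneOn.intervalIntegrable (hl.mono (by rw [uIcc_of_le hT]; exact Icc_subset_Ici_self))

theorem likelihood_one_pos : 0 < likelihood n y β fun _ => 1 :=
  (likelihood_pos_iff fun _ _ => zero_le_one).2 fun _ _ _ => zero_lt_one

/-- A nondecreasing hazard can be lowered on an initial segment `[0, t]` without losing
monotonicity. Within it the sets where `l` is large are final segments, and if `l x` is large they
contain `(x, t)`. -/
theorem incNPMLE_le (hs : SampleClose n y β H S τ e) (hn : 0 < n) (hl : l ∈ incHazards M)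
    (hmax : IsMaxOn (likelihood n y β) (incHazards M) l) (hM : 1 ≤ M) (hκ : 0 < κ) (hk : k ≤ κ)
    (hx : 0 ≤ x) (hxt : x < t) (ht : t ≤ τ)
    (hHS : ∀ a b, 0 ≤ a → a ≤ b → b ≤ t → H b - H a ≤ k * (S b - S a))
    (hH : MonotoneOn H (Icc 0 τ)) (hS : MonotoneOn S (Icc 0 τ)) (he0 : 0 ≤ e)
    (hσ : σ ≤ S t - S x) (he : (1 + κ) * e < (κ - k) * σ) : l x ≤ κ := by
  have hmem : (fun u => l u - (Icc 0 t).indicator (fun u => max (min (l u) (l x) - κ) 0) u) ∈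
      incHazards M := by
    refine ⟨fun u hu v hv huv => ?_, fun u hu => ⟨?_, ?_⟩⟩
    · have huv' := hl.1 hu hv huv
      dsimp only
      by_cases hvt : v ∈ Icc 0 t
      · rw [indicator_of_mem hvt, indicator_of_mem (show u ∈ Icc 0 t from ⟨hu, huv.trans hvt.2⟩)]
        exact sub_lowering_mono huv'
      · rw [indicator_of_notMem hvt, sub_zero]
        refine (sub_le_self _ (indicator_nonneg (fun _ _ => le_max_right _ _) u)).trans huv'
    · rw [sub_nonneg]
      refine indicator_apply_le' (fun _ => max_le ?_ (hl.2 u hu).1) fun _ => (hl.2 u hu).1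
      linarith [min_le_left (l u) (l x)]
    · exact (sub_le_self _ (indicator_nonneg (fun _ _ => le_max_right _ _) u)).trans (hl.2 u hu).2
  -- The constant hazard `1` has positive likelihood, hence so has the maximizer; this is where `1 ≤
  -- M` enters.
  have hone : (fun _ => 1 : ℝ → ℝ) ∈ incHazards M :=
    ⟨monotoneOn_const, fun _ _ => ⟨zero_le_one, hM⟩⟩
  refine le_of_lowering (R := Icc 0 t) (c₁ := x) (c₂ := t) hs hn hκ hk measurableSet_Icc
    Icc_subset_Ici_self (measurable_comp_max_of_monotoneOn hl.1) (likelihood_one_pos.trans_le (hmax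
        hone))
    (fun u hu => (hl.2 u hu).1)
    (fun i hi => intervalIntegrable_of_monotoneOn_Ici hl.1 (hs.time_mem i hi).1)
    (fun i hi => intervalIntegrable_of_monotoneOn_Ici hmem.1 (hs.time_mem i hi).1) (hmax hmem)
        le_rfl ht hxt
    (fun a => ordConnected_of_le_max ordConnected_Icc fun u hu v hv w hw huw hwv h1 h2 =>
      h1.trans_le (hl.1 hu.1 hw.1 huw)) (fun u hu => ?_) inter_subset_left hHS hH hS he0 hσ he
  have hu0 : 0 ≤ u := hx.trans hu.1.le
  exact ⟨⟨⟨hu0, hu.2.le⟩, hl.1 hx hu0 hu.1.le⟩, hu0, hu.2.le.trans ht⟩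

/-- Raising must extend to infinity to preserve monotonicity, so the region is `(s, ∞)`. The raised
values do not exceed the larger of `l` and `κ`, and `κ ≤ M` keeps the competitor admissible. -/
theorem le_incNPMLE (hs : SampleClose n y β H S τ e) (hn : 0 < n) (hl : l ∈ incHazards M)
    (hmax : IsMaxOn (likelihood n y β) (incHazards M) l) (hM : 1 ≤ M) (hκM : κ ≤ M)
    (hκ : 0 < κ) (hk : κ ≤ k) (hs0 : 0 ≤ s) (hsx : s < x) (hx : x ≤ τ)
    (hHS : ∀ a b, s ≤ a → a ≤ b → b ≤ τ → k * (S b - S a) ≤ H b - H a)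
    (hS : MonotoneOn S (Icc 0 τ)) (he0 : 0 ≤ e)
    (hσ : σ ≤ S x - S s) (he : (1 + κ) * e < (k - κ) * σ) : κ ≤ l x := by
  have hx0 : 0 ≤ x := hs0.trans hsx.le
  have hmem : (fun u => l u + (Ioi s).indicator (fun u => max (κ - max (l u) (l x)) 0) u) ∈
      incHazards M := by
    refine ⟨fun u hu v hv huv => ?_, fun u hu => ⟨?_, ?_⟩⟩
    · have huv' := hl.1 hu hv huv
      dsimp only
      by_cases hus : u ∈ Ioi s
      · rw [indicator_of_mem hus, indicator_of_mem (show v ∈ Ioi s from lt_of_lt_of_le hus huv)]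
        exact add_raising_mono huv'
      · rw [indicator_of_notMem hus, add_zero]
        exact huv'.trans (le_add_of_nonneg_right (indicator_nonneg (fun _ _ => le_max_right _ _) v))
    · exact add_nonneg (hl.2 u hu).1 (indicator_nonneg (fun _ _ => le_max_right _ _) u)
    · rw [← le_sub_iff_add_le']
      have := (hl.2 u hu).2
      refine indicator_apply_le' (fun _ => max_le ?_ (by linarith)) fun _ => by linarith
      linarith [le_max_left (l u) (l x)]
  have hone : (fun _ => 1 : ℝ → ℝ) ∈ incHazards M :=
    ⟨monotoneOn_const, fun _ _ => ⟨zero_le_one, hM⟩⟩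
  have hR0 : Ioi s ⊆ Ici 0 := fun u hu => hs0.trans (le_of_lt hu)
  refine le_of_raising (R := Ioi s) (c₁ := s) (c₂ := x) (d₁ := s) (d₂ := τ) hs hn hκ hk
    measurableSet_Ioi hR0 (measurable_comp_max_of_monotoneOn hl.1) (likelihood_one_pos.trans_le
        (hmax hone))
    (fun u hu => (hl.2 u hu).1)
    (fun i hi => intervalIntegrable_of_monotoneOn_Ici hl.1 (hs.time_mem i hi).1)
    (fun i hi => intervalIntegrable_of_monotoneOn_Ici hmem.1 (hs.time_mem i hi).1) (hmax hmem) hs0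
        le_rfl hsx
    (fun a => ordConnected_of_le_max ordConnected_Ioi fun u hu v hv w hw huw hwv h1 h2 =>
      (hl.1 (hR0 hw) (hR0 hv) hwv).trans_lt h2) (fun u hu => ?_)
    (fun u hu => ⟨le_of_lt hu.1, hu.2.2⟩) hHS hS he0 hσ he
  have hu0 : 0 ≤ u := hR0 hu.1
  exact ⟨⟨hu.1, hl.1 hu0 hx0 hu.2.le⟩, hu0, hu.2.le.trans hx⟩

/-- For nonincreasing hazards the regions are exchanged: lowering is harmless on final segments,
raising on initial ones. No bound `M` is needed. -/
theorem decNPMLE_le (hs : SampleClose n y β H S τ e) (hn : 0 < n) (hl : l ∈ decHazards)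
    (hmax : IsMaxOn (likelihood n y β) decHazards l)
    (hκ : 0 < κ) (hk : k ≤ κ) (hs0 : 0 ≤ s) (hsx : s < x) (hx : x ≤ τ)
    (hHS : ∀ a b, s ≤ a → a ≤ b → b ≤ τ → H b - H a ≤ k * (S b - S a))
    (hH : MonotoneOn H (Icc 0 τ)) (hS : MonotoneOn S (Icc 0 τ)) (he0 : 0 ≤ e)
    (hσ : σ ≤ S x - S s) (he : (1 + κ) * e < (κ - k) * σ) : l x ≤ κ := by
  have hx0 : 0 ≤ x := hs0.trans hsx.le
  have hmem : (fun u => l u - (Ioi s).indicator (fun u => max (min (l u) (l x) - κ) 0) u) ∈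
      decHazards := by
    refine ⟨fun u hu v hv huv => ?_, fun u hu => ?_⟩
    · have huv' := hl.1 hu hv huv
      dsimp only
      by_cases hus : u ∈ Ioi s
      · rw [indicator_of_mem hus, indicator_of_mem (show v ∈ Ioi s from lt_of_lt_of_le hus huv)]
        exact sub_lowering_mono huv'
      · rw [indicator_of_notMem hus, sub_zero]
        exact (sub_le_self _ (indicator_nonneg (fun _ _ => le_max_right _ _) v)).trans huv'
    · rw [sub_nonneg]
      refine indicator_apply_le' (fun _ => max_le ?_ (hl.2 u hu)) fun _ => hl.2 u hu
      linarith [min_le_left (l u) (l x)]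
  have hone : (fun _ => 1 : ℝ → ℝ) ∈ decHazards := ⟨antitoneOn_const, fun _ _ => zero_le_one⟩
  have hR0 : Ioi s ⊆ Ici 0 := fun u hu => hs0.trans (le_of_lt hu)
  refine le_of_lowering (R := Ioi s) (c₁ := s) (c₂ := x) (d₁ := s) (d₂ := τ) hs hn hκ hk
    measurableSet_Ioi hR0 (measurable_comp_max_of_antitoneOn hl.1) (likelihood_one_pos.trans_le
        (hmax hone))
    (fun u hu => hl.2 u hu)
    (fun i hi => intervalIntegrable_of_antitoneOn_Ici hl.1 (hs.time_mem i hi).1)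
    (fun i hi => intervalIntegrable_of_antitoneOn_Ici hmem.1 (hs.time_mem i hi).1) (hmax hmem) hs0
        le_rfl hsx
    (fun a => ordConnected_of_le_max ordConnected_Ioi fun u hu v hv w hw huw hwv h1 h2 =>
      h2.trans_le (hl.1 (hR0 hw) (hR0 hv) hwv)) (fun u hu => ?_)
    (fun u hu => ⟨le_of_lt hu.1, hu.2.2⟩) hHS hH hS he0 hσ he
  have hu0 : 0 ≤ u := hR0 hu.1
  exact ⟨⟨hu.1, hl.1 hu0 hx0 hu.2.le⟩, hu0, hu.2.le.trans hx⟩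

theorem le_decNPMLE (hs : SampleClose n y β H S τ e) (hn : 0 < n) (hl : l ∈ decHazards)
    (hmax : IsMaxOn (likelihood n y β) decHazards l)
    (hκ : 0 < κ) (hk : κ ≤ k) (hx : 0 ≤ x) (hxt : x < t) (ht : t ≤ τ)
    (hHS : ∀ a b, 0 ≤ a → a ≤ b → b ≤ t → k * (S b - S a) ≤ H b - H a)
    (hS : MonotoneOn S (Icc 0 τ)) (he0 : 0 ≤ e)
    (hσ : σ ≤ S t - S x) (he : (1 + κ) * e < (k - κ) * σ) : κ ≤ l x := by
  have hmem : (fun u => l u + (Icc 0 t).indicator (fun u => max (κ - max (l u) (l x)) 0) u) ∈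
      decHazards := by
    refine ⟨fun u hu v hv huv => ?_, fun u hu => ?_⟩
    · have huv' := hl.1 hu hv huv
      dsimp only
      by_cases hvt : v ∈ Icc 0 t
      · rw [indicator_of_mem hvt, indicator_of_mem (show u ∈ Icc 0 t from ⟨hu, huv.trans hvt.2⟩)]
        exact add_raising_mono huv'
      · rw [indicator_of_notMem hvt, add_zero]
        exact huv'.trans (le_add_of_nonneg_right (indicator_nonneg (fun _ _ => le_max_right _ _) u))
    · exact add_nonneg (hl.2 u hu) (indicator_nonneg (fun _ _ => le_max_right _ _) u)
  have hone : (fun _ => 1 : ℝ → ℝ) ∈ decHazards := ⟨antitoneOn_const, fun _ _ => zero_le_one⟩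
  refine le_of_raising (R := Icc 0 t) (c₁ := x) (c₂ := t) hs hn hκ hk measurableSet_Icc
    Icc_subset_Ici_self (measurable_comp_max_of_antitoneOn hl.1) (likelihood_one_pos.trans_le (hmax
        hone))
    (fun u hu => hl.2 u hu)
    (fun i hi => intervalIntegrable_of_antitoneOn_Ici hl.1 (hs.time_mem i hi).1)
    (fun i hi => intervalIntegrable_of_antitoneOn_Ici hmem.1 (hs.time_mem i hi).1) (hmax hmem)
        le_rfl ht hxt
    (fun a => ordConnected_of_le_max ordConnected_Icc fun u hu v hv w hw huw hwv h1 h2 =>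
      (hl.1 hu.1 hw.1 huw).trans_lt h1) (fun u hu => ?_) inter_subset_left hHS hS he0 hσ he
  have hu0 : 0 ≤ u := hx.trans hu.1.le
  exact ⟨⟨⟨hu0, hu.2.le⟩, hl.1 hx hu0 hu.1.le⟩, hu0, hu.2.le.trans ht⟩

end

end CoxShape

/-! ### The law of a single observation -/

namespace CoxShape
open Function
variable {p : ℕ}

@[fun_prop]
theorem measurable_time : Measurable (time : Obs p → ℝ) := measurable_fst

@[fun_prop]
theorem measurable_ind : Measurable (ind : Obs p → ℝ) := measurable_snd.fst

@[fun_prop]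
theorem measurable_cov : Measurable (cov : Obs p → Cov p) := measurable_snd.snd

/-- The measure on `[0, ∞)` with the baseline hazard as its density. -/
noncomputable def hazardMeasure (lam0 : ℝ → ℝ) : Measure ℝ :=
  (volume.restrict (Ici 0)).withDensity fun t => ENNReal.ofReal (lam0 t)

instance (lam0 : ℝ → ℝ) : NullSingletonClass (hazardMeasure lam0) := by
  unfold hazardMeasure; infer_instance
instance (lam0 : ℝ → ℝ) : SFinite (hazardMeasure lam0) := by
  unfold hazardMeasure; infer_instance

/-- The properties of the law `Q` of an observation that the asymptotics depend on. -/
structure CoxLaw (Q : Measure (Obs p)) (β₀ : Cov p) (Λ : Measure ℝ) (τ : ℝ) : Prop where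
  campbell : ∀ h : ℝ → Cov p → ENNReal, Measurable (uncurry h) →
    ∫⁻ o, (if ind o = 1 then h (time o) (cov o) else 0) ∂Q =
      ∫⁻ o, ∫⁻ t, (if t ≤ time o then ENNReal.ofReal (Real.exp ⟪β₀, cov o⟫) * h t (cov o) else 0)
        ∂Λ ∂Q
  time_mem : ∀ᵐ o ∂Q, time o ∈ Ico 0 τ
  time_pos : ∀ t < τ, 0 < Q {o | t ≤ time o}
  time_atom : ∀ t, Q {o | time o = t} = 0
  moment : ∃ δ > 0, Integrable (fun o => Real.exp ⟪β₀, cov o⟫ * Real.exp (δ * ‖cov o‖)) Q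
  identifiable : ∀ v : Cov p, ¬ (∀ᵐ o ∂Q, ⟪v, cov o⟫ = 0) →
    ∃ t : ℝ, 0 < Q {o | time o ≤ t ∧ ind o = 1} ∧ ¬ ∃ c : ℝ, ∀ᵐ o ∂Q, t ≤ time o → ⟪v, cov o⟫ = c

theorem HasHazard.lintegral_eq {μ : Measure ℝ} {h : ℝ → ℝ} (hμ : HasHazard μ h) (hh : Measurable h)
    {f : ℝ → ENNReal} (hf : Measurable f) :
    ∫⁻ x, f x ∂μ = ∫⁻ x in Ici 0, ENNReal.ofReal (h x) * μ (Ioi x) * f x := by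
  conv_lhs => rw [hμ]
  rw [lintegral_withDensity_eq_lintegral_mul _ _ hf]
  · rfl
  · exact hh.ennreal_ofReal.mul (Antitone.measurable fun a b hab => measure_mono (Ioi_subset_Ioi
      hab))

theorem HasHazard.absolutelyContinuous {μ : Measure ℝ} {h : ℝ → ℝ} (hμ : HasHazard μ h) :
    μ ≪ volume.restrict (Ici 0) := by
  rw [hμ]; exact withDensity_absolutelyContinuous _ _

section

variable {Ω : Type*} [MeasurableSpace Ω] {P : Measure Ω} [IsProbabilityMeasure P]

theorem lintegral_condDistrib {E F : Type*} [MeasurableSpace E] [MeasurableSpace F]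
    [StandardBorelSpace F] [Nonempty F] {Z : Ω → E} {W : Ω → F} (hZ : Measurable Z)
    (hW : Measurable W) {f : E × F → ENNReal} (hf : Measurable f) :
    ∫⁻ ω, f (Z ω, W ω) ∂P = ∫⁻ z, ∫⁻ w, f (z, w) ∂(condDistrib W Z P z) ∂(P.map Z) := by
  rw [← Measure.lintegral_compProd hf, compProd_map_condDistrib hW.aemeasurable,
    lintegral_map hf (hZ.prodMk hW)]

theorem measure_preimage_eq_zero_of_condDistrib {E F : Type*} [MeasurableSpace E]
    [MeasurableSpace F] [StandardBorelSpace F] [Nonempty F] {Z : Ω → E} {W : Ω → F}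
    (hZ : Measurable Z) (hW : Measurable W) {A : Set F} (hA : MeasurableSet A)
    (h : ∀ᵐ z ∂(P.map Z), condDistrib W Z P z A = 0) : P {ω | W ω ∈ A} = 0 := by
  have := lintegral_condDistrib (P := P) hZ hW
    (f := fun q => A.indicator 1 q.2) ((measurable_one.indicator hA).comp measurable_snd)
  have h2 : ∫⁻ ω, A.indicator 1 (W ω) ∂P = P {ω | W ω ∈ A} := by
    have := lintegral_indicator_one (μ := P) (hW hA)
    exact this
  rw [← h2]
  refine this.trans ?_
  rw [lintegral_eq_zero_iff' ]
  · filter_upwards [h] with z hz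
    simpa [lintegral_indicator_one hA] using hz
  · simp only [lintegral_indicator_one hA]
    exact (Kernel.measurable_coe _ hA).aemeasurable

end

section

variable {Ω : Type*} [MeasurableSpace Ω] {P : Measure Ω} [IsProbabilityMeasure P]
  {X C : Ω → ℝ} {Z : Ω → Cov p} {β₀ : Cov p} {lam0 : ℝ → ℝ}

theorem IsCoxModel.measurable_observe (hc : IsCoxModel P X C Z β₀ lam0) :
    Measurable fun ω => observe (X ω) (C ω) (Z ω) :=
  (hc.measurable_X.min hc.measurable_C).prodMk
    ((Measurable.ite (measurableSet_le hc.measurable_X hc.measurable_C) measurable_const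
      measurable_const).prodMk hc.measurable_Z)

/-- Given `Z = z`, let `μ` and `ν` be the laws of `X` and `C`. By conditional independence and the
form of the hazard, both sides become the integral of `h t z * exp (β₀' z) * μ (t, ∞) * ν [t, ∞)`
against the baseline hazard measure. -/
theorem IsCoxModel.campbell (hc : IsCoxModel P X C Z β₀ lam0)
    {h : ℝ → Cov p → ENNReal} (hh : Measurable (uncurry h)) :
    ∫⁻ ω, (if X ω ≤ C ω then h (X ω) (Z ω) else 0) ∂P =
      ∫⁻ ω, ∫⁻ t, (if t ≤ min (X ω) (C ω) then
        ENNReal.ofReal (Real.exp ⟪β₀, Z ω⟫) * h t (Z ω) else 0) ∂(hazardMeasure lam0) ∂P := by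
  have hXC : Measurable fun ω => (X ω, C ω) := hc.measurable_X.prodMk hc.measurable_C
  have hh1 : ∀ z, Measurable fun x => h x z := fun z =>
    hh.comp (measurable_id.prodMk measurable_const)
  have hF : Measurable fun q : (Cov p × (ℝ × ℝ)) × ℝ => if q.2 ≤ min q.1.2.1 q.1.2.2 then
        ENNReal.ofReal (Real.exp ⟪β₀, q.1.1⟫) * h q.2 q.1.1 else 0 := by
    refine Measurable.ite (measurableSet_le (by fun_prop) (by fun_prop)) ?_ measurable_const
    refine Measurable.mul (by fun_prop) ?_
    exact hh.comp (measurable_snd.prodMk (measurable_fst.comp measurable_fst))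
  rw [lintegral_condDistrib (P := P) hc.measurable_Z hXC
    (f := fun q => if q.2.1 ≤ q.2.2 then h q.2.1 q.1 else 0),
    lintegral_condDistrib (P := P) hc.measurable_Z hXC
    (f := fun q => ∫⁻ t, (if t ≤ min q.2.1 q.2.2 then
        ENNReal.ofReal (Real.exp ⟪β₀, q.1⟫) * h t q.1 else 0) ∂(hazardMeasure lam0))
      hF.lintegral_prod_right']
  · refine lintegral_congr_ae ?_
    filter_upwards [hc.condIndep, hc.hazard] with z hz1 hz2
    rw [hz1]
    set μ := condDistrib X Z P z
    set ν := condDistrib C Z P z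
    have hνm : Measurable fun x => ν (Ici x) :=
      Antitone.measurable fun a b hab => measure_mono (Ici_subset_Ici.2 hab)
    have hμm : Measurable fun x => μ (Ioi x) :=
      Antitone.measurable fun a b hab => measure_mono (Ioi_subset_Ioi hab)
    -- Without atoms of `μ`, the survival function `μ (t, ∞)` in the hazard agrees with the at-risk
    -- probability `μ [t, ∞)`.
    have : NullSingletonClass μ := ⟨fun x => hz2.absolutelyContinuous
      (le_antisymm ((Measure.restrict_apply_le _ _).trans (by simp)) bot_le)⟩
    have hexp : Measurable fun x => lam0 x * Real.exp ⟪β₀, z⟫ :=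
      hc.measurable_hazard.mul_const _
    have L : ∫⁻ w, (if w.1 ≤ w.2 then h w.1 z else 0) ∂(μ.prod ν) =
        ∫⁻ x, h x z * ν (Ici x) ∂μ := by
      rw [lintegral_prod]
      · refine lintegral_congr fun x => ?_
        rw [← lintegral_indicator_const measurableSet_Ici]
        rfl
      · exact (Measurable.ite (measurableSet_le measurable_fst measurable_snd)
          ((hh1 z).comp measurable_fst) measurable_const).aemeasurable
    have R : ∫⁻ w, ∫⁻ t, (if t ≤ min w.1 w.2 then
        ENNReal.ofReal (Real.exp ⟪β₀, z⟫) * h t z else 0) ∂(hazardMeasure lam0) ∂(μ.prod ν) =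
        ∫⁻ t, ENNReal.ofReal (Real.exp ⟪β₀, z⟫) * h t z * (μ (Ioi t) * ν (Ici t))
          ∂(hazardMeasure lam0) := by
      rw [lintegral_lintegral_swap]
      · refine lintegral_congr fun t => ?_
        rw [measure_congr (Ioi_ae_eq_Ici (μ := μ) (a := t)), ← Measure.prod_prod,
          ← lintegral_indicator_const (measurableSet_Ici.prod measurableSet_Ici)]
        refine lintegral_congr fun w => ?_
        simp only [indicator, mem_prod, mem_Ici, le_min_iff]
      · exact (hF.comp ((measurable_const.prodMk measurable_fst).prodMk
          measurable_snd)).aemeasurable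
    refine L.trans (Eq.trans ?_ R.symm)
    refine (hz2.lintegral_eq hexp ((hh1 z).mul hνm)).trans ?_
    rw [hazardMeasure, lintegral_withDensity_eq_lintegral_mul _ hc.measurable_hazard.ennreal_ofReal]
    · refine setLIntegral_congr_fun measurableSet_Ici fun t ht => ?_
      simp only [Pi.mul_apply]
      rw [ENNReal.ofReal_mul (hc.hazard_nonneg t ht)]
      ring
    · exact ((hh1 z).const_mul _).mul (hμm.mul hνm)
  · exact Measurable.ite (measurableSet_le (by fun_prop) (by fun_prop))
      (hh.comp (measurable_snd.fst.prodMk measurable_fst)) measurable_const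

theorem IsCoxModel.ae_nonneg (hc : IsCoxModel P X C Z β₀ lam0) :
    ∀ᵐ ω ∂P, 0 ≤ X ω ∧ 0 ≤ C ω := by
  have h1 : P {ω | X ω ∈ Iio 0} = 0 :=
    measure_preimage_eq_zero_of_condDistrib hc.measurable_Z hc.measurable_X measurableSet_Iio
      (hc.hazard.mono fun z hz => hz.absolutelyContinuous (by
        rw [Measure.restrict_apply measurableSet_Iio, (by ext; simp : Iio (0 : ℝ) ∩ Ici 0 = ∅),
          measure_empty]))
  have h2 : P {ω | C ω ∈ Iio 0} = 0 :=
    measure_preimage_eq_zero_of_condDistrib hc.measurable_Z hc.measurable_C measurableSet_Iio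
      hc.censoring_nonneg
  have h1' : ∀ᵐ ω ∂P, ¬ X ω ∈ Iio 0 := measure_eq_zero_iff_ae_notMem.1 h1
  have h2' : ∀ᵐ ω ∂P, ¬ C ω ∈ Iio 0 := measure_eq_zero_iff_ae_notMem.1 h2
  filter_upwards [h1', h2'] with ω a b
  exact ⟨not_lt.1 a, not_lt.1 b⟩

theorem IsCoxModel.ae_min_ne (hc : IsCoxModel P X C Z β₀ lam0) (t : ℝ) :
    ∀ᵐ ω ∂P, min (X ω) (C ω) ≠ t := by
  have h1 : P {ω | X ω ∈ ({t} : Set ℝ)} = 0 :=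
    measure_preimage_eq_zero_of_condDistrib hc.measurable_Z hc.measurable_X
      (measurableSet_singleton t)
      (hc.hazard.mono fun z hz => hz.absolutelyContinuous
        (le_antisymm ((Measure.restrict_apply_le _ _).trans (by simp)) bot_le))
  have h2 : P {ω | C ω ∈ ({t} : Set ℝ)} = 0 :=
    measure_preimage_eq_zero_of_condDistrib hc.measurable_Z hc.measurable_C
      (measurableSet_singleton t) (hc.censoring_ac.mono fun z hz => hz (by simp))
  have h1' : ∀ᵐ ω ∂P, ¬ X ω ∈ ({t} : Set ℝ) := measure_eq_zero_iff_ae_notMem.1 h1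
  have h2' : ∀ᵐ ω ∂P, ¬ C ω ∈ ({t} : Set ℝ) := measure_eq_zero_iff_ae_notMem.1 h2
  filter_upwards [h1', h2'] with ω a b
  rcases min_choice (X ω) (C ω) with h | h <;> rw [h]
  · exact a
  · exact b

/-- The total mass one of the conditional law of `X` is at least `exp (β₀' z) * μ (τ, ∞)` times the
baseline hazard up to `τ`. If the latter were infinite, survival beyond `τ` would have probability
zero for almost every `z`. -/
theorem IsCoxModel.hazardMeasure_lt_top (hc : IsCoxModel P X C Z β₀ lam0) {τ : ℝ}
    (hτ : 0 < P {ω | X ω ∈ Ioi τ}) : hazardMeasure lam0 (Iic τ) < ⊤ := by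
  by_contra! htop
  rw [top_le_iff] at htop
  refine hτ.ne' (measure_preimage_eq_zero_of_condDistrib hc.measurable_Z hc.measurable_X
    measurableSet_Ioi (hc.hazard.mono fun z hz => ?_))
  have hexp : Measurable fun x => lam0 x * Real.exp ⟪β₀, z⟫ := hc.measurable_hazard.mul_const _
  set μ := condDistrib X Z P z
  have h1 := hz.lintegral_eq hexp (f := fun _ => 1) measurable_const
  rw [lintegral_one, measure_univ] at h1
  by_contra hne
  have h2 : hazardMeasure lam0 (Iic τ) * (ENNReal.ofReal (Real.exp ⟪β₀, z⟫) * μ (Ioi τ)) ≤ 1 := by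
    rw [h1, hazardMeasure, withDensity_apply _ measurableSet_Iic,
      ← lintegral_mul_const _ hc.measurable_hazard.ennreal_ofReal,
      Measure.restrict_restrict measurableSet_Iic, inter_comm,
      ← Measure.restrict_restrict measurableSet_Ici]
    refine (lintegral_mono_ae ?_).trans (lintegral_mono' (Measure.restrict_mono_measure
      Measure.restrict_le_self _) le_rfl)
    have : ∀ᵐ t ∂(volume.restrict (Iic τ)).restrict (Ici 0), t ∈ Ici 0 :=
      ae_restrict_mem measurableSet_Ici
    have h3 : ∀ᵐ t ∂(volume.restrict (Iic τ)).restrict (Ici 0), t ∈ Iic τ :=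
      ae_restrict_of_ae (ae_restrict_mem measurableSet_Iic)
    filter_upwards [this, h3] with t ht ht2
    rw [ENNReal.ofReal_mul (hc.hazard_nonneg t ht), mul_one, mul_assoc]
    gcongr
    exact ht2
  rw [htop, ENNReal.top_mul] at h2
  · simp at h2
  · exact mul_ne_zero (by simpa using Real.exp_pos _) hne

theorem norm_le_sum_abs (z : Cov p) : ‖z‖ ≤ ∑ k, |z k| := by
  have := EuclideanSpace.norm_eq z
  rw [this]
  refine (Real.sqrt_le_sqrt (Finset.sum_sq_le_sq_sum_of_nonneg fun k _ => norm_nonneg (z k))).trans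
      ?_
  rw [Real.sqrt_sq (Finset.sum_nonneg fun k _ => norm_nonneg _)]
  rfl

theorem exists_abs_ge (z : Cov p) (hz : z ≠ 0) : ∃ k, ‖z‖ / p ≤ |z k| := by
  by_contra! h
  have hp : 0 < p := by
    rcases Nat.eq_zero_or_pos p with h0 | h0
    · subst h0; exact absurd (Subsingleton.elim z 0) hz
    · exact h0
  have hp' : (0 : ℝ) < p := by exact_mod_cast hp
  have : ∑ k, |z k| < ∑ _k : Fin p, ‖z‖ / p :=
    Finset.sum_lt_sum_of_nonempty ⟨⟨0, hp⟩, Finset.mem_univ _⟩ fun k _ => h k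
  rw [Finset.sum_const, Finset.card_univ, Fintype.card_fin, nsmul_eq_mul,
    mul_div_cancel₀ _ hp'.ne'] at this
  exact absurd (norm_le_sum_abs z) (not_le.2 this)

/-- A single exponential moment, derived from the second moment condition. -/
theorem ConditionA2.integrable_exp (h : ConditionA2 P Z β₀) (hZ : Measurable Z) :
    ∃ δ > 0, Integrable (fun ω => Real.exp ⟪β₀, Z ω⟫ * Real.exp (δ * ‖Z ω‖)) P := by
  obtain ⟨ε, hε, K, hK⟩ := h
  -- Shifts of `β₀` by `±ε` along the axes. Some coordinate of `z` has modulus at least `‖z‖ / p`,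
  -- so one of these finitely many shifts dominates `exp (δ * ‖z‖)`.
  set b : Fin p → Bool → Cov p := fun k s =>
    β₀ + EuclideanSpace.single k (if s then ε else -ε) with hb
  set w : Fin p → Bool → Ω → ℝ := fun k s ω => ‖Z ω‖ ^ 2 * Real.exp (2 * ⟪b k s, Z ω⟫) with hw
  have hwm : ∀ k s, Measurable (w k s) := fun k s => by simp only [hw]; fun_prop
  have hwi : ∀ k s, Integrable (w k s) P := fun k s => by
    refine ⟨(hwm k s).aestronglyMeasurable, ?_⟩
    rw [hasFiniteIntegral_iff_ofReal (ae_of_all _ fun ω => by simp only [hw]; positivity)]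
    refine (hK (b k s) ?_).trans_lt ENNReal.coe_lt_top
    rw [hb]; simp only [add_sub_cancel_left, PiLp.norm_single]
    split_ifs <;> simp [abs_of_pos hε]
  -- The denominator `p + 1` instead of `p` keeps `δ` positive also for `p = 0`.
  set δ := ε / (p + 1) with hδ
  have hδpos : 0 < δ := by positivity
  refine ⟨δ, hδpos, Integrable.mono'
    (g := fun ω => Real.exp (‖β₀‖ + δ) + (1 + ∑ k, ∑ s, w k s ω)) ?_ (by fun_prop) ?_⟩
  · refine (integrable_const _).add ((integrable_const _).add ?_)
    exact integrable_finsetSum _ fun k _ => integrable_finsetSum _ fun s _ => hwi k s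
  · refine ae_of_all _ fun ω => ?_
    have hw0 : ∀ k s, 0 ≤ w k s ω := fun k s => by simp only [hw]; positivity
    rw [Real.norm_of_nonneg (by positivity)]
    set z := Z ω with hz
    rcases le_total ‖z‖ 1 with h1 | h1
    · have : Real.exp ⟪β₀, z⟫ * Real.exp (δ * ‖z‖) ≤ Real.exp (‖β₀‖ + δ) := by
        rw [← Real.exp_add]
        refine Real.exp_le_exp.2 (add_le_add ?_ ?_)
        · exact (real_inner_le_norm _ _).trans (mul_le_of_le_one_right (norm_nonneg _) h1)
        · exact mul_le_of_le_one_right hδpos.le h1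
      have h2 : 0 ≤ ∑ k, ∑ s, w k s ω :=
        Finset.sum_nonneg fun k _ => Finset.sum_nonneg fun s _ => hw0 k s
      linarith
    · have hz0 : z ≠ 0 := by rintro h0; rw [h0, norm_zero] at h1; linarith
      obtain ⟨k, hk⟩ := exists_abs_ge z hz0
      obtain ⟨s, hs⟩ : ∃ s, Real.exp (2 * ⟪β₀, z⟫) * Real.exp (2 * (δ * ‖z‖)) ≤ w k s ω := by
        have hpk : (0 : ℝ) < p := by
          have := k.pos; exact_mod_cast this
        have hin : ∀ s, ⟪b k s, z⟫ = ⟪β₀, z⟫ + (if s then ε else -ε) * z k := fun s => by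
          simp only [hb, inner_add_left, EuclideanSpace.inner_single_left]
          simp
        have hδz : δ * ‖z‖ ≤ ε * |z k| := by
          have h3 : δ ≤ ε / p := div_le_div_of_nonneg_left hε.le hpk (by linarith)
          calc δ * ‖z‖ ≤ ε / p * ‖z‖ := by gcongr
            _ = ε * (‖z‖ / p) := by ring
            _ ≤ _ := by gcongr
        have key : ∀ s, ε * |z k| = (if s then ε else -ε) * z k →
            Real.exp (2 * ⟪β₀, z⟫) * Real.exp (2 * (δ * ‖z‖)) ≤ w k s ω := fun s hs => by
          simp only [hw]
          rw [← hz, hin s, ← hs, ← Real.exp_add]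
          refine le_trans (Real.exp_le_exp.2 (by linarith)) (le_mul_of_one_le_left
            (Real.exp_pos _).le (one_le_pow₀ h1))
        rcases le_total 0 (z k) with h3 | h3
        · exact ⟨true, key true (by rw [abs_of_nonneg h3]; simp)⟩
        · exact ⟨false, key false (by rw [abs_of_nonpos h3]; simp)⟩
      have h3 : w k s ω ≤ ∑ k, ∑ s, w k s ω :=
        (Finset.single_le_sum (f := fun s => w k s ω) (fun s _ => hw0 k s) (Finset.mem_univ
            s)).trans
          (Finset.single_le_sum (f := fun k => ∑ s, w k s ω)
            (fun k _ => Finset.sum_nonneg fun s _ => hw0 k s) (Finset.mem_univ k))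
      have h4 : Real.exp ⟪β₀, z⟫ * Real.exp (δ * ‖z‖) ≤
          1 + Real.exp (2 * ⟪β₀, z⟫) * Real.exp (2 * (δ * ‖z‖)) := by
        have e1 : Real.exp (2 * ⟪β₀, z⟫) * Real.exp (2 * (δ * ‖z‖)) =
            (Real.exp ⟪β₀, z⟫ * Real.exp (δ * ‖z‖)) ^ 2 := by
          rw [mul_pow, ← Real.exp_nat_mul, ← Real.exp_nat_mul]; norm_num
        rw [e1]
        nlinarith [sq_nonneg (Real.exp ⟪β₀, z⟫ * Real.exp (δ * ‖z‖) - 1)]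
      linarith [Real.exp_pos (‖β₀‖ + δ)]

theorem exists_mem_support_gt {μ : Measure ℝ} {a : EReal} (h : a < supportEnd μ) :
    ∃ u ∈ μ.support, a < (u : EReal) := by
  obtain ⟨_, ⟨u, hu, rfl⟩, h2⟩ := lt_sSup_iff.1 h
  exact ⟨u, hu, h2⟩

theorem measure_Ioi_pos_of_mem_support {μ : Measure ℝ} {a u : ℝ} (hu : u ∈ μ.support)
    (h : a < u) : 0 < μ (Ioi a) :=
  (Measure.mem_support_iff_forall u).1 hu _ (Ioi_mem_nhds h)

/-- Here `τ` is the end point `τ_H`. That `τ_H < τ_F` makes it finite and leaves event times beyond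
it with positive probability, whence the baseline hazard has finite mass up to `τ`. -/
theorem exists_coxLaw (hc : IsCoxModel P X C Z β₀ lam0) (hid : Identifiable P X C Z)
    (hA1 : ConditionA1 P X C) (hA2 : ConditionA2 P Z β₀) {x₀ : ℝ}
    (hx₀ : (x₀ : EReal) < supportEnd (P.map fun ω => min (X ω) (C ω))) :
    ∃ τ, x₀ < τ ∧ hazardMeasure lam0 (Iic τ) < ⊤ ∧
      CoxLaw (P.map fun ω => observe (X ω) (C ω) (Z ω)) β₀
        ((hazardMeasure lam0).restrict (Iic τ)) τ := by
  have hm := hc.measurable_observe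
  have hT : Measurable fun ω => min (X ω) (C ω) := hc.measurable_X.min hc.measurable_C
  have hlt := hA1.1.trans_lt hA1.2
  obtain ⟨τ, hτ⟩ : ∃ τ : ℝ, (τ : EReal) = supportEnd (P.map fun ω => min (X ω) (C ω)) :=
    ⟨_, EReal.coe_toReal (hlt.trans_le le_top).ne (hx₀.trans_le' bot_le).ne'⟩
  have hxτ : x₀ < τ := EReal.coe_lt_coe_iff.1 (hτ ▸ hx₀)
  obtain ⟨u, hu, hτu⟩ := exists_mem_support_gt hlt
  rw [← hτ, EReal.coe_lt_coe_iff] at hτu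
  have hfin : hazardMeasure lam0 (Iic τ) < ⊤ := by
    refine hc.hazardMeasure_lt_top ?_
    have := measure_Ioi_pos_of_mem_support hu hτu
    rwa [Measure.map_apply hc.measurable_X measurableSet_Ioi] at this
  have hmem : ∀ᵐ ω ∂P, min (X ω) (C ω) ∈ Ico 0 τ := by
    have h1 : ∀ᵐ ω ∂P, min (X ω) (C ω) ∈ (P.map fun ω => min (X ω) (C ω)).support :=
      ae_of_ae_map hT.aemeasurable Measure.support_mem_ae
    filter_upwards [h1, hc.ae_nonneg, hc.ae_min_ne τ] with ω a b c
    refine ⟨le_min b.1 b.2, lt_of_le_of_ne ?_ c⟩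
    rw [← EReal.coe_le_coe_iff, hτ]
    exact le_sSup ⟨_, a, rfl⟩
  refine ⟨τ, hxτ, hfin, ?_, ?_, fun t ht => ?_, fun t => ?_, ?_, fun v hv => ?_⟩
  · intro h hh
    have hg : Measurable fun q : Obs p × ℝ => if q.2 ≤ time q.1 then
        ENNReal.ofReal (Real.exp ⟪β₀, cov q.1⟫) * h q.2 (cov q.1) else 0 := by
      unfold time cov
      refine Measurable.ite (measurableSet_le (by fun_prop) (by fun_prop)) ?_ measurable_const
      refine Measurable.mul (by fun_prop) ?_
      exact hh.comp (measurable_snd.prodMk measurable_fst.snd.snd)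
    rw [lintegral_map (by
      unfold ind time cov
      exact Measurable.ite (measurableSet_eq_fun (by fun_prop) (by fun_prop))
        (hh.comp (measurable_fst.prodMk measurable_snd.snd)) measurable_const) hm,
      lintegral_map hg.lintegral_prod_right' hm]
    have hL : ∀ ω, (if ind (observe (X ω) (C ω) (Z ω)) = 1 then
        h (time (observe (X ω) (C ω) (Z ω))) (cov (observe (X ω) (C ω) (Z ω))) else 0) =
        if X ω ≤ C ω then h (X ω) (Z ω) else 0 := fun ω => by
      by_cases hle : X ω ≤ C ω <;> simp [observe, ind, time, cov, hle]
    simp_rw [hL]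
    rw [hc.campbell hh]
    refine lintegral_congr_ae ?_
    filter_upwards [hmem] with ω hω
    rw [← lintegral_indicator measurableSet_Iic]
    refine lintegral_congr fun t => ?_
    -- Follow-up ends before `τ` almost surely, so restricting the hazard measure to `(-∞, τ]` loses
    -- nothing.
    by_cases ht : t ≤ τ
    · rw [indicator_of_mem (mem_Iic.2 ht)]; rfl
    · rw [indicator_of_notMem (by simpa using ht), if_neg]
      exact fun h => ht (h.trans hω.2.le)
  · exact (ae_map_iff hm.aemeasurable (measurable_fst measurableSet_Ico)).2 hmem
  · rw [Measure.map_apply hm (measurableSet_le measurable_const measurable_time)]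
    obtain ⟨w, hw, htw⟩ := exists_mem_support_gt (a := (t : EReal))
      (hτ ▸ EReal.coe_lt_coe_iff.2 ht)
    have := measure_Ioi_pos_of_mem_support hw (EReal.coe_lt_coe_iff.1 htw)
    rw [Measure.map_apply hT measurableSet_Ioi] at this
    exact this.trans_le (measure_mono fun ω (hω : t < min (X ω) (C ω)) => (hω.le : t ≤ min (X ω) (C
        ω)))
  · rw [Measure.map_apply hm (measurableSet_eq_fun measurable_time measurable_const)]
    exact measure_eq_zero_iff_ae_notMem.2 (hc.ae_min_ne t)
  · obtain ⟨δ, hδ, hi⟩ := hA2.integrable_exp hc.measurable_Z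
    refine ⟨δ, hδ, (integrable_map_measure ?_ hm.aemeasurable).2 hi⟩
    unfold cov; fun_prop
  · have hms : ∀ c : ℝ, MeasurableSet {o : Obs p | ⟪v, cov o⟫ = c} := fun c => by
      unfold cov; exact measurableSet_eq_fun (by fun_prop) (by fun_prop)
    have hms' : ∀ t : ℝ, MeasurableSet {o : Obs p | t ≤ time o} := fun t =>
      measurable_fst measurableSet_Ici
    rw [ae_map_iff hm.aemeasurable (hms 0)] at hv
    obtain ⟨t, ht1, ht2⟩ := hid v hv
    refine ⟨t, ?_, ?_⟩
    · rw [Measure.map_apply hm]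
      · convert ht1 using 3
        ext ω
        by_cases hle : X ω ≤ C ω <;> simp [observe, ind, time, hle]
      · exact (measurable_fst measurableSet_Iic).inter
          (measurable_fst.comp measurable_snd (measurableSet_singleton 1))
    · rintro ⟨c, hcc⟩
      refine ht2 ⟨c, ?_⟩
      rw [ae_map_iff hm.aemeasurable] at hcc
      · exact hcc
      · have : {o : Obs p | t ≤ time o → ⟪v, cov o⟫ = c} =
            {o : Obs p | t ≤ time o}ᶜ ∪ {o | ⟪v, cov o⟫ = c} := by
          ext o; simp only [mem_ofPred_eq, mem_union, mem_compl_iff, imp_iff_not_or]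
        rw [this]
        exact (hms' t).compl.union (hms c)

end

end CoxShape

/-! ### Independent samples and resampling of one observation -/

namespace CoxShape
open Function
variable {p : ℕ} {Ω : Type*} [MeasurableSpace Ω] {P : Measure Ω} {Q : Measure (Obs p)}
  {Y : ℕ → Ω → Obs p}

/-- `Y` is an i.i.d. sequence of observations with law `Q`. -/
structure IsSample (Y : ℕ → Ω → Obs p) (P : Measure Ω) (Q : Measure (Obs p)) : Prop where
  measurable : ∀ i, Measurable (Y i)
  indep : iIndepFun Y P
  law : ∀ i, P.map (Y i) = Q

/-- The sequence of observations in the outcome `ω`. -/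
def path (Y : ℕ → Ω → Obs p) (ω : Ω) : ℕ → Obs p := fun i => Y i ω

theorem IsSample.measurable_path (hY : IsSample Y P Q) : Measurable (path Y) :=
  measurable_pi_lambda _ hY.measurable

theorem IsSample.measurePreserving (hY : IsSample Y P Q) (i : ℕ) : MeasurePreserving (Y i) P Q :=
  ⟨hY.measurable i, hY.law i⟩

variable [IsProbabilityMeasure P]

theorem IsSample.isProbabilityMeasure (hY : IsSample Y P Q) : IsProbabilityMeasure Q :=
  hY.law 0 ▸ Measure.isProbabilityMeasure_map (hY.measurable 0).aemeasurable

theorem IsSample.ae_forall (hY : IsSample Y P Q) {q : Obs p → Prop} (h : ∀ᵐ o ∂Q, q o) :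
    ∀ᵐ ω ∂P, ∀ i, q (path Y ω i) :=
  ae_all_iff.2 fun i => (hY.measurePreserving i).quasiMeasurePreserving.ae h

/-- Overwriting coordinate `i` by a constant leaves a function of the other observations only. -/
theorem IsSample.indepFun_update (hY : IsSample Y P Q) (i : ℕ) (o : Obs p) :
    IndepFun (fun ω => update (path Y ω) i o) (Y i) P := by
  rw [IndepFun_iff_Indep]
  have hind := indep_iSup_of_disjoint (m := fun j => MeasurableSpace.comap (Y j) inferInstance)
    (fun j => (hY.measurable j).comap_le) ((iIndepFun_iff_iIndep _ _ _).1 hY.indep)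
    (S := {i}ᶜ) (T := {i}) disjoint_compl_left
  refine indep_of_indep_of_le_left (indep_of_indep_of_le_right hind ?_) ?_
  · exact le_iSup₂_of_le (f := fun j (_ : j ∈ ({i} : Set ℕ)) =>
      MeasurableSpace.comap (Y j) inferInstance) i rfl le_rfl
  · rw [← measurable_iff_comap_le]
    refine @measurable_pi_lambda _ _ _ (_) _ _ fun j => ?_
    by_cases hj : j = i
    · subst hj; simp only [update_self]; exact measurable_const
    · simp only [update_of_ne hj]
      refine Measurable.mono (comap_measurable (Y j)) ?_ le_rfl
      exact le_iSup₂_of_le (f := fun j (_ : j ∈ ({i}ᶜ : Set ℕ)) =>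
        MeasurableSpace.comap (Y j) inferInstance) j hj le_rfl

/-- A single observation may be resampled. -/
theorem IsSample.lintegral_update (hY : IsSample Y P Q) (i : ℕ) {F : (ℕ → Obs p) → ENNReal}
    (hF : Measurable F) :
    ∫⁻ ω, F (path Y ω) ∂P = ∫⁻ ω, ∫⁻ o, F (update (path Y ω) i o) ∂Q ∂P := by
  have := hY.isProbabilityMeasure
  have o₀ : Obs p := (0, 0, 0)
  set V : Ω → ℕ → Obs p := fun ω => update (path Y ω) i o₀
  have hup : Measurable fun q : (ℕ → Obs p) × Obs p => update q.1 i q.2 := measurable_update'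
  have hV : Measurable V := hup.comp (hY.measurable_path.prodMk measurable_const)
  have hmap := (indepFun_iff_map_prod_eq_prod_map_map hV.aemeasurable
    (hY.measurable i).aemeasurable).1 (hY.indepFun_update i o₀)
  have hFm : Measurable fun q : (ℕ → Obs p) × Obs p => F (update q.1 i q.2) := hF.comp hup
  have h1 : ∫⁻ ω, F (path Y ω) ∂P = ∫⁻ q, F (update q.1 i q.2) ∂(P.map fun ω => (V ω, Y i ω)) := by
    rw [lintegral_map hFm (hV.prodMk (hY.measurable i))]
    refine lintegral_congr fun ω => ?_
    congr 1
    simp only [V, update_idem]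
    exact (update_eq_self i (path Y ω)).symm
  rw [h1, hmap, hY.law i, lintegral_prod _ hFm.aemeasurable,
    lintegral_map hFm.lintegral_prod_right' hV]
  simp only [V, update_idem]

/-- Campbell's formula for the `i`-th observation and a predictable integrand. -/
theorem IsSample.campbell (hY : IsSample Y P Q) {β₀ : Cov p} {Λ : Measure ℝ} [SFinite Λ] {τ : ℝ}
    (hQ : CoxLaw Q β₀ Λ τ) (i : ℕ) {H : ℝ → (ℕ → Obs p) → ENNReal} (hH : Measurable (uncurry H))
    (hpred : ∀ t y o o', cov o = cov o' → t ≤ time o → t ≤ time o' →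
      H t (update y i o) = H t (update y i o')) :
    ∫⁻ ω, (if ind (path Y ω i) = 1 then H (time (path Y ω i)) (path Y ω) else 0) ∂P =
      ∫⁻ ω, ∫⁻ t, (if t ≤ time (path Y ω i) then
        ENNReal.ofReal (Real.exp ⟪β₀, cov (path Y ω i)⟫) * H t (path Y ω) else 0) ∂Λ ∂P := by
  have hup : Measurable fun q : (ℕ → Obs p) × Obs p => update q.1 i q.2 := measurable_update'
  have hm1 : Measurable fun y : ℕ → Obs p => if ind (y i) = 1 then H (time (y i)) y else 0 := by
    refine Measurable.ite (measurableSet_eq_fun (by fun_prop) measurable_const) ?_ measurable_const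
    exact hH.comp (Measurable.prodMk (by fun_prop) measurable_id)
  have hm2 : Measurable fun q : (ℕ → Obs p) × ℝ => if q.2 ≤ time (q.1 i) then
      ENNReal.ofReal (Real.exp ⟪β₀, cov (q.1 i)⟫) * H q.2 q.1 else 0 := by
    refine Measurable.ite (measurableSet_le (by fun_prop) (by fun_prop)) ?_ measurable_const
    refine Measurable.mul (by fun_prop) (hH.comp (measurable_snd.prodMk measurable_fst))
  rw [hY.lintegral_update i hm1, hY.lintegral_update i hm2.lintegral_prod_right']
  refine lintegral_congr fun ω => ?_
  set y := path Y ω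
  -- Predictability allows observation `i` to be replaced by `(t, 1, z)`, so with the other
  -- observations fixed the integrand depends on `t` and `z` alone and the formula for a single
  -- observation applies.
  have hh : Measurable (uncurry fun (t : ℝ) (z : Cov p) => H t (update y i (t, 1, z))) :=
    hH.comp (measurable_fst.prodMk (hup.comp (measurable_const.prodMk
      (measurable_fst.prodMk (measurable_const.prodMk measurable_snd)))))
  have key := hQ.campbell (fun t z => H t (update y i (t, 1, z))) hh
  simp only [update_self]
  refine Eq.trans ?_ (key.trans ?_)
  · refine lintegral_congr fun o => ?_
    split_ifs
    · exact hpred _ _ _ _ rfl le_rfl le_rfl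
    · rfl
  · refine lintegral_congr fun o => lintegral_congr fun t => ?_
    split_ifs with h
    · rw [hpred t y (t, 1, cov o) o rfl le_rfl h]
    · rfl

theorem IsSample.tendsto_average (hY : IsSample Y P Q) {f : Obs p → ℝ} (hf : Measurable f)
    (hi : Integrable f Q) : ∀ᵐ ω ∂P, Tendsto
      (fun n : ℕ => (∑ i ∈ Finset.range n, f (path Y ω i)) / n) atTop (𝓝 (∫ o, f o ∂Q)) := by
  have h0 := (hY.measurePreserving 0)
  have := strong_law_ae_real (fun i ω => f (Y i ω)) (μ := P)
    (h0.integrable_comp_of_integrable hi)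
    (fun i j hij => (hY.indep.indepFun hij).comp hf hf)
    (fun i => IdentDistrib.comp ⟨(hY.measurable i).aemeasurable, (hY.measurable 0).aemeasurable,
      by rw [hY.law, hY.law]⟩ hf)
  have h2 : ∫ ω, f (Y 0 ω) ∂P = ∫ o, f o ∂Q := by
    rw [← hY.law 0, integral_map (hY.measurable 0).aemeasurable hf.aestronglyMeasurable]
  rw [← h2]
  exact this

end CoxShape

namespace CoxShape
open Function
variable {p : ℕ} {β₀ : Cov p} {y : ℕ → Obs p}

/-! ### Risk sums -/

theorem riskSum_succ (n : ℕ) (y : ℕ → Obs p) (β : Cov p) (t : ℝ) :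
    riskSum (n + 1) y β t =
      riskSum n y β t + if t ≤ time (y n) then Real.exp ⟪β, cov (y n)⟫ else 0 :=
  Finset.sum_range_succ _ _

theorem riskSum_nonneg (n : ℕ) (y : ℕ → Obs p) (β : Cov p) (t : ℝ) : 0 ≤ riskSum n y β t :=
  Finset.sum_nonneg fun _ _ => by split_ifs <;> positivity

theorem riskSum_mono {n m : ℕ} (h : n ≤ m) (y : ℕ → Obs p) (β : Cov p) (t : ℝ) :
    riskSum n y β t ≤ riskSum m y β t :=
  Finset.sum_le_sum_of_subset_of_nonneg (Finset.range_mono h)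
    fun _ _ _ => by split_ifs <;> positivity

theorem riskSum_antitone (n : ℕ) (y : ℕ → Obs p) (β : Cov p) : Antitone (riskSum n y β) :=
  fun s t h => Finset.sum_le_sum fun i _ => by
    split_ifs with h1 h2
    · exact le_rfl
    · exact absurd (h.trans h1) h2
    · positivity
    · exact le_rfl

theorem exp_le_riskSum {n i : ℕ} (hi : i < n) (y : ℕ → Obs p) (β : Cov p) {t : ℝ}
    (ht : t ≤ time (y i)) : Real.exp ⟪β, cov (y i)⟫ ≤ riskSum n y β t := by
  have := Finset.single_le_sum (f := fun i => if t ≤ time (y i) then Real.exp ⟪β, cov (y i)⟫ else 0)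
    (fun _ _ => by split_ifs <;> positivity) (Finset.mem_range.2 hi)
  rw [if_pos ht] at this
  exact this

theorem riskSum_pos {n i : ℕ} (hi : i < n) (y : ℕ → Obs p) (β : Cov p) {t : ℝ}
    (ht : t ≤ time (y i)) : 0 < riskSum n y β t :=
  (Real.exp_pos _).trans_le (exp_le_riskSum hi y β ht)

theorem measurable_riskSum (n : ℕ) (β : Cov p) :
    Measurable fun q : ℝ × (ℕ → Obs p) => riskSum n q.2 β q.1 := by
  unfold riskSum
  refine Finset.measurable_sum _ fun i _ => ?_
  exact Measurable.ite (measurableSet_le (by fun_prop) (by fun_prop)) (by fun_prop) measurable_const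

/-- Predictability of the risk sum: of an individual still at risk at `t`, only the covariate
matters. -/
theorem riskSum_update (n i : ℕ) (y : ℕ → Obs p) (β : Cov p) {t : ℝ} {o o' : Obs p}
    (hc : cov o = cov o') (ho : t ≤ time o) (ho' : t ≤ time o') :
    riskSum n (update y i o) β t = riskSum n (update y i o') β t := by
  refine Finset.sum_congr rfl fun j _ => ?_
  rcases eq_or_ne j i with rfl | hj
  · simp only [update_self, ho, ho', hc]
  · simp only [update_of_ne hj]

/-! ### Events at times of small risk sums -/

/-- The indicator that `t` lies in `G` and that the risk sum of the first `i + 1` observations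
is at most `L`. -/
noncomputable def lowRisk (β₀ : Cov p) (L : ℝ) (G : Set ℝ) (i : ℕ) (t : ℝ) (y : ℕ → Obs p) :
    ENNReal :=
  open Classical in if t ∈ G ∧ riskSum (i + 1) y β₀ t ≤ L then 1 else 0

/-- The indicator that observation `i` is an event in `G` with a small risk sum. -/
noncomputable def lowEvent (β₀ : Cov p) (L : ℝ) (G : Set ℝ) (i : ℕ) (y : ℕ → Obs p) : ENNReal :=
  if ind (y i) = 1 then lowRisk β₀ L G i (time (y i)) y else 0

/-- The compensator of `lowEvent`. -/
noncomputable def lowComp (β₀ : Cov p) (Λ : Measure ℝ) (L : ℝ) (G : Set ℝ) (i : ℕ) (y : ℕ → Obs p)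
    : ENNReal :=
  ∫⁻ t, (if t ≤ time (y i) then
    ENNReal.ofReal (Real.exp ⟪β₀, cov (y i)⟫) * lowRisk β₀ L G i t y else 0) ∂Λ

section

variable {L : ℝ} {G : Set ℝ}

theorem measurable_lowRisk (hG : MeasurableSet G) (i : ℕ) :
    Measurable (uncurry (lowRisk β₀ L G i)) := by
  unfold lowRisk uncurry
  exact Measurable.ite ((measurable_fst hG).inter
    (measurableSet_le (measurable_riskSum _ _) measurable_const)) measurable_const measurable_const

theorem lowRisk_update (i j : ℕ) {t : ℝ} {o o' : Obs p}
    (hc : cov o = cov o') (ho : t ≤ time o) (ho' : t ≤ time o') :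
    lowRisk β₀ L G i t (update y j o) = lowRisk β₀ L G i t (update y j o') := by
  unfold lowRisk
  rw [riskSum_update _ _ _ _ hc ho ho']

theorem riskSum_update_of_le {n j : ℕ} (h : n ≤ j) (β : Cov p) (t : ℝ) (o : Obs p) :
    riskSum n (update y j o) β t = riskSum n y β t :=
  Finset.sum_congr rfl fun i hi => by
    rw [update_of_ne (by have := Finset.mem_range.1 hi; omega)]

theorem lowEvent_update {i j : ℕ} (h : i < j) (o : Obs p) :
    lowEvent β₀ L G i (update y j o) = lowEvent β₀ L G i y := by
  unfold lowEvent lowRisk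
  rw [update_of_ne h.ne, riskSum_update_of_le h]

theorem lowComp_update (Λ : Measure ℝ) {i j : ℕ} (h : i < j) (o : Obs p) :
    lowComp β₀ Λ L G i (update y j o) = lowComp β₀ Λ L G i y := by
  unfold lowComp
  refine lintegral_congr fun t => ?_
  rw [update_of_ne h.ne, lowRisk, lowRisk, riskSum_update_of_le h]

theorem measurable_lowEvent (hG : MeasurableSet G) (i : ℕ) : Measurable (lowEvent β₀ L G i) := by
  unfold lowEvent
  refine Measurable.ite (measurableSet_eq_fun (by fun_prop) measurable_const) ?_ measurable_const
  exact (measurable_lowRisk hG i).comp (Measurable.prodMk (by fun_prop) measurable_id)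

theorem measurable_lowComp_integrand (hG : MeasurableSet G) (i : ℕ) :
    Measurable fun q : (ℕ → Obs p) × ℝ => if q.2 ≤ time (q.1 i) then
      ENNReal.ofReal (Real.exp ⟪β₀, cov (q.1 i)⟫) * lowRisk β₀ L G i q.2 q.1 else 0 := by
  refine Measurable.ite (measurableSet_le (by fun_prop) (by fun_prop)) ?_ measurable_const
  exact Measurable.mul (by fun_prop)
    ((measurable_lowRisk hG i).comp (measurable_snd.prodMk measurable_fst))

theorem measurable_lowComp_integrand_right (hG : MeasurableSet G) (i : ℕ) (y : ℕ → Obs p) :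
    Measurable fun t : ℝ => if t ≤ time (y i) then
      ENNReal.ofReal (Real.exp ⟪β₀, cov (y i)⟫) * lowRisk β₀ L G i t y else 0 :=
  (measurable_lowComp_integrand hG i).comp (measurable_const.prodMk measurable_id)

theorem measurable_lowComp (Λ : Measure ℝ) [SFinite Λ] (hG : MeasurableSet G) (i : ℕ) :
    Measurable (lowComp β₀ Λ L G i) :=
  (measurable_lowComp_integrand hG i).lintegral_prod_right'

theorem lowEvent_sq (i : ℕ) (y : ℕ → Obs p) :
    lowEvent β₀ L G i y ^ 2 = lowEvent β₀ L G i y := by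
  unfold lowEvent lowRisk; split_ifs <;> simp

theorem lowEvent_le_one (i : ℕ) (y : ℕ → Obs p) : lowEvent β₀ L G i y ≤ 1 := by
  unfold lowEvent lowRisk; split_ifs <;> simp

/-- At a fixed time `t`, the weights of the individuals at risk are added up one after the other and
counted only while the running total is at most `L`. This is why `lowRisk` uses the first `i + 1`
observations: the bound does not depend on `n`. -/
theorem sum_lowRisk_le (hL : 0 ≤ L) (n : ℕ) (y : ℕ → Obs p) (t : ℝ) :
    ∑ i ∈ Finset.range n, (if t ≤ time (y i) then
      ENNReal.ofReal (Real.exp ⟪β₀, cov (y i)⟫) * lowRisk β₀ L G i t y else 0) ≤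
      G.indicator (fun _ => ENNReal.ofReal L) t := by
  by_cases ht : t ∈ G
  · rw [indicator_of_mem ht]
    -- The induction carries the sharper bound with the risk sum itself, which is what allows one
    -- more term to be added while the total stays below `L`.
    suffices h : ∑ i ∈ Finset.range n, (if t ≤ time (y i) then
        ENNReal.ofReal (Real.exp ⟪β₀, cov (y i)⟫) * lowRisk β₀ L G i t y else 0) ≤
        ENNReal.ofReal (min (riskSum n y β₀ t) L) from
      h.trans (ENNReal.ofReal_le_ofReal (min_le_right _ _))
    induction n with
    | zero => simp
    | succ n ih =>
      rw [Finset.sum_range_succ]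
      refine (add_le_add_left ih _).trans ?_
      by_cases h1 : t ≤ time (y n)
      · by_cases h2 : riskSum (n + 1) y β₀ t ≤ L
        · rw [if_pos h1, lowRisk, if_pos ⟨ht, h2⟩, mul_one, min_eq_left h2,
            ← ENNReal.ofReal_add (le_min (riskSum_nonneg _ _ _ _) hL) (Real.exp_pos _).le,
            riskSum_succ, if_pos h1]
          gcongr
          exact min_le_left _ _
        · rw [if_pos h1, lowRisk, if_neg (fun h => h2 h.2), mul_zero, add_zero]
          gcongr
          exact riskSum_mono (Nat.le_succ n) _ _ _
      · rw [if_neg h1, add_zero]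
        gcongr
        exact riskSum_mono (Nat.le_succ n) _ _ _
  · refine (Finset.sum_eq_zero fun i _ => ?_).le.trans zero_le
    split_ifs
    · rw [lowRisk, if_neg (fun h => ht h.1), mul_zero]
    · rfl

theorem sum_lowComp_le {Λ : Measure ℝ} [SFinite Λ] (hG : MeasurableSet G) (hL : 0 ≤ L) (n : ℕ)
    (y : ℕ → Obs p) :
    ∑ i ∈ Finset.range n, lowComp β₀ Λ L G i y ≤ ENNReal.ofReal L * Λ G := by
  unfold lowComp
  rw [← lintegral_finsetSum _ fun i _ => measurable_lowComp_integrand_right hG i y]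
  refine (lintegral_mono fun t => sum_lowRisk_le hL n y t).trans ?_
  rw [lintegral_indicator_const hG]

end

section

variable {Ω : Type*} [MeasurableSpace Ω] {P : Measure Ω} {Q : Measure (Obs p)}
  {Y : ℕ → Ω → Obs p} [IsProbabilityMeasure P] {Λ : Measure ℝ} [SFinite Λ] {τ : ℝ}
  {L : ℝ} {G : Set ℝ}

/-- `lowEvent` minus `lowComp` is orthogonal to everything that does not involve observation `i`, in
particular to the past in the order of the indices. -/
theorem lintegral_lowEvent_mul (hY : IsSample Y P Q) (hQ : CoxLaw Q β₀ Λ τ) (hG : MeasurableSet G)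
    (i : ℕ) {W : (ℕ → Obs p) → ENNReal} (hW : Measurable W)
    (hWu : ∀ y o, W (update y i o) = W y) :
    ∫⁻ ω, lowEvent β₀ L G i (path Y ω) * W (path Y ω) ∂P =
      ∫⁻ ω, lowComp β₀ Λ L G i (path Y ω) * W (path Y ω) ∂P := by
  have := hY.campbell hQ i (H := fun t y => lowRisk β₀ L G i t y * W y)
    ((measurable_lowRisk hG i).mul (hW.comp measurable_snd)) fun t y o o' hc ho ho' => by
      rw [lowRisk_update i i hc ho ho', hWu, hWu]
  refine Eq.trans ?_ (this.trans ?_)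
  · refine lintegral_congr fun ω => ?_
    unfold lowEvent; split_ifs <;> simp
  · refine lintegral_congr fun ω => ?_
    unfold lowComp
    rw [← lintegral_mul_const _ (measurable_lowComp_integrand_right hG i _)]
    refine lintegral_congr fun t => ?_
    split_ifs
    · rw [mul_assoc]
    · simp

/-- The square is the union of two triangles, exchanged by symmetry; the diagonal is counted twice,
whence an inequality. -/
theorem sq_lintegral_le {c : ℝ → ENNReal} (hc : Measurable c) :
    (∫⁻ t, c t ∂Λ) ^ 2 ≤ 2 * ∫⁻ t, c t * ∫⁻ s, (if s ≤ t then c s else 0) ∂Λ ∂Λ := by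
  have hcc : Measurable fun q : ℝ × ℝ => if q.2 ≤ q.1 then c q.1 * c q.2 else 0 :=
    Measurable.ite (measurableSet_le (by fun_prop) (by fun_prop))
      ((hc.comp measurable_fst).mul (hc.comp measurable_snd)) measurable_const
  have hr : ∀ t, Measurable fun s => if s ≤ t then c t * c s else 0 := fun t =>
    hcc.comp (measurable_const.prodMk measurable_id)
  have e1 : (∫⁻ t, c t ∂Λ) ^ 2 = ∫⁻ t, ∫⁻ s, c t * c s ∂Λ ∂Λ := by
    rw [sq, ← lintegral_mul_const _ hc]
    exact lintegral_congr fun t => (lintegral_const_mul _ hc).symm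
  have e2 : ∫⁻ t, c t * ∫⁻ s, (if s ≤ t then c s else 0) ∂Λ ∂Λ =
      ∫⁻ t, ∫⁻ s, (if s ≤ t then c t * c s else 0) ∂Λ ∂Λ := by
    refine lintegral_congr fun t => ?_
    rw [← lintegral_const_mul _ (Measurable.ite measurableSet_Iic hc measurable_const)]
    exact lintegral_congr fun s => by split_ifs <;> simp
  have e3 : ∫⁻ t, ∫⁻ s, (if s ≤ t then c t * c s else 0) ∂Λ ∂Λ =
      ∫⁻ t, ∫⁻ s, (if t ≤ s then c s * c t else 0) ∂Λ ∂Λ :=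
    lintegral_lintegral_swap hcc.aemeasurable
  have hm : Measurable fun t => ∫⁻ s, (if s ≤ t then c t * c s else 0) ∂Λ :=
    hcc.lintegral_prod_right'
  rw [e1, e2, two_mul]
  nth_rewrite 2 [e3]
  rw [← lintegral_add_left hm]
  refine lintegral_mono fun t => ?_
  change _ ≤ ∫⁻ s, (if s ≤ t then c t * c s else 0) ∂Λ + ∫⁻ s, (if t ≤ s then c s * c t else 0) ∂Λ
  rw [← lintegral_add_left (hr t)]
  refine lintegral_mono fun s => ?_
  rcases le_total s t with h | h
  · simp [h]
  · simp [h, mul_comm]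

/-- The square of the compensator is at most twice the integral of the compensator run up to time
`t` against its own increment. That integrand is predictable, and at the event it has become the
full compensator, so Campbell's formula applies. -/
theorem lintegral_lowComp_sq_le (hY : IsSample Y P Q) (hQ : CoxLaw Q β₀ Λ τ)
    (hG : MeasurableSet G) (i : ℕ) :
    ∫⁻ ω, lowComp β₀ Λ L G i (path Y ω) ^ 2 ∂P ≤
      2 * ∫⁻ ω, lowEvent β₀ L G i (path Y ω) * lowComp β₀ Λ L G i (path Y ω) ∂P := by
  obtain ⟨B, hB⟩ : ∃ B : ℝ → (ℕ → Obs p) → ENNReal, ∀ t y, B t y = ∫⁻ s, (if s ≤ t then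
      ENNReal.ofReal (Real.exp ⟪β₀, cov (y i)⟫) * lowRisk β₀ L G i s y else 0) ∂Λ :=
    ⟨_, fun _ _ => rfl⟩
  have hBint : Measurable fun q : (ℝ × (ℕ → Obs p)) × ℝ => if q.2 ≤ q.1.1 then
      ENNReal.ofReal (Real.exp ⟪β₀, cov (q.1.2 i)⟫) * lowRisk β₀ L G i q.2 q.1.2 else 0 := by
    refine Measurable.ite (measurableSet_le (by fun_prop) (by fun_prop)) ?_ measurable_const
    exact Measurable.mul (by fun_prop)
      ((measurable_lowRisk hG i).comp (measurable_snd.prodMk measurable_fst.snd))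
  have hBm : Measurable (uncurry B) := by
    have := hBint.lintegral_prod_right' (ν := Λ)
    have h : uncurry B = fun q : ℝ × (ℕ → Obs p) => ∫⁻ s, (if s ≤ q.1 then
      ENNReal.ofReal (Real.exp ⟪β₀, cov (q.2 i)⟫) * lowRisk β₀ L G i s q.2 else 0) ∂Λ :=
      funext fun q => hB q.1 q.2
    rw [h]
    exact this
  have key := hY.campbell hQ i (H := fun t y => lowRisk β₀ L G i t y * B t y)
    ((measurable_lowRisk hG i).mul hBm) fun t y o o' hc ho ho' => by
      rw [lowRisk_update i i hc ho ho', hB, hB]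
      congr 1
      refine lintegral_congr fun s => ?_
      by_cases hs : s ≤ t
      · rw [if_pos hs, if_pos hs, update_self, update_self, hc,
          lowRisk_update i i hc (hs.trans ho) (hs.trans ho')]
      · rw [if_neg hs, if_neg hs]
  have h1 : ∀ y : ℕ → Obs p, lowComp β₀ Λ L G i y ^ 2 ≤ 2 * ∫⁻ t, (if t ≤ time (y i) then
      ENNReal.ofReal (Real.exp ⟪β₀, cov (y i)⟫) * (lowRisk β₀ L G i t y * B t y) else 0) ∂Λ := by
    intro y
    refine (sq_lintegral_le (measurable_lowComp_integrand_right hG i y)).trans_eq ?_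
    congr 1
    refine lintegral_congr fun t => ?_
    by_cases ht : t ≤ time (y i)
    · rw [if_pos ht, if_pos ht, mul_assoc, hB]
      congr 2
      refine lintegral_congr fun s => ?_
      by_cases hs : s ≤ t
      · rw [if_pos hs, if_pos hs, if_pos (hs.trans ht)]
      · rw [if_neg hs, if_neg hs]
    · rw [if_neg ht, if_neg ht, zero_mul]
  refine (lintegral_mono fun ω => h1 (path Y ω)).trans_eq ?_
  rw [lintegral_const_mul' _ _ (by simp), ← key]
  congr 1
  refine lintegral_congr fun ω => ?_
  unfold lowEvent
  by_cases hi : ind (path Y ω i) = 1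
  · rw [if_pos hi, if_pos hi, hB]; rfl
  · rw [if_neg hi, if_neg hi, zero_mul]

theorem lintegral_sum_lowEvent_le (hY : IsSample Y P Q) (hQ : CoxLaw Q β₀ Λ τ)
    (hG : MeasurableSet G) (hL : 0 ≤ L) (n : ℕ) :
    ∫⁻ ω, ∑ i ∈ Finset.range n, lowEvent β₀ L G i (path Y ω) ∂P ≤ ENNReal.ofReal L * Λ G := by
  have h : ∀ i, ∫⁻ ω, lowEvent β₀ L G i (path Y ω) ∂P = ∫⁻ ω, lowComp β₀ Λ L G i (path Y ω) ∂P :=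
    fun i => by
      have := lintegral_lowEvent_mul (L := L) hY hQ hG i (W := fun _ => 1) measurable_const
        (fun _ _ => rfl)
      simpa only [mul_one] using this
  have h1 : ∀ i, Measurable fun ω => lowEvent β₀ L G i (path Y ω) :=
    fun i => (measurable_lowEvent hG i).comp hY.measurable_path
  have h2 : ∀ i, Measurable fun ω => lowComp β₀ Λ L G i (path Y ω) :=
    fun i => (measurable_lowComp Λ hG i).comp hY.measurable_path
  rw [lintegral_finsetSum _ fun i _ => h1 i, Finset.sum_congr rfl fun i _ => h i,
    ← lintegral_finsetSum _ fun i _ => h2 i]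
  refine (lintegral_mono fun ω => sum_lowComp_le hG hL n _).trans ?_
  simp

/-- With `Ξ` the number of counted events and `𝒜` its compensator, this is `E (Ξ - 𝒜)² ≤ E Ξ`
without subtraction. In the step from `n` to `n + 1` the cross terms with the past cancel by
orthogonality, and the new diagonal term contributes at most `E ξ`, because `ξ² = ξ` and `E A² ≤ 2 E
(ξ A)`. -/
theorem lintegral_sq_add_sq_le (hY : IsSample Y P Q) (hQ : CoxLaw Q β₀ Λ τ)
    (hG : MeasurableSet G) (n : ℕ) :
    ∫⁻ ω, ((∑ i ∈ Finset.range n, lowEvent β₀ L G i (path Y ω)) ^ 2 +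
        (∑ i ∈ Finset.range n, lowComp β₀ Λ L G i (path Y ω)) ^ 2) ∂P ≤
      ∫⁻ ω, 2 * ((∑ i ∈ Finset.range n, lowEvent β₀ L G i (path Y ω)) *
        ∑ i ∈ Finset.range n, lowComp β₀ Λ L G i (path Y ω)) ∂P +
      ∫⁻ ω, ∑ i ∈ Finset.range n, lowEvent β₀ L G i (path Y ω) ∂P := by
  induction n with
  | zero => simp
  | succ n ih =>
    set ξ : Ω → ENNReal := fun ω => lowEvent β₀ L G n (path Y ω)
    set A : Ω → ENNReal := fun ω => lowComp β₀ Λ L G n (path Y ω)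
    set Ξ : Ω → ENNReal := fun ω => ∑ i ∈ Finset.range n, lowEvent β₀ L G i (path Y ω)
    set 𝒜 : Ω → ENNReal := fun ω => ∑ i ∈ Finset.range n, lowComp β₀ Λ L G i (path Y ω)
    have mξ : Measurable ξ := (measurable_lowEvent hG n).comp hY.measurable_path
    have mA : Measurable A := (measurable_lowComp Λ hG n).comp hY.measurable_path
    have mΞ' : Measurable fun y : ℕ → Obs p => ∑ i ∈ Finset.range n, lowEvent β₀ L G i y :=
      Finset.measurable_sum _ fun i _ => measurable_lowEvent hG i
    have m𝒜' : Measurable fun y : ℕ → Obs p => ∑ i ∈ Finset.range n, lowComp β₀ Λ L G i y :=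
      Finset.measurable_sum _ fun i _ => measurable_lowComp Λ hG i
    have mΞ : Measurable Ξ := mΞ'.comp hY.measurable_path
    have m𝒜 : Measurable 𝒜 := m𝒜'.comp hY.measurable_path
    have c1 : ∫⁻ ω, ξ ω * Ξ ω ∂P = ∫⁻ ω, A ω * Ξ ω ∂P :=
      lintegral_lowEvent_mul hY hQ hG n mΞ' fun y o =>
        Finset.sum_congr rfl fun i hi => lowEvent_update (Finset.mem_range.1 hi) o
    have c2 : ∫⁻ ω, ξ ω * 𝒜 ω ∂P = ∫⁻ ω, A ω * 𝒜 ω ∂P :=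
      lintegral_lowEvent_mul hY hQ hG n m𝒜' fun y o =>
        Finset.sum_congr rfl fun i hi => lowComp_update Λ (Finset.mem_range.1 hi) o
    have c3 : ∫⁻ ω, A ω ^ 2 ∂P ≤ 2 * ∫⁻ ω, ξ ω * A ω ∂P := lintegral_lowComp_sq_le hY hQ hG n
    have l : ∀ ω, (∑ i ∈ Finset.range (n + 1), lowEvent β₀ L G i (path Y ω)) ^ 2 +
        (∑ i ∈ Finset.range (n + 1), lowComp β₀ Λ L G i (path Y ω)) ^ 2 =
        (Ξ ω ^ 2 + 𝒜 ω ^ 2) + (2 * (ξ ω * Ξ ω) + 2 * (A ω * 𝒜 ω) + ξ ω + A ω ^ 2) := fun ω => by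
      rw [Finset.sum_range_succ, Finset.sum_range_succ]
      have := lowEvent_sq (β₀ := β₀) (L := L) (G := G) n (path Y ω)
      change (Ξ ω + ξ ω) ^ 2 + (𝒜 ω + A ω) ^ 2 = _
      change ξ ω ^ 2 = ξ ω at this
      nth_rewrite 3 [← this]
      ring
    have r : ∀ ω, 2 * ((∑ i ∈ Finset.range (n + 1), lowEvent β₀ L G i (path Y ω)) *
        ∑ i ∈ Finset.range (n + 1), lowComp β₀ Λ L G i (path Y ω)) =
        2 * (Ξ ω * 𝒜 ω) + (2 * (A ω * Ξ ω) + 2 * (ξ ω * 𝒜 ω) + 2 * (ξ ω * A ω)) := fun ω => by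
      rw [Finset.sum_range_succ, Finset.sum_range_succ]
      change 2 * ((Ξ ω + ξ ω) * (𝒜 ω + A ω)) = _
      ring
    have r2 : ∀ ω, ∑ i ∈ Finset.range (n + 1), lowEvent β₀ L G i (path Y ω) = Ξ ω + ξ ω :=
      fun ω => Finset.sum_range_succ _ _
    simp_rw [l, r, r2]
    have d1 : ∫⁻ ω, ((Ξ ω ^ 2 + 𝒜 ω ^ 2) +
        (2 * (ξ ω * Ξ ω) + 2 * (A ω * 𝒜 ω) + ξ ω + A ω ^ 2)) ∂P = ∫⁻ ω, Ξ ω ^ 2 + 𝒜 ω ^ 2 ∂P +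
        (2 * ∫⁻ ω, ξ ω * Ξ ω ∂P + 2 * ∫⁻ ω, A ω * 𝒜 ω ∂P + ∫⁻ ω, ξ ω ∂P + ∫⁻ ω, A ω ^ 2 ∂P) := by
      rw [← lintegral_const_mul _ (by fun_prop), ← lintegral_const_mul _ (by fun_prop),
        ← lintegral_add_left (by fun_prop), ← lintegral_add_left (by fun_prop),
        ← lintegral_add_left (by fun_prop), ← lintegral_add_left (by fun_prop)]
    have d2 : ∫⁻ ω, (2 * (Ξ ω * 𝒜 ω) +
        (2 * (A ω * Ξ ω) + 2 * (ξ ω * 𝒜 ω) + 2 * (ξ ω * A ω))) ∂P = ∫⁻ ω, 2 * (Ξ ω * 𝒜 ω) ∂P +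
        (2 * ∫⁻ ω, A ω * Ξ ω ∂P + 2 * ∫⁻ ω, ξ ω * 𝒜 ω ∂P + 2 * ∫⁻ ω, ξ ω * A ω ∂P) := by
      rw [← lintegral_const_mul (f := fun ω => A ω * Ξ ω) _ (by fun_prop),
        ← lintegral_const_mul (f := fun ω => ξ ω * 𝒜 ω) _ (by fun_prop),
        ← lintegral_const_mul (f := fun ω => ξ ω * A ω) _ (by fun_prop),
        ← lintegral_add_left (by fun_prop), ← lintegral_add_left (by fun_prop),
        ← lintegral_add_left (by fun_prop)]
    rw [d1, d2, lintegral_add_left mΞ, c1, c2]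
    calc _ ≤ _ := add_le_add ih (add_le_add_right c3 _)
      _ = _ := by ring

/-- A tail bound for the number of events with small risk sums. -/
theorem measure_sum_lowEvent_ge_le (hY : IsSample Y P Q) (hQ : CoxLaw Q β₀ Λ τ)
    (hG : MeasurableSet G) (hL : 0 ≤ L) {m : ℝ} (hm : 0 < m)
    (hLm : ENNReal.ofReal L * Λ G ≤ ENNReal.ofReal m) (n : ℕ) :
    P {ω | ENNReal.ofReal (2 * m) ≤ ∑ i ∈ Finset.range n, lowEvent β₀ L G i (path Y ω)} ≤
      ENNReal.ofReal (1 / m) := by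
  set Ξ : Ω → ENNReal := fun ω => ∑ i ∈ Finset.range n, lowEvent β₀ L G i (path Y ω)
  set 𝒜 : Ω → ENNReal := fun ω => ∑ i ∈ Finset.range n, lowComp β₀ Λ L G i (path Y ω)
  have mΞ : Measurable Ξ :=
    (Finset.measurable_sum _ fun i _ => measurable_lowEvent hG i).comp hY.measurable_path
  have m𝒜 : Measurable 𝒜 :=
    (Finset.measurable_sum _ fun i _ => measurable_lowComp Λ hG i).comp hY.measurable_path
  have h𝒜 : ∀ ω, 𝒜 ω ≤ ENNReal.ofReal m := fun ω => (sum_lowComp_le hG hL n _).trans hLm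
  have hΞ : ∀ ω, Ξ ω ≤ n := fun ω =>
    (Finset.sum_le_sum fun i _ => lowEvent_le_one i _).trans (by simp)
  set E := {ω | ENNReal.ofReal (2 * m) ≤ Ξ ω}
  have hE : MeasurableSet E := measurableSet_le measurable_const mΞ
  -- Chebyshev's inequality: on `E` the count is at least `2 * m` while its compensator is at most
  -- `m`, so the squared difference is at least `m ^ 2`. Together with `E Ξ ≤ m` this gives `P E ≤ 1
  -- / m`.
  have hpt : ∀ ω, 2 * (Ξ ω * 𝒜 ω) + E.indicator (fun _ => ENNReal.ofReal (m ^ 2)) ω ≤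
      Ξ ω ^ 2 + 𝒜 ω ^ 2 := by
    intro ω
    have f1 : Ξ ω ≠ ⊤ := ((hΞ ω).trans_lt (by simp)).ne
    have f2 : 𝒜 ω ≠ ⊤ := ((h𝒜 ω).trans_lt ENNReal.ofReal_lt_top).ne
    obtain ⟨a, ha⟩ : ∃ a : NNReal, Ξ ω = ENNReal.ofReal a := ⟨(Ξ ω).toNNReal, by simp [f1]⟩
    obtain ⟨b, hb⟩ : ∃ b : NNReal, 𝒜 ω = ENNReal.ofReal b := ⟨(𝒜 ω).toNNReal, by simp [f2]⟩
    have hbm : (b : ℝ) ≤ m := by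
      have := h𝒜 ω; rw [hb] at this; exact (ENNReal.ofReal_le_ofReal_iff hm.le).1 this
    have h2 : (2 : ENNReal) = ENNReal.ofReal 2 := by simp
    have a0 : (0 : ℝ) ≤ a := a.2
    have b0 : (0 : ℝ) ≤ b := b.2
    rw [ha, hb, h2, ← ENNReal.ofReal_mul a0, ← ENNReal.ofReal_mul zero_le_two,
      ← ENNReal.ofReal_pow a0, ← ENNReal.ofReal_pow b0, ← ENNReal.ofReal_add (by positivity)
      (by positivity)]
    by_cases hω : ω ∈ E
    · rw [indicator_of_mem hω, ← ENNReal.ofReal_add (by positivity) (by positivity)]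
      refine ENNReal.ofReal_le_ofReal ?_
      have : 2 * m ≤ a := by
        have h3 : ENNReal.ofReal (2 * m) ≤ Ξ ω := hω
        rw [ha] at h3; exact (ENNReal.ofReal_le_ofReal_iff a.2).1 h3
      nlinarith
    · rw [indicator_of_notMem hω, add_zero]
      refine ENNReal.ofReal_le_ofReal ?_
      nlinarith [sq_nonneg ((a : ℝ) - b)]
  have hint := (lintegral_mono hpt).trans (lintegral_sq_add_sq_le (L := L) hY hQ hG n)
  rw [lintegral_add_left (by fun_prop)] at hint
  have hfin : ∫⁻ ω, 2 * (Ξ ω * 𝒜 ω) ∂P ≠ ⊤ := by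
    refine ((lintegral_mono fun ω => mul_le_mul_right (mul_le_mul' (hΞ ω) (h𝒜 ω)) 2).trans_lt ?_).ne
    rw [lintegral_const, measure_univ, mul_one]
    exact ENNReal.mul_lt_top (by simp) (ENNReal.mul_lt_top (by simp) ENNReal.ofReal_lt_top)
  have h3 := (ENNReal.add_le_add_iff_left hfin).1 hint
  rw [lintegral_indicator_const hE] at h3
  have h4 := h3.trans ((lintegral_sum_lowEvent_le hY hQ hG hL n).trans hLm)
  rw [mul_comm, ← ENNReal.le_div_iff_mul_le (Or.inl (by simp; positivity)) (Or.inl (by simp)),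
    ← ENNReal.ofReal_div_of_pos (by positivity)] at h4
  refine h4.trans (ENNReal.ofReal_le_ofReal (le_of_eq ?_))
  field_simp

/-- The counts increase with `n`, so the exceedance events increase and the bound holds for their
union: no maximal inequality is needed. -/
theorem measure_exists_sum_lowEvent_ge_le (hY : IsSample Y P Q) (hQ : CoxLaw Q β₀ Λ τ)
    (hG : MeasurableSet G) (hL : 0 ≤ L) {m : ℝ} (hm : 0 < m)
    (hLm : ENNReal.ofReal L * Λ G ≤ ENNReal.ofReal m) :
    P {ω | ∃ n, ENNReal.ofReal (2 * m) ≤ ∑ i ∈ Finset.range n, lowEvent β₀ L G i (path Y ω)} ≤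
      ENNReal.ofReal (1 / m) := by
  rw [Set.ofPred_exists, Monotone.measure_iUnion]
  · exact iSup_le fun n => measure_sum_lowEvent_ge_le hY hQ hG hL hm hLm n
  · intro n k hnk ω hω
    exact (show ENNReal.ofReal (2 * m) ≤ _ from hω).trans
      (Finset.sum_le_sum_of_subset (Finset.range_mono hnk))

end

end CoxShape

namespace CoxShape
open Function
variable {p : ℕ} {β₀ : Cov p} {y : ℕ → Obs p}

/-! ### Means of risk sums -/

/-- `E[{T ≥ t} exp (β₀' Z)]`. -/
noncomputable def meanRisk (Q : Measure (Obs p)) (β₀ : Cov p) (t : ℝ) : ℝ :=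
  ∫ o, (if t ≤ time o then Real.exp ⟪β₀, cov o⟫ else 0) ∂Q

section

variable {Q : Measure (Obs p)} {Λ : Measure ℝ} {τ : ℝ}

theorem CoxLaw.integrable_exp (hQ : CoxLaw Q β₀ Λ τ) :
    Integrable (fun o => Real.exp ⟪β₀, cov o⟫) Q := by
  obtain ⟨δ, hδ, h⟩ := hQ.moment
  refine h.mono' (by fun_prop) (ae_of_all _ fun o => ?_)
  rw [Real.norm_of_nonneg (Real.exp_pos _).le]
  exact le_mul_of_one_le_right (Real.exp_pos _).le (Real.one_le_exp (by positivity))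

theorem measurable_risk (β : Cov p) (t : ℝ) :
    Measurable fun o : Obs p => if t ≤ time o then Real.exp ⟪β, cov o⟫ else 0 :=
  Measurable.ite (measurableSet_le (by fun_prop) (by fun_prop)) (by fun_prop) measurable_const

theorem CoxLaw.integrable_risk (hQ : CoxLaw Q β₀ Λ τ) (t : ℝ) :
    Integrable (fun o => if t ≤ time o then Real.exp ⟪β₀, cov o⟫ else 0) Q := by
  refine hQ.integrable_exp.mono' (measurable_risk β₀ t).aestronglyMeasurable
    (ae_of_all _ fun o => ?_)
  split_ifs
  · rw [Real.norm_of_nonneg (Real.exp_pos _).le]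
  · simp [(Real.exp_pos _).le]

theorem CoxLaw.meanRisk_antitone (hQ : CoxLaw Q β₀ Λ τ) : Antitone (meanRisk Q β₀) := fun s t h =>
  integral_mono (hQ.integrable_risk t) (hQ.integrable_risk s) fun o => by
    dsimp only
    split_ifs with h1 h2
    · exact le_rfl
    · exact absurd (h.trans h1) h2
    · positivity
    · exact le_rfl

theorem CoxLaw.meanRisk_pos (hQ : CoxLaw Q β₀ Λ τ) {t : ℝ} (ht : t < τ) : 0 < meanRisk Q β₀ t := by
  refine (integral_pos_iff_support_of_nonneg (fun o => ?_) (hQ.integrable_risk t)).2 ?_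
  · dsimp only; split_ifs <;> simp [(Real.exp_pos _).le]
  · refine (hQ.time_pos t ht).trans_le (measure_mono fun o ho => ?_)
    have : t ≤ time o := ho
    simp [this, (Real.exp_pos _).ne']

variable {Ω : Type*} [MeasurableSpace Ω] {P : Measure Ω} [IsProbabilityMeasure P]
  {Y : ℕ → Ω → Obs p}

theorem tendsto_riskSum_div (hY : IsSample Y P Q) (hQ : CoxLaw Q β₀ Λ τ) (t : ℝ) :
    ∀ᵐ ω ∂P, Tendsto (fun n : ℕ => riskSum n (path Y ω) β₀ t / n) atTop (𝓝 (meanRisk Q β₀ t)) :=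
  hY.tendsto_average (measurable_risk β₀ t) (hQ.integrable_risk t)

theorem tendsto_riskSum_atTop (hY : IsSample Y P Q) (hQ : CoxLaw Q β₀ Λ τ) :
    ∀ᵐ ω ∂P, ∀ t < τ, Tendsto (fun n : ℕ => riskSum n (path Y ω) β₀ t) atTop atTop := by
  have h := ae_all_iff.2 fun k : ℕ => tendsto_riskSum_div hY hQ (τ - 1 / (k + 1))
  filter_upwards [h] with ω hω t ht
  obtain ⟨k, hk⟩ := exists_nat_one_div_lt (sub_pos.2 ht)
  have h1 : Tendsto (fun n : ℕ => riskSum n (path Y ω) β₀ (τ - 1 / (k + 1)) / n * n) atTop atTop :=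
    (hω k).pos_mul_atTop (hQ.meanRisk_pos (sub_lt_self _ (by positivity)))
      tendsto_natCast_atTop_atTop
  refine tendsto_atTop_mono' _ ?_ h1
  filter_upwards [eventually_gt_atTop 0] with n hn
  rw [div_mul_cancel₀ _ (by positivity)]
  exact riskSum_antitone _ _ _ (by linarith)

end

/-! ### Sums of reciprocal risk sums near the end point -/

/-- A cell of the dyadic partition of `[b, τ)` into `2 ^ l` cells. -/
def cell (b τ : ℝ) (l c : ℕ) : Set ℝ := {t | t ∈ Ico b τ ∧ ⌊2 ^ l * ((t - b) / (τ - b))⌋₊ = c}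

theorem measurableSet_cell (b τ : ℝ) (l c : ℕ) : MeasurableSet (cell b τ l c) := by
  have : Measurable fun t : ℝ => ⌊2 ^ l * ((t - b) / (τ - b))⌋₊ := by fun_prop
  exact measurableSet_Ico.inter (this (measurableSet_singleton c))

theorem cell_subset {b τ : ℝ} (hb : b < τ) (l c : ℕ) : cell b τ l c ⊆
    Icc (b + (τ - b) * (c / 2 ^ l)) (b + (τ - b) * ((c + 1) / 2 ^ l)) := by
  rintro t ⟨⟨h1, h2⟩, h3⟩
  have hw : 0 < τ - b := by linarith
  have h4 := (Nat.floor_eq_iff (by have := sub_nonneg.2 h1; positivity)).1 h3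
  have e : t = b + (τ - b) * ((2 ^ l * ((t - b) / (τ - b))) / 2 ^ l) := by
    field_simp; ring
  constructor
  · rw [e]; gcongr
    exact h4.1
  · rw [e]; gcongr
    exact h4.2.le

theorem lt_of_mem_cell {b τ : ℝ} (hb : b < τ) {l c : ℕ} {t : ℝ} (ht : t ∈ cell b τ l c) :
    c < 2 ^ l := by
  obtain ⟨⟨h1, h2⟩, h3⟩ := ht
  have hw : 0 < τ - b := by linarith
  rw [← h3, Nat.floor_lt (by have := sub_nonneg.2 h1; positivity)]
  push_cast
  have : (t - b) / (τ - b) < 1 := (div_lt_one hw).2 (by linarith)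
  exact mul_lt_of_lt_one_right (by positivity) this

/-- If the points in each cell at which an antitone function `S` takes values of size `16 ^ l` are
few, then the sum of `1 / S` over all the points is bounded. -/
theorem sum_inv_le_of_cells {S : ℝ → ℝ} (hS : Antitone S) {b τ K : ℝ} (hb : b < τ) (hK : 0 ≤ K)
    {T : ℕ → ℝ} {I : Finset ℕ} {l₀ : ℕ} (hT : ∀ i ∈ I, T i ∈ Ico b τ)
    (hbig : ∀ i ∈ I, 16 ^ l₀ ≤ S (T i))
    (hcount : ∀ l ≥ l₀, ∀ c < 2 ^ l, ∀ J ⊆ I,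
      (∀ i ∈ J, T i ∈ cell b τ l c ∧ S (T i) ≤ 16 ^ (l + 1)) → (J.card : ℝ) ≤ K * 8 ^ l) :
    ∑ i ∈ I, 1 / S (T i) ≤ 5 * K := by
  classical
  have hw : 0 < τ - b := by linarith
  have hex : ∀ i, ∃ l : ℕ, i ∈ I → (16 : ℝ) ^ l ≤ S (T i) ∧ S (T i) < 16 ^ (l + 1) := fun i => by
    by_cases hi : i ∈ I
    · obtain ⟨l, hl⟩ := exists_nat_pow_near (one_le_pow₀ (by norm_num : (1 : ℝ) ≤ 16) |>.trans
        (hbig i hi)) (by norm_num : (1 : ℝ) < 16)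
      exact ⟨l, fun _ => hl⟩
    · exact ⟨0, fun h => absurd h hi⟩
  choose lev hlev using hex
  -- Its supremum `u l` is where `S` drops below `16 ^ l`; points of level `l` lie in `[u (l + 1), u
  -- l]`. Inserting `b` keeps the set nonempty.
  set U : ℕ → Set ℝ := fun l => insert b {t | t ∈ Icc b τ ∧ 16 ^ l ≤ S t} with hU
  have hUbdd : ∀ l, BddAbove (U l) := fun l => ⟨τ, by
    rintro t (rfl | ht)
    · exact hb.le
    · exact ht.1.2⟩
  set u : ℕ → ℝ := fun l => sSup (U l) with hu
  have hub : ∀ l, b ≤ u l := fun l => le_csSup (hUbdd l) (mem_insert _ _)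
  have huτ : ∀ l, u l ≤ τ := fun l => csSup_le ⟨b, mem_insert _ _⟩ (by
    rintro t (rfl | ht)
    · exact hb.le
    · exact ht.1.2)
  have huanti : ∀ l, u (l + 1) ≤ u l := fun l => csSup_le_csSup (hUbdd l) ⟨b, mem_insert _ _⟩ (by
    rintro t (rfl | ht)
    · exact mem_insert _ _
    · exact mem_insert_of_mem _ ⟨ht.1, (pow_le_pow_right₀ (by norm_num) (Nat.le_succ l)).trans
        ht.2⟩)
  have hTu : ∀ i ∈ I, T i ≤ u (lev i) := fun i hi =>
    le_csSup (hUbdd _) (mem_insert_of_mem _ ⟨⟨(hT i hi).1, (hT i hi).2.le⟩, (hlev i hi).1⟩)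
  have huT : ∀ i ∈ I, u (lev i + 1) ≤ T i := fun i hi => csSup_le ⟨b, mem_insert _ _⟩ (by
    rintro t (rfl | ht)
    · exact (hT i hi).1
    · by_contra! hlt
      exact absurd ((ht.2.trans (hS hlt.le)).trans_lt (hlev i hi).2) (lt_irrefl _))
  -- An interval meets at most its length in units of the cell width, plus two, cells. Divided by
  -- `16 ^ l`, the first part telescopes to `K` over the levels and the second is a geometric series
  -- with sum at most `4 * K`, hence the factor five.
  have hcard : ∀ l, (((I.filter fun i => lev i = l).card : ℕ) : ℝ) ≤
      (2 ^ l * ((u l - u (l + 1)) / (τ - b)) + 2) * (K * 8 ^ l) := fun l => by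
    set A := 2 ^ l * ((u l - b) / (τ - b)) with hA
    set A' := 2 ^ l * ((u (l + 1) - b) / (τ - b)) with hA'
    have hA0 : 0 ≤ A := by have := sub_nonneg.2 (hub l); positivity
    have hA'0 : 0 ≤ A' := by have := sub_nonneg.2 (hub (l + 1)); positivity
    have hAA : A - A' = 2 ^ l * ((u l - u (l + 1)) / (τ - b)) := by rw [hA, hA']; ring
    have hAA0 : 0 ≤ A - A' := by
      rw [hAA]; have := sub_nonneg.2 (huanti l); positivity
    have hmaps : ∀ i ∈ I.filter (fun i => lev i = l),
        ⌊2 ^ l * ((T i - b) / (τ - b))⌋₊ ∈ Finset.Icc ⌊A'⌋₊ ⌊A⌋₊ := by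
      intro i hi
      obtain ⟨hiI, rfl⟩ := Finset.mem_filter.1 hi
      rw [Finset.mem_Icc]
      constructor <;> apply Nat.floor_le_floor
      · rw [hA']; gcongr; exact huT i hiI
      · rw [hA]; gcongr; exact hTu i hiI
    rw [Finset.card_eq_sum_card_fiberwise hmaps]
    push_cast
    have hfib : ∀ c ∈ Finset.Icc ⌊A'⌋₊ ⌊A⌋₊, ((((I.filter fun i => lev i = l).filter fun i =>
        ⌊2 ^ l * ((T i - b) / (τ - b))⌋₊ = c).card : ℕ) : ℝ) ≤ K * 8 ^ l := by
      intro c _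
      rcases Finset.eq_empty_or_nonempty ((I.filter fun i => lev i = l).filter fun i =>
        ⌊2 ^ l * ((T i - b) / (τ - b))⌋₊ = c) with h0 | ⟨i, hi⟩
      · rw [h0]; simp; positivity
      · have hmem : ∀ i ∈ ((I.filter fun i => lev i = l).filter fun i =>
            ⌊2 ^ l * ((T i - b) / (τ - b))⌋₊ = c), i ∈ I ∧ lev i = l ∧ T i ∈ cell b τ l c := by
          intro i hi
          simp only [Finset.mem_filter] at hi
          exact ⟨hi.1.1, hi.1.2, hT i hi.1.1, hi.2⟩
        have hl0 : l₀ ≤ l := by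
          obtain ⟨h1, h2, -⟩ := hmem i hi
          have := (hbig i h1).trans_lt (hlev i h1).2
          rw [h2] at this
          exact Nat.lt_succ_iff.1 ((pow_lt_pow_iff_right₀ (by norm_num)).1 this)
        refine hcount l hl0 c (lt_of_mem_cell hb (hmem i hi).2.2) _
          ((Finset.filter_subset _ _).trans (Finset.filter_subset _ _)) fun j hj => ?_
        obtain ⟨h1, h2, h3⟩ := hmem j hj
        exact ⟨h3, h2 ▸ (hlev j h1).2.le⟩
    refine (Finset.sum_le_card_nsmul _ _ _ hfib).trans ?_
    rw [nsmul_eq_mul]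
    refine mul_le_mul_of_nonneg_right ?_ (by positivity)
    rw [Nat.card_Icc, ← hAA]
    have h1 := Nat.floor_le hA0
    have h2 := Nat.lt_floor_add_one A'
    rcases le_total ⌊A'⌋₊ (⌊A⌋₊ + 1) with h | h
    · rw [Nat.cast_sub h]; push_cast; linarith
    · rw [Nat.sub_eq_zero_of_le h]; push_cast; linarith
  set N := I.sup lev + 1
  have hN : ∀ i ∈ I, lev i ∈ Finset.range N := fun i hi =>
    Finset.mem_range.2 (Nat.lt_succ_of_le (Finset.le_sup hi))
  calc ∑ i ∈ I, 1 / S (T i) ≤ ∑ i ∈ I, 1 / (16 : ℝ) ^ lev i :=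
        Finset.sum_le_sum fun i hi => one_div_le_one_div_of_le (by positivity) (hlev i hi).1
    _ = ∑ l ∈ Finset.range N, ∑ i ∈ I.filter (fun i => lev i = l), 1 / (16 : ℝ) ^ lev i :=
        (Finset.sum_fiberwise_of_maps_to hN _).symm
    _ = ∑ l ∈ Finset.range N, ((I.filter fun i => lev i = l).card : ℝ) * (1 / (16 : ℝ) ^ l) := by
        refine Finset.sum_congr rfl fun l _ => ?_
        rw [← nsmul_eq_mul, ← Finset.sum_const]
        exact Finset.sum_congr rfl fun i hi => by rw [(Finset.mem_filter.1 hi).2]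
    _ ≤ ∑ l ∈ Finset.range N, ((K / (τ - b)) * (u l - u (l + 1)) + 2 * K * (1 / 2) ^ l) := by
        refine Finset.sum_le_sum fun l _ => ?_
        refine (mul_le_mul_of_nonneg_right (hcard l) (by positivity)).trans_eq ?_
        have e1 : (8 : ℝ) ^ l * (1 / 16 ^ l) = (1 / 2) ^ l := by
          rw [← one_div_pow, ← mul_pow]; norm_num
        have e2 : (2 : ℝ) ^ l * (1 / 2) ^ l = 1 := by rw [← mul_pow]; norm_num
        calc _ = K * (u l - u (l + 1)) / (τ - b) * (2 ^ l * ((8 : ℝ) ^ l * (1 / 16 ^ l))) +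
              2 * K * (8 ^ l * (1 / 16 ^ l)) := by ring
          _ = _ := by rw [e1, e2]; ring
    _ = (K / (τ - b)) * (u 0 - u N) + 2 * K * ∑ l ∈ Finset.range N, (1 / 2 : ℝ) ^ l := by
        rw [Finset.sum_add_distrib, ← Finset.mul_sum, ← Finset.mul_sum, Finset.sum_range_sub']
    _ ≤ K / (τ - b) * (τ - b) + 2 * K * 2 := by
        gcongr
        · exact huτ 0
        · exact hub N
        · exact sum_geometric_two_le N
    _ = 5 * K := by rw [div_mul_cancel₀ _ hw.ne']; ring

section

variable {Ω : Type*} [MeasurableSpace Ω] {P : Measure Ω} {Q : Measure (Obs p)}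
  {Y : ℕ → Ω → Obs p} [IsProbabilityMeasure P] {Λ : Measure ℝ} [SFinite Λ] {τ : ℝ}

theorem card_le_sum_lowEvent {L : ℝ} {G : Set ℝ} {n : ℕ} {J : Finset ℕ} (hJ : J ⊆ Finset.range n)
    (h : ∀ i ∈ J, ind (y i) = 1 ∧ time (y i) ∈ G ∧ riskSum (i + 1) y β₀ (time (y i)) ≤ L) :
    (J.card : ENNReal) ≤ ∑ i ∈ Finset.range n, lowEvent β₀ L G i y := by
  refine le_trans ?_ (Finset.sum_le_sum_of_subset hJ)
  rw [Finset.card_eq_sum_ones]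
  push_cast
  refine Finset.sum_le_sum fun i hi => ?_
  obtain ⟨h1, h2⟩ := h i hi
  rw [lowEvent, if_pos h1, lowRisk, if_pos h2]

/-- The increment of the Nelson–Aalen type estimator over `[b, τ)` is eventually bounded by a
multiple of the length of the interval. -/
theorem eventually_sum_inv_riskSum_le (hY : IsSample Y P Q) (hQ : CoxLaw Q β₀ Λ τ) {b B : ℝ}
    (hb : b < τ) (hB : 0 < B)
    (hΛ : ∀ a c, b ≤ a → a ≤ c → c ≤ τ → Λ (Icc a c) ≤ ENNReal.ofReal (B * (c - a))) :
    ∀ᵐ ω ∂P, ∀ᶠ n in atTop, ∑ i ∈ Finset.range n,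
      (if ind (path Y ω i) = 1 ∧ b ≤ time (path Y ω i) then
        1 / riskSum n (path Y ω) β₀ (time (path Y ω i)) else 0) ≤ 160 * (B * (τ - b)) := by
  have hw : 0 < τ - b := by linarith
  set η := B * (τ - b) with hη
  have hη0 : 0 < η := by positivity
  set bad : ℕ → Set Ω := fun l => ⋃ c ∈ Finset.range (2 ^ l), {ω | ∃ n,
    ENNReal.ofReal (2 * (16 * 8 ^ l * η)) ≤
      ∑ i ∈ Finset.range n, lowEvent β₀ (16 ^ (l + 1)) (cell b τ l c) i (path Y ω)} with hbad
  -- A cell has length `(τ - b) / 2 ^ l`, so with `L = 16 ^ (l + 1)` the compensator is at most `m =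
  -- 16 * 8 ^ l * η`. The `2 ^ l` cells together have probability at most `2 ^ l / m`, which is
  -- summable over `l`.
  have hP : ∀ l, P (bad l) ≤ ENNReal.ofReal (1 / (16 * η) * (1 / 4) ^ l) := fun l => by
    refine (measure_biUnion_finset_le _ _).trans ?_
    refine (Finset.sum_le_card_nsmul _ _ (ENNReal.ofReal (1 / (16 * 8 ^ l * η))) fun c hc =>
        ?_).trans ?_
    · refine measure_exists_sum_lowEvent_ge_le hY hQ (measurableSet_cell b τ l c) (by positivity)
        (by positivity) ?_
      have hc' : ((c : ℝ) + 1) / 2 ^ l ≤ 1 := by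
        rw [div_le_one (by positivity)]
        exact_mod_cast Finset.mem_range.1 hc
      have h1 := hΛ (b + (τ - b) * (c / 2 ^ l)) (b + (τ - b) * ((c + 1) / 2 ^ l))
        (le_add_of_nonneg_right (by positivity)) (by gcongr; linarith)
        (by nlinarith)
      refine (mul_le_mul_right ((measure_mono (cell_subset hb l c)).trans h1) _).trans ?_
      rw [← ENNReal.ofReal_mul (by positivity)]
      refine ENNReal.ofReal_le_ofReal (le_of_eq ?_)
      have e : (16 : ℝ) ^ (l + 1) / 2 ^ l = 16 * 8 ^ l := by
        rw [pow_succ, show (16 : ℝ) = 8 * 2 by norm_num, mul_pow]; field_simp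
      calc _ = (16 : ℝ) ^ (l + 1) / 2 ^ l * (B * (τ - b)) := by ring
        _ = _ := by rw [e]
    · rw [Finset.card_range, nsmul_eq_mul]
      push_cast
      rw [show (2 : ENNReal) ^ l = ENNReal.ofReal (2 ^ l) by
        rw [ENNReal.ofReal_pow (by norm_num)]; simp, ← ENNReal.ofReal_mul (by positivity)]
      refine ENNReal.ofReal_le_ofReal (le_of_eq ?_)
      have e : (8 : ℝ) ^ l = 2 ^ l * 4 ^ l := by rw [← mul_pow]; norm_num
      rw [e, one_div_pow]
      field_simp
  have hsum : ∑' l, P (bad l) ≠ ⊤ := by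
    refine ne_top_of_le_ne_top ?_ (ENNReal.tsum_le_tsum hP)
    have hs : Summable fun l : ℕ => 1 / (16 * η) * (1 / 4 : ℝ) ^ l :=
      (summable_geometric_of_lt_one (by norm_num) (by norm_num)).mul_left _
    exact hs.tsum_ofReal_ne_top
  filter_upwards [ae_eventually_notMem hsum, tendsto_riskSum_atTop hY hQ,
    hY.ae_forall hQ.time_mem] with ω hω hinf hmem
  set y := path Y ω
  obtain ⟨l₀, hl₀⟩ := eventually_atTop.1 hω
  have hgood : ∀ l ≥ l₀, ∀ c < 2 ^ l, ∀ n, ∑ i ∈ Finset.range n,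
      lowEvent β₀ (16 ^ (l + 1)) (cell b τ l c) i y < ENNReal.ofReal (2 * (16 * 8 ^ l * η)) := by
    intro l hl c hc n
    by_contra! hcon
    exact hl₀ l hl (mem_biUnion (Finset.mem_coe.2 (Finset.mem_range.2 hc)) ⟨n, hcon⟩)
  -- The total count at level `l₀` is finite along the whole sequence, so observations of large
  -- index produce no event with a risk sum this small.
  have hzero : ∀ c < 2 ^ l₀, ∀ᶠ i in atTop,
      lowEvent β₀ (16 ^ (l₀ + 1)) (cell b τ l₀ c) i y < 1 := by
    intro c hc
    have : ∑' i, lowEvent β₀ (16 ^ (l₀ + 1)) (cell b τ l₀ c) i y ≠ ⊤ := by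
      rw [ENNReal.tsum_eq_iSup_nat]
      exact ((iSup_le fun n => (hgood l₀ le_rfl c hc n).le).trans_lt ENNReal.ofReal_lt_top).ne
    have h := ENNReal.tendsto_cofinite_zero_of_tsum_ne_top this
    rw [Nat.cofinite_eq_atTop] at h
    exact h.eventually_lt_const zero_lt_one
  have hzero' : ∀ᶠ i in atTop, ∀ c ∈ Finset.range (2 ^ l₀),
      lowEvent β₀ (16 ^ (l₀ + 1)) (cell b τ l₀ c) i y < 1 :=
    (Finset.eventually_all _).2 fun c hc => hzero c (Finset.mem_range.1 hc)
  obtain ⟨N, hN⟩ := eventually_atTop.1 hzero'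
  -- The finitely many remaining observations have fixed times below `τ`, where the risk sums
  -- diverge as `n` grows.
  have hev : ∀ᶠ n in atTop, ∀ i ∈ Finset.range N, 16 ^ l₀ ≤ riskSum n y β₀ (time (y i)) :=
    (Finset.eventually_all _).2 fun i _ => (hinf _ (hmem i).2).eventually_ge_atTop _
  filter_upwards [hev] with n hn
  rw [← Finset.sum_filter]
  refine (sum_inv_le_of_cells (riskSum_antitone n y β₀) (T := fun i => time (y i)) (l₀ := l₀)
    hb (K := 32 * η) (by positivity) ?_ ?_ ?_).trans_eq (by ring)
  · intro i hi
    exact ⟨(Finset.mem_filter.1 hi).2.2, (hmem i).2⟩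
  · intro i hi
    obtain ⟨hin, hind, hbi⟩ := Finset.mem_filter.1 hi
    rcases lt_or_ge i N with h | h
    · exact hn i (Finset.mem_range.2 h)
    · by_contra! hlt
      have hcell : time (y i) ∈ cell b τ l₀ ⌊2 ^ l₀ * ((time (y i) - b) / (τ - b))⌋₊ :=
        ⟨⟨hbi, (hmem i).2⟩, rfl⟩
      have h1 := hN i h _ (Finset.mem_range.2 (lt_of_mem_cell hb hcell))
      have h2 : riskSum (i + 1) y β₀ (time (y i)) ≤ 16 ^ (l₀ + 1) :=
        ((riskSum_mono (Finset.mem_range.1 hin) _ _ _).trans hlt.le).trans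
          (pow_le_pow_right₀ (by norm_num) (Nat.le_succ _))
      rw [lowEvent, if_pos hind, lowRisk, if_pos ⟨hcell, h2⟩] at h1
      exact lt_irrefl _ h1
  · intro l hl c hc J hJ hJ2
    have h1 := card_le_sum_lowEvent (n := n) (y := y) (β₀ := β₀) (L := 16 ^ (l + 1))
      (G := cell b τ l c) (hJ.trans (Finset.filter_subset _ _)) fun i hi =>
        ⟨(Finset.mem_filter.1 (hJ hi)).2.1, (hJ2 i hi).1, (riskSum_mono
          (Finset.mem_range.1 (Finset.mem_filter.1 (hJ hi)).1) _ _ _).trans (hJ2 i hi).2⟩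
    have h2 := h1.trans (hgood l hl c hc n).le
    rw [← ENNReal.ofReal_natCast, ENNReal.ofReal_le_ofReal_iff (by positivity)] at h2
    linarith

end

end CoxShape

namespace CoxShape
open Function
variable {p : ℕ} {β₀ : Cov p} {y : ℕ → Obs p}

/-! ### The partial likelihood ratio has expectation at most one -/

/-- The telescoping expansion of `∏ ρ - 1` into increments `(ρ i - 1)` times the product over
earlier times, free of subtraction. Distinct times make the order strict. -/
theorem prod_add_sum_prod_lt {ρ : ℕ → ENNReal} {T : ℕ → ℝ} (I : Finset ℕ)
    (hT : Set.InjOn T (I : Set ℕ)) :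
    ∏ i ∈ I, ρ i + ∑ i ∈ I, ∏ j ∈ I with T j < T i, ρ j =
      1 + ∑ i ∈ I, ρ i * ∏ j ∈ I with T j < T i, ρ j := by
  induction I using Finset.induction_on_max_value T with
  | empty => simp
  | insert a s ha hmax ih =>
    have hlt : ∀ x ∈ s, T x < T a := fun x hx => lt_of_le_of_ne (hmax x hx) fun h =>
      ha (hT (Finset.mem_coe.2 (Finset.mem_insert_of_mem hx))
        (Finset.mem_coe.2 (Finset.mem_insert_self a s)) h ▸ hx)
    have e1 : (insert a s).filter (fun j => T j < T a) = s := by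
      ext x
      simp only [Finset.mem_filter, Finset.mem_insert]
      exact ⟨fun h => h.1.resolve_left (by rintro rfl; exact lt_irrefl _ h.2),
        fun h => ⟨Or.inr h, hlt x h⟩⟩
    have e2 : ∀ i ∈ s, (insert a s).filter (fun j => T j < T i) = s.filter (fun j => T j < T i) :=
        by
      intro i hi
      rw [Finset.filter_insert, if_neg (not_lt.2 (hmax i hi))]
    have ih' := ih (hT.mono (by simp))
    have e3 : ∑ i ∈ s, ∏ j ∈ insert a s with T j < T i, ρ j =
        ∑ i ∈ s, ∏ j ∈ s with T j < T i, ρ j := Finset.sum_congr rfl fun i hi => by rw [e2 i hi]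
    have e4 : ∑ i ∈ s, ρ i * ∏ j ∈ insert a s with T j < T i, ρ j =
        ∑ i ∈ s, ρ i * ∏ j ∈ s with T j < T i, ρ j :=
      Finset.sum_congr rfl fun i hi => by rw [e2 i hi]
    rw [Finset.prod_insert ha, Finset.sum_insert ha, Finset.sum_insert ha, e1, e3, e4, ih']
    ring

/-- The factor that an event at time `t` with covariate `z` contributes to the ratio of the
partial likelihoods at `β₀ + γ` and at `β₀`. -/
noncomputable def lrTerm (n : ℕ) (β₀ γ : Cov p) (t : ℝ) (z : Cov p) (y : ℕ → Obs p) : ENNReal :=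
  ENNReal.ofReal (Real.exp ⟪γ, z⟫ * (riskSum n y β₀ t / riskSum n y (β₀ + γ) t))

/-- The part of the partial likelihood ratio that stems from the events before `t`. -/
noncomputable def lrBefore (n : ℕ) (β₀ γ : Cov p) (t : ℝ) (y : ℕ → Obs p) : ENNReal :=
  ∏ j ∈ Finset.range n, if ind (y j) = 1 ∧ time (y j) < t then
    lrTerm n β₀ γ (time (y j)) (cov (y j)) y else 1

/-- The ratio of the partial likelihoods at `β₀ + γ` and at `β₀`. -/
noncomputable def plRatio (n : ℕ) (β₀ γ : Cov p) (y : ℕ → Obs p) : ENNReal :=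
  ∏ j ∈ Finset.range n, if ind (y j) = 1 then lrTerm n β₀ γ (time (y j)) (cov (y j)) y else 1

/-- The indicator that the first `n` covariates are bounded by `M`. -/
noncomputable def covBound (n : ℕ) (M : ℝ) (y : ℕ → Obs p) : ENNReal :=
  ∏ j ∈ Finset.range n, if ‖cov (y j)‖ ≤ M then 1 else 0

theorem measurable_covBound (n : ℕ) (M : ℝ) :
    Measurable (covBound n M : (ℕ → Obs p) → ENNReal) :=
  Finset.measurable_prod _ fun i _ => Measurable.ite
    (measurableSet_le (by fun_prop) measurable_const) measurable_const measurable_const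

theorem covBound_le_one (n : ℕ) (M : ℝ) (y : ℕ → Obs p) : covBound n M y ≤ 1 :=
  Finset.prod_le_one' fun i _ => by split_ifs <;> simp

theorem covBound_eq_zero_or (n : ℕ) (M : ℝ) (y : ℕ → Obs p) :
    covBound n M y = 0 ∨ ∀ i < n, ‖cov (y i)‖ ≤ M := by
  by_cases h : ∀ i < n, ‖cov (y i)‖ ≤ M
  · exact Or.inr h
  · push Not at h
    obtain ⟨i, hi, h⟩ := h
    exact Or.inl (Finset.prod_eq_zero (Finset.mem_range.2 hi) (if_neg (not_le.2 h)))

theorem measurable_lrTerm {α : Type*} [MeasurableSpace α] (n : ℕ) (β₀ γ : Cov p) {t : α → ℝ}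
    {z : α → Cov p} {Y : α → ℕ → Obs p} (ht : Measurable t) (hz : Measurable z)
    (hY : Measurable Y) : Measurable fun a => lrTerm n β₀ γ (t a) (z a) (Y a) := by
  have h : ∀ β : Cov p, Measurable fun a => riskSum n (Y a) β (t a) :=
    fun β => (measurable_riskSum n β).comp (ht.prodMk hY)
  unfold lrTerm
  exact (Measurable.mul (by fun_prop) ((h _).div (h _))).ennreal_ofReal

theorem measurable_lrTerm_obs (n : ℕ) (β₀ γ : Cov p) (j : ℕ) :
    Measurable fun y : ℕ → Obs p => lrTerm n β₀ γ (time (y j)) (cov (y j)) y :=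
  measurable_lrTerm n β₀ γ (by fun_prop) (by fun_prop) measurable_id

theorem measurable_lrBefore (n : ℕ) (β₀ γ : Cov p) : Measurable (uncurry (lrBefore n β₀ γ)) := by
  unfold lrBefore uncurry
  refine Finset.measurable_prod _ fun j _ => Measurable.ite ?_
    ((measurable_lrTerm_obs n β₀ γ j).comp measurable_snd) measurable_const
  have h1 : Measurable fun q : ℝ × (ℕ → Obs p) => ind (q.2 j) := by fun_prop
  have h2 : Measurable fun q : ℝ × (ℕ → Obs p) => time (q.2 j) := by fun_prop
  exact (measurableSet_eq_fun h1 measurable_const).inter (measurableSet_lt h2 measurable_fst)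

theorem measurable_plRatio (n : ℕ) (β₀ γ : Cov p) : Measurable (plRatio n β₀ γ) :=
  Finset.measurable_prod _ fun j _ => Measurable.ite
    (measurableSet_eq_fun (by fun_prop) measurable_const) (measurable_lrTerm_obs n β₀ γ j)
    measurable_const

theorem lrTerm_update (n i : ℕ) (γ : Cov p) {t : ℝ} (z : Cov p) {o o' : Obs p}
    (hc : cov o = cov o') (ho : t ≤ time o) (ho' : t ≤ time o') :
    lrTerm n β₀ γ t z (update y i o) = lrTerm n β₀ γ t z (update y i o') := by
  unfold lrTerm
  rw [riskSum_update n i y _ hc ho ho', riskSum_update n i y _ hc ho ho']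

theorem lrBefore_update (n i : ℕ) (γ : Cov p) {t : ℝ} {o o' : Obs p}
    (hc : cov o = cov o') (ho : t ≤ time o) (ho' : t ≤ time o') :
    lrBefore n β₀ γ t (update y i o) = lrBefore n β₀ γ t (update y i o') := by
  refine Finset.prod_congr rfl fun j _ => ?_
  rcases eq_or_ne j i with rfl | hj
  · simp only [update_self, not_lt.2 ho, not_lt.2 ho', and_false, if_false]
  · rw [update_of_ne hj, update_of_ne hj]
    by_cases h : ind (y j) = 1 ∧ time (y j) < t
    · rw [if_pos h, if_pos h, lrTerm_update n i γ _ hc (h.2.le.trans ho) (h.2.le.trans ho')]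
    · rw [if_neg h, if_neg h]

theorem covBound_update (n i : ℕ) (M : ℝ) {o o' : Obs p} (hc : cov o = cov o') :
    covBound n M (update y i o) = covBound n M (update y i o') := by
  refine Finset.prod_congr rfl fun j _ => ?_
  rcases eq_or_ne j i with rfl | hj
  · simp only [update_self, hc]
  · rw [update_of_ne hj, update_of_ne hj]

theorem riskSum_add (n : ℕ) (y : ℕ → Obs p) (β γ : Cov p) (t : ℝ) :
    riskSum n y (β + γ) t = ∑ j ∈ Finset.range n,
      (if t ≤ time (y j) then Real.exp ⟪β, cov (y j)⟫ else 0) * Real.exp ⟪γ, cov (y j)⟫ := by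
  refine Finset.sum_congr rfl fun j _ => ?_
  split_ifs
  · rw [inner_add_left, Real.exp_add]
  · rw [zero_mul]

/-- Averaged over the individuals at risk with weights `exp (β₀' Z)`, the factor of an event at `t`
equals one. This makes the likelihood ratio a martingale in time. -/
theorem sum_mul_lrTerm (n : ℕ) (y : ℕ → Obs p) (β₀ γ : Cov p) (t : ℝ) :
    ∑ i ∈ Finset.range n, (if t ≤ time (y i) then
      ENNReal.ofReal (Real.exp ⟪β₀, cov (y i)⟫) * lrTerm n β₀ γ t (cov (y i)) y else 0) =
    ∑ i ∈ Finset.range n, (if t ≤ time (y i) then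
      ENNReal.ofReal (Real.exp ⟪β₀, cov (y i)⟫) else 0) := by
  have hq : 0 ≤ riskSum n y β₀ t / riskSum n y (β₀ + γ) t :=
    div_nonneg (riskSum_nonneg _ _ _ _) (riskSum_nonneg _ _ _ _)
  have e1 : ∑ i ∈ Finset.range n, (if t ≤ time (y i) then
      ENNReal.ofReal (Real.exp ⟪β₀, cov (y i)⟫) * lrTerm n β₀ γ t (cov (y i)) y else 0) =
      ENNReal.ofReal (riskSum n y (β₀ + γ) t * (riskSum n y β₀ t / riskSum n y (β₀ + γ) t)) := by
    rw [riskSum_add, Finset.sum_mul, ENNReal.ofReal_sum_of_nonneg]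
    · refine Finset.sum_congr rfl fun i _ => ?_
      split_ifs
      · rw [lrTerm, ← ENNReal.ofReal_mul (Real.exp_pos _).le, mul_assoc, riskSum_add]
      · simp
    · intro i _
      rw [← riskSum_add]
      split_ifs <;> positivity
  have e2 : ∑ i ∈ Finset.range n, (if t ≤ time (y i) then
      ENNReal.ofReal (Real.exp ⟪β₀, cov (y i)⟫) else 0) = ENNReal.ofReal (riskSum n y β₀ t) := by
    rw [riskSum, ENNReal.ofReal_sum_of_nonneg fun i _ => by split_ifs <;> positivity]
    refine Finset.sum_congr rfl fun i _ => ?_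
    split_ifs <;> simp
  rw [e1, e2]
  congr 1
  by_cases h : ∃ i < n, t ≤ time (y i)
  · obtain ⟨i, hi, ht⟩ := h
    rw [mul_div_cancel₀ _ (riskSum_pos hi y _ ht).ne']
  · push Not at h
    have h0 : riskSum n y β₀ t = 0 := Finset.sum_eq_zero fun i hi =>
      if_neg (not_le.2 (h i (Finset.mem_range.1 hi)))
    rw [h0]; simp

theorem plRatio_add_sum (n : ℕ) (γ : Cov p)
    (hT : Set.InjOn (fun i => time (y i)) (Finset.range n : Set ℕ)) :
    plRatio n β₀ γ y + ∑ i ∈ Finset.range n,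
        (if ind (y i) = 1 then lrBefore n β₀ γ (time (y i)) y else 0) =
      1 + ∑ i ∈ Finset.range n, (if ind (y i) = 1 then
        lrTerm n β₀ γ (time (y i)) (cov (y i)) y * lrBefore n β₀ γ (time (y i)) y else 0) := by
  classical
  have h := prod_add_sum_prod_lt (ρ := fun j => lrTerm n β₀ γ (time (y j)) (cov (y j)) y)
    (T := fun i => time (y i)) ((Finset.range n).filter fun i => ind (y i) = 1)
    (hT.mono (Finset.coe_subset.2 (Finset.filter_subset _ _)))
  have e : ∀ t, lrBefore n β₀ γ t y = ∏ j ∈ (Finset.range n).filter (fun i => ind (y i) = 1) with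
      time (y j) < t, lrTerm n β₀ γ (time (y j)) (cov (y j)) y := fun t => by
    rw [lrBefore, Finset.filter_filter, Finset.prod_filter]
  simp only [e]
  rw [plRatio, ← Finset.prod_filter, ← Finset.sum_filter, ← Finset.sum_filter]
  exact h

/-- Needed only for finiteness: with bounded covariates the expectations can be cancelled. -/
theorem lrTerm_le (n : ℕ) {γ : Cov p} {M t : ℝ} {z : Cov p} (hz : ‖z‖ ≤ M)
    (hM : ∀ i < n, ‖cov (y i)‖ ≤ M) :
    lrTerm n β₀ γ t z y ≤ ENNReal.ofReal (Real.exp (‖γ‖ * M) * Real.exp (‖γ‖ * M)) := by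
  have hin : ∀ z : Cov p, ‖z‖ ≤ M → |⟪γ, z⟫| ≤ ‖γ‖ * M := fun z hz =>
    (abs_real_inner_le_norm γ z).trans (by gcongr)
  refine ENNReal.ofReal_le_ofReal ?_
  refine mul_le_mul (Real.exp_le_exp.2 ((le_abs_self _).trans (hin z hz))) ?_
    (div_nonneg (riskSum_nonneg _ _ _ _) (riskSum_nonneg _ _ _ _)) (Real.exp_pos _).le
  · refine div_le_of_le_mul₀ (riskSum_nonneg _ _ _ _) (Real.exp_pos _).le ?_
    rw [riskSum_add, Finset.mul_sum]
    refine Finset.sum_le_sum fun i hi => ?_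
    have h1 := (neg_abs_le _).trans' (neg_le_neg (hin _ (hM i (Finset.mem_range.1 hi))))
    have h2 : 1 ≤ Real.exp (‖γ‖ * M) * Real.exp ⟪γ, cov (y i)⟫ := by
      rw [← Real.exp_add]; exact Real.one_le_exp (by linarith)
    split_ifs
    · have := Real.exp_pos ⟪β₀, cov (y i)⟫
      nlinarith
    · simp

section

variable {Ω : Type*} [MeasurableSpace Ω] {P : Measure Ω} {Q : Measure (Obs p)}
  {Y : ℕ → Ω → Obs p} [IsProbabilityMeasure P] {Λ : Measure ℝ} [SFinite Λ] {τ : ℝ}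

/-- Resampling observation `i` with observation `j` fixed, a tie means hitting a given point, which
has probability zero. -/
theorem ae_injective_time (hY : IsSample Y P Q) (hQ : CoxLaw Q β₀ Λ τ) :
    ∀ᵐ ω ∂P, Injective fun i => time (path Y ω i) := by
  have h : ∀ i j : ℕ, i ≠ j → ∀ᵐ ω ∂P, time (path Y ω i) ≠ time (path Y ω j) := by
    intro i j hij
    have hm : Measurable fun y : ℕ → Obs p =>
        ({y : ℕ → Obs p | time (y i) = time (y j)}.indicator 1 y : ENNReal) :=
      measurable_one.indicator (measurableSet_eq_fun (by fun_prop) (by fun_prop))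
    have h1 := hY.lintegral_update i hm
    have h2 : ∀ y : ℕ → Obs p, ∫⁻ o, ({y : ℕ → Obs p | time (y i) = time (y j)}.indicator 1
        (update y i o) : ENNReal) ∂Q = 0 := fun y => by
      have : ∀ o, ({y : ℕ → Obs p | time (y i) = time (y j)}.indicator 1 (update y i o) : ENNReal) =
          {o : Obs p | time o = time (y j)}.indicator 1 o := fun o => by
        simp only [indicator, mem_ofPred_eq, update_self, update_of_ne hij.symm]
        rfl
      simp only [this]
      rw [lintegral_indicator_one (measurableSet_eq_fun (by fun_prop) measurable_const)]
      exact hQ.time_atom _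
    simp only [h2, lintegral_zero] at h1
    have h3 := (lintegral_eq_zero_iff (hm.comp hY.measurable_path)).1 h1
    filter_upwards [h3] with ω hω heq
    have : ({y : ℕ → Obs p | time (y i) = time (y j)}.indicator 1 (path Y ω) : ENNReal) = 0 := hω
    rw [indicator_of_mem (show path Y ω ∈ {y : ℕ → Obs p | time (y i) = time (y j)} from heq)]
          at this
    exact one_ne_zero this
  have h2 := ae_all_iff.2 fun i => ae_all_iff.2 fun j => ae_all_iff.2 fun hij => h i j hij
  filter_upwards [h2] with ω hω i j hij
  by_contra hne
  exact hω i j hne hij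

theorem IsSample.sum_campbell (hY : IsSample Y P Q) (hQ : CoxLaw Q β₀ Λ τ) (n : ℕ)
    {H : ℕ → ℝ → (ℕ → Obs p) → ENNReal} (hH : ∀ i, Measurable (uncurry (H i)))
    (hpred : ∀ i t y o o', cov o = cov o' → t ≤ time o → t ≤ time o' →
      H i t (update y i o) = H i t (update y i o')) :
    ∫⁻ ω, ∑ i ∈ Finset.range n,
        (if ind (path Y ω i) = 1 then H i (time (path Y ω i)) (path Y ω) else 0) ∂P =
      ∫⁻ ω, ∫⁻ t, ∑ i ∈ Finset.range n, (if t ≤ time (path Y ω i) then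
        ENNReal.ofReal (Real.exp ⟪β₀, cov (path Y ω i)⟫) * H i t (path Y ω) else 0) ∂Λ ∂P := by
  have m1 : ∀ i, Measurable fun y : ℕ → Obs p =>
      if ind (y i) = 1 then H i (time (y i)) y else 0 := fun i => by
    refine Measurable.ite (measurableSet_eq_fun (by fun_prop) measurable_const) ?_ measurable_const
    exact (hH i).comp (Measurable.prodMk (by fun_prop) measurable_id)
  have m2 : ∀ i, Measurable fun q : (ℕ → Obs p) × ℝ => if q.2 ≤ time (q.1 i) then
      ENNReal.ofReal (Real.exp ⟪β₀, cov (q.1 i)⟫) * H i q.2 q.1 else 0 := fun i => by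
    refine Measurable.ite (measurableSet_le (by fun_prop) (by fun_prop)) ?_ measurable_const
    refine Measurable.mul (by fun_prop) ((hH i).comp (measurable_snd.prodMk measurable_fst))
  have m1' : ∀ i, Measurable fun ω =>
      if ind (path Y ω i) = 1 then H i (time (path Y ω i)) (path Y ω) else 0 :=
    fun i => (m1 i).comp hY.measurable_path
  have m2' : ∀ i ω, Measurable fun t : ℝ => if t ≤ time (path Y ω i) then
      ENNReal.ofReal (Real.exp ⟪β₀, cov (path Y ω i)⟫) * H i t (path Y ω) else 0 :=
    fun i ω => (m2 i).comp (measurable_const.prodMk measurable_id)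
  have m3 : ∀ i, Measurable fun ω => ∫⁻ t, (if t ≤ time (path Y ω i) then
      ENNReal.ofReal (Real.exp ⟪β₀, cov (path Y ω i)⟫) * H i t (path Y ω) else 0) ∂Λ :=
    fun i => (m2 i).lintegral_prod_right'.comp hY.measurable_path
  rw [lintegral_finsetSum _ fun i _ => m1' i,
    Finset.sum_congr rfl fun i _ => hY.campbell hQ i (hH i) (hpred i),
    ← lintegral_finsetSum _ fun i _ => m3 i]
  exact lintegral_congr fun ω => (lintegral_finsetSum _ fun i _ => m2' i ω).symm

/-- In the telescoping identity the two sums over events have the same compensator, by Campbell's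
formula and `sum_mul_lrTerm`, and hence the same expectation. The truncation depends on the
covariates only, so it is predictable. -/
theorem lintegral_plRatio_mul_covBound_le (hY : IsSample Y P Q) (hQ : CoxLaw Q β₀ Λ τ) (n : ℕ)
    (γ : Cov p) (M : ℝ) :
    ∫⁻ ω, plRatio n β₀ γ (path Y ω) * covBound n M (path Y ω) ∂P ≤ 1 := by
  obtain ⟨R, hR⟩ : ∃ R : ℝ → (ℕ → Obs p) → ENNReal,
      ∀ t y, R t y = lrBefore n β₀ γ t y * covBound n M y := ⟨_, fun _ _ => rfl⟩
  have mR : Measurable (uncurry R) := by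
    have : uncurry R = fun q => uncurry (lrBefore n β₀ γ) q * covBound n M q.2 :=
      funext fun q => hR q.1 q.2
    rw [this]
    exact (measurable_lrBefore n β₀ γ).mul ((measurable_covBound n M).comp measurable_snd)
  have hRu : ∀ i t (y : ℕ → Obs p) o o', cov o = cov o' → t ≤ time o → t ≤ time o' →
      R t (update y i o) = R t (update y i o') := fun i t y o o' hc ho ho' => by
    rw [hR, hR, lrBefore_update n i γ hc ho ho', covBound_update n i M hc]
  have mT : ∀ i, Measurable fun q : ℝ × (ℕ → Obs p) => lrTerm n β₀ γ q.1 (cov (q.2 i)) q.2 :=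
    fun i => measurable_lrTerm n β₀ γ measurable_fst (by fun_prop) measurable_snd
  have cA := hY.sum_campbell hQ n (H := fun i t y => lrTerm n β₀ γ t (cov (y i)) y * R t y)
    (fun i => (mT i).mul mR) fun i t y o o' hc ho ho' => by
      rw [update_self, update_self, hc, lrTerm_update n i γ _ hc ho ho', hRu i t y o o' hc ho ho']
  have cB := hY.sum_campbell hQ n (H := fun _ => R) (fun _ => mR) hRu
  have key : ∀ ω t, ∑ i ∈ Finset.range n, (if t ≤ time (path Y ω i) then
      ENNReal.ofReal (Real.exp ⟪β₀, cov (path Y ω i)⟫) *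
        (lrTerm n β₀ γ t (cov (path Y ω i)) (path Y ω) * R t (path Y ω)) else 0) =
      ∑ i ∈ Finset.range n, (if t ≤ time (path Y ω i) then
        ENNReal.ofReal (Real.exp ⟪β₀, cov (path Y ω i)⟫) * R t (path Y ω) else 0) := fun ω t => by
    have := congrArg (· * R t (path Y ω)) (sum_mul_lrTerm n (path Y ω) β₀ γ t)
    simp only [Finset.sum_mul, ite_mul, zero_mul, mul_assoc] at this
    exact this
  simp only [key] at cA
  rw [← cB] at cA
  have mB : Measurable fun ω => ∑ i ∈ Finset.range n,
      (if ind (path Y ω i) = 1 then R (time (path Y ω i)) (path Y ω) else 0) := by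
    have : ∀ i, Measurable fun y : ℕ → Obs p => if ind (y i) = 1 then R (time (y i)) y else 0 :=
      fun i => Measurable.ite (measurableSet_eq_fun (by fun_prop) measurable_const)
        (mR.comp (Measurable.prodMk (by fun_prop) measurable_id)) measurable_const
    exact Finset.measurable_sum _ fun i _ => (this i).comp hY.measurable_path
  have mχ : Measurable fun ω => covBound n M (path Y ω) :=
    (measurable_covBound n M).comp hY.measurable_path
  -- Cancellation in the extended reals requires a finite term; this is the only purpose of
  -- truncating the covariates.
  have hfin : ∫⁻ ω, ∑ i ∈ Finset.range n,
      (if ind (path Y ω i) = 1 then R (time (path Y ω i)) (path Y ω) else 0) ∂P ≠ ⊤ := by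
    obtain ⟨D, hD⟩ : ∃ D, D = max 1 (ENNReal.ofReal (Real.exp (‖γ‖ * M) * Real.exp (‖γ‖ * M))) :=
      ⟨_, rfl⟩
    have hDn : D ^ n < ⊤ := ENNReal.pow_lt_top (hD ▸ max_lt ENNReal.one_lt_top
        ENNReal.ofReal_lt_top)
    have hRD : ∀ t y, R t y ≤ D ^ n := fun t y => by
      rw [hR]
      rcases covBound_eq_zero_or n M y with h | h
      · simp [h]
      · refine (mul_le_of_le_one_right' (covBound_le_one _ _ _)).trans ?_
        refine (Finset.prod_le_pow_card _ _ D fun j hj => ?_).trans_eq (by simp)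
        rw [hD]
        split_ifs
        · exact (lrTerm_le n (h j (Finset.mem_range.1 hj)) h).trans (le_max_right _ _)
        · exact le_max_left _ _
    refine ((lintegral_mono (g := fun _ => n * D ^ n) fun ω => ?_).trans_lt ?_).ne
    · refine (Finset.sum_le_card_nsmul _ _ (D ^ n) fun i _ => ?_).trans_eq (by simp)
      split_ifs
      · exact hRD _ _
      · exact zero_le
    · rw [lintegral_const, measure_univ, mul_one]
      exact ENNReal.mul_lt_top (by simp) hDn
  have hid : ∫⁻ ω, plRatio n β₀ γ (path Y ω) * covBound n M (path Y ω) ∂P +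
      ∫⁻ ω, ∑ i ∈ Finset.range n,
        (if ind (path Y ω i) = 1 then R (time (path Y ω i)) (path Y ω) else 0) ∂P =
      ∫⁻ ω, covBound n M (path Y ω) ∂P + ∫⁻ ω, ∑ i ∈ Finset.range n, (if ind (path Y ω i) = 1 then
        lrTerm n β₀ γ (time (path Y ω i)) (cov (path Y ω i)) (path Y ω) *
          R (time (path Y ω i)) (path Y ω) else 0) ∂P := by
    rw [← lintegral_add_right _ mB, ← lintegral_add_left mχ]
    refine lintegral_congr_ae ?_
    filter_upwards [ae_injective_time hY hQ] with ω hω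
    have := congrArg (· * covBound n M (path Y ω)) (plRatio_add_sum (β₀ := β₀) n γ hω.injOn)
    simp only [add_mul, Finset.sum_mul, ite_mul, zero_mul, one_mul, mul_assoc] at this
    simp only [hR]
    exact this
  rw [cA, ENNReal.add_left_inj hfin] at hid
  rw [hid]
  refine (lintegral_mono fun ω => covBound_le_one n M (path Y ω)).trans ?_
  simp

/-- Fatou's lemma removes the truncation, which is inactive for large `M` in each outcome. -/
theorem lintegral_plRatio_le_one (hY : IsSample Y P Q) (hQ : CoxLaw Q β₀ Λ τ) (n : ℕ)
    (γ : Cov p) : ∫⁻ ω, plRatio n β₀ γ (path Y ω) ∂P ≤ 1 := by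
  have h : ∀ ω, plRatio n β₀ γ (path Y ω) ≤
      liminf (fun M : ℕ => plRatio n β₀ γ (path Y ω) * covBound n M (path Y ω)) atTop := by
    intro ω
    refine le_liminf_of_le (by isBoundedDefault) ?_
    obtain ⟨M₀, hM₀⟩ := exists_nat_ge (∑ j ∈ Finset.range n, ‖cov (path Y ω j)‖)
    filter_upwards [eventually_ge_atTop M₀] with M hM
    have : covBound n M (path Y ω) = 1 := Finset.prod_eq_one fun j hj => if_pos <|
      (Finset.single_le_sum (f := fun j => ‖cov (path Y ω j)‖) (fun _ _ => norm_nonneg _) hj).trans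
        (hM₀.trans (by exact_mod_cast hM))
    rw [this, mul_one]
  have hm : ∀ M : ℕ, Measurable fun ω => plRatio n β₀ γ (path Y ω) * covBound n M (path Y ω) :=
    fun M => ((measurable_plRatio n β₀ γ).mul (measurable_covBound n M)).comp hY.measurable_path
  refine (lintegral_mono h).trans ((lintegral_liminf_le hm).trans ?_)
  refine liminf_le_of_le (by isBoundedDefault) fun b hb => ?_
  obtain ⟨M, hM⟩ := hb.exists
  exact hM.trans (lintegral_plRatio_mul_covBound_le hY hQ n γ M)

/-- The partial likelihood ratio grows at most polynomially along every sequence. -/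
theorem eventually_plRatio_le (hY : IsSample Y P Q) (hQ : CoxLaw Q β₀ Λ τ) (γ : ℕ → Cov p) :
    ∀ᵐ ω ∂P, ∀ᶠ n : ℕ in atTop, plRatio n β₀ (γ n) (path Y ω) ≤ ENNReal.ofReal (n ^ 2) := by
  -- Markov's inequality, for sample sizes `n + 1` so that the reciprocals of the squares make
  -- sense.
  have hP : ∀ n : ℕ, P {ω | ENNReal.ofReal ((n + 1 : ℕ) ^ 2) <
      plRatio (n + 1) β₀ (γ (n + 1)) (path Y ω)} ≤ ENNReal.ofReal (1 / ((n + 1 : ℕ) : ℝ) ^ 2) := by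
    intro n
    have h1 := mul_meas_ge_le_lintegral ((measurable_plRatio (n + 1) β₀ (γ (n + 1))).comp
      hY.measurable_path) (μ := P) (ENNReal.ofReal (((n + 1 : ℕ) : ℝ) ^ 2))
    have h2 := h1.trans (lintegral_plRatio_le_one hY hQ (n + 1) (γ (n + 1)))
    rw [ENNReal.ofReal_div_of_pos (by positivity), ENNReal.ofReal_one,
      ENNReal.le_div_iff_mul_le (Or.inl (by simp; positivity)) (Or.inl (by simp)), mul_comm]
    refine le_trans (mul_le_mul_right (measure_mono fun ω hω => ?_) _) h2
    exact le_of_lt (show ENNReal.ofReal _ < _ from hω)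
  have hsum : ∑' n : ℕ, P {ω | ENNReal.ofReal ((n + 1 : ℕ) ^ 2) <
      plRatio (n + 1) β₀ (γ (n + 1)) (path Y ω)} ≠ ⊤ := by
    refine ne_top_of_le_ne_top ?_ (ENNReal.tsum_le_tsum hP)
    have hs : Summable fun n : ℕ => 1 / ((n + 1 : ℕ) : ℝ) ^ 2 :=
      (summable_nat_add_iff 1).2 (Real.summable_one_div_nat_pow.2 one_lt_two)
    exact hs.tsum_ofReal_ne_top
  filter_upwards [ae_eventually_notMem hsum] with ω hω
  obtain ⟨N, hN⟩ := eventually_atTop.1 hω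
  refine eventually_atTop.2 ⟨N + 1, fun n hn => ?_⟩
  obtain ⟨k, rfl⟩ : ∃ k, n = k + 1 := ⟨n - 1, by omega⟩
  exact not_lt.1 (hN k (by omega))

end

end CoxShape

namespace CoxShape
open Function
variable {p : ℕ} {β₀ : Cov p} {y : ℕ → Obs p}

/-! ### Weighted averages of exponentials -/

theorem exp_le_one_add_add_sq (x : ℝ) : Real.exp x ≤ 1 + x + x ^ 2 * Real.exp |x| := by
  have h0 : Real.exp x - 1 ≤ x * Real.exp x := by
    have h1 := Real.add_one_le_exp (-x)
    have h2 : Real.exp (-x) * Real.exp x = 1 := by rw [← Real.exp_add]; simp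
    nlinarith [Real.exp_pos x]
  rcases le_total 0 x with hx | hx
  · rw [abs_of_nonneg hx]
    nlinarith
  · have h1 : 1 ≤ Real.exp |x| := Real.one_le_exp (abs_nonneg x)
    have h2 := Real.add_one_le_exp x
    nlinarith [sq_nonneg x]

theorem sq_div_four_le_exp_sub {d x : ℝ} (hd : 0 ≤ d) (hd1 : d ≤ 1) (hx : d ≤ |x|) :
    d ^ 2 / 4 ≤ Real.exp x - 1 - x := by
  rcases le_total 0 x with h | h
  · rw [abs_of_nonneg h] at hx
    have := Real.quadratic_le_exp_of_nonneg h
    nlinarith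
  · rw [abs_of_nonpos h] at hx
    rcases le_total (-2) x with h2 | h2
    · have h3 : (1 + x / 2) ^ 2 ≤ Real.exp x := by
        have h4 := Real.add_one_le_exp (x / 2)
        have h5 : Real.exp x = Real.exp (x / 2) ^ 2 := by
          rw [← Real.exp_nat_mul]; congr 1; push_cast; ring
        rw [h5]
        exact pow_le_pow_left₀ (by linarith) (by linarith) 2
      nlinarith
    · nlinarith [Real.exp_pos x]

section weights

variable {s : Finset ℕ} {w X : ℕ → ℝ}

theorem sum_weight_exp_pos (hw : ∀ j ∈ s, 0 ≤ w j) (h1 : ∑ j ∈ s, w j = 1) :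
    0 < ∑ j ∈ s, w j * Real.exp (X j) := by
  refine (Finset.sum_nonneg fun j hj => mul_nonneg (hw j hj) (Real.exp_pos _).le).lt_of_ne' fun h0
      => ?_
  have h2 := (Finset.sum_eq_zero_iff_of_nonneg fun j hj =>
    mul_nonneg (hw j hj) (Real.exp_pos (X j)).le).1 h0
  have : ∑ j ∈ s, w j = 0 := Finset.sum_eq_zero fun j hj =>
    (mul_eq_zero.1 (h2 j hj)).resolve_right (Real.exp_pos _).ne'
  linarith

theorem log_sum_weight_exp_le (hw : ∀ j ∈ s, 0 ≤ w j) (h1 : ∑ j ∈ s, w j = 1) :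
    Real.log (∑ j ∈ s, w j * Real.exp (X j)) ≤
      ∑ j ∈ s, w j * X j + ∑ j ∈ s, w j * (X j ^ 2 * Real.exp |X j|) := by
  have h2 := Real.log_le_sub_one_of_pos (sum_weight_exp_pos (X := X) hw h1)
  have h3 : ∑ j ∈ s, w j * Real.exp (X j) ≤
      ∑ j ∈ s, (w j + w j * X j + w j * (X j ^ 2 * Real.exp |X j|)) :=
    Finset.sum_le_sum fun j hj => by
      have := mul_le_mul_of_nonneg_left (exp_le_one_add_add_sq (X j)) (hw j hj)
      linarith
  rw [Finset.sum_add_distrib, Finset.sum_add_distrib, h1] at h3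
  linarith

theorem sum_weight_le_log (hw : ∀ j ∈ s, 0 ≤ w j) (h1 : ∑ j ∈ s, w j = 1) :
    ∑ j ∈ s, w j * X j ≤ Real.log (∑ j ∈ s, w j * Real.exp (X j)) := by
  rw [Real.le_log_iff_exp_le (sum_weight_exp_pos hw h1)]
  have := convexOn_exp.map_sum_le (t := s) (w := w) (p := X) hw h1 fun _ _ => mem_univ _
  simpa using this

/-- Jensen's inequality for the concave power `u ↦ u ^ a`. It yields concavity of the log partial
likelihood along rays from `β₀`. -/
theorem log_sum_weight_exp_smul_le (hw : ∀ j ∈ s, 0 ≤ w j) (h1 : ∑ j ∈ s, w j = 1) {a : ℝ}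
    (ha : 0 ≤ a) (ha1 : a ≤ 1) :
    Real.log (∑ j ∈ s, w j * Real.exp (a * X j)) ≤
      a * Real.log (∑ j ∈ s, w j * Real.exp (X j)) := by
  rw [← Real.log_rpow (sum_weight_exp_pos hw h1)]
  refine Real.log_le_log (sum_weight_exp_pos (X := fun j => a * X j) hw h1) ?_
  have := (Real.concaveOn_rpow ha ha1).le_map_sum (t := s) (w := w) (p := fun j => Real.exp (X j))
    hw h1 fun _ _ => (Real.exp_pos _).le
  simp only [smul_eq_mul, ← Real.exp_mul] at this
  simpa only [mul_comm a] using this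

/-- A quantitative Jensen inequality. The mean lies on one side of the midpoint of `x₁` and `x₂`, so
one of the two groups is entirely at distance at least `d` from it, and that group contributes at
least `q * d ^ 2 / 4`. -/
theorem le_log_sum_weight_exp_sub (hw : ∀ j ∈ s, 0 ≤ w j) (h1 : ∑ j ∈ s, w j = 1)
    {A B : Finset ℕ} (hA : A ⊆ s) (hB : B ⊆ s) {q d x₁ x₂ : ℝ} (hq : 0 ≤ q)
    (hqA : q ≤ ∑ j ∈ A, w j) (hqB : q ≤ ∑ j ∈ B, w j) (hXA : ∀ j ∈ A, X j ≤ x₁)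
    (hXB : ∀ j ∈ B, x₂ ≤ X j) (hd : 0 ≤ d) (hd1 : d ≤ 1) (hx : 2 * d ≤ x₂ - x₁) :
    q * d ^ 2 / 8 ≤ Real.log (∑ j ∈ s, w j * Real.exp (X j)) - ∑ j ∈ s, w j * X j := by
  set m := ∑ j ∈ s, w j * X j with hm
  have hq1 : q ≤ 1 := hqA.trans ((Finset.sum_le_sum_of_subset_of_nonneg hA fun j hj _ => hw j
      hj).trans h1.le)
  have key : ∀ D ⊆ s, q ≤ ∑ j ∈ D, w j → (∀ j ∈ D, d ≤ |X j - m|) →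
      q * (d ^ 2 / 4) ≤ ∑ j ∈ s, w j * (Real.exp (X j - m) - 1 - (X j - m)) := by
    intro D hD hqD hXD
    calc q * (d ^ 2 / 4) ≤ ∑ j ∈ D, w j * (d ^ 2 / 4) := by rw [← Finset.sum_mul]; gcongr
      _ ≤ ∑ j ∈ D, w j * (Real.exp (X j - m) - 1 - (X j - m)) := Finset.sum_le_sum fun j hj =>
          mul_le_mul_of_nonneg_left (sq_div_four_le_exp_sub hd hd1 (hXD j hj)) (hw j (hD hj))
      _ ≤ _ := Finset.sum_le_sum_of_subset_of_nonneg hD fun j hj _ =>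
          mul_nonneg (hw j hj) (by linarith [Real.add_one_le_exp (X j - m)])
  have hφ : q * (d ^ 2 / 4) ≤ ∑ j ∈ s, w j * (Real.exp (X j - m) - 1 - (X j - m)) := by
    rcases le_total m ((x₁ + x₂) / 2) with h | h
    · exact key B hB hqB fun j hj => le_abs.2 (Or.inl (by linarith [hXB j hj]))
    · exact key A hA hqA fun j hj => le_abs.2 (Or.inr (by linarith [hXA j hj]))
  have e1 : ∑ j ∈ s, w j * (Real.exp (X j - m) - 1 - (X j - m)) =
      Real.exp (-m) * ∑ j ∈ s, w j * Real.exp (X j) - 1 := by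
    have : ∀ j ∈ s, w j * (Real.exp (X j - m) - 1 - (X j - m)) =
        Real.exp (-m) * (w j * Real.exp (X j)) - w j - w j * X j + w j * m := fun j _ => by
      rw [sub_eq_add_neg (X j) m, Real.exp_add]; ring
    rw [Finset.sum_congr rfl this, Finset.sum_add_distrib, Finset.sum_sub_distrib,
      Finset.sum_sub_distrib, ← Finset.mul_sum, ← Finset.sum_mul, h1, ← hm]
    ring
  have hpos := sum_weight_exp_pos (X := X) hw h1
  have e2 : Real.log (∑ j ∈ s, w j * Real.exp (X j)) - m =
      Real.log (Real.exp (-m) * ∑ j ∈ s, w j * Real.exp (X j)) := by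
    rw [Real.log_mul (Real.exp_pos _).ne' hpos.ne', Real.log_exp]; ring
  rw [e2, Real.le_log_iff_exp_le (by positivity)]
  have h3 : 1 + q * (d ^ 2 / 4) ≤ Real.exp (-m) * ∑ j ∈ s, w j * Real.exp (X j) := by linarith
  refine le_trans ?_ h3
  have hz : q * d ^ 2 / 8 ≤ 1 / 8 := by
    have : q * d ^ 2 ≤ 1 := mul_le_one₀ hq1 (by positivity) (pow_le_one₀ hd hd1)
    linarith
  have hz0 : 0 ≤ q * d ^ 2 / 8 := by positivity
  -- For small `z ≥ 0`, `exp z ≤ 1 + 2 * z`; taking the logarithm thus costs a factor two, from `1 /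
  -- 4` to `1 / 8`.
  have := Real.abs_exp_sub_one_le (x := q * d ^ 2 / 8) (by rw [abs_of_nonneg hz0]; linarith)
  rw [abs_of_nonneg hz0] at this
  have := le_abs_self (Real.exp (q * d ^ 2 / 8) - 1)
  linarith

end weights

/-! ### The logarithm of the partial likelihood ratio -/

/-- The weight of observation `j` among those at risk at `t`. -/
noncomputable def riskWeight (n : ℕ) (y : ℕ → Obs p) (β₀ : Cov p) (t : ℝ) (j : ℕ) : ℝ :=
  (if t ≤ time (y j) then Real.exp ⟪β₀, cov (y j)⟫ else 0) / riskSum n y β₀ t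

theorem riskWeight_nonneg (n : ℕ) (y : ℕ → Obs p) (β₀ : Cov p) (t : ℝ) (j : ℕ) :
    0 ≤ riskWeight n y β₀ t j :=
  div_nonneg (by split_ifs <;> positivity) (riskSum_nonneg _ _ _ _)

theorem sum_riskWeight {n i : ℕ} (hi : i < n) (y : ℕ → Obs p) (β₀ : Cov p) :
    ∑ j ∈ Finset.range n, riskWeight n y β₀ (time (y i)) j = 1 := by
  unfold riskWeight
  rw [← Finset.sum_div]
  exact div_self (riskSum_pos hi y β₀ le_rfl).ne'

theorem sum_riskWeight_mul_exp (n : ℕ) (y : ℕ → Obs p) (β₀ γ : Cov p) (t : ℝ) :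
    ∑ j ∈ Finset.range n, riskWeight n y β₀ t j * Real.exp ⟪γ, cov (y j)⟫ =
      riskSum n y (β₀ + γ) t / riskSum n y β₀ t := by
  rw [riskSum_add, Finset.sum_div]
  exact Finset.sum_congr rfl fun j _ => by rw [riskWeight]; ring

/-- The logarithm of the ratio of the partial likelihoods at `β₀ + γ` and at `β₀`. -/
noncomputable def logRatio (n : ℕ) (y : ℕ → Obs p) (β₀ γ : Cov p) : ℝ :=
  ∑ i ∈ Finset.range n, if ind (y i) = 1 then ⟪γ, cov (y i)⟫ - Real.log
    (∑ j ∈ Finset.range n, riskWeight n y β₀ (time (y i)) j * Real.exp ⟪γ, cov (y j)⟫) else 0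

/-- The gradient of the logarithm of the partial likelihood at `β₀`. -/
noncomputable def scoreVec (n : ℕ) (y : ℕ → Obs p) (β₀ : Cov p) : Cov p :=
  ∑ i ∈ Finset.range n, if ind (y i) = 1 then
    cov (y i) - ∑ j ∈ Finset.range n, riskWeight n y β₀ (time (y i)) j • cov (y j) else 0

/-- The sum of the reciprocals of the risk sums at the events. -/
noncomputable def invRiskSum (n : ℕ) (y : ℕ → Obs p) (β₀ : Cov p) : ℝ :=
  ∑ i ∈ Finset.range n, if ind (y i) = 1 then 1 / riskSum n y β₀ (time (y i)) else 0

theorem inner_scoreVec (n : ℕ) (y : ℕ → Obs p) (β₀ γ : Cov p) :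
    ⟪γ, scoreVec n y β₀⟫ = ∑ i ∈ Finset.range n, if ind (y i) = 1 then
      ⟪γ, cov (y i)⟫ - ∑ j ∈ Finset.range n, riskWeight n y β₀ (time (y i)) j * ⟪γ, cov (y j)⟫
        else 0 := by
  rw [scoreVec, inner_sum]
  refine Finset.sum_congr rfl fun i _ => ?_
  split_ifs
  · rw [inner_sub_right, inner_sum]
    simp only [inner_smul_right]
  · exact inner_zero_right _

theorem ofReal_exp_logRatio (n : ℕ) (y : ℕ → Obs p) (β₀ γ : Cov p) :
    plRatio n β₀ γ y = ENNReal.ofReal (Real.exp (logRatio n y β₀ γ)) := by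
  rw [logRatio, Real.exp_sum, ENNReal.ofReal_prod_of_nonneg fun i _ => (Real.exp_pos _).le, plRatio]
  refine Finset.prod_congr rfl fun i hi => ?_
  have hi' := Finset.mem_range.1 hi
  split_ifs
  · have h1 := riskSum_pos hi' y β₀ le_rfl
    have h2 := riskSum_pos hi' y (β₀ + γ) le_rfl
    rw [lrTerm, sum_riskWeight_mul_exp, Real.exp_sub, Real.exp_log (by positivity)]
    congr 1
    field_simp
  · simp

theorem partialLikelihood_pos (n : ℕ) (y : ℕ → Obs p) (β : Cov p) : 0 < partialLikelihood n y β :=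
  Finset.prod_pos fun i hi => by
    split_ifs
    · exact div_pos (Real.exp_pos _) (riskSum_pos (Finset.mem_range.1 hi) y β le_rfl)
    · exact one_pos

theorem partialLikelihood_add (n : ℕ) (y : ℕ → Obs p) (β₀ γ : Cov p) :
    partialLikelihood n y (β₀ + γ) =
      partialLikelihood n y β₀ * Real.exp (logRatio n y β₀ γ) := by
  rw [logRatio, Real.exp_sum, partialLikelihood, partialLikelihood, ← Finset.prod_mul_distrib]
  refine Finset.prod_congr rfl fun i hi => ?_
  have hi' := Finset.mem_range.1 hi
  split_ifs
  · have h1 := riskSum_pos hi' y β₀ le_rfl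
    have h2 := riskSum_pos hi' y (β₀ + γ) le_rfl
    rw [sum_riskWeight_mul_exp, Real.exp_sub, Real.exp_log (by positivity), inner_add_left,
      Real.exp_add]
    field_simp
  · simp

/-- A one-sided Taylor expansion of the log partial likelihood at `β₀`. The remainder at an event is
bounded through the reciprocal risk sum there times a sample moment common to all events. -/
theorem inner_scoreVec_le {n : ℕ} {γ : Cov p} {δ : ℝ} (hδ : 0 < δ) (hγ : ‖γ‖ ≤ δ / 2) :
    ⟪γ, scoreVec n y β₀⟫ ≤ logRatio n y β₀ γ + ‖γ‖ ^ 2 * (8 / δ ^ 2) * invRiskSum n y β₀ *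
      ∑ j ∈ Finset.range n, Real.exp ⟪β₀, cov (y j)⟫ * Real.exp (δ * ‖cov (y j)‖) := by
  rw [inner_scoreVec, logRatio, invRiskSum, mul_right_comm, Finset.mul_sum _ _ (‖γ‖ ^ 2 * _ * _),
    ← Finset.sum_add_distrib]
  refine Finset.sum_le_sum fun i hi => ?_
  have hi' := Finset.mem_range.1 hi
  split_ifs with hind
  swap
  · simp
  have h1 := log_sum_weight_exp_le (s := Finset.range n) (X := fun j => ⟪γ, cov (y j)⟫)
    (fun j _ => riskWeight_nonneg n y β₀ (time (y i)) j) (sum_riskWeight hi' y β₀)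
  have h2 : ∑ j ∈ Finset.range n, riskWeight n y β₀ (time (y i)) j *
      (⟪γ, cov (y j)⟫ ^ 2 * Real.exp |⟪γ, cov (y j)⟫|) ≤
      ‖γ‖ ^ 2 * (8 / δ ^ 2) * (∑ j ∈ Finset.range n,
        Real.exp ⟪β₀, cov (y j)⟫ * Real.exp (δ * ‖cov (y j)‖)) *
          (1 / riskSum n y β₀ (time (y i))) := by
    rw [Finset.mul_sum, Finset.sum_mul]
    refine Finset.sum_le_sum fun j _ => ?_
    set z := ‖cov (y j)‖
    have hz : 0 ≤ z := norm_nonneg _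
    have a1 : |⟪γ, cov (y j)⟫| ≤ ‖γ‖ * z := abs_real_inner_le_norm γ _
    have a2 : ⟪γ, cov (y j)⟫ ^ 2 ≤ ‖γ‖ ^ 2 * z ^ 2 := by
      rw [← sq_abs, ← mul_pow]; exact pow_le_pow_left₀ (abs_nonneg _) a1 2
    -- One half of the exponential moment absorbs the square, the other half the factor `exp |⟪γ,
    -- Z⟫|`; the `8` comes from `exp x ≥ x ^ 2 / 2`.
    have a3 : z ^ 2 ≤ 8 / δ ^ 2 * Real.exp (δ / 2 * z) := by
      have := Real.quadratic_le_exp_of_nonneg (x := δ / 2 * z) (by positivity)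
      rw [div_mul_eq_mul_div, le_div_iff₀ (by positivity)]
      nlinarith [mul_nonneg hδ.le hz]
    have a4 : Real.exp |⟪γ, cov (y j)⟫| ≤ Real.exp (δ / 2 * z) :=
      Real.exp_le_exp.2 (a1.trans (by gcongr))
    have a5 : ⟪γ, cov (y j)⟫ ^ 2 * Real.exp |⟪γ, cov (y j)⟫| ≤
        ‖γ‖ ^ 2 * (8 / δ ^ 2) * Real.exp (δ * z) := by
      calc _ ≤ (‖γ‖ ^ 2 * (8 / δ ^ 2 * Real.exp (δ / 2 * z))) * Real.exp (δ / 2 * z) := by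
            gcongr
            exact a2.trans (by gcongr)
        _ = ‖γ‖ ^ 2 * (8 / δ ^ 2) * (Real.exp (δ / 2 * z) * Real.exp (δ / 2 * z)) := by ring
        _ = _ := by rw [← Real.exp_add]; ring_nf
    have a6 : riskWeight n y β₀ (time (y i)) j ≤
        Real.exp ⟪β₀, cov (y j)⟫ * (1 / riskSum n y β₀ (time (y i))) := by
      rw [riskWeight, mul_one_div]
      refine div_le_div_of_nonneg_right ?_ (riskSum_nonneg _ _ _ _)
      split_ifs <;> simp [(Real.exp_pos _).le]
    have a7 := mul_le_mul a6 a5 (by positivity)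
      (mul_nonneg (Real.exp_pos _).le (one_div_nonneg.2 (riskSum_nonneg _ _ _ _)))
    refine a7.trans_eq ?_
    ring
  linarith

/-- Every event contributes at most its linear part, by Jensen. Those in `J`, at which two separated
groups `A` and `B` are both substantially at risk, contribute a quadratic deficit as well. -/
theorem logRatio_le_inner_scoreVec (n : ℕ) (y : ℕ → Obs p) (β₀ γ : Cov p) {J A B : Finset ℕ}
    (hJ : J ⊆ Finset.range n) (hA : A ⊆ Finset.range n) (hB : B ⊆ Finset.range n)
    (hJi : ∀ i ∈ J, ind (y i) = 1) {q d x₁ x₂ : ℝ} (hq : 0 ≤ q)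
    (hqA : ∀ i ∈ J, q ≤ ∑ j ∈ A, riskWeight n y β₀ (time (y i)) j)
    (hqB : ∀ i ∈ J, q ≤ ∑ j ∈ B, riskWeight n y β₀ (time (y i)) j)
    (hXA : ∀ j ∈ A, ⟪γ, cov (y j)⟫ ≤ x₁) (hXB : ∀ j ∈ B, x₂ ≤ ⟪γ, cov (y j)⟫)
    (hd : 0 ≤ d) (hd1 : d ≤ 1) (hx : 2 * d ≤ x₂ - x₁) :
    logRatio n y β₀ γ ≤ ⟪γ, scoreVec n y β₀⟫ - J.card * (q * d ^ 2 / 8) := by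
  have h1 : (J.card : ℝ) * (q * d ^ 2 / 8) ≤ ∑ i ∈ Finset.range n, (if ind (y i) = 1 then
      (Real.log (∑ j ∈ Finset.range n, riskWeight n y β₀ (time (y i)) j * Real.exp ⟪γ, cov (y j)⟫) -
        ∑ j ∈ Finset.range n, riskWeight n y β₀ (time (y i)) j * ⟪γ, cov (y j)⟫) else 0) := by
    rw [← nsmul_eq_mul]
    refine (Finset.card_nsmul_le_sum J (fun i => if ind (y i) = 1 then
      (Real.log (∑ j ∈ Finset.range n, riskWeight n y β₀ (time (y i)) j * Real.exp ⟪γ, cov (y j)⟫) -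
        ∑ j ∈ Finset.range n, riskWeight n y β₀ (time (y i)) j * ⟪γ, cov (y j)⟫) else 0) _
        fun i hi => ?_).trans
      (Finset.sum_le_sum_of_subset_of_nonneg hJ fun i hi _ => ?_)
    · rw [if_pos (hJi i hi)]
      exact le_log_sum_weight_exp_sub (fun j _ => riskWeight_nonneg n y β₀ (time (y i)) j)
        (sum_riskWeight (Finset.mem_range.1 (hJ hi)) y β₀) hA hB hq (hqA i hi) (hqB i hi) hXA hXB
        hd hd1 hx
    · split_ifs
      · exact sub_nonneg.2 (sum_weight_le_log (fun j _ => riskWeight_nonneg n y β₀ (time (y i)) j)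
          (sum_riskWeight (Finset.mem_range.1 hi) y β₀))
      · exact le_rfl
  rw [inner_scoreVec, logRatio]
  rw [le_sub_iff_add_le']
  refine (add_le_add_left h1 _).trans_eq ?_
  rw [← Finset.sum_add_distrib]
  refine Finset.sum_congr rfl fun i _ => ?_
  split_ifs
  · ring
  · ring

theorem mul_logRatio_le (n : ℕ) (y : ℕ → Obs p) (β₀ γ : Cov p) {a : ℝ} (ha : 0 ≤ a)
    (ha1 : a ≤ 1) : a * logRatio n y β₀ γ ≤ logRatio n y β₀ (a • γ) := by
  rw [logRatio, logRatio, Finset.mul_sum]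
  refine Finset.sum_le_sum fun i hi => ?_
  split_ifs
  · simp only [inner_smul_left, RCLike.conj_to_real]
    have := log_sum_weight_exp_smul_le (s := Finset.range n) (X := fun j => ⟪γ, cov (y j)⟫)
      (fun j _ => riskWeight_nonneg n y β₀ (time (y i)) j)
      (sum_riskWeight (Finset.mem_range.1 hi) y β₀) ha ha1
    linarith
  · simp

theorem continuous_logRatio (n : ℕ) (y : ℕ → Obs p) (β₀ : Cov p) :
    Continuous (logRatio n y β₀) := by
  unfold logRatio
  refine continuous_finsetSum _ fun i hi => ?_
  split_ifs
  · refine (by fun_prop : Continuous fun γ : Cov p => ⟪γ, cov (y i)⟫).sub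
      (Continuous.log (by fun_prop) fun γ => ?_)
    exact (sum_weight_exp_pos (fun j _ => riskWeight_nonneg n y β₀ (time (y i)) j)
      (sum_riskWeight (Finset.mem_range.1 hi) y β₀)).ne'
  · exact continuous_const

theorem logRatio_zero (n : ℕ) (y : ℕ → Obs p) (β₀ : Cov p) : logRatio n y β₀ 0 = 0 := by
  refine Finset.sum_eq_zero fun i hi => ?_
  split_ifs
  · simp [sum_riskWeight (Finset.mem_range.1 hi) y β₀]
  · rfl

theorem logRatio_starProjection {E : Submodule ℝ (Cov p)} (hE : ∀ i, cov (y i) ∈ E) (n : ℕ)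
    (γ : Cov p) : logRatio n y β₀ (E.starProjection γ) = logRatio n y β₀ γ := by
  have h : ∀ i, ⟪E.starProjection γ, cov (y i)⟫ = ⟪γ, cov (y i)⟫ := fun i => by
    rw [Submodule.inner_starProjection_left_eq_right, Submodule.starProjection_eq_self_iff.2 (hE i)]
  simp only [logRatio, h]

/-- If the partial likelihood is smaller on a sphere around `β₀` than at `β₀`, then the maximum
partial likelihood estimate lies inside, up to directions that the covariates do not see. -/
theorem exists_norm_sub_le_of_isMPLE {n : ℕ} {E : Submodule ℝ (Cov p)} (hE : ∀ i, cov (y i) ∈ E)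
    {ρ : ℝ} (hρ : 0 < ρ) (hneg : ∀ γ ∈ E, ‖γ‖ = ρ → logRatio n y β₀ γ < 0) {b : Cov p}
    (hb : IsMPLE n y b) :
    ∃ b' : Cov p, ‖b' - β₀‖ ≤ ρ ∧ ∀ i, ⟪b', cov (y i)⟫ = ⟪b, cov (y i)⟫ := by
  have hout : ∀ γ ∈ E, ρ < ‖γ‖ → logRatio n y β₀ γ < 0 := by
    intro γ hγ hlt
    have hγ0 : 0 < ‖γ‖ := hρ.trans hlt
    have h1 := hneg ((ρ / ‖γ‖) • γ) (E.smul_mem _ hγ) (by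
      rw [norm_smul, Real.norm_of_nonneg (by positivity), div_mul_cancel₀ _ hγ0.ne'])
    have h2 := mul_logRatio_le n y β₀ γ (a := ρ / ‖γ‖) (by positivity)
      ((div_le_one hγ0).2 hlt.le)
    by_contra! h3
    have : 0 ≤ ρ / ‖γ‖ * logRatio n y β₀ γ := by positivity
    linarith
  -- `IsMPLE` says nothing unless the supremum is attained. A maximizer over the compact ball is
  -- global, because outside it the ratio, after projection onto `E`, is negative.
  obtain ⟨γ₁, hγ₁, hmax⟩ := (isCompact_closedBall (0 : Cov p) ρ).exists_isMaxOn
    ⟨0, by simp [hρ.le]⟩ (continuous_logRatio n y β₀).continuousOn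
  have h0 : 0 ≤ logRatio n y β₀ γ₁ := by
    rw [← logRatio_zero n y β₀]; exact hmax (by simp [hρ.le])
  have hglob : ∀ γ, logRatio n y β₀ γ ≤ logRatio n y β₀ γ₁ := by
    intro γ
    rw [← logRatio_starProjection hE n γ]
    rcases le_or_gt ‖E.starProjection γ‖ ρ with h | h
    · exact hmax (by simpa using h)
    · exact (hout _ (E.starProjection_apply_mem γ) h).le.trans h0
  have hbmax := hb ⟨β₀ + γ₁, fun β _ => by
    have e : β = β₀ + (β - β₀) := by abel
    change partialLikelihood n y β ≤ _
    rw [e, partialLikelihood_add, partialLikelihood_add]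
    have := (partialLikelihood_pos n y β₀).le
    gcongr
    exact hglob _⟩
  have h1 : 0 ≤ logRatio n y β₀ (b - β₀) := by
    have h2 : partialLikelihood n y β₀ ≤ partialLikelihood n y b := hbmax (mem_univ _)
    have e : b = β₀ + (b - β₀) := by abel
    rw [e, partialLikelihood_add] at h2
    have h3 := (le_mul_iff_one_le_right (partialLikelihood_pos n y β₀)).1 h2
    exact Real.one_le_exp_iff.1 h3
  refine ⟨β₀ + E.starProjection (b - β₀), ?_, fun i => ?_⟩
  · rw [add_sub_cancel_left]
    by_contra! h
    have := hout _ (E.starProjection_apply_mem _) h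
    rw [logRatio_starProjection hE] at this
    linarith
  · rw [inner_add_left, Submodule.inner_starProjection_left_eq_right,
      Submodule.starProjection_eq_self_iff.2 (hE i), ← inner_add_left]
    congr 1
    abel

end CoxShape

namespace CoxShape
open Function
variable {p : ℕ} {β₀ : Cov p} {y : ℕ → Obs p}

/-! ### A rate of convergence -/

/-- The rate `n ^ (-1/4)`. -/
noncomputable def rate (n : ℕ) : ℝ := (n : ℝ) ^ (-(1 / 4) : ℝ)

theorem rate_pos {n : ℕ} (hn : 0 < n) : 0 < rate n := Real.rpow_pos_of_pos (by positivity) _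

theorem tendsto_rate : Tendsto rate atTop (𝓝 0) :=
  (tendsto_rpow_neg_atTop (by norm_num : (0 : ℝ) < 1 / 4)).comp tendsto_natCast_atTop_atTop

theorem eventually_log_le_mul_rate_sq : ∀ᶠ n : ℕ in atTop, Real.log n ≤ n * rate n ^ 2 := by
  have h := ((isLittleO_log_rpow_atTop (by norm_num : (0 : ℝ) < 1 / 2)).bound one_pos)
  filter_upwards [tendsto_natCast_atTop_atTop.eventually h, eventually_gt_atTop 0] with n hn h0
  have hn0 : (0 : ℝ) < n := by positivity
  have e : (n : ℝ) * rate n ^ 2 = (n : ℝ) ^ (1 / 2 : ℝ) := by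
    rw [rate, ← Real.rpow_natCast, ← Real.rpow_mul hn0.le]
    nth_rewrite 1 [← Real.rpow_one (n : ℝ)]
    rw [← Real.rpow_add hn0]
    norm_num
  rw [e]
  have h2 := le_trans (Real.le_norm_self _) hn
  rwa [one_mul, Real.norm_of_nonneg (by positivity)] at h2

theorem tendsto_log_mul_rate : Tendsto (fun n : ℕ => Real.log n * rate n) atTop (𝓝 0) := by
  have h := (isLittleO_log_rpow_atTop (by norm_num : (0 : ℝ) < 1 / 4)).tendsto_div_nhds_zero
  refine (h.comp tendsto_natCast_atTop_atTop).congr fun n => ?_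
  simp only [comp_apply, rate]
  rw [Real.rpow_neg (by positivity), div_eq_mul_inv]

section

variable {Ω : Type*} [MeasurableSpace Ω] {P : Measure Ω} {Q : Measure (Obs p)}
  {Y : ℕ → Ω → Obs p} [IsProbabilityMeasure P] {Λ : Measure ℝ} [SFinite Λ] {τ : ℝ}

theorem eventually_invRiskSum_le (hY : IsSample Y P Q) (hQ : CoxLaw Q β₀ Λ τ) {b B : ℝ}
    (hb : b < τ) (hB : 0 < B)
    (hΛ : ∀ a c, b ≤ a → a ≤ c → c ≤ τ → Λ (Icc a c) ≤ ENNReal.ofReal (B * (c - a))) :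
    ∃ V > 0, ∀ᵐ ω ∂P, ∀ᶠ n in atTop, invRiskSum n (path Y ω) β₀ ≤ V := by
  have hs := hQ.meanRisk_pos hb
  refine ⟨160 * (B * (τ - b)) + 2 / meanRisk Q β₀ b, by
    have := sub_pos.2 hb; positivity, ?_⟩
  filter_upwards [eventually_sum_inv_riskSum_le hY hQ hb hB hΛ, tendsto_riskSum_div hY hQ b]
    with ω h1 h2
  filter_upwards [h1, h2.eventually_const_le (half_lt_self hs), eventually_gt_atTop 0]
    with n hn1 hn2 hn0
  set y := path Y ω
  have hn0' : (0 : ℝ) < n := by positivity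
  rw [le_div_iff₀ hn0'] at hn2
  have h3 : ∑ i ∈ Finset.range n, (if ind (y i) = 1 ∧ ¬ b ≤ time (y i) then
      1 / riskSum n y β₀ (time (y i)) else 0) ≤ 2 / meanRisk Q β₀ b := by
    refine (Finset.sum_le_card_nsmul _ _ (1 / (meanRisk Q β₀ b / 2 * n)) fun i _ => ?_).trans_eq ?_
    · split_ifs with h
      · exact one_div_le_one_div_of_le (by positivity)
          (hn2.trans (riskSum_antitone n y β₀ (not_le.1 h.2).le))
      · positivity
    · rw [Finset.card_range, nsmul_eq_mul]
      field_simp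
  refine le_trans (le_of_eq ?_) (add_le_add hn1 h3)
  rw [invRiskSum, ← Finset.sum_add_distrib]
  refine Finset.sum_congr rfl fun i _ => ?_
  by_cases h1 : ind (y i) = 1 <;> by_cases h2 : b ≤ time (y i) <;> simp [h1, h2]

theorem eventually_sum_moment_le (hY : IsSample Y P Q) {δ : ℝ}
    (hi : Integrable (fun o => Real.exp ⟪β₀, cov o⟫ * Real.exp (δ * ‖cov o‖)) Q) :
    ∃ W > 0, ∀ᵐ ω ∂P, ∀ᶠ n : ℕ in atTop, ∑ j ∈ Finset.range n,
      Real.exp ⟪β₀, cov (path Y ω j)⟫ * Real.exp (δ * ‖cov (path Y ω j)‖) ≤ W * n := by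
  have h0 : 0 ≤ ∫ o, Real.exp ⟪β₀, cov o⟫ * Real.exp (δ * ‖cov o‖) ∂Q :=
    integral_nonneg fun o => by positivity
  refine ⟨∫ o, Real.exp ⟪β₀, cov o⟫ * Real.exp (δ * ‖cov o‖) ∂Q + 1, by positivity, ?_⟩
  filter_upwards [hY.tendsto_average (by fun_prop) hi] with ω hω
  filter_upwards [hω.eventually_le_const (lt_add_one _), eventually_gt_atTop 0] with n hn hn0
  rwa [div_le_iff₀ (by positivity)] at hn

theorem norm_le_of_forall_abs_le {v : Cov p} {D : ℝ} (hD : 0 ≤ D) (h : ∀ k, |v k| ≤ D) :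
    ‖v‖ ≤ p * D := by
  rcases Nat.eq_zero_or_pos p with rfl | hp
  · rw [Subsingleton.elim v 0]; simp
  have h1 : ‖v‖ ^ 2 ≤ (p * D) ^ 2 := by
    rw [EuclideanSpace.norm_sq_eq]
    calc ∑ k, ‖v k‖ ^ 2 ≤ ∑ _k : Fin p, D ^ 2 := Finset.sum_le_sum fun k _ =>
          pow_le_pow_left₀ (norm_nonneg _) (h k) 2
      _ = p * D ^ 2 := by simp
      _ ≤ (p * D) ^ 2 := by
          rw [mul_pow]
          gcongr
          have : (1 : ℝ) ≤ p := by exact_mod_cast hp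
          nlinarith
  exact (pow_le_pow_iff_left₀ (norm_nonneg _) (by positivity) two_ne_zero).1 h1

/-- The log ratio at `rate n • v` is at most `2 * log n ≤ 2 * n * rate n ^ 2`, and the Taylor
remainder is of order `n * rate n ^ 2` as well; division by `rate n` bounds the score in direction
`v`. Only the directions `±e_k` are needed, so finitely many exceptional null sets occur. -/
theorem eventually_norm_scoreVec_le (hY : IsSample Y P Q) (hQ : CoxLaw Q β₀ Λ τ) {V : ℝ}
    (hV : ∀ᵐ ω ∂P, ∀ᶠ n in atTop, invRiskSum n (path Y ω) β₀ ≤ V) (hV0 : 0 < V) :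
    ∃ D > 0, ∀ᵐ ω ∂P, ∀ᶠ n : ℕ in atTop, ‖scoreVec n (path Y ω) β₀‖ ≤ D * (n * rate n) := by
  obtain ⟨δ, hδ, hi⟩ := hQ.moment
  obtain ⟨W, hW0, hW⟩ := eventually_sum_moment_le hY hi
  set D₀ := 2 + 8 / δ ^ 2 * V * W with hD₀
  have hD0 : 0 < D₀ := by positivity
  have hdir : ∀ v : Cov p, ‖v‖ = 1 → ∀ᵐ ω ∂P, ∀ᶠ n : ℕ in atTop,
      ⟪v, scoreVec n (path Y ω) β₀⟫ ≤ D₀ * (n * rate n) := by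
    intro v hv
    filter_upwards [eventually_plRatio_le hY hQ fun n => rate n • v, hV, hW] with ω h1 h2 h3
    filter_upwards [h1, h2, h3, tendsto_rate.eventually_le_const (by positivity : 0 < δ / 2),
      eventually_log_le_mul_rate_sq, eventually_gt_atTop 0] with n g1 g2 g3 g4 g5 g0
    have hr := rate_pos g0
    have hn : (0 : ℝ) < n := by positivity
    have hnorm : ‖rate n • v‖ = rate n := by rw [norm_smul, hv, mul_one, Real.norm_of_nonneg hr.le]
    have k1 := inner_scoreVec_le (y := path Y ω) (β₀ := β₀) (n := n) (γ := rate n • v) hδ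
      (hnorm.trans_le g4)
    rw [ofReal_exp_logRatio, ENNReal.ofReal_le_ofReal_iff (by positivity),
      ← Real.le_log_iff_exp_le (by positivity), Real.log_pow] at g1
    push_cast at g1
    rw [hnorm, inner_smul_left, RCLike.conj_to_real] at k1
    have hI : 0 ≤ invRiskSum n (path Y ω) β₀ := Finset.sum_nonneg fun i _ => by
      split_ifs
      · exact one_div_nonneg.2 (riskSum_nonneg _ _ _ _)
      · exact le_rfl
    have k2 : rate n ^ 2 * (8 / δ ^ 2) * invRiskSum n (path Y ω) β₀ * ∑ j ∈ Finset.range n,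
        Real.exp ⟪β₀, cov (path Y ω j)⟫ * Real.exp (δ * ‖cov (path Y ω j)‖) ≤
        rate n ^ 2 * (8 / δ ^ 2) * V * (W * n) := by gcongr
    have k3 : rate n * ⟪v, scoreVec n (path Y ω) β₀⟫ ≤ rate n * (D₀ * (n * rate n)) := by
      rw [hD₀]
      nlinarith
    exact le_of_mul_le_mul_left k3 hr
  -- The summand `1` keeps the constant positive for `p = 0`.
  refine ⟨p * D₀ + 1, by positivity, ?_⟩
  have hk : ∀ k : Fin p, ∀ᵐ ω ∂P, ∀ᶠ n : ℕ in atTop,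
      |scoreVec n (path Y ω) β₀ k| ≤ D₀ * (n * rate n) := fun k => by
    filter_upwards [hdir (EuclideanSpace.single k 1) (by simp),
      hdir (-EuclideanSpace.single k 1) (by simp)] with ω h1 h2
    filter_upwards [h1, h2] with n g1 g2
    rw [inner_neg_left] at g2
    have e : ⟪EuclideanSpace.single k (1 : ℝ), scoreVec n (path Y ω) β₀⟫ =
        scoreVec n (path Y ω) β₀ k := by
      rw [EuclideanSpace.inner_single_left]; simp
    rw [e] at g1 g2
    exact abs_le.2 ⟨by linarith, g1⟩
  filter_upwards [ae_all_iff.2 hk] with ω hω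
  filter_upwards [eventually_all.2 hω, eventually_gt_atTop 0] with n hn h0
  have hr := rate_pos h0
  refine (norm_le_of_forall_abs_le (by positivity) hn).trans ?_
  have : (0 : ℝ) ≤ n * rate n := by positivity
  nlinarith

/-! ### Curvature of the partial likelihood -/

/-- Otherwise every threshold has a null set on one side. Discarding the null sets for rational
thresholds leaves points at which `f` takes a single value, since two different values would be
separated by a rational. -/
theorem exists_measure_le_lt_pos {α : Type*} [MeasurableSpace α] {μ : Measure α} {f : α → ℝ}
    {q : α → Prop} (h : ¬ ∃ c : ℝ, ∀ᵐ a ∂μ, q a → f a = c) :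
    ∃ x : ℝ, 0 < μ {a | q a ∧ f a ≤ x} ∧ 0 < μ {a | q a ∧ x < f a} := by
  by_contra! hcon
  refine h ?_
  have hgood : ∀ᵐ a ∂μ, ∀ x : ℚ, (μ {a | q a ∧ f a ≤ x} = 0 → ¬ (q a ∧ f a ≤ x)) ∧
      (μ {a | q a ∧ (x : ℝ) < f a} = 0 → ¬ (q a ∧ x < f a)) := by
    refine ae_all_iff.2 fun x => Eventually.and ?_ ?_
    · by_cases h0 : μ {a | q a ∧ f a ≤ x} = 0
      · filter_upwards [measure_eq_zero_iff_ae_notMem.1 h0] with a ha _ using ha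
      · exact Eventually.of_forall fun a h => absurd h h0
    · by_cases h0 : μ {a | q a ∧ (x : ℝ) < f a} = 0
      · filter_upwards [measure_eq_zero_iff_ae_notMem.1 h0] with a ha _ using ha
      · exact Eventually.of_forall fun a h => absurd h h0
  have hle : ∀ a b, (∀ x : ℚ, (μ {a | q a ∧ f a ≤ x} = 0 → ¬ (q a ∧ f a ≤ x)) ∧
      (μ {a | q a ∧ (x : ℝ) < f a} = 0 → ¬ (q a ∧ x < f a))) →
      (∀ x : ℚ, (μ {a | q a ∧ f a ≤ x} = 0 → ¬ (q b ∧ f b ≤ x)) ∧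
      (μ {a | q a ∧ (x : ℝ) < f a} = 0 → ¬ (q b ∧ x < f b))) → q a → q b → f b ≤ f a := by
    intro a b ha hb qa qb
    by_contra! hlt
    obtain ⟨x, h1, h2⟩ := exists_rat_btwn hlt
    have p1 : μ {a | q a ∧ f a ≤ x} ≠ 0 := fun h0 => (ha x).1 h0 ⟨qa, h1.le⟩
    exact (hb x).2 (nonpos_iff_eq_zero.1 (hcon x (pos_iff_ne_zero.2 p1))) ⟨qb, h2⟩
  by_cases hex : ∃ a, q a ∧ ∀ x : ℚ, (μ {a | q a ∧ f a ≤ x} = 0 → ¬ (q a ∧ f a ≤ x)) ∧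
      (μ {a | q a ∧ (x : ℝ) < f a} = 0 → ¬ (q a ∧ x < f a))
  · obtain ⟨a, qa, ha⟩ := hex
    exact ⟨f a, hgood.mono fun b hb qb => le_antisymm (hle a b ha hb qa qb) (hle b a hb ha qb qa)⟩
  · exact ⟨0, hgood.mono fun b hb qb => absurd ⟨b, qb, hb⟩ hex⟩

theorem eventually_le_sum_indicator (hY : IsSample Y P Q) (hQ : CoxLaw Q β₀ Λ τ) {A : Set (Obs p)}
    (hA : MeasurableSet A) (hpos : 0 < Q A) : ∃ e > 0, ∀ᵐ ω ∂P, ∀ᶠ n : ℕ in atTop,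
      e * n ≤ ∑ j ∈ Finset.range n, A.indicator (fun o => Real.exp ⟪β₀, cov o⟫) (path Y ω j) := by
  have hi : Integrable (A.indicator fun o => Real.exp ⟪β₀, cov o⟫) Q := hQ.integrable_exp.indicator
      hA
  have h0 : 0 < ∫ o, A.indicator (fun o => Real.exp ⟪β₀, cov o⟫) o ∂Q := by
    refine (integral_pos_iff_support_of_nonneg (fun o => ?_) hi).2 ?_
    · exact indicator_nonneg (fun _ _ => (Real.exp_pos _).le) _
    · rw [Set.support_indicator]
      refine hpos.trans_le (measure_mono fun o ho => ⟨ho, (Real.exp_pos _).ne'⟩)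
  refine ⟨_, half_pos h0, ?_⟩
  filter_upwards [hY.tendsto_average ((by fun_prop : Measurable fun o : Obs p =>
    Real.exp ⟪β₀, cov o⟫).indicator hA) hi] with ω hω
  filter_upwards [hω.eventually_const_le (half_lt_self h0), eventually_gt_atTop 0] with n hn hn0
  rwa [le_div_iff₀ (by positivity)] at hn

theorem eventually_le_card (hY : IsSample Y P Q) {A : Set (Obs p)}
    (hA : MeasurableSet A) (hpos : 0 < Q A) : ∃ e > 0, ∀ᵐ ω ∂P, ∀ᶠ n : ℕ in atTop,
      e * n ≤ ∑ j ∈ Finset.range n, A.indicator (fun _ => (1 : ℝ)) (path Y ω j) := by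
  have := hY.isProbabilityMeasure
  have hi : Integrable (A.indicator fun _ => (1 : ℝ)) Q := (integrable_const 1).indicator hA
  have h0 : 0 < ∫ o, A.indicator (fun _ => (1 : ℝ)) o ∂Q := by
    rw [integral_indicator_const _ hA, smul_eq_mul, mul_one]
    exact ENNReal.toReal_pos hpos.ne' (measure_ne_top _ _)
  refine ⟨_, half_pos h0, ?_⟩
  filter_upwards [hY.tendsto_average (measurable_const.indicator hA) hi] with ω hω
  filter_upwards [hω.eventually_const_le (half_lt_self h0), eventually_gt_atTop 0] with n hn hn0
  rwa [le_div_iff₀ (by positivity)] at hn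

theorem exists_measure_norm_le_pos {A : Set (Obs p)} (h : 0 < Q A) :
    ∃ M : ℕ, 0 < Q (A ∩ {o | ‖cov o‖ ≤ M}) := by
  have : A = ⋃ M : ℕ, A ∩ {o | ‖cov o‖ ≤ M} := by
    ext o
    simp only [mem_iUnion, mem_inter_iff]
    exact ⟨fun ho => (exists_nat_ge ‖cov o‖).imp fun M hM => ⟨ho, hM⟩, fun ⟨_, ho, _⟩ => ho⟩
  by_contra! hcon
  rw [this, measure_iUnion_null fun M => nonpos_iff_eq_zero.1 (hcon M)] at h
  exact lt_irrefl _ h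

theorem sum_indicator_div_le (n : ℕ) (y : ℕ → Obs p) (β₀ : Cov p) {A : Set (Obs p)} {t x : ℝ}
    (hA : ∀ o ∈ A, t ≤ time o) (hx : x ≤ t) [DecidablePred fun j => y j ∈ A] :
    (∑ j ∈ Finset.range n, A.indicator (fun o => Real.exp ⟪β₀, cov o⟫) (y j)) / riskSum n y β₀ x ≤
      ∑ j ∈ (Finset.range n).filter (fun j => y j ∈ A), riskWeight n y β₀ x j := by
  rw [Finset.sum_div, Finset.sum_filter]
  refine Finset.sum_le_sum fun j _ => ?_
  by_cases hj : y j ∈ A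
  · rw [indicator_of_mem hj, if_pos hj, riskWeight, if_pos (hx.trans (hA _ hj))]
  · rw [indicator_of_notMem hj, if_neg hj, zero_div]

theorem riskSum_le_sum (n : ℕ) (y : ℕ → Obs p) (β₀ : Cov p) (x : ℝ) :
    riskSum n y β₀ x ≤ ∑ j ∈ Finset.range n, Real.exp ⟪β₀, cov (y j)⟫ :=
  Finset.sum_le_sum fun j _ => by split_ifs <;> simp [(Real.exp_pos _).le]

/-- The logarithm of the partial likelihood is uniformly concave near a direction in which the
covariates vary. -/
theorem eventually_logRatio_le_of_direction (hY : IsSample Y P Q) (hQ : CoxLaw Q β₀ Λ τ)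
    {u₀ : Cov p} (hu : ¬ ∀ᵐ o ∂Q, ⟪u₀, cov o⟫ = 0) :
    ∃ ε > 0, ∃ r > 0, ∃ c > 0, ∀ᵐ ω ∂P, ∀ᶠ n : ℕ in atTop, ∀ γ : Cov p, ‖γ‖ ≤ r →
      ‖γ - ‖γ‖ • u₀‖ ≤ ε * ‖γ‖ →
        logRatio n (path Y ω) β₀ γ ≤ ⟪γ, scoreVec n (path Y ω) β₀⟫ - n * (c * ‖γ‖ ^ 2) := by
  classical
  obtain ⟨t, ht, hnc⟩ := hQ.identifiable u₀ hu
  obtain ⟨a, ha1, ha2⟩ := exists_measure_le_lt_pos hnc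
  obtain ⟨b, hab, hb⟩ : ∃ b > a, 0 < Q {o | t ≤ time o ∧ b ≤ ⟪u₀, cov o⟫} := by
    have : {o : Obs p | t ≤ time o ∧ a < ⟪u₀, cov o⟫} =
        ⋃ k : ℕ, {o | t ≤ time o ∧ a + 1 / (k + 1) ≤ ⟪u₀, cov o⟫} := by
      ext o
      simp only [mem_iUnion, mem_ofPred_eq]
      constructor
      · rintro ⟨h1, h2⟩
        obtain ⟨k, hk⟩ := exists_nat_one_div_lt (sub_pos.2 h2)
        exact ⟨k, h1, by linarith⟩
      · rintro ⟨k, h1, h2⟩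
        exact ⟨h1, lt_of_lt_of_le (lt_add_of_pos_right a (by positivity)) h2⟩
    by_contra! hcon
    rw [this, measure_iUnion_null fun k => nonpos_iff_eq_zero.1 (hcon _
      (lt_add_of_pos_right a (by positivity)))] at ha2
    exact lt_irrefl _ ha2
  obtain ⟨M₁, hM₁⟩ := exists_measure_norm_le_pos ha1
  obtain ⟨M₂, hM₂⟩ := exists_measure_norm_le_pos hb
  set A : Set (Obs p) := {o | t ≤ time o ∧ ⟪u₀, cov o⟫ ≤ a} ∩ {o | ‖cov o‖ ≤ M₁} with hA
  set B : Set (Obs p) := {o | t ≤ time o ∧ b ≤ ⟪u₀, cov o⟫} ∩ {o | ‖cov o‖ ≤ M₂} with hB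
  set G : Set (Obs p) := {o | time o ≤ t ∧ ind o = 1} with hG
  have m1 : MeasurableSet {o : Obs p | t ≤ time o} :=
    measurableSet_le measurable_const measurable_time
  have m2 : ∀ x, MeasurableSet {o : Obs p | ⟪u₀, cov o⟫ ≤ x} := fun x =>
    measurableSet_le (by fun_prop) measurable_const
  have m3 : ∀ x, MeasurableSet {o : Obs p | x ≤ ⟪u₀, cov o⟫} := fun x =>
    measurableSet_le measurable_const (by fun_prop)
  have m4 : ∀ x, MeasurableSet {o : Obs p | ‖cov o‖ ≤ x} := fun x =>
    measurableSet_le (by fun_prop) measurable_const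
  have m5 : MeasurableSet {o : Obs p | time o ≤ t} :=
    measurableSet_le measurable_time measurable_const
  have m6 : MeasurableSet {o : Obs p | ind o = 1} :=
    measurableSet_eq_fun measurable_ind measurable_const
  have mA : MeasurableSet A := (m1.inter (m2 a)).inter (m4 M₁)
  have mB : MeasurableSet B := (m1.inter (m3 b)).inter (m4 M₂)
  have mG : MeasurableSet G := m5.inter m6
  obtain ⟨eA, eA0, hevA⟩ := eventually_le_sum_indicator hY hQ mA hM₁
  obtain ⟨eB, eB0, hevB⟩ := eventually_le_sum_indicator hY hQ mB hM₂
  obtain ⟨eG, eG0, hevG⟩ := eventually_le_card hY mG ht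
  obtain ⟨W, W0, hevW⟩ := eventually_sum_moment_le (δ := 0) (β₀ := β₀) hY
    (by simpa using hQ.integrable_exp)
  simp only [zero_mul, Real.exp_zero, mul_one] at hevW
  set M : ℝ := max (M₁ : ℝ) (M₂ : ℝ) + 1 with hM
  have hM0 : 0 < M := by
    have : (0 : ℝ) ≤ max (M₁ : ℝ) (M₂ : ℝ) := le_max_of_le_left (Nat.cast_nonneg _)
    linarith
  have hba : 0 < b - a := sub_pos.2 hab
  set q := min eA eB / W with hq
  have hq0 : 0 < q := by positivity
  -- For covariates bounded by `M`, replacing `‖γ‖ • u₀` by `γ` moves the inner products by at most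
  -- a quarter of `‖γ‖ * (b - a)`, so half the gap, `2 * d`, survives. The radius `4 / (b - a)` is
  -- where `d` reaches one.
  refine ⟨(b - a) / (4 * M), by positivity, 4 / (b - a), by positivity,
    eG * (q * ((b - a) / 4) ^ 2 / 8), by positivity, ?_⟩
  filter_upwards [hevA, hevB, hevG, hevW] with ω h1 h2 h3 h4
  filter_upwards [h1, h2, h3, h4, eventually_gt_atTop 0] with n g1 g2 g3 g4 g0 γ hγr hγ
  set y := path Y ω
  have hn : (0 : ℝ) < n := by positivity
  have hdev : ∀ j, ‖cov (y j)‖ ≤ M → |⟪γ, cov (y j)⟫ - ‖γ‖ * ⟪u₀, cov (y j)⟫| ≤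
      ‖γ‖ * ((b - a) / 4) := fun j hj => by
    have e : ⟪γ, cov (y j)⟫ - ‖γ‖ * ⟪u₀, cov (y j)⟫ = ⟪γ - ‖γ‖ • u₀, cov (y j)⟫ := by
      rw [inner_sub_left, inner_smul_left, RCLike.conj_to_real]
    rw [e]
    refine (abs_real_inner_le_norm _ _).trans ((mul_le_mul hγ hj (norm_nonneg _)
      (by positivity)).trans_eq ?_)
    field_simp
  obtain ⟨F, hF⟩ : ∃ F : Set (Obs p) → Finset ℕ,
      ∀ D, F D = (Finset.range n).filter fun j => y j ∈ D := ⟨_, fun _ => rfl⟩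
  have hFs : ∀ D, F D ⊆ Finset.range n := fun D => hF D ▸ Finset.filter_subset _ _
  have hFm : ∀ D, ∀ j ∈ F D, y j ∈ D := fun D j hj => by
    rw [hF] at hj; exact (Finset.mem_filter.1 hj).2
  have hcardG : eG * n ≤ ((F G).card : ℝ) := by
    refine g3.trans_eq ?_
    rw [hF, Finset.card_filter]
    push_cast
    exact Finset.sum_congr rfl fun j _ => by rw [indicator_apply]
  -- Individuals in `A` and `B` survive to `t`, so they are at risk at every event before `t`, with
  -- a total weight of order `n` compared with a risk sum of at most `W * n`.
  have hwt : ∀ (D : Set (Obs p)) (e : ℝ), 0 < e → min eA eB ≤ e → (∀ o ∈ D, t ≤ time o) →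
      e * n ≤ ∑ j ∈ Finset.range n, D.indicator (fun o => Real.exp ⟪β₀, cov o⟫) (y j) →
      ∀ i ∈ F G, q ≤ ∑ j ∈ F D, riskWeight n y β₀ (time (y i)) j := by
    intro D e he hle hD hsum i hi
    have hiG := hFm G i hi
    have hi := hFs G hi
    rw [hF]
    refine le_trans ?_ (sum_indicator_div_le n y β₀ hD hiG.1)
    have hS := riskSum_pos (Finset.mem_range.1 hi) y β₀ le_rfl
    rw [hq, le_div_iff₀ hS, div_mul_eq_mul_div, div_le_iff₀ W0]
    have h5 := (riskSum_le_sum n y β₀ (time (y i))).trans g4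
    have h6 : 0 < min eA eB := lt_min eA0 eB0
    calc min eA eB * riskSum n y β₀ (time (y i)) ≤ min eA eB * (W * n) := by gcongr
      _ = min eA eB * n * W := by ring
      _ ≤ e * n * W := by gcongr
      _ ≤ _ := by gcongr
  have key := logRatio_le_inner_scoreVec n y β₀ γ
    (hFs G) (hFs A) (hFs B) (fun i hi => (hFm G i hi).2) hq0.le
    (hwt A eA eA0 (min_le_left _ _) (fun o ho => ho.1.1) g1)
    (hwt B eB eB0 (min_le_right _ _) (fun o ho => ho.1.1) g2)
    (x₁ := ‖γ‖ * (a + (b - a) / 4)) (x₂ := ‖γ‖ * (b - (b - a) / 4)) (d := ‖γ‖ * ((b - a) / 4))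
    (fun j hj => by
      have hj := hFm A j hj
      have h5 : ‖cov (y j)‖ ≤ M := (show ‖cov (y j)‖ ≤ M₁ from hj.2).trans
        ((le_max_left (M₁ : ℝ) M₂).trans (le_add_of_nonneg_right zero_le_one))
      have h6 := (abs_le.1 (hdev j h5)).2
      have h7 := mul_le_mul_of_nonneg_left hj.1.2 (norm_nonneg γ)
      linarith)
    (fun j hj => by
      have hj := hFm B j hj
      have h5 : ‖cov (y j)‖ ≤ M := (show ‖cov (y j)‖ ≤ M₂ from hj.2).trans
        ((le_max_right (M₁ : ℝ) M₂).trans (le_add_of_nonneg_right zero_le_one))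
      have h6 := (abs_le.1 (hdev j h5)).1
      have h7 := mul_le_mul_of_nonneg_left hj.1.2 (norm_nonneg γ)
      linarith)
    (by positivity)
    (by
      rw [le_div_iff₀ hba] at hγr
      linarith)
    (le_of_eq (by ring))
  refine key.trans (sub_le_sub_left ?_ _)
  calc (n : ℝ) * (eG * (q * ((b - a) / 4) ^ 2 / 8) * ‖γ‖ ^ 2)
      = eG * n * (q * (‖γ‖ * ((b - a) / 4)) ^ 2 / 8) := by ring
    _ ≤ _ := by gcongr

/-- The directions that the covariates do not see. -/
def nullDirections (Q : Measure (Obs p)) : Submodule ℝ (Cov p) where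
  carrier := {v | ∀ᵐ o ∂Q, ⟪v, cov o⟫ = 0}
  zero_mem' := ae_of_all _ fun o => inner_zero_left _
  add_mem' {v w} hv hw := by
    have hv' : ∀ᵐ o ∂Q, ⟪v, cov o⟫ = 0 := hv
    have hw' : ∀ᵐ o ∂Q, ⟪w, cov o⟫ = 0 := hw
    refine (hv'.and hw').mono fun o h => ?_
    rw [inner_add_left, h.1, h.2, add_zero]
  smul_mem' a v hv := by
    have hv' : ∀ᵐ o ∂Q, ⟪v, cov o⟫ = 0 := hv
    refine hv'.mono fun o h => ?_
    rw [inner_smul_left, h, mul_zero]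

/-- A finite spanning set of the null directions exchanges the quantifiers "for each direction" and
"almost surely". -/
theorem ae_cov_mem_orthogonal (Q : Measure (Obs p)) :
    ∀ᵐ o ∂Q, cov o ∈ (nullDirections Q)ᗮ := by
  obtain ⟨S, hS⟩ := IsNoetherian.noetherian (nullDirections Q)
  have h : ∀ v ∈ S, ∀ᵐ o ∂Q, ⟪v, cov o⟫ = 0 := fun v hv =>
    show v ∈ nullDirections Q from hS ▸ Submodule.subset_span hv
  have h2 : ∀ᵐ o ∂Q, ∀ v ∈ S, ⟪v, cov o⟫ = 0 := (Finset.eventually_all S).2 h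
  filter_upwards [h2] with o ho
  rw [Submodule.mem_orthogonal]
  intro u hu
  rw [← hS] at hu
  induction hu using Submodule.span_induction with
  | mem x hx => exact ho x hx
  | zero => exact inner_zero_left _
  | add x z _ _ hx hz => rw [inner_add_left, hx, hz, add_zero]
  | smul a x _ hx => rw [inner_smul_left, hx, mul_zero]

/-- The curvature bound holds near each unit vector orthogonal to the null directions; compactness
of this part of the sphere makes it uniform with one exceptional null set. -/
theorem eventually_logRatio_le (hY : IsSample Y P Q) (hQ : CoxLaw Q β₀ Λ τ) :
    ∃ r > 0, ∃ c > 0, ∀ᵐ ω ∂P, ∀ᶠ n : ℕ in atTop, ∀ γ ∈ (nullDirections Q)ᗮ, ‖γ‖ ≤ r →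
      logRatio n (path Y ω) β₀ γ ≤ ⟪γ, scoreVec n (path Y ω) β₀⟫ - n * (c * ‖γ‖ ^ 2) := by
  have hK : IsCompact (Metric.sphere (0 : Cov p) 1 ∩ ((nullDirections Q)ᗮ : Set (Cov p))) :=
    (isCompact_sphere _ _).inter_right (Submodule.closed_of_finiteDimensional _)
  obtain ⟨r, hr, c, hc, h⟩ := hK.induction_on (p := fun S : Set (Cov p) => ∃ r > 0, ∃ c > 0, ∀ᵐ ω
      ∂P,
    ∀ᶠ n : ℕ in atTop, ∀ γ : Cov p, ‖γ‖ ≤ r → (∃ u ∈ S, γ = ‖γ‖ • u) →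
      logRatio n (path Y ω) β₀ γ ≤ ⟪γ, scoreVec n (path Y ω) β₀⟫ - n * (c * ‖γ‖ ^ 2))
    ⟨1, one_pos, 1, one_pos, ae_of_all _ fun ω => Eventually.of_forall
      fun n γ _ ⟨u, hu, _⟩ => absurd hu (notMem_empty u)⟩
    (fun S T hST ⟨r, hr, c, hc, h⟩ => ⟨r, hr, c, hc, h.mono fun ω hω => hω.mono
      fun n hn γ hγ ⟨u, hu, e⟩ => hn γ hγ ⟨u, hST hu, e⟩⟩)
    (fun S T ⟨r, hr, c, hc, h⟩ ⟨r', hr', c', hc', h'⟩ => by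
      refine ⟨min r r', lt_min hr hr', min c c', lt_min hc hc', ?_⟩
      filter_upwards [h, h'] with ω hω hω'
      filter_upwards [hω, hω'] with n hn hn' γ hγ ⟨u, hu, e⟩
      rcases hu with hu | hu
      · refine (hn γ (hγ.trans (min_le_left _ _)) ⟨u, hu, e⟩).trans (sub_le_sub_left ?_ _)
        gcongr
        exact min_le_left _ _
      · refine (hn' γ (hγ.trans (min_le_right _ _)) ⟨u, hu, e⟩).trans (sub_le_sub_left ?_ _)
        gcongr
        exact min_le_right _ _)
    (fun u₀ ⟨hu1, hu2⟩ => by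
      have hu : ¬ ∀ᵐ o ∂Q, ⟪u₀, cov o⟫ = 0 := fun hu => by
        have h0 := (Submodule.mem_orthogonal _ _).1 hu2 u₀ hu
        rw [inner_self_eq_zero] at h0
        simp [h0] at hu1
      obtain ⟨ε, hε, r, hr, c, hc, h⟩ := eventually_logRatio_le_of_direction hY hQ hu
      refine ⟨Metric.ball u₀ ε, mem_nhdsWithin_of_mem_nhds (Metric.ball_mem_nhds u₀ hε), r, hr, c,
        hc, ?_⟩
      filter_upwards [h] with ω hω
      filter_upwards [hω] with n hn γ hγ ⟨u, hu, e⟩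
      refine hn γ hγ ?_
      nth_rewrite 1 [e]
      rw [← smul_sub, norm_smul, norm_norm, mul_comm]
      gcongr
      exact (mem_ball_iff_norm.1 hu).le)
  refine ⟨r, hr, c, hc, ?_⟩
  filter_upwards [h] with ω hω
  filter_upwards [hω] with n hn γ hγE hγ
  rcases eq_or_ne γ 0 with rfl | h0
  · simp [logRatio_zero]
  · have hpos := norm_pos_iff.2 h0
    refine hn γ hγ ⟨‖γ‖⁻¹ • γ, ⟨?_, Submodule.smul_mem _ _ hγE⟩, ?_⟩
    · simp [norm_smul, hpos.ne']
    · rw [smul_inv_smul₀ hpos.ne']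

/-- The maximum partial likelihood estimators converge at the rate `n ^ (-1/4)`, up to directions
that the covariates do not see. -/
theorem exists_rate_of_isMPLE (hY : IsSample Y P Q) (hQ : CoxLaw Q β₀ Λ τ) {V : ℝ}
    (hV : ∀ᵐ ω ∂P, ∀ᶠ n in atTop, invRiskSum n (path Y ω) β₀ ≤ V) (hV0 : 0 < V) :
    ∃ K > 0, ∀ᵐ ω ∂P, ∀ᶠ n : ℕ in atTop, ∀ b, IsMPLE n (path Y ω) b →
      ∃ b' : Cov p, ‖b' - β₀‖ ≤ K * rate n ∧
        ∀ i, ⟪b', cov (path Y ω i)⟫ = ⟪b, cov (path Y ω i)⟫ := by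
  obtain ⟨D, hD, hsc⟩ := eventually_norm_scoreVec_le hY hQ hV hV0
  obtain ⟨r, hr, c, hc, hcurv⟩ := eventually_logRatio_le hY hQ
  -- At this radius the quadratic deficit is twice the largest possible linear term, so the log
  -- ratio is negative on the sphere.
  refine ⟨2 * D / c, by positivity, ?_⟩
  filter_upwards [hsc, hcurv, hY.ae_forall (ae_cov_mem_orthogonal Q)] with ω h1 h2 h3
  have h4 : ∀ᶠ n in atTop, 2 * D / c * rate n ≤ r := by
    have := tendsto_rate.const_mul (2 * D / c)
    rw [mul_zero] at this
    exact this.eventually_le_const hr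
  filter_upwards [h1, h2, h4, eventually_gt_atTop 0] with n g1 g2 g4 g0 b hb
  have hrate := rate_pos g0
  have hn : (0 : ℝ) < n := by positivity
  refine exists_norm_sub_le_of_isMPLE h3 (by positivity) (fun γ hγ hnorm => ?_) hb
  refine (g2 γ hγ (hnorm.trans_le g4)).trans_lt ?_
  have k1 : ⟪γ, scoreVec n (path Y ω) β₀⟫ ≤ ‖γ‖ * (D * (n * rate n)) :=
    (real_inner_le_norm _ _).trans (by gcongr)
  have k2 : n * (c * ‖γ‖ ^ 2) = 2 * (‖γ‖ * (D * (n * rate n))) := by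
    rw [sq, hnorm]; field_simp
  have k3 : 0 < ‖γ‖ * (D * (n * rate n)) := by
    rw [hnorm]; positivity
  linarith

end

end CoxShape

namespace CoxShape
open Function
variable {p : ℕ} {β₀ : Cov p} {y : ℕ → Obs p}

/-! ### Risk sums at nearby regression coefficients -/

theorem abs_exp_sub_one_le_mul (x : ℝ) : |Real.exp x - 1| ≤ |x| * Real.exp |x| := by
  rcases le_total 0 x with h | h
  · rw [abs_of_nonneg h, abs_of_nonneg (sub_nonneg.2 (Real.one_le_exp h))]
    have h1 := Real.add_one_le_exp (-x)
    have h2 : Real.exp (-x) * Real.exp x = 1 := by rw [← Real.exp_add]; simp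
    nlinarith [Real.exp_pos x]
  · rw [abs_of_nonpos h, abs_of_nonpos (sub_nonpos.2 (Real.exp_le_one_iff.2 h))]
    have h1 := Real.add_one_le_exp x
    have h2 := Real.one_le_exp (neg_nonneg.2 h)
    nlinarith

theorem abs_riskSum_sub_le {γ : Cov p} {δ : ℝ} (hδ : 0 < δ) (hγ : ‖γ‖ ≤ δ / 2) (n : ℕ)
    (y : ℕ → Obs p) (t : ℝ) :
    |riskSum n y (β₀ + γ) t - riskSum n y β₀ t| ≤ ‖γ‖ * (2 / δ) *
      ∑ j ∈ Finset.range n, Real.exp ⟪β₀, cov (y j)⟫ * Real.exp (δ * ‖cov (y j)‖) := by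
  rw [riskSum_add, riskSum, ← Finset.sum_sub_distrib, Finset.mul_sum]
  refine (Finset.abs_sum_le_sum_abs _ _).trans (Finset.sum_le_sum fun j _ => ?_)
  set z := ‖cov (y j)‖
  have hz : 0 ≤ z := norm_nonneg _
  have a1 : |⟪γ, cov (y j)⟫| ≤ ‖γ‖ * z := abs_real_inner_le_norm γ _
  have a2 : z ≤ 2 / δ * Real.exp (δ / 2 * z) := by
    have := Real.add_one_le_exp (δ / 2 * z)
    rw [div_mul_eq_mul_div, le_div_iff₀ hδ]
    linarith
  have a3 : |Real.exp ⟪γ, cov (y j)⟫ - 1| ≤ ‖γ‖ * (2 / δ) * Real.exp (δ * z) := by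
    calc _ ≤ |⟪γ, cov (y j)⟫| * Real.exp |⟪γ, cov (y j)⟫| := abs_exp_sub_one_le_mul _
      _ ≤ (‖γ‖ * (2 / δ * Real.exp (δ / 2 * z))) * Real.exp (δ / 2 * z) := by
          have := Real.exp_le_exp.2 (a1.trans (mul_le_mul_of_nonneg_right hγ hz))
          gcongr
          exact a1.trans (by gcongr)
      _ = ‖γ‖ * (2 / δ) * (Real.exp (δ / 2 * z) * Real.exp (δ / 2 * z)) := by ring
      _ = _ := by rw [← Real.exp_add]; ring_nf
  split_ifs
  · rw [← mul_sub_one, abs_mul, abs_of_pos (Real.exp_pos _)]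
    have := Real.exp_pos ⟪β₀, cov (y j)⟫
    nlinarith
  · rw [zero_mul, sub_zero, abs_zero]
    positivity

/-- By Jensen, the logarithm of the ratio of the risk sums is at least `-‖γ‖` times the weighted
mean of `‖Z‖`. By Jensen again, `δ` times that mean is at most the logarithm of the weighted
exponential moment, hence at most `log (V * M)`, since `V` bounds the reciprocal of the risk sum at
each event. This is a relative bound, useful where the risk sum is small. -/
theorem exp_mul_riskSum_le {n i : ℕ} (hi : i < n) (hind : ind (y i) = 1) (γ : Cov p) {δ V M : ℝ}
    (hδ : 0 < δ) (hV : invRiskSum n y β₀ ≤ V)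
    (hM : ∑ j ∈ Finset.range n, Real.exp ⟪β₀, cov (y j)⟫ * Real.exp (δ * ‖cov (y j)‖) ≤ M) :
    Real.exp (-(‖γ‖ * (Real.log (V * M) / δ))) * riskSum n y β₀ (time (y i)) ≤
      riskSum n y (β₀ + γ) (time (y i)) := by
  have hS := riskSum_pos hi y β₀ le_rfl
  have hw := fun j (_ : j ∈ Finset.range n) => riskWeight_nonneg n y β₀ (time (y i)) j
  have h1 := sum_riskWeight hi y β₀
  have hMpos : 0 < M := lt_of_lt_of_le (Finset.sum_pos (fun j _ => by positivity)
    ⟨i, Finset.mem_range.2 hi⟩) hM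
  have hSV : 1 / riskSum n y β₀ (time (y i)) ≤ V := by
    refine le_trans ?_ hV
    have := Finset.single_le_sum (f := fun i => if ind (y i) = 1 then
      1 / riskSum n y β₀ (time (y i)) else 0) (fun j _ => by
        split_ifs
        · exact one_div_nonneg.2 (riskSum_nonneg _ _ _ _)
        · exact le_rfl) (Finset.mem_range.2 hi)
    rw [if_pos hind] at this
    exact this
  have h2 := sum_weight_le_log (X := fun j => δ * ‖cov (y j)‖) hw h1
  have h3 : ∑ j ∈ Finset.range n, riskWeight n y β₀ (time (y i)) j * Real.exp (δ * ‖cov (y j)‖) ≤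
      V * M := by
    have : ∑ j ∈ Finset.range n, riskWeight n y β₀ (time (y i)) j * Real.exp (δ * ‖cov (y j)‖) ≤
        (1 / riskSum n y β₀ (time (y i))) *
        ∑ j ∈ Finset.range n, Real.exp ⟪β₀, cov (y j)⟫ * Real.exp (δ * ‖cov (y j)‖) := by
      rw [Finset.mul_sum]
      refine Finset.sum_le_sum fun j _ => ?_
      rw [riskWeight, ← mul_assoc, one_div_mul_eq_div]
      gcongr
      split_ifs <;> simp [(Real.exp_pos _).le]
    exact this.trans (mul_le_mul hSV hM (Finset.sum_nonneg fun j _ => by positivity)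
      ((by positivity : (0 : ℝ) ≤ 1 / riskSum n y β₀ (time (y i))).trans hSV))
  have h4 := h2.trans (Real.log_le_log (sum_weight_exp_pos (X := fun j => δ * ‖cov (y j)‖) hw h1)
      h3)
  have h5 := sum_weight_le_log (X := fun j => ⟪γ, cov (y j)⟫) hw h1
  rw [sum_riskWeight_mul_exp] at h5
  have h6 : -(‖γ‖ * (Real.log (V * M) / δ)) ≤
      ∑ j ∈ Finset.range n, riskWeight n y β₀ (time (y i)) j * ⟪γ, cov (y j)⟫ := by
    have h7 : -(‖γ‖ / δ * ∑ j ∈ Finset.range n,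
        riskWeight n y β₀ (time (y i)) j * (δ * ‖cov (y j)‖)) ≤
        ∑ j ∈ Finset.range n, riskWeight n y β₀ (time (y i)) j * ⟪γ, cov (y j)⟫ := by
      rw [Finset.mul_sum, ← Finset.sum_neg_distrib]
      refine Finset.sum_le_sum fun j hj => ?_
      have h8 := (abs_le.1 (abs_real_inner_le_norm γ (cov (y j)))).1
      calc _ = riskWeight n y β₀ (time (y i)) j * (-(‖γ‖ * ‖cov (y j)‖)) := by
            field_simp
        _ ≤ _ := mul_le_mul_of_nonneg_left h8 (hw j hj)
    refine le_trans ?_ h7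
    rw [neg_le_neg_iff, ← mul_div_assoc, div_mul_eq_mul_div]
    gcongr
  have h9 := Real.exp_le_exp.2 (h6.trans h5)
  have hS2 := riskSum_pos hi y (β₀ + γ) le_rfl
  rw [Real.exp_log (by positivity), le_div_iff₀ hS] at h9
  exact h9

section

variable {Q : Measure (Obs p)} {Λ : Measure ℝ} {τ : ℝ}

theorem CoxLaw.ae_time_ne (hQ : CoxLaw Q β₀ Λ τ) (t : ℝ) : ∀ᵐ o ∂Q, time o ≠ t := by
  filter_upwards [measure_eq_zero_iff_ae_notMem.1 (hQ.time_atom t)] with o ho using ho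

theorem CoxLaw.continuous_meanRisk (hQ : CoxLaw Q β₀ Λ τ) : Continuous (meanRisk Q β₀) := by
  refine continuous_iff_continuousAt.2 fun t => ?_
  refine continuousAt_of_dominated (bound := fun o => Real.exp ⟪β₀, cov o⟫)
    (Eventually.of_forall fun u => (measurable_risk β₀ u).aestronglyMeasurable)
    (Eventually.of_forall fun u => ae_of_all _ fun o => ?_) hQ.integrable_exp ?_
  · split_ifs
    · rw [Real.norm_of_nonneg (Real.exp_pos _).le]
    · simp [(Real.exp_pos _).le]
  · filter_upwards [hQ.ae_time_ne t] with o ho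
    rcases lt_or_gt_of_ne ho with h | h
    · refine continuousAt_const (y := (0 : ℝ)).congr ?_
      filter_upwards [eventually_gt_nhds h] with u hu
      rw [if_neg (not_le.2 hu)]
    · refine continuousAt_const (y := Real.exp ⟪β₀, cov o⟫).congr ?_
      filter_upwards [eventually_le_nhds h] with u hu
      rw [if_pos hu]

variable [IsFiniteMeasure Λ] [SFinite Q]

/-- Campbell's formula for functions of the event time. -/
theorem CoxLaw.lintegral_event (hQ : CoxLaw Q β₀ Λ τ) {h : ℝ → ENNReal} (hh : Measurable h) :
    ∫⁻ o, (if ind o = 1 then h (time o) else 0) ∂Q =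
      ∫⁻ t, h t * ENNReal.ofReal (meanRisk Q β₀ t) ∂Λ := by
  rw [hQ.campbell (fun t _ => h t) (hh.comp measurable_fst), lintegral_lintegral_swap]
  · refine lintegral_congr fun t => ?_
    have m : Measurable fun o : Obs p =>
        ENNReal.ofReal (if t ≤ time o then Real.exp ⟪β₀, cov o⟫ else 0) :=
      (measurable_risk β₀ t).ennreal_ofReal
    rw [meanRisk, ofReal_integral_eq_lintegral_ofReal (hQ.integrable_risk t)
      (ae_of_all _ fun o => by dsimp only; split_ifs <;> simp [(Real.exp_pos _).le]),
      ← lintegral_const_mul _ m]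
    refine lintegral_congr fun o => ?_
    split_ifs
    · rw [mul_comm]
    · simp
  · refine Measurable.aemeasurable (Measurable.ite (measurableSet_le (by fun_prop) (by fun_prop))
      (Measurable.mul (by fun_prop) (hh.comp measurable_snd)) measurable_const)

/-- The mean number of events in `(0, t]`. -/
noncomputable def meanEvents (Q : Measure (Obs p)) (β₀ : Cov p) (Λ : Measure ℝ) (t : ℝ) : ℝ :=
  ∫ u in (0 : ℝ)..t, meanRisk Q β₀ u ∂Λ

/-- The mean time at risk in `(0, t]`. -/
noncomputable def meanExposure (Q : Measure (Obs p)) (β₀ : Cov p) (t : ℝ) : ℝ :=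
  ∫ u in (0 : ℝ)..t, meanRisk Q β₀ u

theorem meanRisk_nonneg (Q : Measure (Obs p)) (β₀ : Cov p) (t : ℝ) : 0 ≤ meanRisk Q β₀ t :=
  integral_nonneg fun o => by dsimp only; split_ifs <;> simp [(Real.exp_pos _).le]

theorem CoxLaw.intervalIntegrable_meanRisk (hQ : CoxLaw Q β₀ Λ τ) (μ : Measure ℝ)
    [IsLocallyFiniteMeasure μ] (a b : ℝ) : IntervalIntegrable (meanRisk Q β₀) μ a b :=
  hQ.continuous_meanRisk.intervalIntegrable a b

theorem CoxLaw.integral_event (hQ : CoxLaw Q β₀ Λ τ) {h : ℝ → ℝ} (hh : Measurable h)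
    (h0 : ∀ t, 0 ≤ h t) {x : ℝ} (hx : 0 ≤ x) :
    ∫ o, (if ind o = 1 ∧ time o ≤ x then h (time o) else 0) ∂Q =
      ∫ t in (0 : ℝ)..x, h t * meanRisk Q β₀ t ∂Λ := by
  have m : Measurable fun o : Obs p => if ind o = 1 ∧ time o ≤ x then h (time o) else 0 :=
    Measurable.ite ((measurableSet_eq_fun measurable_ind measurable_const).inter
      (measurableSet_le measurable_time measurable_const)) (hh.comp measurable_time)
          measurable_const
  have key := hQ.lintegral_event (h := (Ioc 0 x).indicator fun t => ENNReal.ofReal (h t))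
    (hh.ennreal_ofReal.indicator measurableSet_Ioc)
  rw [intervalIntegral.integral_of_le hx, integral_eq_lintegral_of_nonneg_ae
    (ae_of_all _ fun o => by split_ifs <;> simp [h0]) m.aestronglyMeasurable,
    integral_eq_lintegral_of_nonneg_ae
    (ae_of_all _ fun t => mul_nonneg (h0 t) (meanRisk_nonneg _ _ _))
    (hh.mul hQ.continuous_meanRisk.measurable).aestronglyMeasurable]
  congr 1
  refine Eq.trans (lintegral_congr_ae ?_) (key.trans ?_)
  · filter_upwards [hQ.time_mem, hQ.ae_time_ne 0] with o h1 h2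
    have h3 : 0 < time o := lt_of_le_of_ne h1.1 h2.symm
    by_cases hi : ind o = 1 <;> by_cases ht : time o ≤ x <;> simp [hi, ht, h3, indicator]
  · rw [← lintegral_indicator measurableSet_Ioc]
    refine lintegral_congr fun t => ?_
    by_cases ht : t ∈ Ioc 0 x
    · rw [indicator_of_mem ht, indicator_of_mem ht, ENNReal.ofReal_mul (h0 t)]
    · rw [indicator_of_notMem ht, indicator_of_notMem ht, zero_mul]

variable {Ω : Type*} [MeasurableSpace Ω] {P : Measure Ω} [IsProbabilityMeasure P]
  {Y : ℕ → Ω → Obs p}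

/-- The sequence `b` converges to `β₀` at the rate `K * rate`. -/
def CloseSeq (β₀ : Cov p) (K : ℝ) (b : ℕ → Cov p) : Prop := ∀ᶠ n in atTop, ‖b n - β₀‖ ≤ K * rate n

theorem tendsto_const_mul_rate (K : ℝ) : Tendsto (fun n => K * rate n) atTop (𝓝 0) := by
  simpa using tendsto_rate.const_mul K

/-- The risk sums converge uniformly. -/
theorem eventually_abs_riskSum_sub_le (hY : IsSample Y P Q) (hQ : CoxLaw Q β₀ Λ τ) (hτ : 0 < τ)
    (K : ℝ) : ∀ᵐ ω ∂P, ∀ b, CloseSeq β₀ K b → ∀ ε > 0, ∀ᶠ n : ℕ in atTop, ∀ t ∈ Icc 0 τ,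
      |riskSum n (path Y ω) (b n) t / n - meanRisk Q β₀ t| ≤ ε := by
  obtain ⟨δ, hδ, hi⟩ := hQ.moment
  obtain ⟨W, hW0, hW⟩ := eventually_sum_moment_le hY hi
  have hgrid := ae_all_iff.2 fun k : ℕ => ae_all_iff.2 fun m : ℕ =>
    tendsto_riskSum_div hY hQ (0 + (τ - 0) * (k / m))
  filter_upwards [hW, hgrid] with ω h1 h2 b hb ε hε
  have h3 := eventually_uniform_of_antitoneOn (f := fun n t => riskSum n (path Y ω) β₀ t / n) hτ
    (fun n s _ t _ hst => div_le_div_of_nonneg_right (riskSum_antitone n (path Y ω) β₀ hst)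
      (Nat.cast_nonneg n))
    hQ.continuous_meanRisk.continuousOn (fun k m _ _ => h2 k m) (half_pos hε)
  have h4 : Tendsto (fun n => K * rate n * (2 / δ) * W) atTop (𝓝 0) := by
    simpa using ((tendsto_const_mul_rate K).mul_const (2 / δ)).mul_const W
  filter_upwards [h1, h3, hb, h4.eventually_le_const (half_pos hε),
    (tendsto_const_mul_rate K).eventually_le_const (half_pos hδ), eventually_gt_atTop 0]
    with n g1 g3 gb g4 g5 g0 t ht
  have hn : (0 : ℝ) < n := by positivity
  have k1 := abs_riskSum_sub_le (β₀ := β₀) hδ (gb.trans g5) n (path Y ω) t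
  rw [add_sub_cancel] at k1
  have k2 : |riskSum n (path Y ω) (b n) t / n - riskSum n (path Y ω) β₀ t / n| ≤ ε / 2 := by
    rw [← sub_div, abs_div, abs_of_pos hn, div_le_iff₀ hn]
    refine k1.trans ?_
    have k0 := (norm_nonneg _).trans gb
    calc _ ≤ K * rate n * (2 / δ) * (W * n) := by gcongr
      _ = K * rate n * (2 / δ) * W * n := by ring
      _ ≤ _ := by gcongr
  have k3 := g3 t ht
  have := abs_sub_le (riskSum n (path Y ω) (b n) t / n) (riskSum n (path Y ω) β₀ t / n)
    (meanRisk Q β₀ t)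
  linarith

/-- At the events, the risk sums are not much smaller than those at the true coefficients. -/
theorem eventually_riskSum_le_two_mul (hY : IsSample Y P Q) (hQ : CoxLaw Q β₀ Λ τ) {V : ℝ}
    (hV : ∀ᵐ ω ∂P, ∀ᶠ n in atTop, invRiskSum n (path Y ω) β₀ ≤ V) (hV0 : 0 < V) (K : ℝ) :
    ∀ᵐ ω ∂P, ∀ b, CloseSeq β₀ K b → ∀ᶠ n : ℕ in atTop, ∀ i < n, ind (path Y ω i) = 1 →
      riskSum n (path Y ω) β₀ (time (path Y ω i)) ≤
        2 * riskSum n (path Y ω) (b n) (time (path Y ω i)) := by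
  obtain ⟨δ, hδ, hi⟩ := hQ.moment
  obtain ⟨W, hW0, hW⟩ := eventually_sum_moment_le hY hi
  filter_upwards [hW, hV] with ω h1 h2 b hb
  -- The relative error is governed by `rate n * log n`; here a polynomial rate for the coefficients
  -- is indispensable.
  have h3 : Tendsto (fun n : ℕ => K / δ * (Real.log (V * W) * rate n + Real.log n * rate n)) atTop
      (𝓝 0) := by
    simpa using ((tendsto_rate.const_mul (Real.log (V * W))).add tendsto_log_mul_rate).const_mul
      (K / δ)
  have h4 : ∀ᶠ n : ℕ in atTop, 0 ≤ Real.log (V * (W * n)) := by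
    have : Tendsto (fun n : ℕ => V * (W * n)) atTop atTop :=
      (tendsto_natCast_atTop_atTop.const_mul_atTop hW0).const_mul_atTop hV0
    filter_upwards [this.eventually_ge_atTop 1] with n hn using Real.log_nonneg hn
  filter_upwards [h1, h2, hb, h3.eventually_le_const (Real.log_pos one_lt_two), h4,
    eventually_gt_atTop 0] with n g1 g2 gb g3 g4 g0 i hin hind
  have hn : (0 : ℝ) < n := by positivity
  have k1 := exp_mul_riskSum_le (β₀ := β₀) hin hind (b n - β₀) hδ g2 g1
  rw [add_sub_cancel] at k1
  have k2 : ‖b n - β₀‖ * (Real.log (V * (W * n)) / δ) ≤ Real.log 2 := by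
    refine le_trans ?_ g3
    calc _ ≤ K * rate n * (Real.log (V * (W * n)) / δ) := by gcongr
      _ = _ := by
        rw [← mul_assoc V W, Real.log_mul (by positivity) (by positivity)]; ring
  have k3 : 1 / 2 ≤ Real.exp (-(‖b n - β₀‖ * (Real.log (V * (W * n)) / δ))) := by
    rw [show (1 / 2 : ℝ) = Real.exp (-Real.log 2) by
      rw [Real.exp_neg, Real.exp_log two_pos, one_div]]
    exact Real.exp_le_exp.2 (neg_le_neg k2)
  have k4 := riskSum_nonneg n (path Y ω) β₀ (time (path Y ω i))
  nlinarith

theorem eventually_sum_inv_riskSum_close_le (hY : IsSample Y P Q) (hQ : CoxLaw Q β₀ Λ τ) {V : ℝ}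
    (hV : ∀ᵐ ω ∂P, ∀ᶠ n in atTop, invRiskSum n (path Y ω) β₀ ≤ V) (hV0 : 0 < V) (K : ℝ)
    {c B : ℝ} (hc : c < τ) (hB : 0 < B)
    (hΛ : ∀ u v, c ≤ u → u ≤ v → v ≤ τ → Λ (Icc u v) ≤ ENNReal.ofReal (B * (v - u))) :
    ∀ᵐ ω ∂P, ∀ b, CloseSeq β₀ K b → ∀ᶠ n : ℕ in atTop, ∑ i ∈ Finset.range n,
      (if ind (path Y ω i) = 1 ∧ c ≤ time (path Y ω i) then
        1 / riskSum n (path Y ω) (b n) (time (path Y ω i)) else 0) ≤ 320 * (B * (τ - c)) := by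
  filter_upwards [eventually_riskSum_le_two_mul hY hQ hV hV0 K,
    eventually_sum_inv_riskSum_le hY hQ hc hB hΛ] with ω h1 h2 b hb
  filter_upwards [h1 b hb, h2] with n g1 g2
  have : ∑ i ∈ Finset.range n, (if ind (path Y ω i) = 1 ∧ c ≤ time (path Y ω i) then
        1 / riskSum n (path Y ω) (b n) (time (path Y ω i)) else 0) ≤
      2 * ∑ i ∈ Finset.range n, (if ind (path Y ω i) = 1 ∧ c ≤ time (path Y ω i) then
        1 / riskSum n (path Y ω) β₀ (time (path Y ω i)) else 0) := by
    rw [Finset.mul_sum]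
    refine Finset.sum_le_sum fun i hi => ?_
    have hi' := Finset.mem_range.1 hi
    split_ifs with h
    · rw [mul_one_div, div_le_div_iff₀ (riskSum_pos hi' _ _ le_rfl) (riskSum_pos hi' _ _ le_rfl)]
      have := g1 i hi' h.1
      linarith
    · simp
  linarith

end

end CoxShape

namespace CoxShape
open Function
variable {p : ℕ} {β₀ : Cov p} {y : ℕ → Obs p}

/-! ### Uniform laws of large numbers -/

theorem eventMeasure_apply (n : ℕ) (y : ℕ → Obs p) {A : Set ℝ} (hA : MeasurableSet A) :
    eventMeasure n y A = ENNReal.ofReal (∑ i ∈ Finset.range n,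
      if ind (y i) = 1 then A.indicator (fun _ => (1 : ℝ)) (time (y i)) else 0) := by
  rw [eventMeasure, Measure.finsetSum_apply, ENNReal.ofReal_sum_of_nonneg]
  · refine Finset.sum_congr rfl fun i _ => ?_
    split_ifs
    · rw [Measure.dirac_apply' _ hA]
      by_cases h : time (y i) ∈ A <;> simp [h]
    · simp
  · intro i _
    split_ifs
    · exact indicator_nonneg (fun _ _ => zero_le_one) _
    · exact le_rfl

/-- The number of events up to time `t`. -/
noncomputable def eventCount (n : ℕ) (y : ℕ → Obs p) (t : ℝ) : ℝ :=
  ∑ i ∈ Finset.range n, if ind (y i) = 1 ∧ time (y i) ≤ t then 1 else 0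

theorem eventCount_mono (n : ℕ) (y : ℕ → Obs p) : Monotone (eventCount n y) := fun s t h =>
  Finset.sum_le_sum fun i _ => by
    split_ifs with h1 h2
    · exact le_rfl
    · exact absurd ⟨h1.1, h1.2.trans h⟩ h2
    · exact zero_le_one
    · exact le_rfl

theorem sum_time_eq_le_one (hinj : Injective fun i => time (y i)) (n : ℕ) (a : ℝ) :
    ∑ i ∈ Finset.range n, (if time (y i) = a then (1 : ℝ) else 0) ≤ 1 := by
  rw [Finset.sum_boole]
  have : ((Finset.range n).filter fun i => time (y i) = a).card ≤ 1 :=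
    Finset.card_le_one.2 fun i hi j hj => hinj
      ((Finset.mem_filter.1 hi).2.trans (Finset.mem_filter.1 hj).2.symm)
  exact_mod_cast this

/-- The difference of counts covers `(a, b]`; the summand `1` pays for a possible event at `a`,
unique because times are distinct. -/
theorem eventMeasure_Icc_le (hinj : Injective fun i => time (y i)) (n : ℕ) {a b : ℝ} (hab : a ≤ b) :
    eventMeasure n y (Icc a b) ≤ ENNReal.ofReal (eventCount n y b - eventCount n y a + 1) := by
  rw [eventMeasure_apply n y measurableSet_Icc]
  refine ENNReal.ofReal_le_ofReal ?_
  refine le_trans ?_ (add_le_add le_rfl (sum_time_eq_le_one hinj n a))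
  rw [eventCount, eventCount, ← Finset.sum_sub_distrib, ← Finset.sum_add_distrib]
  refine Finset.sum_le_sum fun i _ => ?_
  by_cases hi : ind (y i) = 1
  · rcases lt_trichotomy (time (y i)) a with h | h | h
    · simp [hi, h.le, h.le.trans hab, h.not_ge, h.ne]
    · simp [hi, h, hab]
    · simp [hi, h.le, h.not_ge, h.ne', indicator]
  · simp [hi]; split_ifs <;> simp

theorem le_eventMeasure_Ioo (hinj : Injective fun i => time (y i)) (n : ℕ) {a b : ℝ} :
    ENNReal.ofReal (eventCount n y b - eventCount n y a - 1) ≤ eventMeasure n y (Ioo a b) := by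
  rw [eventMeasure_apply n y measurableSet_Ioo]
  refine ENNReal.ofReal_le_ofReal ?_
  rw [sub_le_iff_le_add]
  refine le_trans ?_ (add_le_add le_rfl (sum_time_eq_le_one hinj n b))
  rw [eventCount, eventCount, ← Finset.sum_sub_distrib, ← Finset.sum_add_distrib]
  refine Finset.sum_le_sum fun i _ => ?_
  by_cases hi : ind (y i) = 1
  · rcases lt_trichotomy (time (y i)) b with h | h | h
    · by_cases ha : a < time (y i)
      · simp [hi, h, h.le, h.ne, ha, ha.not_ge, indicator]
      · simp [hi, h, h.le, h.ne, ha, not_lt.1 ha, indicator]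
    · simp [hi, h, indicator]
      split_ifs <;> norm_num
    · simp [hi, h.not_ge, h.not_gt, h.ne', indicator]
      split_ifs <;> norm_num
  · simp [hi]; split_ifs <;> simp

theorem riskMeasure_apply (n : ℕ) (y : ℕ → Obs p) (β : Cov p) {A : Set ℝ} (hA : MeasurableSet A) :
    riskMeasure n y β A = ∫⁻ t in A ∩ Ioi 0, ENNReal.ofReal (riskSum n y β t) := by
  have h : ∀ t, ENNReal.ofReal (riskSum n y β t) = ∑ i ∈ Finset.range n,
      ENNReal.ofReal (if t ≤ time (y i) then Real.exp ⟪β, cov (y i)⟫ else 0) := fun t =>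
    ENNReal.ofReal_sum_of_nonneg fun i _ => by split_ifs <;> positivity
  simp only [h]
  have m : ∀ i, Measurable fun t : ℝ =>
      ENNReal.ofReal (if t ≤ time (y i) then Real.exp ⟪β, cov (y i)⟫ else 0) := fun i =>
    (Measurable.ite measurableSet_Iic measurable_const measurable_const).ennreal_ofReal
  rw [lintegral_finsetSum _ fun i _ => m i, riskMeasure, Measure.finsetSum_apply]
  refine Finset.sum_congr rfl fun i _ => ?_
  have e : ∀ t : ℝ, ENNReal.ofReal (if t ≤ time (y i) then Real.exp ⟪β, cov (y i)⟫ else 0) =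
      (Iic (time (y i))).indicator (fun _ => ENNReal.ofReal (Real.exp ⟪β, cov (y i)⟫)) t := fun t
          => by
    by_cases ht : t ≤ time (y i) <;> simp [ht]
  simp only [e]
  rw [lintegral_indicator_const measurableSet_Iic, Measure.smul_apply, smul_eq_mul,
    Measure.restrict_apply hA, Measure.restrict_apply measurableSet_Iic]
  congr 2
  ext t
  simp only [mem_inter_iff, mem_Ioc, mem_Iic, mem_Ioi]
  tauto

section

variable {Q : Measure (Obs p)} {Λ : Measure ℝ} {τ : ℝ} [IsFiniteMeasure Λ] [SFinite Q]

theorem CoxLaw.meanExposure_sub (hQ : CoxLaw Q β₀ Λ τ) (a b : ℝ) :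
    meanExposure Q β₀ b - meanExposure Q β₀ a = ∫ u in a..b, meanRisk Q β₀ u :=
  intervalIntegral.integral_interval_sub_left (hQ.intervalIntegrable_meanRisk _ _ _)
    (hQ.intervalIntegrable_meanRisk _ _ _)

theorem CoxLaw.meanEvents_sub (hQ : CoxLaw Q β₀ Λ τ) (a b : ℝ) :
    meanEvents Q β₀ Λ b - meanEvents Q β₀ Λ a = ∫ u in a..b, meanRisk Q β₀ u ∂Λ :=
  intervalIntegral.integral_interval_sub_left (hQ.intervalIntegrable_meanRisk _ _ _)
    (hQ.intervalIntegrable_meanRisk _ _ _)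

theorem CoxLaw.riskMeasure_Icc_le (hQ : CoxLaw Q β₀ Λ τ) {n : ℕ} {β : Cov p} {ε a b : ℝ}
    (hn : 0 < n) (h : ∀ t ∈ Icc 0 τ, |riskSum n y β t / n - meanRisk Q β₀ t| ≤ ε) (ha : 0 ≤ a)
    (hab : a ≤ b) (hb : b ≤ τ) : riskMeasure n y β (Icc a b) ≤
      ENNReal.ofReal (n * (meanExposure Q β₀ b - meanExposure Q β₀ a + ε * (b - a))) := by
  have hn' : (0 : ℝ) < n := by positivity
  have hε : 0 ≤ ε := (abs_nonneg _).trans (h a ⟨ha, hab.trans hb⟩)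
  have hi : IntegrableOn (fun t => n * (meanRisk Q β₀ t + ε)) (Icc a b) :=
    ((hQ.continuous_meanRisk.add continuous_const).const_mul _).integrableOn_Icc
  have e : (n : ℝ) * ((∫ t in a..b, meanRisk Q β₀ t) + ε * (b - a)) =
      ∫ t in Icc a b, n * (meanRisk Q β₀ t + ε) := by
    rw [integral_Icc_eq_integral_Ioc, ← intervalIntegral.integral_of_le hab,
      intervalIntegral.integral_const_mul, intervalIntegral.integral_add
      (hQ.intervalIntegrable_meanRisk _ _ _) (by simp)]
    simp [mul_comm]
  rw [riskMeasure_apply n y β measurableSet_Icc, hQ.meanExposure_sub]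
  rw [e, ofReal_integral_eq_lintegral_ofReal hi (ae_of_all _ fun t =>
    mul_nonneg hn'.le (add_nonneg (meanRisk_nonneg _ _ _) hε))]
  refine (lintegral_mono_set inter_subset_left).trans (setLIntegral_mono' measurableSet_Icc
    fun t ht => ENNReal.ofReal_le_ofReal ?_)
  have := (abs_le.1 (h t ⟨ha.trans ht.1, ht.2.trans hb⟩)).2
  have h2 : riskSum n y β t / n ≤ meanRisk Q β₀ t + ε := by linarith
  rw [div_le_iff₀ hn'] at h2
  linarith

theorem ofReal_integral_le_lintegral {α : Type*} [MeasurableSpace α] {μ : Measure α} {f : α → ℝ}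
    (hf : Integrable f μ) : ENNReal.ofReal (∫ a, f a ∂μ) ≤ ∫⁻ a, ENNReal.ofReal (f a) ∂μ := by
  rw [integral_eq_lintegral_pos_part_sub_lintegral_neg_part hf]
  refine le_trans (ENNReal.ofReal_le_ofReal (sub_le_self _ ENNReal.toReal_nonneg))
    ENNReal.ofReal_toReal_le

theorem CoxLaw.le_riskMeasure_Ioo (hQ : CoxLaw Q β₀ Λ τ) {n : ℕ} {β : Cov p} {ε a b : ℝ}
    (hn : 0 < n) (h : ∀ t ∈ Icc 0 τ, |riskSum n y β t / n - meanRisk Q β₀ t| ≤ ε) (ha : 0 ≤ a)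
    (hab : a ≤ b) (hb : b ≤ τ) :
    ENNReal.ofReal (n * (meanExposure Q β₀ b - meanExposure Q β₀ a - ε * (b - a))) ≤
      riskMeasure n y β (Ioo a b) := by
  have hn' : (0 : ℝ) < n := by positivity
  have hi : IntegrableOn (fun t => n * (meanRisk Q β₀ t - ε)) (Ioo a b) :=
    ((hQ.continuous_meanRisk.sub continuous_const).const_mul _).integrableOn_Icc.mono_set
      Ioo_subset_Icc_self
  have e : (n : ℝ) * ((∫ t in a..b, meanRisk Q β₀ t) - ε * (b - a)) =
      ∫ t in Ioo a b, n * (meanRisk Q β₀ t - ε) := by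
    rw [← integral_Ioc_eq_integral_Ioo, ← intervalIntegral.integral_of_le hab,
      intervalIntegral.integral_const_mul, intervalIntegral.integral_sub
      (hQ.intervalIntegrable_meanRisk _ _ _) (by simp)]
    simp [mul_comm]
  have hs : Ioo a b ⊆ Ioi 0 := fun t ht => ha.trans_lt ht.1
  rw [riskMeasure_apply n y β measurableSet_Ioo, hQ.meanExposure_sub, e, inter_eq_left.2 hs]
  refine (ofReal_integral_le_lintegral hi).trans (setLIntegral_mono' measurableSet_Ioo
    fun t ht => ENNReal.ofReal_le_ofReal ?_)
  have := (abs_le.1 (h t ⟨ha.trans ht.1.le, ht.2.le.trans hb⟩)).1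
  have h2 : meanRisk Q β₀ t - ε ≤ riskSum n y β t / n := by linarith
  rw [le_div_iff₀ hn'] at h2
  linarith

variable [NullSingletonClass Λ]

theorem CoxLaw.continuous_meanEvents (hQ : CoxLaw Q β₀ Λ τ) : Continuous (meanEvents Q β₀ Λ) :=
  intervalIntegral.continuous_primitive (fun a b => hQ.intervalIntegrable_meanRisk Λ a b) 0

variable {Ω : Type*} [MeasurableSpace Ω] {P : Measure Ω} [IsProbabilityMeasure P]
  {Y : ℕ → Ω → Obs p}

theorem eventually_abs_eventCount_sub_le (hY : IsSample Y P Q) (hQ : CoxLaw Q β₀ Λ τ)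
    (hτ : 0 < τ) : ∀ᵐ ω ∂P, ∀ ε > 0, ∀ᶠ n : ℕ in atTop, ∀ t ∈ Icc 0 τ,
      |eventCount n (path Y ω) t / n - meanEvents Q β₀ Λ t| ≤ ε := by
  have := hY.isProbabilityMeasure
  have hx : ∀ x, 0 ≤ x → ∀ᵐ ω ∂P, Tendsto (fun n : ℕ => eventCount n (path Y ω) x / n) atTop
      (𝓝 (meanEvents Q β₀ Λ x)) := by
    intro x hx
    have m : Measurable fun o : Obs p => if ind o = 1 ∧ time o ≤ x then (1 : ℝ) else 0 :=
      Measurable.ite ((measurableSet_eq_fun measurable_ind measurable_const).inter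
        (measurableSet_le measurable_time measurable_const)) measurable_const measurable_const
    have h1 := hY.tendsto_average m ((integrable_const (1 : ℝ)).mono' m.aestronglyMeasurable
      (ae_of_all _ fun o => by split_ifs <;> simp))
    rw [hQ.integral_event (h := fun _ => 1) measurable_const (fun _ => zero_le_one) hx] at h1
    simp only [one_mul] at h1
    exact h1
  have hgrid := ae_all_iff.2 fun k : ℕ => ae_all_iff.2 fun m : ℕ =>
    hx (0 + (τ - 0) * (k / m)) (by rw [zero_add, sub_zero]; positivity)
  filter_upwards [hgrid] with ω h ε hε
  exact eventually_uniform_of_monotoneOn (f := fun n t => eventCount n (path Y ω) t / n) hτ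
    (fun n s _ t _ hst => div_le_div_of_nonneg_right (eventCount_mono n (path Y ω) hst)
      (Nat.cast_nonneg n)) hQ.continuous_meanEvents.continuousOn (fun k m _ _ => h k m) hε

/-- The exceptional null set is chosen before the sequence `b`, so that `b` may later depend on the
data in any way. -/
theorem eventually_sampleClose (hY : IsSample Y P Q) (hQ : CoxLaw Q β₀ Λ τ) (hτ : 0 < τ) (K : ℝ) :
    ∀ᵐ ω ∂P, ∀ b, CloseSeq β₀ K b → ∀ e > 0, ∀ᶠ n : ℕ in atTop,
      SampleClose n (path Y ω) (b n) (meanEvents Q β₀ Λ) (meanExposure Q β₀) τ e := by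
  filter_upwards [eventually_abs_riskSum_sub_le hY hQ hτ K, eventually_abs_eventCount_sub_le hY hQ
      hτ,
    ae_injective_time hY hQ, hY.ae_forall hQ.time_mem] with ω h1 h2 hinj hmem b hb e he
  -- Two end points with error `e / 4` each use up `e / 2`, and the single event at an end point is
  -- at most `n * e / 2` once `n ≥ 2 / e`.
  filter_upwards [h1 b hb (e / τ) (by positivity), h2 (e / 4) (by positivity),
    eventually_gt_atTop 0, tendsto_natCast_atTop_atTop.eventually_ge_atTop (2 / e)]
    with n g1 g2 g0 gn
  have hn : (0 : ℝ) < n := by positivity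
  rw [div_le_iff₀ he] at gn
  have hcount : ∀ t ∈ Icc 0 τ, n * (meanEvents Q β₀ Λ t - e / 4) ≤ eventCount n (path Y ω) t ∧
      eventCount n (path Y ω) t ≤ n * (meanEvents Q β₀ Λ t + e / 4) := fun t ht => by
    have := abs_le.1 (g2 t ht)
    constructor
    · have h3 : meanEvents Q β₀ Λ t - e / 4 ≤ eventCount n (path Y ω) t / n := by linarith
      rw [le_div_iff₀ hn] at h3
      linarith
    · have h3 : eventCount n (path Y ω) t / n ≤ meanEvents Q β₀ Λ t + e / 4 := by linarith
      rw [div_le_iff₀ hn] at h3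
      linarith
  have heτ : ∀ a b : ℝ, 0 ≤ a → b ≤ τ → e / τ * (b - a) ≤ e := fun a b ha hb => by
    rw [div_mul_eq_mul_div, div_le_iff₀ hτ]; nlinarith
  refine ⟨fun i _ => Ico_subset_Icc_self (hmem i), fun u v hu huv hv => ?_,
    fun u v hu huv hv => ?_, fun u v hu huv hv => ?_, fun u v hu huv hv => ?_⟩
  · refine (eventMeasure_Icc_le hinj n huv).trans (ENNReal.ofReal_le_ofReal ?_)
    have k1 := (hcount v ⟨hu.trans huv, hv⟩).2
    have k2 := (hcount u ⟨hu, huv.trans hv⟩).1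
    linarith
  · refine le_trans (ENNReal.ofReal_le_ofReal ?_) (le_eventMeasure_Ioo hinj n)
    have k1 := (hcount v ⟨hu.trans huv, hv⟩).1
    have k2 := (hcount u ⟨hu, huv.trans hv⟩).2
    linarith
  · refine (hQ.riskMeasure_Icc_le g0 g1 hu huv hv).trans (ENNReal.ofReal_le_ofReal ?_)
    have := heτ u v hu hv
    gcongr
  · refine le_trans (ENNReal.ofReal_le_ofReal ?_) (hQ.le_riskMeasure_Ioo g0 g1 hu huv hv)
    have := heτ u v hu hv
    gcongr

/-! ### Consistency of the Breslow estimator -/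

theorem breslow_mono (n : ℕ) (y : ℕ → Obs p) (β : Cov p) : Monotone (breslow n y β) := fun s t h =>
  Finset.sum_le_sum fun i _ => by
    split_ifs with h1 h2
    · exact le_rfl
    · exact absurd ⟨h1.1, h1.2.trans h⟩ h2
    · exact one_div_nonneg.2 (riskSum_nonneg _ _ _ _)
    · exact le_rfl

/-- On `[0, x]` the mean risk is bounded away from zero. The average over events of its reciprocal
converges to the integral of one against `Λ`, and replacing it by the risk sum divided by `n` is
uniformly harmless. -/
theorem tendsto_breslow_of_nonneg (hY : IsSample Y P Q) (hQ : CoxLaw Q β₀ Λ τ) (hτ : 0 < τ) (K : ℝ)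
    {x : ℝ}
    (hx : 0 ≤ x) (hxτ : x < τ) : ∀ᵐ ω ∂P, ∀ b, CloseSeq β₀ K b →
      Tendsto (fun n => breslow n (path Y ω) (b n) x) atTop (𝓝 (Λ.real (Ioc 0 x))) := by
  have := hY.isProbabilityMeasure
  have hs := hQ.meanRisk_pos hxτ
  -- The maximum keeps `h` bounded everywhere and is inactive for `t ≤ x`, the mean risk being
  -- nonincreasing.
  set h : ℝ → ℝ := fun t => 1 / max (meanRisk Q β₀ t) (meanRisk Q β₀ x) with hh
  have hm : Measurable h :=
    measurable_const.div (hQ.continuous_meanRisk.measurable.max measurable_const)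
  have h0 : ∀ t, 0 ≤ h t := fun t => one_div_nonneg.2 (le_max_of_le_right hs.le)
  have hbd : ∀ t, h t ≤ 1 / meanRisk Q β₀ x := fun t =>
    one_div_le_one_div_of_le hs (le_max_right _ _)
  have m : Measurable fun o : Obs p => if ind o = 1 ∧ time o ≤ x then h (time o) else 0 :=
    Measurable.ite ((measurableSet_eq_fun measurable_ind measurable_const).inter
      (measurableSet_le measurable_time measurable_const)) (hm.comp measurable_time)
          measurable_const
  have h1 := hY.tendsto_average m ((integrable_const (1 / meanRisk Q β₀ x)).mono'
    m.aestronglyMeasurable (ae_of_all _ fun o => by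
      split_ifs
      · rw [Real.norm_of_nonneg (h0 _)]; exact hbd _
      · rw [norm_zero]; positivity))
  have e : ∫ t in (0 : ℝ)..x, h t * meanRisk Q β₀ t ∂Λ = Λ.real (Ioc 0 x) := by
    rw [intervalIntegral.integral_of_le hx]
    have : ∫ t in Ioc 0 x, h t * meanRisk Q β₀ t ∂Λ = ∫ _t in Ioc 0 x, (1 : ℝ) ∂Λ := by
      refine setIntegral_congr_fun measurableSet_Ioc fun t ht => ?_
      have h2 := hQ.meanRisk_antitone ht.2
      simp only [hh]
      rw [max_eq_left h2, one_div_mul_cancel (hs.trans_le h2).ne']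
    rw [this]; simp
  rw [hQ.integral_event hm h0 hx, e] at h1
  filter_upwards [h1, eventually_abs_riskSum_sub_le hY hQ hτ K, hY.ae_forall hQ.time_mem]
    with ω h1 h2 hmem b hb
  refine h1.congr_dist ?_
  rw [Metric.tendsto_nhds]
  intro ε hε
  set s := meanRisk Q β₀ x with hsx
  set ε' := min (s / 2) (ε * s ^ 2 / 4) with hε'
  have hε'0 : 0 < ε' := by positivity
  filter_upwards [h2 b hb ε' hε'0, eventually_gt_atTop 0] with n g g0
  have hn : (0 : ℝ) < n := by positivity
  rw [Real.dist_0_eq_abs, abs_of_nonneg dist_nonneg, Real.dist_eq, breslow, Finset.sum_div,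
    ← Finset.sum_sub_distrib]
  refine (Finset.abs_sum_le_sum_abs _ _).trans_lt ?_
  refine (Finset.sum_le_card_nsmul _ _ (ε / (2 * n)) fun i hi => ?_).trans_lt ?_
  · split_ifs with hi
    · have k1 := g (time (path Y ω i)) ⟨(hmem i).1, (hmem i).2.le⟩
      have k2 := hQ.meanRisk_antitone hi.2
      simp only [hh]
      rw [max_eq_left k2]
      set r := riskSum n (path Y ω) (b n) (time (path Y ω i)) / n with hr
      set u := meanRisk Q β₀ (time (path Y ω i)) with hu
      have k3 : s / 2 ≤ r := by
        have := (abs_le.1 k1).1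
        have := min_le_left (s / 2) (ε * s ^ 2 / 4)
        linarith
      have hr0 : 0 < r := (half_pos hs).trans_le k3
      have hu0 : 0 < u := hs.trans_le k2
      have e2 : 1 / riskSum n (path Y ω) (b n) (time (path Y ω i)) = 1 / r / n := by
        rw [hr]
        rcases eq_or_ne (riskSum n (path Y ω) (b n) (time (path Y ω i))) 0 with h0 | h0
        · rw [h0]; simp
        · field_simp
      rw [e2, ← sub_div, abs_div, abs_of_pos hn, div_sub_div _ _ hu0.ne' hr0.ne', abs_div,
        abs_of_pos (mul_pos hu0 hr0), one_mul, mul_one, div_div, div_le_div_iff₀ (by positivity)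
        (by positivity)]
      have k4 : |r - u| ≤ ε * s ^ 2 / 4 := k1.trans (min_le_right _ _)
      have k5 : s * (s / 2) ≤ u * r := mul_le_mul k2 k3 (by positivity) hu0.le
      calc |r - u| * (2 * n) ≤ ε * s ^ 2 / 4 * (2 * n) := by gcongr
        _ = ε * (s * (s / 2) * n) := by ring
        _ ≤ ε * (u * r * n) := by gcongr
    · simp; positivity
  · rw [Finset.card_range, nsmul_eq_mul]
    have : (n : ℝ) * (ε / (2 * n)) = ε / 2 := by field_simp
    rw [this]
    exact half_lt_self hε

theorem continuous_real_Ioc (Λ : Measure ℝ) [IsFiniteMeasure Λ] [NullSingletonClass Λ] :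
    ContinuousOn (fun x => Λ.real (Ioc 0 x)) (Ici 0) := by
  have h := intervalIntegral.continuous_primitive (μ := Λ) (f := fun _ => (1 : ℝ))
    (fun a b => intervalIntegrable_const) 0
  refine h.continuousOn.congr fun x hx => ?_
  change Λ.real (Ioc 0 x) = ∫ _ in (0 : ℝ)..x, (1 : ℝ) ∂Λ
  rw [intervalIntegral.integral_of_le hx]
  simp

/-- One null set for all `x`: countably many grid points on intervals exhausting `[0, τ)` suffice,
by monotonicity and continuity of the limit. -/
theorem tendsto_breslow (hY : IsSample Y P Q) (hQ : CoxLaw Q β₀ Λ τ) (hτ : 0 < τ) (K : ℝ) :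
    ∀ᵐ ω ∂P, ∀ b, CloseSeq β₀ K b → ∀ x, 0 ≤ x → x < τ →
      Tendsto (fun n => breslow n (path Y ω) (b n) x) atTop (𝓝 (Λ.real (Ioc 0 x))) := by
  have hc : ∀ j : ℕ, 0 < τ * (1 - 1 / (j + 2)) ∧ τ * (1 - 1 / (j + 2)) < τ := fun j => by
    have h1 : 1 / ((j : ℝ) + 2) < 1 := by rw [div_lt_one (by positivity)]; linarith
    have h2 : 0 < 1 / ((j : ℝ) + 2) := by positivity
    exact ⟨mul_pos hτ (by linarith), mul_lt_of_lt_one_right hτ (by linarith)⟩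
  have hgrid : ∀ j k m : ℕ, ∀ᵐ ω ∂P, 0 < m → k ≤ m → ∀ b, CloseSeq β₀ K b →
      Tendsto (fun n => breslow n (path Y ω) (b n) (0 + (τ * (1 - 1 / (j + 2)) - 0) * (k / m)))
        atTop (𝓝 (Λ.real (Ioc 0 (0 + (τ * (1 - 1 / (j + 2)) - 0) * (k / m))))) := by
    intro j k m
    by_cases hkm : 0 < m ∧ k ≤ m
    · have h1 : (k : ℝ) / m ≤ 1 := by
        rw [div_le_one (by exact_mod_cast hkm.1)]; exact_mod_cast hkm.2
      have h2 : 0 ≤ (k : ℝ) / m := by positivity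
      have := tendsto_breslow_of_nonneg (x := 0 + (τ * (1 - 1 / (j + 2)) - 0) * (k / m)) hY hQ hτ K
        (by rw [zero_add, sub_zero]; exact mul_nonneg (hc j).1.le h2)
        (by rw [zero_add, sub_zero]; exact (mul_le_of_le_one_right (hc j).1.le h1).trans_lt (hc
            j).2)
      exact this.mono fun ω hω _ _ => hω
    · exact ae_of_all _ fun ω h1 h2 => absurd ⟨h1, h2⟩ hkm
  have hgrid' := ae_all_iff.2 fun j => ae_all_iff.2 fun k => ae_all_iff.2 fun m => hgrid j k m
  filter_upwards [hgrid'] with ω hω b hb x hx hxτ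
  obtain ⟨j, hj⟩ : ∃ j : ℕ, x ≤ τ * (1 - 1 / (j + 2)) := by
    obtain ⟨j, hj⟩ := exists_nat_one_div_lt (div_pos (sub_pos.2 hxτ) hτ)
    refine ⟨j, ?_⟩
    have h1 : 1 / ((j : ℝ) + 2) ≤ 1 / (j + 1) := one_div_le_one_div_of_le (by positivity) (by
        linarith)
    rw [lt_div_iff₀ hτ] at hj
    nlinarith
  have key := fun ε hε => eventually_uniform_of_monotoneOn
    (f := fun n => breslow n (path Y ω) (b n)) (g := fun x => Λ.real (Ioc 0 x)) (hc j).1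
    (fun n => (breslow_mono _ _ _).monotoneOn _)
    ((continuous_real_Ioc Λ).mono Icc_subset_Ici_self) (fun k m hm hk => hω j k m hm hk b hb)
    (ε := ε) hε
  rw [Metric.tendsto_nhds]
  intro ε hε
  filter_upwards [key (ε / 2) (half_pos hε)] with n hn
  rw [Real.dist_eq]
  linarith [hn x ⟨hx, hj⟩]

end

end CoxShape

namespace CoxShape
open Function
variable {p : ℕ} {β₀ : Cov p} {y : ℕ → Obs p}

/-! ### Paths along which the estimators are consistent -/

section

variable {β β' : Cov p}

theorem riskSum_congr (h : ∀ i, ⟪β', cov (y i)⟫ = ⟪β, cov (y i)⟫) (n : ℕ) :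
    riskSum n y β' = riskSum n y β := by
  funext x; simp only [riskSum, h]

theorem breslow_congr (h : ∀ i, ⟪β', cov (y i)⟫ = ⟪β, cov (y i)⟫) (n : ℕ) :
    breslow n y β' = breslow n y β := by
  funext x; simp only [breslow, riskSum_congr h]

theorem riskMeasure_congr (h : ∀ i, ⟪β', cov (y i)⟫ = ⟪β, cov (y i)⟫) (n : ℕ) :
    riskMeasure n y β' = riskMeasure n y β := by
  simp only [riskMeasure, h]

theorem SampleClose.congr (h : ∀ i, ⟪β', cov (y i)⟫ = ⟪β, cov (y i)⟫)
    {n : ℕ} {H S : ℝ → ℝ} {τ e : ℝ} (hs : SampleClose n y β' H S τ e) :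
    SampleClose n y β H S τ e :=
  ⟨hs.time_mem, hs.event_le, hs.le_event, riskMeasure_congr h n ▸ hs.risk_le,
    riskMeasure_congr h n ▸ hs.le_risk⟩

end

/-- The properties of a data sequence `y` and of the estimates `β n` of the regression
coefficients from which the consistency of the estimators of the baseline hazard follows. -/
structure ConsistentPath (Q : Measure (Obs p)) (β₀ : Cov p) (Λ : Measure ℝ) (τ : ℝ)
    (y : ℕ → Obs p) (β : ℕ → Cov p) : Prop where
  close : ∀ e > 0, ∀ᶠ n in atTop,
    SampleClose n y (β n) (meanEvents Q β₀ Λ) (meanExposure Q β₀) τ e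
  tendsto_breslow : ∀ x, 0 ≤ x → x < τ →
    Tendsto (fun n => breslow n y (β n) x) atTop (𝓝 (Λ.real (Ioc 0 x)))
  tail : ∀ ε > 0, ∃ c, 0 < c ∧ c < τ ∧ ∀ᶠ n in atTop, ∀ u,
    breslow n y (β n) u ≤ breslow n y (β n) c + ε
  reach : ∀ t < τ, ∀ᶠ n in atTop, ∃ i < n, t ≤ time (y i)
  time_mem : ∀ i, time (y i) ∈ Ico 0 τ

theorem breslow_le_add (n : ℕ) (y : ℕ → Obs p) (β : Cov p) (c u : ℝ) :
    breslow n y β u ≤ breslow n y β c + ∑ i ∈ Finset.range n,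
      (if ind (y i) = 1 ∧ c ≤ time (y i) then 1 / riskSum n y β (time (y i)) else 0) := by
  rw [breslow, breslow, ← Finset.sum_add_distrib]
  refine Finset.sum_le_sum fun i _ => ?_
  have h0 : 0 ≤ 1 / riskSum n y β (time (y i)) := one_div_nonneg.2 (riskSum_nonneg _ _ _ _)
  by_cases h1 : ind (y i) = 1
  · rcases le_total (time (y i)) c with h2 | h2
    · by_cases h3 : c ≤ time (y i) <;> by_cases h4 : time (y i) ≤ u <;>
      simp only [h1, h2, h3, h4, true_and, if_true, if_false] <;> linarith
    · by_cases h3 : time (y i) ≤ c <;> by_cases h4 : time (y i) ≤ u <;>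
      simp only [h1, h2, h3, h4, true_and, if_true, if_false] <;> linarith
  · simp [h1]

/-- The bound on `Λ` by a multiple of length is needed only near `τ`, so a nonincreasing hazard may
be unbounded at zero. The tail bound uses a countable sequence of left end points increasing to `τ`.
-/
theorem ae_consistentPath {Q : Measure (Obs p)} {Λ : Measure ℝ} {τ : ℝ} [IsFiniteMeasure Λ]
    [SFinite Q] [NullSingletonClass Λ] {Ω : Type*} [MeasurableSpace Ω] {P : Measure Ω}
    [IsProbabilityMeasure P] {Y : ℕ → Ω → Obs p} (hY : IsSample Y P Q) (hQ : CoxLaw Q β₀ Λ τ)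
    (hτ : 0 < τ) {c₀ B : ℝ} (hc₀ : c₀ < τ) (hB : 0 < B)
    (hΛ : ∀ u v, c₀ ≤ u → u ≤ v → v ≤ τ → Λ (Icc u v) ≤ ENNReal.ofReal (B * (v - u))) :
    ∀ᵐ ω ∂P, ∀ β : ℕ → Cov p, (∀ n, IsMPLE n (path Y ω) (β n)) →
      ConsistentPath Q β₀ Λ τ (path Y ω) β := by
  obtain ⟨V, hV0, hV⟩ := eventually_invRiskSum_le hY hQ hc₀ hB hΛ
  obtain ⟨K, hK, hrate⟩ := exists_rate_of_isMPLE hY hQ hV hV0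
  set m := max c₀ 0 with hm
  have hmτ : m < τ := max_lt hc₀ hτ
  obtain ⟨c, hc⟩ : ∃ c : ℕ → ℝ, ∀ k, c k = τ - (τ - m) * (1 / (k + 2)) := ⟨_, fun _ => rfl⟩
  have hcm : ∀ k, m < c k ∧ c k < τ := fun k => by
    have h1 : 1 / ((k : ℝ) + 2) < 1 := by rw [div_lt_one (by positivity)]; linarith
    have h2 : 0 < 1 / ((k : ℝ) + 2) := by positivity
    have h3 := sub_pos.2 hmτ
    rw [hc]; constructor <;> nlinarith
  have htail := ae_all_iff.2 fun k => eventually_sum_inv_riskSum_close_le hY hQ hV hV0 K (hcm k).2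
      hB
    fun u v hu => hΛ u v ((le_max_left c₀ 0).trans ((hcm k).1.le.trans hu))
  filter_upwards [hrate, htail, eventually_sampleClose hY hQ hτ K, tendsto_breslow hY hQ hτ K,
    tendsto_riskSum_atTop hY hQ, hY.ae_forall hQ.time_mem] with ω h1 h2 h3 h4 h5 h6 β hβ
  -- The estimate itself may be far from `β₀` in null directions. It is exchanged for a close one
  -- with the same linear predictors, hence the same risk sums and Breslow estimator.
  obtain ⟨b, hb⟩ : ∃ b : ℕ → Cov p, ∀ n, (∃ b' : Cov p, ‖b' - β₀‖ ≤ K * rate n ∧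
      ∀ i, ⟪b', cov (path Y ω i)⟫ = ⟪β n, cov (path Y ω i)⟫) → ‖b n - β₀‖ ≤ K * rate n ∧
      ∀ i, ⟪b n, cov (path Y ω i)⟫ = ⟪β n, cov (path Y ω i)⟫ := by
    refine ⟨fun n => Classical.epsilon fun b' => ‖b' - β₀‖ ≤ K * rate n ∧
      ∀ i, ⟪b', cov (path Y ω i)⟫ = ⟪β n, cov (path Y ω i)⟫, fun n h => Classical.epsilon_spec h⟩
  have hb' : ∀ᶠ n in atTop, ‖b n - β₀‖ ≤ K * rate n ∧
      ∀ i, ⟪b n, cov (path Y ω i)⟫ = ⟪β n, cov (path Y ω i)⟫ :=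
    h1.mono fun n hn => hb n (hn _ (hβ n))
  have hclose : CloseSeq β₀ K b := hb'.mono fun n hn => hn.1
  refine ⟨fun e he => ?_, fun x hx hxτ => ?_, fun ε hε => ?_, fun t ht => ?_, h6⟩
  · filter_upwards [h3 b hclose e he, hb'] with n g1 g2
    exact g1.congr g2.2
  · refine (h4 b hclose x hx hxτ).congr' ?_
    filter_upwards [hb'] with n g
    rw [breslow_congr g.2]
  · obtain ⟨k, hk⟩ : ∃ k : ℕ, 320 * (B * (τ - c k)) ≤ ε := by
      have h0 : 0 < 320 * (B * (τ - m)) := by have := sub_pos.2 hmτ; positivity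
      obtain ⟨k, hk⟩ := exists_nat_one_div_lt (div_pos hε h0)
      refine ⟨k, ?_⟩
      have h1 : 1 / ((k : ℝ) + 2) ≤ 1 / (k + 1) :=
        one_div_le_one_div_of_le (by positivity) (by linarith)
      rw [lt_div_iff₀ h0] at hk
      rw [hc]
      nlinarith
    refine ⟨c k, (le_max_right c₀ 0).trans_lt (hcm k).1, (hcm k).2, ?_⟩
    filter_upwards [h2 k b hclose, hb'] with n g1 g2 u
    rw [← breslow_congr g2.2]
    exact (breslow_le_add _ _ _ _ _).trans (by linarith)
  · filter_upwards [(h5 t ht).eventually_gt_atTop 0] with n hn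
    by_contra hcon
    push Not at hcon
    refine hn.ne' (Finset.sum_eq_zero fun i hi => if_neg (hcon i (Finset.mem_range.1 hi)).not_ge)

end CoxShape

namespace CoxShape
open Function
variable {p : ℕ} {β₀ : Cov p} {lam0 : ℝ → ℝ} {τ a b k : ℝ}

/-! ### The baseline hazard up to the end of follow-up -/

/-- The measure with density `lam0` on `[0, τ]`. -/
noncomputable def hazardUpTo (lam0 : ℝ → ℝ) (τ : ℝ) : Measure ℝ :=
  (hazardMeasure lam0).restrict (Iic τ)

instance (lam0 : ℝ → ℝ) (τ : ℝ) : NullSingletonClass (hazardUpTo lam0 τ) := by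
  unfold hazardUpTo; infer_instance

theorem restrict_hazardUpTo_Ioc (ha : 0 ≤ a) (hb : b ≤ τ) :
    (hazardUpTo lam0 τ).restrict (Ioc a b) =
      (volume.restrict (Ioc a b)).withDensity fun x => ENNReal.ofReal (lam0 x) := by
  have h1 : Ioc a b ∩ Iic τ = Ioc a b := inter_eq_left.2 fun x hx => hx.2.trans hb
  have h2 : Ioc a b ∩ Ici 0 = Ioc a b := inter_eq_left.2 fun x hx => ha.trans hx.1.le
  rw [hazardUpTo, Measure.restrict_restrict measurableSet_Ioc, h1, hazardMeasure,
    restrict_withDensity measurableSet_Ioc, Measure.restrict_restrict measurableSet_Ioc, h2]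

theorem hazardUpTo_restrict_le (ha : 0 ≤ a) (hb : b ≤ τ) (h : ∀ x ∈ Ioc a b, lam0 x ≤ k) :
    (hazardUpTo lam0 τ).restrict (Ioc a b) ≤ ENNReal.ofReal k • volume.restrict (Ioc a b) := by
  rw [restrict_hazardUpTo_Ioc ha hb, ← withDensity_const]
  exact withDensity_mono (ae_restrict_of_forall_mem measurableSet_Ioc fun x hx =>
    ENNReal.ofReal_le_ofReal (h x hx))

theorem le_hazardUpTo_restrict (ha : 0 ≤ a) (hb : b ≤ τ) (h : ∀ x ∈ Ioc a b, k ≤ lam0 x) :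
    ENNReal.ofReal k • volume.restrict (Ioc a b) ≤ (hazardUpTo lam0 τ).restrict (Ioc a b) := by
  rw [restrict_hazardUpTo_Ioc ha hb, ← withDensity_const]
  exact withDensity_mono (ae_restrict_of_forall_mem measurableSet_Ioc fun x hx =>
    ENNReal.ofReal_le_ofReal (h x hx))

theorem hazardUpTo_Ioc_le (ha : 0 ≤ a) (hb : b ≤ τ) (h : ∀ x ∈ Ioc a b, lam0 x ≤ k) :
    hazardUpTo lam0 τ (Ioc a b) ≤ ENNReal.ofReal k * ENNReal.ofReal (b - a) := by
  have := hazardUpTo_restrict_le ha hb h (Ioc a b)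
  simpa using this

theorem hazardUpTo_Icc_le (ha : 0 ≤ a) (hb : b ≤ τ) (hk : 0 ≤ k)
    (h : ∀ x ∈ Ioc a b, lam0 x ≤ k) :
    hazardUpTo lam0 τ (Icc a b) ≤ ENNReal.ofReal (k * (b - a)) := by
  rw [ENNReal.ofReal_mul hk, ← measure_congr (Ioc_ae_eq_Icc (μ := hazardUpTo lam0 τ))]
  exact hazardUpTo_Ioc_le ha hb h

variable [IsFiniteMeasure (hazardUpTo lam0 τ)]

theorem real_hazardUpTo_Ioc_le (ha : 0 ≤ a) (hab : a ≤ b) (hb : b ≤ τ) (hk : 0 ≤ k)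
    (h : ∀ x ∈ Ioc a b, lam0 x ≤ k) : (hazardUpTo lam0 τ).real (Ioc a b) ≤ k * (b - a) := by
  refine ENNReal.toReal_le_of_le_ofReal (mul_nonneg hk (sub_nonneg.2 hab)) ?_
  rw [ENNReal.ofReal_mul hk]
  exact hazardUpTo_Ioc_le ha hb h

theorem le_real_hazardUpTo_Ioc (ha : 0 ≤ a) (hab : a ≤ b) (hb : b ≤ τ)
    (h : ∀ x ∈ Ioc a b, k ≤ lam0 x) : k * (b - a) ≤ (hazardUpTo lam0 τ).real (Ioc a b) := by
  rcases le_total k 0 with hk | hk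
  · exact (mul_nonpos_of_nonpos_of_nonneg hk (sub_nonneg.2 hab)).trans measureReal_nonneg
  · refine (ENNReal.ofReal_le_iff_le_toReal (measure_ne_top _ _)).1 ?_
    rw [ENNReal.ofReal_mul hk]
    have := le_hazardUpTo_restrict ha hb h (Ioc a b)
    simpa using this

theorem real_Ioc_sub_real_Ioc (Λ : Measure ℝ) [IsFiniteMeasure Λ] (ha : 0 ≤ a) (hab : a ≤ b) :
    Λ.real (Ioc 0 b) - Λ.real (Ioc 0 a) = Λ.real (Ioc a b) := by
  rw [← Ioc_union_Ioc_eq_Ioc ha hab, measureReal_union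
    (disjoint_left.2 fun x h1 h2 => h1.2.not_gt h2.1) measurableSet_Ioc, add_sub_cancel_left]

variable {Q : Measure (Obs p)} [SFinite Q]

theorem meanEvents_sub_le (hQ : CoxLaw Q β₀ (hazardUpTo lam0 τ) τ) (ha : 0 ≤ a) (hab : a ≤ b)
    (hb : b ≤ τ) (hk : 0 ≤ k) (h : ∀ x ∈ Ioc a b, lam0 x ≤ k) :
    meanEvents Q β₀ (hazardUpTo lam0 τ) b - meanEvents Q β₀ (hazardUpTo lam0 τ) a ≤
      k * (meanExposure Q β₀ b - meanExposure Q β₀ a) := by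
  rw [hQ.meanEvents_sub, hQ.meanExposure_sub, intervalIntegral.integral_of_le hab,
    intervalIntegral.integral_of_le hab]
  refine (integral_mono_measure (hazardUpTo_restrict_le ha hb h)
    (ae_of_all _ fun t => meanRisk_nonneg Q β₀ t) ?_).trans_eq ?_
  · exact Integrable.smul_measure (hQ.intervalIntegrable_meanRisk _ a b).1 ENNReal.ofReal_ne_top
  · rw [integral_smul_measure, ENNReal.toReal_ofReal hk, smul_eq_mul]

theorem le_meanEvents_sub (hQ : CoxLaw Q β₀ (hazardUpTo lam0 τ) τ) (ha : 0 ≤ a) (hab : a ≤ b)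
    (hb : b ≤ τ) (hk : 0 ≤ k) (h : ∀ x ∈ Ioc a b, k ≤ lam0 x) :
    k * (meanExposure Q β₀ b - meanExposure Q β₀ a) ≤
      meanEvents Q β₀ (hazardUpTo lam0 τ) b - meanEvents Q β₀ (hazardUpTo lam0 τ) a := by
  rw [hQ.meanEvents_sub, hQ.meanExposure_sub, intervalIntegral.integral_of_le hab,
    intervalIntegral.integral_of_le hab]
  refine le_trans (le_of_eq ?_) (integral_mono_measure (le_hazardUpTo_restrict ha hb h)
    (ae_of_all _ fun t => meanRisk_nonneg Q β₀ t) (hQ.intervalIntegrable_meanRisk _ a b).1)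
  rw [integral_smul_measure, ENNReal.toReal_ofReal hk, smul_eq_mul]

theorem monotoneOn_meanEvents (hQ : CoxLaw Q β₀ (hazardUpTo lam0 τ) τ) (s : Set ℝ) :
    MonotoneOn (meanEvents Q β₀ (hazardUpTo lam0 τ)) s := fun a _ b _ hab =>
  sub_nonneg.1 (hQ.meanEvents_sub a b ▸ intervalIntegral.integral_nonneg_of_forall hab
    fun t => meanRisk_nonneg Q β₀ t)

theorem monotoneOn_meanExposure (hQ : CoxLaw Q β₀ (hazardUpTo lam0 τ) τ) (s : Set ℝ) :
    MonotoneOn (meanExposure Q β₀) s := fun a _ b _ hab =>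
  sub_nonneg.1 (hQ.meanExposure_sub a b ▸ intervalIntegral.integral_nonneg_of_forall hab
    fun t => meanRisk_nonneg Q β₀ t)

/-- Supplies the positive core amount `σ` in the perturbation argument. -/
theorem meanExposure_lt (hQ : CoxLaw Q β₀ (hazardUpTo lam0 τ) τ) (hab : a < b) (hb : b < τ) :
    meanExposure Q β₀ a < meanExposure Q β₀ b :=
  sub_pos.1 (hQ.meanExposure_sub a b ▸ intervalIntegral.intervalIntegral_pos_of_pos_on
    (hQ.intervalIntegrable_meanRisk _ _ _) (fun _ ht => hQ.meanRisk_pos (ht.2.trans hb)) hab)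

end CoxShape

namespace CoxShape
open Function
variable {p : ℕ} {β₀ : Cov p} {lam0 : ℝ → ℝ} {τ : ℝ} {y : ℕ → Obs p} {β : ℕ → Cov p}
  {Q : Measure (Obs p)} [SFinite Q] [IsFiniteMeasure (hazardUpTo lam0 τ)]

/-! ### Consistency of the maximum likelihood estimators along a consistent path -/

theorem exists_pos_mul_lt {κ d : ℝ} (hκ : 0 ≤ κ) (hd : 0 < d) : ∃ e > 0, (1 + κ) * e < d := by
  refine ⟨d / (2 * (1 + κ)), by positivity, ?_⟩
  have : (1 + κ) * (d / (2 * (1 + κ))) = d / 2 := by field_simp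
  rw [this]; exact half_lt_self hd

theorem ConsistentPath.eventually_exists_lt (hy : ConsistentPath Q β₀ (hazardUpTo lam0 τ) τ y β)
    {t : ℝ} (ht : t < τ) : ∀ᶠ n in atTop, ∃ i < n, t < time (y i) := by
  obtain ⟨u, htu, hu⟩ := exists_between ht
  filter_upwards [hy.reach u hu] with n ⟨i, hi, h⟩
  exact ⟨i, hi, htu.trans_le h⟩

theorem ConsistentPath.eventually_incNPMLE_le
    (hy : ConsistentPath Q β₀ (hazardUpTo lam0 τ) τ y β) (hQ : CoxLaw Q β₀ (hazardUpTo lam0 τ) τ)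
    {l : ℕ → ℝ → ℝ} (hl : ∀ n, IsIncNPMLE n y (β n) (l n)) {x t k κ : ℝ} (hx : 0 ≤ x) (hxt : x < t)
    (ht : t < τ) (hk : 0 ≤ k) (hkκ : k < κ) (h : ∀ u ∈ Ioc 0 t, lam0 u ≤ k) :
    ∀ᶠ n in atTop, l n x ≤ κ := by
  have hκ : 0 < κ := hk.trans_lt hkκ
  obtain ⟨e, he, hd⟩ := exists_pos_mul_lt hκ.le
    (mul_pos (sub_pos.2 hkκ) (sub_pos.2 (meanExposure_lt hQ hxt ht)))
  filter_upwards [hy.close e he, eventually_gt_atTop 0, hy.eventually_exists_lt (hxt.trans ht)]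
    with n hs hn hr
  obtain ⟨s, hs1, hs2⟩ := hl n
  -- The bound holds for the maximizer under every large bound `M`, with the same `n`, and passes to
  -- the limit in `M`.
  refine le_of_tendsto (hs2 x hx hr) ?_
  filter_upwards [hs1, eventually_ge_atTop 1] with M h1 hM
  exact incNPMLE_le hs hn h1.1 h1.2 hM hκ hkκ.le hx hxt ht.le
    (fun a b ha hab hb => meanEvents_sub_le hQ ha hab (hb.trans ht.le) hk
      fun u hu => h u ⟨ha.trans_lt hu.1, hu.2.trans hb⟩)
    (monotoneOn_meanEvents hQ _) (monotoneOn_meanExposure hQ _) he.le le_rfl hd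

theorem ConsistentPath.eventually_le_incNPMLE
    (hy : ConsistentPath Q β₀ (hazardUpTo lam0 τ) τ y β) (hQ : CoxLaw Q β₀ (hazardUpTo lam0 τ) τ)
    {l : ℕ → ℝ → ℝ} (hl : ∀ n, IsIncNPMLE n y (β n) (l n)) {s x k κ : ℝ} (hs : 0 ≤ s) (hsx : s < x)
    (hxτ : x < τ) (hκ : 0 < κ) (hkκ : κ < k) (h : ∀ u ∈ Ioc s τ, k ≤ lam0 u) :
    ∀ᶠ n in atTop, κ ≤ l n x := by
  obtain ⟨e, he, hd⟩ := exists_pos_mul_lt hκ.le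
    (mul_pos (sub_pos.2 hkκ) (sub_pos.2 (meanExposure_lt hQ hsx hxτ)))
  filter_upwards [hy.close e he, eventually_gt_atTop 0, hy.eventually_exists_lt hxτ] with n hc hn hr
  obtain ⟨g, hg1, hg2⟩ := hl n
  refine ge_of_tendsto (hg2 x (hs.trans hsx.le) hr) ?_
  filter_upwards [hg1, eventually_ge_atTop (max 1 κ)] with M h1 hM
  exact le_incNPMLE hc hn h1.1 h1.2 ((le_max_left _ _).trans hM) ((le_max_right _ _).trans hM) hκ
    hkκ.le hs hsx hxτ.le (fun a b ha hab hb => le_meanEvents_sub hQ (hs.trans ha) hab hb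
      (hκ.trans hkκ).le fun u hu => h u ⟨ha.trans_lt hu.1, hu.2.trans hb⟩)
    (monotoneOn_meanExposure hQ _) he.le le_rfl hd

theorem ConsistentPath.eventually_decNPMLE_le
    (hy : ConsistentPath Q β₀ (hazardUpTo lam0 τ) τ y β) (hQ : CoxLaw Q β₀ (hazardUpTo lam0 τ) τ)
    {l : ℕ → ℝ → ℝ} (hl : ∀ n, IsDecNPMLE n y (β n) (l n)) {s x k κ : ℝ} (hs : 0 ≤ s) (hsx : s < x)
    (hxτ : x < τ) (hk : 0 ≤ k) (hkκ : k < κ) (h : ∀ u ∈ Ioc s τ, lam0 u ≤ k) :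
    ∀ᶠ n in atTop, l n x ≤ κ := by
  have hκ : 0 < κ := hk.trans_lt hkκ
  obtain ⟨e, he, hd⟩ := exists_pos_mul_lt hκ.le
    (mul_pos (sub_pos.2 hkκ) (sub_pos.2 (meanExposure_lt hQ hsx hxτ)))
  filter_upwards [hy.close e he, eventually_gt_atTop 0] with n hc hn
  exact decNPMLE_le hc hn (hl n).1 (hl n).2 hκ hkκ.le hs hsx hxτ.le
    (fun a b ha hab hb => meanEvents_sub_le hQ (hs.trans ha) hab hb hk
      fun u hu => h u ⟨ha.trans_lt hu.1, hu.2.trans hb⟩)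
    (monotoneOn_meanEvents hQ _) (monotoneOn_meanExposure hQ _) he.le le_rfl hd

theorem ConsistentPath.eventually_le_decNPMLE
    (hy : ConsistentPath Q β₀ (hazardUpTo lam0 τ) τ y β) (hQ : CoxLaw Q β₀ (hazardUpTo lam0 τ) τ)
    {l : ℕ → ℝ → ℝ} (hl : ∀ n, IsDecNPMLE n y (β n) (l n)) {x t k κ : ℝ} (hx : 0 ≤ x) (hxt : x < t)
    (ht : t < τ) (hκ : 0 < κ) (hkκ : κ < k) (h : ∀ u ∈ Ioc 0 t, k ≤ lam0 u) :
    ∀ᶠ n in atTop, κ ≤ l n x := by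
  obtain ⟨e, he, hd⟩ := exists_pos_mul_lt hκ.le
    (mul_pos (sub_pos.2 hkκ) (sub_pos.2 (meanExposure_lt hQ hxt ht)))
  filter_upwards [hy.close e he, eventually_gt_atTop 0] with n hc hn
  exact le_decNPMLE hc hn (hl n).1 (hl n).2 hκ hkκ.le hx hxt ht.le
    (fun a b ha hab hb => le_meanEvents_sub hQ ha hab (hb.trans ht.le) (hκ.trans hkκ).le
      fun u hu => h u ⟨ha.trans_lt hu.1, hu.2.trans hb⟩)
    (monotoneOn_meanExposure hQ _) he.le le_rfl hd

theorem IsIncNPMLE.nonneg {n : ℕ} {b : Cov p} {l : ℝ → ℝ} (hl : IsIncNPMLE n y b l) {x : ℝ}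
    (hx : 0 ≤ x) (h : ∃ i < n, x < time (y i)) : 0 ≤ l x := by
  obtain ⟨s, hs1, hs2⟩ := hl
  exact ge_of_tendsto (hs2 x hx h) (hs1.mono fun M hM => (hM.1.2 x hx).1)

theorem ConsistentPath.limitsBetween_incNPMLE
    (hy : ConsistentPath Q β₀ (hazardUpTo lam0 τ) τ y β) (hQ : CoxLaw Q β₀ (hazardUpTo lam0 τ) τ)
    {l : ℕ → ℝ → ℝ} (hl : ∀ n, IsIncNPMLE n y (β n) (l n)) {x lo hi : ℝ} (hx : 0 < x) (hxτ : x < τ)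
    (hhi0 : 0 ≤ hi) (hlo : ∀ ε > 0, ∃ s ∈ Ioo 0 x, ∀ u, s ≤ u → lo - ε ≤ lam0 u)
    (hhi : ∀ ε > 0, ∃ t ∈ Ioo x τ, ∀ u ∈ Ioc 0 t, lam0 u ≤ hi + ε) :
    LimitsBetween lo (fun n => l n x) hi := by
  refine limitsBetween_of_eventually fun ε hε => Filter.Eventually.and ?_ ?_
  -- Raising works towards a positive level only; a nonpositive lower bound is trivial.
  · rcases le_or_gt (lo - ε) 0 with h0 | h0
    · filter_upwards [hy.eventually_exists_lt hxτ] with n hn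
      exact h0.trans ((hl n).nonneg hx.le hn)
    · obtain ⟨s, hs, h⟩ := hlo (ε / 2) (half_pos hε)
      exact hy.eventually_le_incNPMLE hQ hl hs.1.le hs.2 hxτ h0 (by linarith) fun u hu => h u
          hu.1.le
  · obtain ⟨t, ht, h⟩ := hhi (ε / 2) (half_pos hε)
    exact hy.eventually_incNPMLE_le hQ hl hx.le ht.1 ht.2 (by positivity) (by linarith) h

theorem ConsistentPath.limitsBetween_decNPMLE
    (hy : ConsistentPath Q β₀ (hazardUpTo lam0 τ) τ y β) (hQ : CoxLaw Q β₀ (hazardUpTo lam0 τ) τ)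
    {l : ℕ → ℝ → ℝ} (hl : ∀ n, IsDecNPMLE n y (β n) (l n)) {x lo hi : ℝ} (hx : 0 < x) (hxτ : x < τ)
    (hhi0 : 0 ≤ hi) (hhi : ∀ ε > 0, ∃ s ∈ Ioo 0 x, ∀ u, s ≤ u → lam0 u ≤ hi + ε)
    (hlo : ∀ ε > 0, ∃ t ∈ Ioo x τ, ∀ u ∈ Ioc 0 t, lo - ε ≤ lam0 u) :
    LimitsBetween lo (fun n => l n x) hi := by
  refine limitsBetween_of_eventually fun ε hε => Filter.Eventually.and ?_ ?_
  · rcases le_or_gt (lo - ε) 0 with h0 | h0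
    · exact Filter.Eventually.of_forall fun n => h0.trans ((hl n).1.2 x hx.le)
    · obtain ⟨t, ht, h⟩ := hlo (ε / 2) (half_pos hε)
      exact hy.eventually_le_decNPMLE hQ hl hx.le ht.1 ht.2 h0 (by linarith) h
  · obtain ⟨s, hs, h⟩ := hhi (ε / 2) (half_pos hε)
    exact hy.eventually_decNPMLE_le hQ hl hs.1.le hs.2 hxτ (by positivity) (by linarith)
      fun u hu => h u hu.1.le

/-! ### Consistency of the Grenander type estimators along a consistent path -/

theorem convex_obsInterval (n : ℕ) (y : ℕ → Obs p) : Convex ℝ (obsInterval n y) := by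
  refine OrdConnected.convex ⟨fun a ha b hb x hx => ⟨ha.1.trans hx.1, ?_⟩⟩
  obtain ⟨-, i, hi, h⟩ := hb
  exact ⟨i, hi, hx.2.trans h⟩

theorem ConsistentPath.eventually_mem_obsInterval
    (hy : ConsistentPath Q β₀ (hazardUpTo lam0 τ) τ y β) {t : ℝ} (h0 : 0 ≤ t) (ht : t < τ) :
    ∀ᶠ n in atTop, t ∈ obsInterval n y := by
  filter_upwards [hy.reach t ht] with n hn
  exact ⟨h0, hn⟩

theorem ConsistentPath.obsInterval_subset (hy : ConsistentPath Q β₀ (hazardUpTo lam0 τ) τ y β)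
    (n : ℕ) : obsInterval n y ⊆ Ico 0 τ := fun _ hu => by
  obtain ⟨h0, i, -, hi⟩ := hu
  exact ⟨h0, hi.trans_lt (hy.time_mem i).2⟩

theorem eventually_uniform_of_monotone {f : ℕ → ℝ → ℝ} {Φ : ℝ → ℝ} {c : ℝ} (hc : 0 < c)
    (hcτ : c < τ) (hf : ∀ n, Monotone (f n)) (hΦ : ContinuousOn Φ (Icc 0 τ))
    (hconv : ∀ x, 0 ≤ x → x < τ → Tendsto (fun n => f n x) atTop (𝓝 (Φ x))) {ε : ℝ} (hε : 0 < ε) :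
    ∀ᶠ n in atTop, ∀ t ∈ Icc 0 c, |f n t - Φ t| ≤ ε := by
  refine eventually_uniform_of_monotoneOn hc (fun n => (hf n).monotoneOn _)
    (hΦ.mono (Icc_subset_Icc_right hcτ.le)) (fun k m hm hk => ?_) hε
  have h1 : (k : ℝ) / m ≤ 1 := by
    rw [div_le_one (by exact_mod_cast hm)]; exact_mod_cast hk
  have h2 : 0 ≤ (k : ℝ) / m := by positivity
  rw [zero_add, sub_zero]
  exact hconv _ (by positivity) ((mul_le_of_le_one_right hc.le h1).trans_lt hcτ)

/-- Convergence is uniform only away from `τ`. Near `τ` the lower bound by the line survives without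
tail control, because `f n` is nondecreasing and the line rises little over a short interval. -/
theorem ConsistentPath.limitsBetween_leftSlope_gcm
    (hy : ConsistentPath Q β₀ (hazardUpTo lam0 τ) τ y β) {f : ℕ → ℝ → ℝ} {Φ : ℝ → ℝ}
    {x a lo hi : ℝ} (hx : 0 < x) (hxτ : x < τ) (hf : ∀ n, Monotone (f n))
    (hΦ : ContinuousOn Φ (Icc 0 τ))
    (hconv : ∀ x, 0 ≤ x → x < τ → Tendsto (fun n => f n x) atTop (𝓝 (Φ x))) (ha : 0 ≤ a)
    (hline : ∀ u ∈ Ico 0 τ, Φ x + a * (u - x) ≤ Φ u)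
    (hlo : ∀ ε > 0, ∃ s ∈ Ioo 0 x, ∀ u ∈ Ico s x, (lo - ε) * (x - u) ≤ Φ x - Φ u)
    (hhi : ∀ ε > 0, ∃ t ∈ Ioo x τ, ∀ u ∈ Ioc x t, Φ u - Φ x ≤ (hi + ε) * (u - x)) :
    LimitsBetween lo (fun n => leftSlope (gcm (obsInterval n y) (f n)) x) hi := by
  refine limitsBetween_of_eventually fun ε hε => ?_
  set δ := min x (τ - x) / 2 with hδ
  have hτx := sub_pos.2 hxτ
  have hδ0 : 0 < δ := by positivity
  have hδ1 : 0 ≤ x - δ := by have := min_le_left x (τ - x); linarith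
  have hδ2 : x + δ < τ := by have := min_le_right x (τ - x); linarith
  refine eventually_leftSlope_gcm (Φ := Φ) (a := a) (δ := δ) (fun n => convex_obsInterval n y)
    ?_ (fun ε hε => ?_) (fun u hu => hconv u (hδ1.trans hu.1) (hu.2.trans_lt hδ2))
    (fun ε hε => ?_) (fun ε hε => ?_) hε
  · filter_upwards [hy.eventually_mem_obsInterval hδ1 (by linarith),
      hy.eventually_mem_obsInterval (by linarith) hδ2] with n h1 h2
    exact ⟨h1, h2⟩
  -- The denominator `a + 1` covers `a = 0`; the maximum with `x` makes `c` positive.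
  · obtain ⟨c, hc0, hcτ, hc⟩ : ∃ c, 0 < c ∧ c < τ ∧ a * (τ - c) ≤ ε / 2 := by
      refine ⟨max x (τ - ε / (2 * (a + 1))), lt_max_of_lt_left hx, max_lt hxτ ?_, ?_⟩
      · have : 0 < ε / (2 * (a + 1)) := by positivity
        linarith
      · have h1 : τ - max x (τ - ε / (2 * (a + 1))) ≤ ε / (2 * (a + 1)) := by
          have := le_max_right x (τ - ε / (2 * (a + 1))); linarith
        have h2 : (a + 1) * (ε / (2 * (a + 1))) = ε / 2 := by field_simp
        have h3 : 0 ≤ ε / (2 * (a + 1)) := by positivity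
        nlinarith
    filter_upwards [eventually_uniform_of_monotone hc0 hcτ hf hΦ hconv (half_pos hε)] with n hn u hu
    have hu' := hy.obsInterval_subset n hu
    rcases le_total u c with h | h
    · have h1 := (abs_le.1 (hn u ⟨hu'.1, h⟩)).1
      have h2 := hline u hu'
      linarith
    · have h1 := (abs_le.1 (hn c ⟨hc0.le, le_rfl⟩)).1
      have h2 := hline c ⟨hc0.le, hcτ⟩
      have h3 := hf n h
      have h4 : a * (u - c) ≤ a * (τ - c) := mul_le_mul_of_nonneg_left (by linarith [hu'.2]) ha
      linarith
  · obtain ⟨s, hs, h⟩ := hlo ε hε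
    have h0 : 0 < min δ (x - s) := lt_min hδ0 (sub_pos.2 hs.2)
    refine ⟨min δ (x - s), ⟨h0, min_le_left _ _⟩, ?_⟩
    have := h (x - min δ (x - s)) ⟨by linarith [min_le_right δ (x - s)], by linarith⟩
    rw [le_div_iff₀ h0]
    linarith
  · obtain ⟨t, ht, h⟩ := hhi ε hε
    have h0 : 0 < min δ (t - x) := lt_min hδ0 (sub_pos.2 ht.1)
    refine ⟨min δ (t - x), ⟨h0, min_le_left _ _⟩, ?_⟩
    have := h (x + min δ (t - x)) ⟨by linarith, by linarith [min_le_right δ (t - x)]⟩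
    rw [div_le_iff₀ h0]
    linarith

theorem ConsistentPath.limitsBetween_leftSlope_lcm
    (hy : ConsistentPath Q β₀ (hazardUpTo lam0 τ) τ y β) {f : ℕ → ℝ → ℝ} {Φ : ℝ → ℝ}
    {x a lo hi : ℝ} (hx : 0 < x) (hxτ : x < τ) (hf : ∀ n, Monotone (f n))
    (hΦ : ContinuousOn Φ (Icc 0 τ))
    (hconv : ∀ x, 0 ≤ x → x < τ → Tendsto (fun n => f n x) atTop (𝓝 (Φ x)))
    (htail : ∀ ε > 0, ∃ c, 0 < c ∧ c < τ ∧ ∀ᶠ n in atTop, ∀ u, f n u ≤ f n c + ε) (ha : 0 ≤ a)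
    (hline : ∀ u ∈ Ico 0 τ, Φ u ≤ Φ x + a * (u - x))
    (hhi : ∀ ε > 0, ∃ s ∈ Ioo 0 x, ∀ u ∈ Ico s x, Φ x - Φ u ≤ (hi + ε) * (x - u))
    (hlo : ∀ ε > 0, ∃ t ∈ Ioo x τ, ∀ u ∈ Ioc x t, (lo - ε) * (u - x) ≤ Φ u - Φ x) :
    LimitsBetween lo (fun n => leftSlope (lcm (obsInterval n y) (f n)) x) hi := by
  refine limitsBetween_of_eventually fun ε hε => ?_
  set δ := min x (τ - x) / 2 with hδ
  have hτx := sub_pos.2 hxτ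
  have hδ0 : 0 < δ := by positivity
  have hδ1 : 0 ≤ x - δ := by have := min_le_left x (τ - x); linarith
  have hδ2 : x + δ < τ := by have := min_le_right x (τ - x); linarith
  refine eventually_leftSlope_lcm (Φ := Φ) (a := a) (δ := δ) (fun n => convex_obsInterval n y)
    ?_ (fun ε hε => ?_) (fun u hu => hconv u (hδ1.trans hu.1) (hu.2.trans_lt hδ2))
    (fun ε hε => ?_) (fun ε hε => ?_) hε
  · filter_upwards [hy.eventually_mem_obsInterval hδ1 (by linarith),
      hy.eventually_mem_obsInterval (by linarith) hδ2] with n h1 h2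
    exact ⟨h1, h2⟩
  · obtain ⟨c, hc0, hcτ, hc⟩ := htail (ε / 2) (half_pos hε)
    filter_upwards [hc, eventually_uniform_of_monotone hc0 hcτ hf hΦ hconv (half_pos hε)]
      with n hn' hn u hu
    have hu' := hy.obsInterval_subset n hu
    rcases le_total u c with h | h
    · have h1 := (abs_le.1 (hn u ⟨hu'.1, h⟩)).2
      have h2 := hline u hu'
      linarith
    -- Beyond `c` the majorizing line has nonnegative slope, so it is enough that `f n` rises by at
    -- most `ε / 2`. Monotonicity does not give this, hence the hypothesis `htail`.
    · have h1 := (abs_le.1 (hn c ⟨hc0.le, le_rfl⟩)).2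
      have h2 := hline c ⟨hc0.le, hcτ⟩
      have h3 := hn' u
      have h4 : 0 ≤ a * (u - c) := mul_nonneg ha (sub_nonneg.2 h)
      linarith
  · obtain ⟨s, hs, h⟩ := hhi ε hε
    have h0 : 0 < min δ (x - s) := lt_min hδ0 (sub_pos.2 hs.2)
    refine ⟨min δ (x - s), ⟨h0, min_le_left _ _⟩, ?_⟩
    have := h (x - min δ (x - s)) ⟨by linarith [min_le_right δ (x - s)], by linarith⟩
    rw [div_le_iff₀ h0]
    linarith
  · obtain ⟨t, ht, h⟩ := hlo ε hε
    have h0 : 0 < min δ (t - x) := lt_min hδ0 (sub_pos.2 ht.1)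
    refine ⟨min δ (t - x), ⟨h0, min_le_left _ _⟩, ?_⟩
    have := h (x + min δ (t - x)) ⟨by linarith, by linarith [min_le_right δ (t - x)]⟩
    rw [le_div_iff₀ h0]
    linarith

end CoxShape

namespace CoxShape
open Function

/-! ### One-sided limits of monotone functions -/

section

variable {g : ℝ → ℝ} {x : ℝ}

theorem tendsto_leftLim_of_monotoneOn (hg : MonotoneOn g (Ioi 0)) (hx : 0 < x) :
    Tendsto g (𝓝[<] x) (𝓝 (leftLim g x)) := by
  have h := MonotoneOn.tendsto_nhdsWithin_Ioo_left (nonempty_Ioo.2 hx)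
    (hg.mono Ioo_subset_Ioi_self) ⟨g x, by
      rintro _ ⟨u, hu, rfl⟩; exact hg hu.1 hx hu.2.le⟩
  rwa [leftLim_eq_of_tendsto h]

theorem tendsto_rightLim_of_monotoneOn (hg : MonotoneOn g (Ioi 0)) (hx : 0 < x) :
    Tendsto g (𝓝[>] x) (𝓝 (rightLim g x)) := by
  have h := MonotoneOn.tendsto_nhdsGT (hg.mono (Ioi_subset_Ioi hx.le)) ⟨g x, by
      rintro _ ⟨u, hu, rfl⟩; exact hg hx (hx.trans hu) (le_of_lt hu)⟩
  rwa [rightLim_eq_of_tendsto h]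

theorem tendsto_leftLim_of_antitoneOn (hg : AntitoneOn g (Ioi 0)) (hx : 0 < x) :
    Tendsto g (𝓝[<] x) (𝓝 (leftLim g x)) := by
  have h := (tendsto_leftLim_of_monotoneOn hg.neg hx).neg
  simp only [neg_neg] at h
  rwa [leftLim_eq_of_tendsto h]

theorem tendsto_rightLim_of_antitoneOn (hg : AntitoneOn g (Ioi 0)) (hx : 0 < x) :
    Tendsto g (𝓝[>] x) (𝓝 (rightLim g x)) := by
  have h := (tendsto_rightLim_of_monotoneOn hg.neg hx).neg
  simp only [neg_neg] at h
  rwa [rightLim_eq_of_tendsto h]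

theorem exists_mem_Ioo_of_tendsto_left {l : ℝ} (h : Tendsto g (𝓝[<] x) (𝓝 l)) (hx : 0 < x)
    {ε : ℝ} (hε : 0 < ε) : ∃ s ∈ Ioo 0 x, l - ε ≤ g s ∧ g s ≤ l + ε := by
  obtain ⟨s, hs, h1, h2⟩ := ((eventually_of_mem (Ioo_mem_nhdsLT hx) fun _ hs => hs).and
    ((h.eventually_const_le (sub_lt_self l hε)).and
      (h.eventually_le_const (lt_add_of_pos_right l hε)))).exists
  exact ⟨s, hs, h1, h2⟩

theorem exists_mem_Ioo_of_tendsto_right {l τ : ℝ} (h : Tendsto g (𝓝[>] x) (𝓝 l)) (hx : x < τ)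
    {ε : ℝ} (hε : 0 < ε) : ∃ t ∈ Ioo x τ, l - ε ≤ g t ∧ g t ≤ l + ε := by
  obtain ⟨s, hs, h1, h2⟩ := ((eventually_of_mem (Ioo_mem_nhdsGT hx) fun _ hs => hs).and
    ((h.eventually_const_le (sub_lt_self l hε)).and
      (h.eventually_le_const (lt_add_of_pos_right l hε)))).exists
  exact ⟨s, hs, h1, h2⟩

theorem exists_leftLim_sub_le_of_monotoneOn (hg : MonotoneOn g (Ioi 0)) (hx : 0 < x) {ε : ℝ}
    (hε : 0 < ε) : ∃ s ∈ Ioo 0 x, ∀ u, s ≤ u → leftLim g x - ε ≤ g u := by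
  obtain ⟨s, hs, h, -⟩ :=
    exists_mem_Ioo_of_tendsto_left (tendsto_leftLim_of_monotoneOn hg hx) hx hε
  exact ⟨s, hs, fun u hu => h.trans (hg hs.1 (hs.1.trans_le hu) hu)⟩

theorem exists_le_rightLim_add_of_monotoneOn (hg : MonotoneOn g (Ioi 0)) (hx : 0 < x) {τ : ℝ}
    (hxτ : x < τ) {ε : ℝ} (hε : 0 < ε) :
    ∃ t ∈ Ioo x τ, ∀ u ∈ Ioc 0 t, g u ≤ rightLim g x + ε := by
  obtain ⟨t, ht, -, h⟩ :=
    exists_mem_Ioo_of_tendsto_right (tendsto_rightLim_of_monotoneOn hg hx) hxτ hε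
  exact ⟨t, ht, fun u hu => (hg hu.1 (hx.trans ht.1) hu.2).trans h⟩

theorem exists_le_leftLim_add_of_antitoneOn (hg : AntitoneOn g (Ioi 0)) (hx : 0 < x) {ε : ℝ}
    (hε : 0 < ε) : ∃ s ∈ Ioo 0 x, ∀ u, s ≤ u → g u ≤ leftLim g x + ε := by
  obtain ⟨s, hs, -, h⟩ :=
    exists_mem_Ioo_of_tendsto_left (tendsto_leftLim_of_antitoneOn hg hx) hx hε
  exact ⟨s, hs, fun u hu => (hg hs.1 (hs.1.trans_le hu) hu).trans h⟩

theorem exists_rightLim_sub_le_of_antitoneOn (hg : AntitoneOn g (Ioi 0)) (hx : 0 < x) {τ : ℝ}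
    (hxτ : x < τ) {ε : ℝ} (hε : 0 < ε) :
    ∃ t ∈ Ioo x τ, ∀ u ∈ Ioc 0 t, rightLim g x - ε ≤ g u := by
  obtain ⟨t, ht, h, -⟩ :=
    exists_mem_Ioo_of_tendsto_right (tendsto_rightLim_of_antitoneOn hg hx) hxτ hε
  exact ⟨t, ht, fun u hu => h.trans (hg hu.1 (hx.trans ht.1) hu.2)⟩

end

/-! ### The baseline density -/

section

variable {lam0 : ℝ → ℝ} {τ a b k x : ℝ}

theorem exp_neg_sub_exp_neg_le {s t : ℝ} (hs : 0 ≤ s) (hst : s ≤ t) :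
    Real.exp (-s) - Real.exp (-t) ≤ t - s := by
  have h1 : Real.exp (-t) = Real.exp (-s) * Real.exp (-(t - s)) := by
    rw [← Real.exp_add]; congr 1; ring
  have h2 := Real.one_sub_le_exp_neg (t - s)
  have h3 : Real.exp (-s) ≤ 1 := Real.exp_le_one_iff.2 (by linarith)
  have h4 := Real.exp_pos (-s)
  rw [h1]
  nlinarith

theorem hazardUpTo_Ioc_zero (lam0 : ℝ → ℝ) (hx : x ≤ τ) :
    hazardUpTo lam0 τ (Ioc 0 x) = cumHazard lam0 x := by
  have := congrArg (fun m : Measure ℝ => m univ) (restrict_hazardUpTo_Ioc (lam0 := lam0) le_rfl hx)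
  simpa [withDensity_apply, cumHazard] using this

variable [IsFiniteMeasure (hazardUpTo lam0 τ)]

theorem baselineCDF_eq (hx : x ≤ τ) :
    baselineCDF lam0 x = 1 - Real.exp (-(hazardUpTo lam0 τ).real (Ioc 0 x)) := by
  have h := hazardUpTo_Ioc_zero lam0 hx
  rw [baselineCDF, if_neg (h ▸ measure_ne_top _ _), ← h, Measure.real]

theorem baselineDensity_eq (hx : x ≤ τ) :
    baselineDensity lam0 x = lam0 x * Real.exp (-(hazardUpTo lam0 τ).real (Ioc 0 x)) := by
  rw [baselineDensity, baselineCDF_eq hx, sub_sub_cancel]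

theorem intervalIntegrable_hazard (hm : Measurable lam0) (h0 : ∀ x, 0 ≤ x → 0 ≤ lam0 x)
    (hτ : 0 ≤ τ) : IntervalIntegrable lam0 volume 0 τ := by
  rw [intervalIntegrable_iff_integrableOn_Ioc_of_le hτ]
  refine ⟨hm.aestronglyMeasurable, ?_⟩
  rw [hasFiniteIntegral_iff_ofReal
    (ae_restrict_of_forall_mem measurableSet_Ioc fun x hx => h0 x hx.1.le)]
  exact (hazardUpTo_Ioc_zero lam0 le_rfl).symm.trans_lt (measure_lt_top (hazardUpTo lam0 τ) _)

theorem real_hazardUpTo_eq (hm : Measurable lam0) (h0 : ∀ x, 0 ≤ x → 0 ≤ lam0 x)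
    (hx0 : 0 ≤ x) (hx : x ≤ τ) :
    (hazardUpTo lam0 τ).real (Ioc 0 x) = ∫ u in (0 : ℝ)..x, lam0 u := by
  rw [intervalIntegral.integral_of_le hx0, integral_eq_lintegral_of_nonneg_ae
    (ae_restrict_of_forall_mem measurableSet_Ioc fun x hx => h0 x hx.1.le)
    hm.aestronglyMeasurable, Measure.real, hazardUpTo_Ioc_zero lam0 hx, cumHazard]

/-- `u ↦ exp (-u)` is 1-Lipschitz on `[0, ∞)`, so the same `δ` serves. -/
theorem absolutelyContinuousOnInterval_exp_neg {f : ℝ → ℝ}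
    (hf : AbsolutelyContinuousOnInterval f a b) (h0 : ∀ x ∈ uIcc a b, 0 ≤ f x) :
    AbsolutelyContinuousOnInterval (fun x => Real.exp (-f x)) a b := by
  rw [absolutelyContinuousOnInterval_iff] at hf ⊢
  intro ε hε
  obtain ⟨δ, hδ, h⟩ := hf ε hε
  refine ⟨δ, hδ, fun E hE hlt => (Finset.sum_le_sum fun i hi => ?_).trans_lt (h E hE hlt)⟩
  have hmem := hE.1 i hi
  have h1 := h0 _ hmem.1
  have h2 := h0 _ hmem.2
  rw [Real.dist_eq, Real.dist_eq]
  rcases le_total (f (E.2 i).1) (f (E.2 i).2) with h3 | h3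
  · rw [abs_of_nonneg (sub_nonneg.2 (Real.exp_le_exp.2 (neg_le_neg h3))),
      abs_of_nonpos (sub_nonpos.2 h3), neg_sub]
    exact exp_neg_sub_exp_neg_le h1 h3
  · rw [abs_of_nonpos (sub_nonpos.2 (Real.exp_le_exp.2 (neg_le_neg h3))),
      abs_of_nonneg (sub_nonneg.2 h3), neg_sub]
    exact exp_neg_sub_exp_neg_le h2 h3

/-- `Λ₀` is absolutely continuous with derivative `lam0` almost everywhere, hence so is `exp (-Λ₀)`
with derivative minus the baseline density, and the fundamental theorem of calculus applies. No
continuity of `lam0` is used. -/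
theorem intervalIntegrable_and_baselineCDF_sub (hm : Measurable lam0)
    (h0 : ∀ x, 0 ≤ x → 0 ≤ lam0 x) (ha : 0 ≤ a) (hab : a ≤ b) (hb : b ≤ τ) :
    IntervalIntegrable (baselineDensity lam0) volume a b ∧
      baselineCDF lam0 b - baselineCDF lam0 a = ∫ u in a..b, baselineDensity lam0 u := by
  have hτ : 0 ≤ τ := ha.trans (hab.trans hb)
  have hi := intervalIntegrable_hazard hm h0 hτ
  have hsub : uIcc a b ⊆ uIcc 0 τ := by
    rw [uIcc_of_le hab, uIcc_of_le hτ]; exact Icc_subset_Icc ha hb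
  have hac := (hi.absolutelyContinuousOnInterval_intervalIntegral left_mem_uIcc).mono hsub
  have hE := absolutelyContinuousOnInterval_exp_neg hac fun x hx => by
    rw [uIcc_of_le hab] at hx
    exact intervalIntegral.integral_nonneg (ha.trans hx.1) fun u hu => h0 u hu.1
  have hderiv : ∀ᵐ x, x ∈ uIcc a b →
      deriv (fun x => Real.exp (-∫ u in (0 : ℝ)..x, lam0 u)) x = -baselineDensity lam0 x := by
    filter_upwards [hi.ae_hasDerivAt_integral] with x hx hxab
    have hd := (hx (hsub hxab) 0 left_mem_uIcc).neg.exp.deriv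
    rw [uIcc_of_le hab] at hxab
    rw [baselineDensity_eq (hxab.2.trans hb),
      real_hazardUpTo_eq hm h0 (ha.trans hxab.1) (hxab.2.trans hb)]
    simp only [Pi.neg_apply] at hd
    rw [hd]
    ring
  have hderiv' : ∀ᵐ x, x ∈ uIoc a b →
      deriv (fun x => Real.exp (-∫ u in (0 : ℝ)..x, lam0 u)) x = -baselineDensity lam0 x :=
    hderiv.mono fun x hx h => hx (uIoc_subset_uIcc h)
  have h1 := hE.integral_deriv_eq_sub
  rw [intervalIntegral.integral_congr_ae hderiv', intervalIntegral.integral_neg,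
    ← real_hazardUpTo_eq hm h0 ha (hab.trans hb),
    ← real_hazardUpTo_eq hm h0 (ha.trans hab) hb] at h1
  refine ⟨?_, ?_⟩
  · have h2 : IntervalIntegrable (fun x => -(-baselineDensity lam0 x)) volume a b :=
      (hE.intervalIntegrable_deriv.congr_ae
        ((ae_restrict_iff' measurableSet_uIoc).2 hderiv')).neg
    simpa only [neg_neg] using h2
  · rw [baselineCDF_eq hb, baselineCDF_eq (hab.trans hb)]
    linarith

theorem baselineCDF_sub_le (hm : Measurable lam0) (h0 : ∀ x, 0 ≤ x → 0 ≤ lam0 x) (ha : 0 ≤ a)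
    (hab : a ≤ b) (hb : b ≤ τ) (h : ∀ x ∈ Ioc a b, baselineDensity lam0 x ≤ k) :
    baselineCDF lam0 b - baselineCDF lam0 a ≤ k * (b - a) := by
  obtain ⟨hi, he⟩ := intervalIntegrable_and_baselineCDF_sub hm h0 ha hab hb
  have := intervalIntegral.integral_mono_on_of_le_Ioo hab hi intervalIntegrable_const
    (g := fun _ => k) fun x hx => h x ⟨hx.1, hx.2.le⟩
  rw [he]
  simpa [mul_comm] using this

theorem le_baselineCDF_sub (hm : Measurable lam0) (h0 : ∀ x, 0 ≤ x → 0 ≤ lam0 x) (ha : 0 ≤ a)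
    (hab : a ≤ b) (hb : b ≤ τ) (h : ∀ x ∈ Ioc a b, k ≤ baselineDensity lam0 x) :
    k * (b - a) ≤ baselineCDF lam0 b - baselineCDF lam0 a := by
  obtain ⟨hi, he⟩ := intervalIntegrable_and_baselineCDF_sub hm h0 ha hab hb
  have := intervalIntegral.integral_mono_on_of_le_Ioo hab intervalIntegrable_const hi
    (f := fun _ => k) fun x hx => h x ⟨hx.1, hx.2.le⟩
  rw [he]
  simpa [mul_comm] using this

end

end CoxShape

namespace CoxShape
open Function

section

variable {p : ℕ} {β₀ : Cov p} {lam0 : ℝ → ℝ} {τ x : ℝ} {y : ℕ → Obs p} {β : ℕ → Cov p}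
  {Q : Measure (Obs p)} [SFinite Q] [IsFiniteMeasure (hazardUpTo lam0 τ)]

/-! ### Consistency of the estimators along a consistent path -/

theorem rightLim_nonneg {g : ℝ → ℝ} (h : Tendsto g (𝓝[>] x) (𝓝 (rightLim g x))) (hx : 0 < x)
    (h0 : ∀ u, 0 < u → 0 ≤ g u) : 0 ≤ rightLim g x :=
  ge_of_tendsto h (eventually_of_mem self_mem_nhdsWithin fun u hu => h0 u (hx.trans hu))

theorem leftLim_nonneg {g : ℝ → ℝ} (h : Tendsto g (𝓝[<] x) (𝓝 (leftLim g x))) (hx : 0 < x)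
    (h0 : ∀ u, 0 < u → 0 ≤ g u) : 0 ≤ leftLim g x :=
  ge_of_tendsto h (eventually_of_mem (Ioo_mem_nhdsLT hx) fun u hu => h0 u hu.1)

/-- The line at `x` with slope `g x` supports `Φ`, as increments of `Φ` are bounded by the values of
its nondecreasing derivative `g`; one-sided limits of `g` bound the nearby difference quotients. -/
theorem ConsistentPath.limitsBetween_gcm_of_monotoneOn
    (hy : ConsistentPath Q β₀ (hazardUpTo lam0 τ) τ y β) {f : ℕ → ℝ → ℝ} {Φ g : ℝ → ℝ}
    (hx : 0 < x) (hxτ : x < τ) (hf : ∀ n, Monotone (f n)) (hΦ : ContinuousOn Φ (Icc 0 τ))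
    (hconv : ∀ x, 0 ≤ x → x < τ → Tendsto (fun n => f n x) atTop (𝓝 (Φ x)))
    (hg : MonotoneOn g (Ioi 0)) (h0 : ∀ u, 0 < u → 0 ≤ g u)
    (hle : ∀ a b k, 0 ≤ a → a ≤ b → b ≤ τ → 0 ≤ k → (∀ u ∈ Ioc a b, g u ≤ k) →
      Φ b - Φ a ≤ k * (b - a))
    (hge : ∀ a b k, 0 ≤ a → a ≤ b → b ≤ τ → (∀ u ∈ Ioc a b, k ≤ g u) →
      k * (b - a) ≤ Φ b - Φ a) :
    LimitsBetween (leftLim g x) (fun n => leftSlope (gcm (obsInterval n y) (f n)) x)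
      (rightLim g x) := by
  refine hy.limitsBetween_leftSlope_gcm hx hxτ hf hΦ hconv (h0 x hx) (fun u hu => ?_)
    (fun ε hε => ?_) (fun ε hε => ?_)
  · rcases le_total x u with h | h
    · have := hge x u (g x) hx.le h hu.2.le fun v hv => hg hx (hx.trans hv.1) hv.1.le
      linarith
    · have := hle u x (g x) hu.1 h hxτ.le (h0 x hx) fun v hv => hg (hu.1.trans_lt hv.1) hx hv.2
      linarith
  · obtain ⟨s, hs, h⟩ := exists_leftLim_sub_le_of_monotoneOn hg hx hε
    exact ⟨s, hs, fun u hu => hge u x _ (hs.1.le.trans hu.1) hu.2.le hxτ.le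
      fun v hv => h v (hu.1.trans hv.1.le)⟩
  · obtain ⟨t, ht, h⟩ := exists_le_rightLim_add_of_monotoneOn hg hx hxτ hε
    exact ⟨t, ht, fun u hu => hle x u _ hx.le hu.1.le (hu.2.trans ht.2.le)
      (add_nonneg (rightLim_nonneg (tendsto_rightLim_of_monotoneOn hg hx) hx h0) hε.le)
      fun v hv => h v ⟨hx.trans hv.1, hv.2.trans hu.2⟩⟩

theorem ConsistentPath.limitsBetween_lcm_of_antitoneOn
    (hy : ConsistentPath Q β₀ (hazardUpTo lam0 τ) τ y β) {f : ℕ → ℝ → ℝ} {Φ g : ℝ → ℝ}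
    (hx : 0 < x) (hxτ : x < τ) (hf : ∀ n, Monotone (f n)) (hΦ : ContinuousOn Φ (Icc 0 τ))
    (hconv : ∀ x, 0 ≤ x → x < τ → Tendsto (fun n => f n x) atTop (𝓝 (Φ x)))
    (htail : ∀ ε > 0, ∃ c, 0 < c ∧ c < τ ∧ ∀ᶠ n in atTop, ∀ u, f n u ≤ f n c + ε)
    (hg : AntitoneOn g (Ioi 0)) (h0 : ∀ u, 0 < u → 0 ≤ g u)
    (hle : ∀ a b k, 0 ≤ a → a ≤ b → b ≤ τ → 0 ≤ k → (∀ u ∈ Ioc a b, g u ≤ k) →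
      Φ b - Φ a ≤ k * (b - a))
    (hge : ∀ a b k, 0 ≤ a → a ≤ b → b ≤ τ → (∀ u ∈ Ioc a b, k ≤ g u) →
      k * (b - a) ≤ Φ b - Φ a) :
    LimitsBetween (rightLim g x) (fun n => leftSlope (lcm (obsInterval n y) (f n)) x)
      (leftLim g x) := by
  refine hy.limitsBetween_leftSlope_lcm hx hxτ hf hΦ hconv htail (h0 x hx) (fun u hu => ?_)
    (fun ε hε => ?_) (fun ε hε => ?_)
  · rcases le_total x u with h | h
    · have := hle x u (g x) hx.le h hu.2.le (h0 x hx) fun v hv => hg hx (hx.trans hv.1) hv.1.le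
      linarith
    · have := hge u x (g x) hu.1 h hxτ.le fun v hv => hg (hu.1.trans_lt hv.1) hx hv.2
      linarith
  · obtain ⟨s, hs, h⟩ := exists_le_leftLim_add_of_antitoneOn hg hx hε
    exact ⟨s, hs, fun u hu => hle u x _ (hs.1.le.trans hu.1) hu.2.le hxτ.le
      (add_nonneg (leftLim_nonneg (tendsto_leftLim_of_antitoneOn hg hx) hx h0) hε.le)
      fun v hv => h v (hu.1.trans hv.1.le)⟩
  · obtain ⟨t, ht, h⟩ := exists_rightLim_sub_le_of_antitoneOn hg hx hxτ hε
    exact ⟨t, ht, fun u hu => hge x u _ hx.le hu.1.le (hu.2.trans ht.2.le)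
      fun v hv => h v ⟨hx.trans hv.1, hv.2.trans hu.2⟩⟩

theorem ConsistentPath.limitsBetween_hazardGrenanderInc
    (hy : ConsistentPath Q β₀ (hazardUpTo lam0 τ) τ y β) (hx : 0 < x) (hxτ : x < τ)
    (hg : MonotoneOn lam0 (Ioi 0)) (h0 : ∀ u, 0 ≤ u → 0 ≤ lam0 u) :
    LimitsBetween (leftLim lam0 x) (fun n => hazardGrenanderInc n y (β n) x) (rightLim lam0 x) :=
  hy.limitsBetween_gcm_of_monotoneOn hx hxτ (fun _ => breslow_mono _ _ _)
    ((continuous_real_Ioc _).mono Icc_subset_Ici_self) hy.tendsto_breslow hg (fun u hu => h0 u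
        hu.le)
    (fun _ _ _ ha hab hb hk h => (real_Ioc_sub_real_Ioc _ ha hab).trans_le
      (real_hazardUpTo_Ioc_le ha hab hb hk h))
    fun _ _ _ ha hab hb h => (le_real_hazardUpTo_Ioc ha hab hb h).trans_eq
      (real_Ioc_sub_real_Ioc _ ha hab).symm

theorem ConsistentPath.limitsBetween_hazardGrenanderDec
    (hy : ConsistentPath Q β₀ (hazardUpTo lam0 τ) τ y β) (hx : 0 < x) (hxτ : x < τ)
    (hg : AntitoneOn lam0 (Ioi 0)) (h0 : ∀ u, 0 ≤ u → 0 ≤ lam0 u) :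
    LimitsBetween (rightLim lam0 x) (fun n => hazardGrenanderDec n y (β n) x) (leftLim lam0 x) :=
  hy.limitsBetween_lcm_of_antitoneOn hx hxτ (fun _ => breslow_mono _ _ _)
    ((continuous_real_Ioc _).mono Icc_subset_Ici_self) hy.tendsto_breslow hy.tail hg
    (fun u hu => h0 u hu.le)
    (fun _ _ _ ha hab hb hk h => (real_Ioc_sub_real_Ioc _ ha hab).trans_le
      (real_hazardUpTo_Ioc_le ha hab hb hk h))
    fun _ _ _ ha hab hb h => (le_real_hazardUpTo_Ioc ha hab hb h).trans_eq
      (real_Ioc_sub_real_Ioc _ ha hab).symm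

theorem breslow_nonneg (n : ℕ) (y : ℕ → Obs p) (b : Cov p) (x : ℝ) : 0 ≤ breslow n y b x :=
  Finset.sum_nonneg fun i _ => by
    split_ifs
    · exact one_div_nonneg.2 (riskSum_nonneg _ _ _ _)
    · exact le_rfl

theorem cdfEst_mono (n : ℕ) (y : ℕ → Obs p) (b : Cov p) : Monotone (cdfEst n y b) := fun _ _ h =>
  sub_le_sub_left (Real.exp_le_exp.2 (neg_le_neg (breslow_mono n y b h))) 1

theorem baselineDensity_nonneg (h0 : ∀ u, 0 ≤ u → 0 ≤ lam0 u) {u : ℝ} (hu : 0 ≤ u) :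
    0 ≤ baselineDensity lam0 u := by
  refine mul_nonneg (h0 u hu) ?_
  rw [baselineCDF]
  split_ifs
  · simp
  · rw [sub_sub_cancel]; exact (Real.exp_pos _).le

theorem ConsistentPath.limitsBetween_densityGrenanderDec
    (hy : ConsistentPath Q β₀ (hazardUpTo lam0 τ) τ y β) (hx : 0 < x) (hxτ : x < τ)
    (hm : Measurable lam0) (h0 : ∀ u, 0 ≤ u → 0 ≤ lam0 u)
    (hg : AntitoneOn (baselineDensity lam0) (Ioi 0)) :
    LimitsBetween (rightLim (baselineDensity lam0) x)
      (fun n => densityGrenanderDec n y (β n) x) (leftLim (baselineDensity lam0) x) := by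
  refine hy.limitsBetween_lcm_of_antitoneOn (Φ := baselineCDF lam0) hx hxτ
    (fun _ => cdfEst_mono _ _ _) ?_ (fun u hu huτ => ?_) (fun ε hε => ?_) hg
    (fun u hu => baselineDensity_nonneg h0 hu.le)
    (fun a b k ha hab hb _ h => baselineCDF_sub_le hm h0 ha hab hb h)
    fun a b k ha hab hb h => le_baselineCDF_sub hm h0 ha hab hb h
  · refine ContinuousOn.congr (f := fun u => 1 - Real.exp (-(hazardUpTo lam0 τ).real (Ioc 0 u))) ?_
      fun u hu => baselineCDF_eq hu.2
    exact continuousOn_const.sub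
      ((continuous_real_Ioc (hazardUpTo lam0 τ)).mono Icc_subset_Ici_self).neg.rexp
  · rw [baselineCDF_eq huτ.le]
    exact (Real.continuous_exp.tendsto _ |>.comp (hy.tendsto_breslow u hu huτ).neg).const_sub 1
  · obtain ⟨c, hc0, hcτ, hc⟩ := hy.tail ε hε
    refine ⟨c, hc0, hcτ, hc.mono fun n hn u => ?_⟩
    rcases le_total u c with h | h
    · exact (cdfEst_mono n y (β n) h).trans (le_add_of_nonneg_right hε.le)
    · have := exp_neg_sub_exp_neg_le (breslow_nonneg n y (β n) c) (breslow_mono n y (β n) h)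
      have := hn u
      simp only [cdfEst]
      linarith

end

/-! ### Consistency of the estimators -/

variable {Ω₀ Ω : Type*} [MeasurableSpace Ω₀] [MeasurableSpace Ω] {P₀ : Measure Ω₀}
  [IsProbabilityMeasure P₀] {P : Measure Ω} [IsProbabilityMeasure P] {p : ℕ} {X C : Ω₀ → ℝ}
  {Z : Ω₀ → Cov p} {β₀ : Cov p} {lam0 : ℝ → ℝ}

theorem exists_isSample {Q : Measure (Obs p)} {Y : ℕ → Ω → Obs p} (hY : iIndepFun Y P)
    (hm : ∀ i, AEMeasurable (Y i) P) (hlaw : ∀ i, P.map (Y i) = Q) :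
    ∃ Y' : ℕ → Ω → Obs p, IsSample Y' P Q ∧ ∀ᵐ ω ∂P, (fun i => Y i ω) = path Y' ω := by
  refine ⟨fun i => (hm i).mk, ⟨fun i => (hm i).measurable_mk,
    hY.congr fun i => (hm i).ae_eq_mk, fun i => ?_⟩, ?_⟩
  · rw [← hlaw i]; exact (Measure.map_congr (hm i).ae_eq_mk).symm
  · filter_upwards [ae_all_iff.2 fun i => (hm i).ae_eq_mk] with ω h
    exact funext h

/-- The only shape-dependent input to the probabilistic part is a bound for `lam0` on `(x₀, τ]`; it
is left as a hypothesis so that all three monotonicity assumptions can supply it. -/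
theorem exists_ae_consistentPath (hcox : IsCoxModel P₀ X C Z β₀ lam0) (hid : Identifiable P₀ X C Z)
    (hA1 : ConditionA1 P₀ X C) (hA2 : ConditionA2 P₀ Z β₀) {Y : ℕ → Ω → Obs p}
    (hYindep : iIndepFun Y P)
    (hYlaw : ∀ i, IdentDistrib (Y i) (fun ω => observe (X ω) (C ω) (Z ω)) P P₀)
    {βhat : ℕ → Ω → Cov p} (hβhat : ∀ᵐ ω ∂P, ∀ n, IsMPLE n (fun i => Y i ω) (βhat n ω))
    {x₀ : ℝ} (hx₀ : 0 < x₀)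
    (hx₀τ : (x₀ : EReal) < supportEnd (P₀.map fun ω => min (X ω) (C ω))) :
    ∃ (τ : ℝ) (Q : Measure (Obs p)), x₀ < τ ∧ SFinite Q ∧ IsFiniteMeasure (hazardUpTo lam0 τ) ∧
      CoxLaw Q β₀ (hazardUpTo lam0 τ) τ ∧ ∀ B, (∀ u ∈ Ioc x₀ τ, lam0 u ≤ B) → ∀ᵐ ω ∂P,
        ConsistentPath Q β₀ (hazardUpTo lam0 τ) τ (fun i => Y i ω) (fun n => βhat n ω) := by
  obtain ⟨τ, hτ, hfin, hQ⟩ := exists_coxLaw hcox hid hA1 hA2 hx₀τ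
  obtain ⟨Y', hY', hYY'⟩ := exists_isSample hYindep (fun i => (hYlaw i).aemeasurable_fst)
    fun i => (hYlaw i).map_eq
  have hF : IsFiniteMeasure (hazardUpTo lam0 τ) := ⟨by
    rw [hazardUpTo, Measure.restrict_apply_univ]; exact hfin⟩
  have := hY'.isProbabilityMeasure
  refine ⟨τ, _, hτ, inferInstance, hF, hQ, fun B hB => ?_⟩
  have hB0 : 0 < |B| + 1 := by positivity
  filter_upwards [ae_consistentPath (Λ := hazardUpTo lam0 τ) hY' hQ (hx₀.trans hτ) hτ hB0
    fun u v hu huv hv => hazardUpTo_Icc_le (hx₀.le.trans hu) hv hB0.le fun w hw =>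
      (hB w ⟨hu.trans_lt hw.1, hw.2.trans hv⟩).trans ((le_abs_self B).trans (le_add_of_nonneg_right
        zero_le_one)), hYY', hβhat] with ω h1 h2 h3
  rw [h2] at h3 ⊢
  exact h1 _ h3

end CoxShape

theorem theorem3p1 {Ω₀ Ω : Type*} [MeasurableSpace Ω₀] [MeasurableSpace Ω]
    (P₀ : Measure Ω₀) [IsProbabilityMeasure P₀] (P : Measure Ω) [IsProbabilityMeasure P]
    {p : ℕ} (X C : Ω₀ → ℝ) (Z : Ω₀ → CoxShape.Cov p) (β₀ : CoxShape.Cov p) (lam0 : ℝ → ℝ)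
    (hcox : CoxShape.IsCoxModel P₀ X C Z β₀ lam0)
    (hid : CoxShape.Identifiable P₀ X C Z)
    (hA1 : CoxShape.ConditionA1 P₀ X C)
    (hA2 : CoxShape.ConditionA2 P₀ Z β₀)
    (Y : ℕ → Ω → CoxShape.Obs p)
    (hYindep : iIndepFun Y P)
    (hYlaw : ∀ i, IdentDistrib (Y i) (fun ω => CoxShape.observe (X ω) (C ω) (Z ω)) P P₀)
    (βhat : ℕ → Ω → CoxShape.Cov p)
    (hβhat : ∀ᵐ ω ∂P, ∀ n, CoxShape.IsMPLE n (fun i => Y i ω) (βhat n ω))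
    (x₀ : ℝ) (hx₀ : 0 < x₀)
    (hx₀τ : (x₀ : EReal) < CoxShape.supportEnd (P₀.map fun ω => min (X ω) (C ω))) :
    (MonotoneOn lam0 (Ioi 0) →
      (∀ lamhat : ℕ → Ω → ℝ → ℝ,
        (∀ᵐ ω ∂P, ∀ n,
          CoxShape.IsIncNPMLE n (fun i => Y i ω) (βhat n ω) (lamhat n ω)) →
        ∀ᵐ ω ∂P, CoxShape.LimitsBetween (Function.leftLim lam0 x₀)
          (fun n => lamhat n ω x₀) (Function.rightLim lam0 x₀)) ∧
      ∀ᵐ ω ∂P, CoxShape.LimitsBetween (Function.leftLim lam0 x₀)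
        (fun n => CoxShape.hazardGrenanderInc n (fun i => Y i ω) (βhat n ω) x₀)
        (Function.rightLim lam0 x₀)) ∧
    (AntitoneOn lam0 (Ioi 0) →
      (∀ lamhat : ℕ → Ω → ℝ → ℝ,
        (∀ᵐ ω ∂P, ∀ n,
          CoxShape.IsDecNPMLE n (fun i => Y i ω) (βhat n ω) (lamhat n ω)) →
        ∀ᵐ ω ∂P, CoxShape.LimitsBetween (Function.rightLim lam0 x₀)
          (fun n => lamhat n ω x₀) (Function.leftLim lam0 x₀)) ∧
      ∀ᵐ ω ∂P, CoxShape.LimitsBetween (Function.rightLim lam0 x₀)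
        (fun n => CoxShape.hazardGrenanderDec n (fun i => Y i ω) (βhat n ω) x₀)
        (Function.leftLim lam0 x₀)) ∧
    (AntitoneOn (CoxShape.baselineDensity lam0) (Ioi 0) →
      ∀ᵐ ω ∂P, CoxShape.LimitsBetween
        (Function.rightLim (CoxShape.baselineDensity lam0) x₀)
        (fun n => CoxShape.densityGrenanderDec n (fun i => Y i ω) (βhat n ω) x₀)
        (Function.leftLim (CoxShape.baselineDensity lam0) x₀)) := by
  obtain ⟨τ, Q, hτ, hSF, hF, hQ, hcons⟩ := CoxShape.exists_ae_consistentPath hcox hid hA1 hA2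
      hYindep
    hYlaw hβhat hx₀ hx₀τ
  have hm := hcox.measurable_hazard
  have h0 := hcox.hazard_nonneg
  have h0' : ∀ u, 0 < u → 0 ≤ lam0 u := fun u hu => h0 u hu.le
  refine ⟨fun hmono => ?_, fun hanti => ?_, fun hanti => ?_⟩
  -- A nondecreasing hazard is bounded by its value at the finite end point `τ`, where it is real
  -- valued.
  · have hpath := hcons (lam0 τ) fun u hu => hmono (hx₀.trans hu.1) (hx₀.trans hτ) hu.2
    refine ⟨fun lamhat hlam => ?_, ?_⟩
    · filter_upwards [hpath, hlam] with ω hy hl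
      exact hy.limitsBetween_incNPMLE hQ hl hx₀ hτ
        (CoxShape.rightLim_nonneg (CoxShape.tendsto_rightLim_of_monotoneOn hmono hx₀) hx₀ h0')
        (fun ε hε => CoxShape.exists_leftLim_sub_le_of_monotoneOn hmono hx₀ hε)
        fun ε hε => CoxShape.exists_le_rightLim_add_of_monotoneOn hmono hx₀ hτ hε
    · filter_upwards [hpath] with ω hy
      exact hy.limitsBetween_hazardGrenanderInc hx₀ hτ hmono h0
  · have hpath := hcons (lam0 x₀) fun u hu => hanti hx₀ (hx₀.trans hu.1) hu.1.le
    refine ⟨fun lamhat hlam => ?_, ?_⟩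
    · filter_upwards [hpath, hlam] with ω hy hl
      exact hy.limitsBetween_decNPMLE hQ hl hx₀ hτ
        (CoxShape.leftLim_nonneg (CoxShape.tendsto_leftLim_of_antitoneOn hanti hx₀) hx₀ h0')
        (fun ε hε => CoxShape.exists_le_leftLim_add_of_antitoneOn hanti hx₀ hε)
        fun ε hε => CoxShape.exists_rightLim_sub_le_of_antitoneOn hanti hx₀ hτ hε
    · filter_upwards [hpath] with ω hy
      exact hy.limitsBetween_hazardGrenanderDec hx₀ hτ hanti h0
  -- With a nonincreasing density the hazard need not be monotone, but it is the density times `exp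
  -- Λ₀`, and `Λ₀` is finite up to `τ`.
  · have hpath := hcons (CoxShape.baselineDensity lam0 x₀ *
        Real.exp ((CoxShape.hazardUpTo lam0 τ).real univ)) fun u hu => by
      have h1 := hanti hx₀ (hx₀.trans hu.1) hu.1.le
      have h2 : (CoxShape.hazardUpTo lam0 τ).real (Ioc 0 u) ≤
        (CoxShape.hazardUpTo lam0 τ).real univ := measureReal_mono (subset_univ _)
      calc lam0 u = CoxShape.baselineDensity lam0 u *
            Real.exp ((CoxShape.hazardUpTo lam0 τ).real (Ioc 0 u)) := by
            rw [CoxShape.baselineDensity_eq hu.2, mul_assoc, ← Real.exp_add, neg_add_cancel,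
              Real.exp_zero, mul_one]
        _ ≤ _ := mul_le_mul h1 (Real.exp_le_exp.2 h2) (Real.exp_pos _).le
            (CoxShape.baselineDensity_nonneg h0 hx₀.le)
    filter_upwards [hpath] with ω hy
    exact hy.limitsBetween_densityGrenanderDec hx₀ hτ hm h0 hanti
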